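/- **Setting.** Work with germs at a divisor point $p$ of a three-dimensional controlled singularly foliated manifold $(\mathbb M,\mathrm{Ax})$. In a local chart of the manifold with $p=0$, this is the following data. The divisor is $\{x=0\}$ (put $i=1$) or $\{x=0\}\cup\{y=0\}$ (put $i=2$), so $i=\#\iota_p$. The line field is generated by an analytic vector field $\chi$ which preserves the divisor and is nondegenerate: no prime germ which is not a divisor component divides all the coefficients of $\chi$, and for no divisor component with reduced equation $t$ are $\chi(t)$ divisible by $t^2$ and all other coefficients divisible by $t$. The axis is generated by an analytic vector field $\zeta$ with $\zeta(0)\neq0$ which preserves the divisor and whose leaf through $p$ is not contained in the set of nonelementary points of $\chi$. A point is *nonelementary* if $\chi$ vanishes there and its Jacobian matrix is nilpotent. Assume that $p$ is nonelementary. Local generators of the line field are the products of $\chi$ with positive analytic functions. A *formal (analytic) adapted chart* at $p$ is a formal (analytic) coordinate system $(x,y,z)$ vanishing at $p$ in which $\zeta$ is a unit multiple of $\partial/\partial z$ and the divisor components are, in the given order, $\{x=0\}$ (and $\{y=0\}$ if $i=2$). A *Newton data* $\Omega$ is such a chart with a local generator written in it as $fx\,\partial_x+gy\,\partial_y+hz\,\partial_z$.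 Let $\mathrm{supp}\,\Omega\subset\mathbb Z^3$ be the set of exponents with nonzero Laurent coefficient in $(f,g,h)$, and $\mathcal N=\mathrm{conv}(\mathrm{supp}\,\Omega)+\mathbb R^3_{\ge0}$. For a vertex $n$ of $\mathcal N$ let $\mathcal N'(n)=\mathcal N\cap\{v_3=n_3-\frac12\}$, let $m'(n)$ be its lexicographically least point, and define $\Delta(n)\in\mathbb Q^2$ by $m'(n)=n+\frac12(\Delta(n),-1)$; the main edge $\mathfrak e(n)$ is the intersection of $\mathcal N$ with the line through $n$ and $m'(n)$. The main side of $\mathcal N'(n)$ is the infinite vertical side if $m_1'(n)>0$, and is the side following the vertical one if $m'_1(n)=0$; $C(n)\in\mathbb Q_{\ge0}\cup\{\infty\}$ is defined by its direction $(C(n),-1,0)$ (horizontal if $C(n)=\infty$). Let $\mathbf h$ be the lexicographically least point of $\mathcal N$. The main vertex $\mathbf m$ is $\mathbf n$ if $i=1$, $\mathbf h=(0,-1,h_3)$ and $\mathfrak e(\mathbf h)=[\mathbf h,\mathbf n]$ with $\mathbf n=(0,0,n_3)$, $n_3<h_3$; otherwise $\mathbf m=\mathbf h$. Put $\Delta=\Delta(\mathbf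 m)$, $C=C(\mathbf m)$ (vertical and horizontal displacement); then $\Omega$ belongs to the class $\mathrm{New}^{i,\mathbf m}_{\Delta,C}$. $\Omega\in\mathrm{New}^{i,\mathbf m}_{\Delta,C}$ is *stable* if it remains in this class under all polynomial changes $(x,\,y+g(x),\,z+f(x,y))$ with $f(0)=g(0)=0$, $g=0$ if $i=2$, such that: if $\Delta_1=0$, the support of $f$ is contained in $\{\Delta+s(C,-1): s\ge0\}$ (in $\{\Delta\}$ if $C=\infty$) and that of $g$ in $\{C\}$; if $\Delta_1>0$, the support of $f$ is contained in $\{\Delta\}$ and $g=0$. The group $\widehat{\mathrm G}^i$ consists of the formal changes $\tilde x=xu(x,y)$, $\tilde y=g(x)+yv(x,y)$, $\tilde z=f(x,y)+zw(x,y,z)$ with $u,v,w$ units, $f(0)=g(0)=0$, and $g=0$ if $i=2$. **Statement.** (1) Let $\Omega\in\mathrm{New}^{i,\mathbf m}_{\Delta,C}$ and $\widetilde\Omega\in\mathrm{New}^{i,\widetilde{\mathbf m}}_{\widetilde\Delta,\widetilde C}$ be stable formal Newton data at $p$ which lie on the same $\widehat{\mathrm G}^i$-orbit. Then $(\mathbf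 m,\Delta,C)=(\widetilde{\mathbf m},\widetilde\Delta,\widetilde C)$. (2) Let two analytic adapted charts at $p$ be given whose Newton data (for any choices of local generators) are stable. Then they have the same $(\mathbf m,\Delta,C)$ and the same invariant $$\mathrm{inv}=\bigl(\mathfrak h,\ m_2+1,\ m_3,\ i-1,\ \lambda\Delta_1,\ \lambda\max\{0,\Delta_2\}\bigr),\qquad \lambda=2(m_3+1)!,$$ where $\mathfrak h=\lfloor m_3+1-1/\Delta_2\rfloor$ if $m_2=-1$ and $\Delta_1=0$, and $\mathfrak h=m_3$ otherwise. For both charts, there is exactly one pair consisting of a weight-vector $\omega\in\mathbb N^3\setminus\{0\}$ with $\gcd(\omega_1,\omega_2,\omega_3)=1$ and a face order $\mu\in\mathbb Z$ such that $\langle\omega,\cdot\rangle\ge\mu$ on $\mathcal N$ and $\mathcal N\cap\{\langle\omega,v\rangle=\mu\}$ is the main face (the face meeting $\mathcal N'(\mathbf m)$ exactly in its main side); and $(\omega,\mu)$ is the same for the two charts. The local blowing-up centers, defined in each chart by the vanishing of the coordinates of nonzero $\omega$-weight, coincide in a neighbourhood of $p$. Finally, the transition map $\phi$ between the two charts preserves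 the $\omega$-quasihomogeneous structure: $\phi^*(H^d_\omega)\subset H^d_\omega$ for all $d\in\mathbb N$, where $H^d_\omega$ is the set of formal power series of $\omega$-multiplicity $d$. -/

import Mathlib

open scoped Pointwise

namespace NewtonFol

noncomputable section

/-! ### Formal and convergent power series in three variables -/

/-- Real formal power series in three variables, `ℝ⟦x, y, z⟧` with `x = X 0`, `y = X 1`, `z = X 2`. -/
abbrev Series := MvPowerSeries (Fin 3) ℝ

open MvPowerSeries

/-- `F` is absolutely convergent on some polydisc around the origin. -/
def IsConvergent (F : Series) : Prop :=
  ∃ r : ℝ, 0 < r ∧ Summable fun n : Fin 3 →₀ ℕ => ‖coeff n F‖ * r ^ n.degree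

lemma summable_of_le {F : Series} {r s : ℝ} (hs : 0 ≤ s) (hsr : s ≤ r)
    (h : Summable fun n : Fin 3 →₀ ℕ => ‖coeff n F‖ * r ^ n.degree) :
    Summable fun n : Fin 3 →₀ ℕ => ‖coeff n F‖ * s ^ n.degree := by
  refine Summable.of_nonneg_of_le (fun n => by positivity) (fun n => ?_) h
  gcongr

lemma isConvergent_of_mem_support_finite {F : Series}
    (h : {n : Fin 3 →₀ ℕ | coeff n F ≠ 0}.Finite) : IsConvergent F := by
  refine ⟨1, one_pos, summable_of_ne_finset_zero (s := h.toFinset) fun n hn => ?_⟩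
  have : coeff n F = 0 := by simpa using hn
  simp [this]

lemma IsConvergent.add {F G : Series} (hF : IsConvergent F) (hG : IsConvergent G) :
    IsConvergent (F + G) := by
  obtain ⟨r, hr, hF⟩ := hF
  obtain ⟨s, hs, hG⟩ := hG
  have h0 : 0 < min r s := lt_min hr hs
  refine ⟨min r s, h0, Summable.of_nonneg_of_le (fun n => by positivity) (fun n => ?_)
    ((summable_of_le h0.le (min_le_left r s) hF).add
      (summable_of_le h0.le (min_le_right r s) hG))⟩
  rw [← add_mul, map_add]
  gcongr
  exact norm_add_le _ _

lemma IsConvergent.neg {F : Series} (hF : IsConvergent F) : IsConvergent (-F) := by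
  obtain ⟨r, hr, hF⟩ := hF
  exact ⟨r, hr, by simpa using hF⟩

lemma IsConvergent.mul {F G : Series} (hF : IsConvergent F) (hG : IsConvergent G) :
    IsConvergent (F * G) := by
  classical
  obtain ⟨r, hr, hF⟩ := hF
  obtain ⟨s, hs, hG⟩ := hG
  have h0 : 0 < min r s := lt_min hr hs
  have h := summable_sum_mul_antidiagonal_of_summable_mul
    (Summable.mul_of_nonneg (summable_of_le h0.le (min_le_left r s) hF)
      (summable_of_le h0.le (min_le_right r s) hG)
      (fun n => by positivity) (fun n => by positivity))
  refine ⟨min r s, h0, Summable.of_nonneg_of_le (fun n => by positivity) (fun n => ?_) h⟩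
  rw [coeff_mul]
  calc ‖∑ p ∈ Finset.HasAntidiagonal.antidiagonal n, coeff p.1 F * coeff p.2 G‖ * (min r s) ^ n.degree
      ≤ (∑ p ∈ Finset.HasAntidiagonal.antidiagonal n, ‖coeff p.1 F‖ * ‖coeff p.2 G‖) * (min r s) ^ n.degree := by
        gcongr
        exact (norm_sum_le _ _).trans (Finset.sum_le_sum fun p _ => norm_mul_le _ _)
    _ = _ := by
        rw [Finset.sum_mul]
        refine Finset.sum_congr rfl fun p hp => ?_
        rw [← Finset.HasAntidiagonal.mem_antidiagonal.mp hp, map_add, pow_add]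
        ring

/-- The ring `ℝ{x, y, z}` of germs at the origin of analytic functions, as a subring of the ring
of formal power series. -/
def AnalyticGerm : Subring Series where
  carrier := {F | IsConvergent F}
  mul_mem' := IsConvergent.mul
  add_mem' := IsConvergent.add
  neg_mem' := IsConvergent.neg
  zero_mem' := isConvergent_of_mem_support_finite (by simp)
  one_mem' := by
    classical
    refine isConvergent_of_mem_support_finite ((Set.finite_singleton 0).subset fun n hn => ?_)
    by_contra h
    exact hn (by rw [coeff_one, if_neg (by simpa using h)])

lemma X_mem_analyticGerm (k : Fin 3) : (X k : Series) ∈ AnalyticGerm := by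
  classical
  refine isConvergent_of_mem_support_finite
    ((Set.finite_singleton (Finsupp.single k 1)).subset fun n hn => ?_)
  by_contra h
  exact hn (by rw [coeff_X, if_neg (by simpa using h)])

/-- The coordinate germs `x, y, z`. -/
def coord (k : Fin 3) : AnalyticGerm := ⟨X k, X_mem_analyticGerm k⟩

/-- The value of a power series at a point; meaningful near the origin for a convergent series. -/
def evalSeries (F : Series) (q : Fin 3 → ℝ) : ℝ :=
  ∑' n : Fin 3 →₀ ℕ, coeff n F * ∏ k, q k ^ n k

/-! ### Vector fields and coordinate changes -/

/-- A formal vector field `a₀ ∂/∂x + a₁ ∂/∂y + a₂ ∂/∂z`, given by its coefficients. -/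
abbrev FormalField := Fin 3 → Series

/-- The action of a formal vector field, as a derivation, on a formal power series. -/
def FormalField.act (χ : FormalField) (F : Series) : Series :=
  ∑ k, χ k * pderiv ℝ k F

/-- The underlying formal vector field of an analytic one. -/
def toFormal (χ : Fin 3 → AnalyticGerm) : FormalField := fun k => (χ k : Series)

/-- The Jacobian matrix at the origin of a triple of power series. -/
def jacobian (Φ : Fin 3 → Series) : Matrix (Fin 3) (Fin 3) ℝ :=
  Matrix.of fun j k => constantCoeff (pderiv ℝ k (Φ j))

/-- `Φ` is a formal coordinate system centred at the origin. -/
def IsFormalCoordinates (Φ : Fin 3 → Series) : Prop :=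
  (∀ j, constantCoeff (Φ j) = 0) ∧ (jacobian Φ).det ≠ 0

/-- The vector field `χ`, written in the coordinates `Φ` (vanishing at the origin), is `Ω`, that is
`χ(Φ_j) = Ω_j ∘ Φ` for `j = 0, 1, 2`. -/
def IsTransform (Φ : Fin 3 → Series) (χ Ω : FormalField) : Prop :=
  ∀ j, χ.act (Φ j) = (Ω j).subst Φ

/-- Restriction of a power series to the axis `{x = y = 0}`. -/
def axisRestrict (F : Series) : PowerSeries ℝ :=
  PowerSeries.mk fun k => coeff (Finsupp.single 2 k) F

/-- The axis `{x = y = 0}` consists of nonelementary points of the vector field `Ω`: along it, `Ω`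
vanishes and its Jacobian matrix has no nonzero eigenvalue. -/
def AxisNonelementary (Ω : FormalField) : Prop :=
  (∀ j, axisRestrict (Ω j) = 0) ∧
    IsNilpotent (Matrix.of fun j k => axisRestrict (pderiv ℝ k (Ω j)) :
      Matrix (Fin 3) (Fin 3) (PowerSeries ℝ))

/-- The index `k` numbers a component `{X k = 0}` of the divisor, which is `{x = 0}` if `i = 1` and
`{x = 0} ∪ {y = 0}` if `i = 2`. -/
def IsDivisorIndex (i : ℕ) (k : Fin 3) : Prop := (k : ℕ) < i

/-- The vector field leaves every component of the divisor invariant. -/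
def PreservesDivisor (i : ℕ) (χ : Fin 3 → AnalyticGerm) : Prop :=
  ∀ k, IsDivisorIndex i k → coord k ∣ χ k

/-- Nondegeneracy of an analytic vector field at the origin with respect to the divisor: a prime
germ that does not define a component of the divisor does not divide all the coefficients, and for
a component `{X k = 0}` one cannot have `(X k)² ∣ χ(X k)` and `X k ∣ χ(X j)` for all `j ≠ k`. -/
def Nondegenerate (i : ℕ) (χ : Fin 3 → AnalyticGerm) : Prop :=
  (∀ g : AnalyticGerm, Prime g → (∀ k, IsDivisorIndex i k → ¬ Associated g (coord k)) →
      ¬ ∀ j, g ∣ χ j) ∧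
  ∀ k, IsDivisorIndex i k → ¬ (coord k ^ 2 ∣ χ k ∧ ∀ j, j ≠ k → coord k ∣ χ j)

/-- `Φ` is a formal adapted chart, for the divisor with `i` components and the axis generated by
`ζ`: formal coordinates in which `ζ` is a unit multiple of `∂/∂z` and which define the (ordered)
components of the divisor. -/
structure IsAdaptedChart (i : ℕ) (ζ : FormalField) (Φ : Fin 3 → Series) : Prop where
  coordinates : IsFormalCoordinates Φ
  axis_x : ζ.act (Φ 0) = 0
  axis_y : ζ.act (Φ 1) = 0
  axis_z : IsUnit (ζ.act (Φ 2))
  divisor : ∀ k, IsDivisorIndex i k → Associated (Φ k) (X k)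

/-- The germ of a controlled singularly foliated manifold `(𝕄, Ax)` at a divisor point `p`, in a
local chart of the manifold in which `p` is the origin and the components of the divisor through
`p` are `{x = 0}` (if `i = 1`), respectively `{x = 0}` and `{y = 0}` (if `i = 2`), listed in the
order of the incidence list `ι_p`, whose length is `i`.  The line field is generated by `χ` and the
axis by `ζ`. -/
structure ControlledGerm where
  i : ℕ
  i_eq : i = 1 ∨ i = 2
  χ : Fin 3 → AnalyticGerm
  ζ : Fin 3 → AnalyticGerm
  χ_preserves : PreservesDivisor i χ
  χ_nondegenerate : Nondegenerate i χ
  ζ_preserves : PreservesDivisor i ζ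
  ζ_nonsingular : ∃ j, constantCoeff (ζ j : Series) ≠ 0
  /-- In any adapted chart, the leaf `{x = y = 0}` of the axis through `p` is not contained in the
  set of nonelementary points. -/
  leaf : ∀ Φ : Fin 3 → Series, IsAdaptedChart i (toFormal ζ) Φ →
    ∀ Ω : FormalField, IsTransform Φ (toFormal χ) Ω → ¬ AxisNonelementary Ω

/-- The point `p` is a nonelementary singular point: `χ(p) = 0` and the Jacobian matrix of `χ` at
`p` has no nonzero (complex) eigenvalue. -/
def ControlledGerm.Nonelementary (K : ControlledGerm) : Prop :=
  (∀ j, constantCoeff (K.χ j : Series) = 0) ∧ IsNilpotent (jacobian (toFormal K.χ))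

/-- `χ'` is a local generator of the line field: a strictly positive analytic multiple of `χ`. -/
def ControlledGerm.IsGenerator (K : ControlledGerm) (χ' : Fin 3 → AnalyticGerm) : Prop :=
  ∃ h : AnalyticGerm, 0 < constantCoeff (h : Series) ∧ ∀ j, χ' j = h * K.χ j

/-- `Ω` is the local generator of the line field written in the formal adapted chart `Φ`. Such an
`Ω`, which amounts to a Newton map, together with the number `i = #ι_p` is a formal Newton data. -/
def ControlledGerm.IsNewtonData (K : ControlledGerm) (Φ : Fin 3 → Series) (Ω : FormalField) :
    Prop :=
  IsAdaptedChart K.i (toFormal K.ζ) Φ ∧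
    ∃ χ' : Fin 3 → AnalyticGerm, K.IsGenerator χ' ∧ IsTransform Φ (toFormal χ') Ω

/-- The power series `F` involves only the variables in `s`. -/
def DependsOnlyOn (s : Set (Fin 3)) (F : Series) : Prop :=
  ∀ n, coeff n F ≠ 0 → ∀ k, k ∉ s → n k = 0

/-- The group `Ĝ^i` of formal changes of coordinates
`x̃ = x u(x,y)`, `ỹ = g(x) + y v(x,y)`, `z̃ = f(x,y) + z w(x,y,z)`
with `u, v, w` units, `f(0) = g(0) = 0`, and `g = 0` if `i = 2`. -/
def formalGroup (i : ℕ) : Set (Fin 3 → Series) :=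
  {Ψ | ∃ f g u v w : Series,
    DependsOnlyOn {0, 1} f ∧ DependsOnlyOn {0} g ∧ DependsOnlyOn {0, 1} u ∧
    DependsOnlyOn {0, 1} v ∧ constantCoeff f = 0 ∧ constantCoeff g = 0 ∧
    IsUnit u ∧ IsUnit v ∧ IsUnit w ∧ (i = 2 → g = 0) ∧
    Ψ = ![X 0 * u, g + X 1 * v, f + X 2 * w]}

/-- `Ω'` lies on the `Ĝ^i`-orbit of `Ω`. -/
def SameOrbit (i : ℕ) (Ω Ω' : FormalField) : Prop :=
  ∃ Ψ ∈ formalGroup i, IsTransform Ψ Ω Ω'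

/-! ### Newton polyhedron -/

/-- The Newton map: for `Ω = f x ∂/∂x + g y ∂/∂y + h z ∂/∂z` (logarithmic basis), the vector
`(f_v, g_v, h_v)` of Laurent coefficients. The `j`-th one is the coefficient of `x^v · X j` in the
`j`-th coefficient of `Ω`. -/
def newtonMap (Ω : FormalField) (v : Fin 3 → ℤ) : Fin 3 → ℝ := fun j =>
  if ∀ k, 0 ≤ (v + Pi.single j 1 : Fin 3 → ℤ) k then
    coeff (Finsupp.equivFunOnFinite.symm fun k => ((v + Pi.single j 1 : Fin 3 → ℤ) k).toNat) (Ω j)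
  else 0

/-- The inclusion of `ℤ³` in `ℝ³`. -/
def intVec (v : Fin 3 → ℤ) : Fin 3 → ℝ := fun k => (v k : ℝ)

/-- The support of the Newton map. -/
def supp (Ω : FormalField) : Set (Fin 3 → ℤ) := {v | newtonMap Ω v ≠ 0}

/-- The Newton polyhedron `conv(supp) + ℝ³₊`. -/
def newtonPolyhedron (Ω : FormalField) : Set (Fin 3 → ℝ) :=
  convexHull ℝ (intVec '' supp Ω) + {w | 0 ≤ w}

/-- `v` is the minimal point of `S` for the lexicographical ordering. -/
def IsLexLeast (S : Set (Fin 3 → ℝ)) (v : Fin 3 → ℝ) : Prop :=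
  v ∈ S ∧ ∀ w ∈ S, toLex v ≤ toLex w

/-- The derived polygon `N'(n) = N ∩ {v₃ = n₃ - 1/2}`. -/
def derivedPolygon (N : Set (Fin 3 → ℝ)) (n : Fin 3 → ℝ) : Set (Fin 3 → ℝ) :=
  N ∩ {v | v 2 = n 2 - 1 / 2}

/-- The direction `(Δ, -1)` of the main edge. -/
def edgeDir (Δ : ℚ × ℚ) : Fin 3 → ℝ := ![(Δ.1 : ℝ), (Δ.2 : ℝ), -1]

/-- The point `m'(n) = (n₁ + Δ₁/2, n₂ + Δ₂/2, n₃ - 1/2)`. -/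
def derivedVertex (n : Fin 3 → ℝ) (Δ : ℚ × ℚ) : Fin 3 → ℝ := n + (1 / 2 : ℝ) • edgeDir Δ

/-- `Δ` is the vertical displacement vector associated to `n`: the point `m'(n)` determined by `Δ`
is the main derived vertex (the lexicographically minimal point, which is a vertex, of the derived
polygon). -/
def IsVerticalDisplacement (N : Set (Fin 3 → ℝ)) (n : Fin 3 → ℝ) (Δ : ℚ × ℚ) : Prop :=
  IsLexLeast (derivedPolygon N n) (derivedVertex n Δ)

/-- The main edge `e(n)`, cut out of `N` by the line through `n` and `m'(n)`. -/
def mainEdge (N : Set (Fin 3 → ℝ)) (n : Fin 3 → ℝ) (Δ : ℚ × ℚ) : Set (Fin 3 → ℝ) :=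
  N ∩ {v | ∃ t : ℝ, v = n + t • edgeDir Δ}

/-- The direction `(C, -1, 0)` of the main side, horizontal if `C = ∞`. -/
def sideDir : WithTop ℚ → Fin 3 → ℝ
  | ⊤ => ![1, 0, 0]
  | (c : ℚ) => ![(c : ℝ), -1, 0]

/-- The main side, cut out of the derived polygon by the line through `m'(n)` with direction
`(C, -1, 0)`. -/
def mainSide (N : Set (Fin 3 → ℝ)) (n : Fin 3 → ℝ) (Δ : ℚ × ℚ) (C : WithTop ℚ) :
    Set (Fin 3 → ℝ) :=
  derivedPolygon N n ∩ {v | ∃ t : ℝ, v = derivedVertex n Δ + t • sideDir C}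

/-- `C` is the horizontal displacement associated to `n`, given the vertical displacement `Δ`.
If `m₁' > 0` the main side is the infinite vertical side, and `C = 0`. If `m₁' = 0` it is the side
next to the vertical one: the infinite horizontal side (`C = ∞`) if no point of the polygon is lower
than the main derived vertex, and otherwise the side with direction `(C, -1, 0)` going down from
that vertex. -/
def IsHorizontalDisplacement (N : Set (Fin 3 → ℝ)) (n : Fin 3 → ℝ) (Δ : ℚ × ℚ) :
    WithTop ℚ → Prop
  | ⊤ => derivedVertex n Δ 0 = 0 ∧ ∀ v ∈ derivedPolygon N n, derivedVertex n Δ 1 ≤ v 1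
  | (c : ℚ) =>
    (0 < derivedVertex n Δ 0 ∧ c = 0) ∨
    (derivedVertex n Δ 0 = 0 ∧
      (∀ v ∈ derivedPolygon N n,
        derivedVertex n Δ 0 + c * derivedVertex n Δ 1 ≤ v 0 + c * v 1) ∧
      ∃ v ∈ mainSide N n Δ (c : ℚ), v 1 < derivedVertex n Δ 1)

/-- The Newton polyhedron, with higher vertex `h`, is in a nilpotent configuration with
`e(h) = [h, n]`, where `h = (0, -1, h₃)` and `n = (0, 0, n₃)`, `n₃ < h₃`. -/
def IsNilpotentConfiguration (i : ℕ) (N : Set (Fin 3 → ℝ)) (h n : Fin 3 → ℝ) : Prop :=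
  i = 1 ∧ h 0 = 0 ∧ h 1 = -1 ∧ n 0 = 0 ∧ n 1 = 0 ∧ n 2 < h 2 ∧
    ∃ Δ : ℚ × ℚ, IsVerticalDisplacement N h Δ ∧ mainEdge N h Δ = segment ℝ h n

/-- `m` is the main vertex: the endpoint `n` of `e(h)` in a nilpotent configuration, and the higher
vertex `h` in a regular configuration. -/
def IsMainVertex (i : ℕ) (N : Set (Fin 3 → ℝ)) (m : Fin 3 → ℝ) : Prop :=
  ∃ h, IsLexLeast N h ∧
    (IsNilpotentConfiguration i N h m ∨
      (m = h ∧ ∀ n, ¬ IsNilpotentConfiguration i N h n))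

/-- The class `New^{i,m}_{Δ,C}`. -/
structure InClass (i : ℕ) (Ω : FormalField) (m : Fin 3 → ℤ) (Δ : ℚ × ℚ) (C : WithTop ℚ) :
    Prop where
  mainVertex : IsMainVertex i (newtonPolyhedron Ω) (intVec m)
  vertical : IsVerticalDisplacement (newtonPolyhedron Ω) (intVec m) Δ
  horizontal : IsHorizontalDisplacement (newtonPolyhedron Ω) (intVec m) Δ C

/-! ### Stability -/

/-- The set of exponents allowed in `f` for `(f, g) ∈ 𝒢_{Δ,C}`: the points `Δ + s (C, -1)`, `s ≥ 0`,
if `Δ₁ = 0`, which reduce to `Δ` if `C = ∞`; and only `Δ` if `Δ₁ > 0`. -/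
def zExponents (Δ : ℚ × ℚ) (C : WithTop ℚ) : Set (ℚ × ℚ) :=
  {e | e = Δ ∨ (Δ.1 = 0 ∧ ∃ c : ℚ, C = c ∧ ∃ s : ℚ, 0 ≤ s ∧ e = Δ + s • (c, -1))}

/-- The group `𝒢^i_{Δ,C}` of polynomial changes of coordinates `x̃ = x`, `ỹ = y + g(x)`,
`z̃ = z + f(x,y)`, as a set of pairs `(f, g)`. -/
def faceGroup (i : ℕ) (Δ : ℚ × ℚ) (C : WithTop ℚ) :
    Set (MvPolynomial (Fin 2) ℝ × Polynomial ℝ) :=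
  {fg | (∀ n ∈ fg.1.support, ((n 0 : ℚ), (n 1 : ℚ)) ∈ zExponents Δ C) ∧
    (∀ c ∈ fg.2.support, Δ.1 = 0 ∧ C = ((c : ℚ) : WithTop ℚ)) ∧ (i = 2 → fg.2 = 0)}

/-- The coordinates `(x, y + g(x), z + f(x,y))`. -/
def polyMap (f : MvPolynomial (Fin 2) ℝ) (g : Polynomial ℝ) : Fin 3 → Series :=
  ![X 0, X 1 + Polynomial.aeval (X 0) g, X 2 + MvPolynomial.aeval ![X 0, X 1] f]

/-- `Ω ∈ New^{i,m}_{Δ,C}` is stable: `(f, g) · Ω ∈ New^{i,m}_{Δ,C}` for all `(f, g) ∈ 𝒢^i_{Δ,C}`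
with `f(0) = g(0) = 0`. -/
def IsStable (i : ℕ) (Ω : FormalField) (m : Fin 3 → ℤ) (Δ : ℚ × ℚ) (C : WithTop ℚ) : Prop :=
  InClass i Ω m Δ C ∧
    ∀ f g, (f, g) ∈ faceGroup i Δ C → f.coeff 0 = 0 → g.coeff 0 = 0 →
      ∃ Ω', IsTransform (polyMap f g) Ω Ω' ∧ InClass i Ω' m Δ C

/-! ### Invariant, weight-vector, face order, local blowing-up center -/

/-- The virtual height. -/
def virtualHeight (m : Fin 3 → ℤ) (Δ : ℚ × ℚ) : ℤ :=
  if m 1 = -1 ∧ Δ.1 = 0 then ⌊(m 2 : ℚ) + 1 - 1 / Δ.2⌋ else m 2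

/-- The invariant `inv = (𝔥, m₂ + 1, m₃, #ι_p - 1, λ Δ₁, λ max(0, Δ₂))` with `λ = 2 (m₃ + 1)!`. -/
def newtonInv (i : ℕ) (m : Fin 3 → ℤ) (Δ : ℚ × ℚ) : Fin 6 → ℚ :=
  let lam : ℚ := 2 * ((m 2 + 1).toNat.factorial : ℚ)
  ![virtualHeight m Δ, m 1 + 1, m 2, (i : ℚ) - 1, lam * Δ.1, lam * max 0 Δ.2]

/-- The pairing `⟨ω, v⟩`. -/
def pairing (ω : Fin 3 → ℕ) (v : Fin 3 → ℝ) : ℝ := ∑ k, (ω k : ℝ) * v k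

/-- `ω` is the weight-vector and `μ` the face order: `ω` is a nonzero vector of natural numbers
without common factor, and `{v ∈ N | ⟨ω, v⟩ = μ}` is the main face of `N`, that is, the face which
meets the main derived polygon in the main side. -/
def IsWeight (Ω : FormalField) (m : Fin 3 → ℤ) (Δ : ℚ × ℚ) (C : WithTop ℚ)
    (ω : Fin 3 → ℕ) (μ : ℤ) : Prop :=
  ω ≠ 0 ∧ Finset.univ.gcd ω = 1 ∧ (∀ v ∈ newtonPolyhedron Ω, (μ : ℝ) ≤ pairing ω v) ∧
    {v ∈ newtonPolyhedron Ω | pairing ω v = μ} ∩ derivedPolygon (newtonPolyhedron Ω) (intVec m) =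
      mainSide (newtonPolyhedron Ω) (intVec m) Δ C

/-- The local blowing-up center for an analytic chart `Φ = (x, y, z)`: the set where the coordinates
of nonzero weight vanish, i.e. `{x = y = z = 0}`, `{x = z = 0}` or `{y = z = 0}` for `ω` of the form
`(*, *, *)`, `(*, 0, *)` or `(0, *, *)`. -/
def blowupCenter (ω : Fin 3 → ℕ) (Φ : Fin 3 → AnalyticGerm) : Set (Fin 3 → ℝ) :=
  {q | ∀ k, ω k ≠ 0 → evalSeries (Φ k : Series) q = 0}

/-- `φ` is the transition map from the coordinates `Φ` to the coordinates `Φ'`. -/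
def IsTransition (Φ Φ' φ : Fin 3 → Series) : Prop :=
  (∀ j, constantCoeff (φ j) = 0) ∧ ∀ j, Φ' j = (φ j).subst Φ

/-- `φ` preserves the `ω`-quasihomogeneous structure: `φ^*(H^d) ⊆ H^d` for all `d`, where `H^d` is
the set of formal series of `ω`-multiplicity `d`. -/
def PreservesQuasihomogeneous (ω : Fin 3 → ℕ) (φ : Fin 3 → Series) : Prop :=
  ∀ (d : ℕ) (F : Series), F.weightedOrder ω = d → (F.subst φ).weightedOrder ω = d

end

end NewtonFol

open NewtonFol

/-! Everything reduces to comparing two Newton data related by one formal change of coordinates `Ψ`.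
Elements of the formal group and transition maps between adapted charts are `Fibered`: `x` divides
`Ψ 0`, neither `Ψ 0` nor `Ψ 1` involves `z`, and the linear part is triangular. Up to a unit factor
the two vector fields correspond (`Rel`). Call `Ψ` compatible with positive weights if every
monomial of `Ψ j` weighs at least as much as the `j`-th coordinate. Then the lowest weighted parts
of the two fields correspond under the lowest part of `Ψ` (`Rel.init`). Lowest parts record faces of
the Newton polyhedron, so the task is to show that `Ψ` is compatible with the weights that cut out
the main vertex, edge and side.

Weights in the lexicographic plane, with `x` infinitely heavier than `y`, are almost automatically
compatible and give the higher vertex (`HigherVertex.eq_of_rel`). For the main edge, suppose that `Ψ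
2` contains a monomial `x^a y^b` with exponent below both vertical displacements. Then the lowest
part of `Ψ` is a tilt `w z + c x^a y^b`, while the lowest parts of the fields are supported at `m`
alone (plus `h` in one nilpotent case), and `m₂ ≥ 1`. The transformed field vanishes on `z = 0`, so
the original one vanishes on a tilted surface, which is impossible (`Rel.tilt_false`,
`Rel.tilt_false'`). The bound `m₂ ≥ 1` is where nonelementarity enters (`ClassFacts.one_le`). Once
`Ψ` is compatible, its lowest part is, up to a diagonal map, one of the changes in the definition of
stability. Stability then forbids a larger displacement (`not_lexLt_of_rel`) and a switch between
nilpotent and regular configurations (`NilConf.of_rel`).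

For the horizontal displacement with `Δ₁ = 0` the weights are `(1, s, s Δ₂)`. Suppose that `Ψ` is
nontrivial in lowest order at a slope `s` below `C` and `C'`. Both lowest parts then lie on the main
edge, in `v₀ = 0`, and commute with `x ∂/∂x`. Pulling `x ∂/∂x` back by the lowest part of `Ψ` and
subtracting gives a nonzero field `b ∂/∂y + c ∂/∂z` commuting with the lowest part. If `b = 0`, the
support has `v₂ ≤ 0` there, against `m₂ ≥ 1`. If `b ≠ 0`, a change allowed by stability brings the
edge into `v₁ ∈ {-1, 0}`, a nilpotent configuration whose main vertex is not `m`
(`not_of_critical_slope`, `nilConf_of_edge`). Hence `Ψ` is compatible up to slope `min C C'`, and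
stability gives `C = C'` (`not_lt_of_rel`).

The weight-vector is the primitive normal to the directions of edge and side, so it depends on `Δ`
and `C` only. The transition map and its inverse are compatible with it, hence multiplicities are
preserved. On an analytic parametrization of the first center, the Taylor polynomials of the
transition vanish in the components of nonzero weight; the corresponding coordinates of the second
chart are flat there, hence zero (`eventually_mem_blowupCenter`). -/

namespace NewtonFol

open MvPowerSeries

set_option linter.unusedSectionVars false
set_option linter.unusedSimpArgs false

/-! ### Weighted filtrations and initial parts -/

section Filtration

variable {Γ : Type*} [AddCommGroup Γ] [LinearOrder Γ] [IsOrderedAddMonoid Γ]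

/-- The weight of an exponent. -/
noncomputable def wt (w : Fin 3 → Γ) : (Fin 3 →₀ ℕ) →+ Γ := Finsupp.weight w

/-- All monomials of `F` have weight at least `γ`. -/
def Filt (w : Fin 3 → Γ) (γ : Γ) (F : Series) : Prop :=
  ∀ n, coeff n F ≠ 0 → γ ≤ wt w n

open Classical in
/-- The part of `F` of weight exactly `γ`. -/
noncomputable def inPart (w : Fin 3 → Γ) (γ : Γ) (F : Series) : Series :=
  fun n => if wt w n = γ then coeff n F else 0

/-- The initial part of a triple of series. -/
noncomputable def inMap (w : Fin 3 → Γ) (Ψ : Fin 3 → Series) : Fin 3 → Series :=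
  fun j => inPart w (w j) (Ψ j)

lemma wt_eq (w : Fin 3 → Γ) (n : Fin 3 →₀ ℕ) :
    wt w n = n 0 • w 0 + n 1 • w 1 + n 2 • w 2 := by
  simp [wt, Finsupp.weight_apply, Finsupp.sum_fintype, Fin.sum_univ_three]

@[simp] lemma wt_single (w : Fin 3 → Γ) (k : Fin 3) (a : ℕ) :
    wt w (Finsupp.single k a) = a • w k := by
  simp [wt, Finsupp.weight_apply]

open Classical in
lemma coeff_inPart (w : Fin 3 → Γ) (γ : Γ) (F : Series) (n : Fin 3 →₀ ℕ) :
    coeff n (inPart w γ F) = if wt w n = γ then coeff n F else 0 := rfl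

lemma coeff_inPart_of_eq {w : Fin 3 → Γ} {γ : Γ} {n : Fin 3 →₀ ℕ} (h : wt w n = γ) (F : Series) :
    coeff n (inPart w γ F) = coeff n F := by rw [coeff_inPart, if_pos h]

lemma coeff_inPart_of_ne {w : Fin 3 → Γ} {γ : Γ} {n : Fin 3 →₀ ℕ} (h : wt w n ≠ γ) (F : Series) :
    coeff n (inPart w γ F) = 0 := by rw [coeff_inPart, if_neg h]

lemma coeff_inPart_ne_zero {w : Fin 3 → Γ} {γ : Γ} {n : Fin 3 →₀ ℕ} {F : Series} :
    coeff n (inPart w γ F) ≠ 0 ↔ wt w n = γ ∧ coeff n F ≠ 0 := by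
  rw [coeff_inPart]; split_ifs with h <;> simp [h]

@[simp] lemma inPart_add (w : Fin 3 → Γ) (γ : Γ) (F G : Series) :
    inPart w γ (F + G) = inPart w γ F + inPart w γ G := by
  ext n; rw [map_add]; simp only [coeff_inPart, map_add]; split_ifs <;> simp

@[simp] lemma inPart_zero (w : Fin 3 → Γ) (γ : Γ) : inPart w γ 0 = 0 := by
  ext n; simp [coeff_inPart]

lemma inPart_sum {ι : Type*} (s : Finset ι) (w : Fin 3 → Γ) (γ : Γ) (F : ι → Series) :
    inPart w γ (∑ k ∈ s, F k) = ∑ k ∈ s, inPart w γ (F k) := by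
  classical
  induction s using Finset.induction_on with
  | empty => simp
  | insert a s ha ih => rw [Finset.sum_insert ha, Finset.sum_insert ha, inPart_add, ih]

lemma filt_inPart (w : Fin 3 → Γ) (γ : Γ) (F : Series) : Filt w γ (inPart w γ F) :=
  fun _ hn => (coeff_inPart_ne_zero.1 hn).1.ge

lemma Filt.mono {w : Fin 3 → Γ} {γ γ' : Γ} {F : Series} (h : Filt w γ F) (hγ : γ' ≤ γ) :
    Filt w γ' F := fun n hn => hγ.trans (h n hn)

lemma Filt.inPart_eq_zero {w : Fin 3 → Γ} {γ γ' : Γ} {F : Series} (h : Filt w γ F) (hγ : γ' < γ) :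
    inPart w γ' F = 0 := by
  ext n
  by_contra hn
  obtain ⟨h1, h2⟩ := coeff_inPart_ne_zero.1 hn
  exact absurd (h n h2) (by rw [h1]; exact not_le.2 hγ)

lemma filt_zero (w : Fin 3 → Γ) (γ : Γ) : Filt w γ 0 := fun n hn => absurd (by simp) hn

lemma Filt.add {w : Fin 3 → Γ} {γ : Γ} {F G : Series} (hF : Filt w γ F) (hG : Filt w γ G) :
    Filt w γ (F + G) := by
  intro n hn
  by_cases h : coeff n F = 0
  · exact hG n (by simpa [h] using hn)
  · exact hF n h

lemma Filt.sum {ι : Type*} {s : Finset ι} {w : Fin 3 → Γ} {γ : Γ} {F : ι → Series}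
    (h : ∀ k ∈ s, Filt w γ (F k)) : Filt w γ (∑ k ∈ s, F k) := by
  classical
  induction s using Finset.induction_on with
  | empty => exact filt_zero _ _
  | insert a s ha ih =>
    rw [Finset.sum_insert ha]
    exact (h a (by simp)).add (ih fun k hk => h k (by simp [hk]))

lemma Filt.neg {w : Fin 3 → Γ} {γ : Γ} {F : Series} (hF : Filt w γ F) : Filt w γ (-F) :=
  fun n hn => hF n (by simpa using hn)

lemma Filt.sub {w : Fin 3 → Γ} {γ : Γ} {F G : Series} (hF : Filt w γ F) (hG : Filt w γ G) :
    Filt w γ (F - G) := by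
  rw [sub_eq_add_neg]; exact hF.add hG.neg

lemma Filt.mul {w : Fin 3 → Γ} {a b : Γ} {F G : Series} (hF : Filt w a F) (hG : Filt w b G) :
    Filt w (a + b) (F * G) := by
  classical
  intro n hn
  rw [coeff_mul] at hn
  obtain ⟨p, hp, hpn⟩ := Finset.exists_ne_zero_of_sum_ne_zero hn
  rw [← Finset.HasAntidiagonal.mem_antidiagonal.mp hp, map_add]
  exact add_le_add (hF _ (left_ne_zero_of_mul hpn)) (hG _ (right_ne_zero_of_mul hpn))

/-- A product of monomials has weight exactly `a + b` only if both factors sit at their lower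
bounds. -/
lemma inPart_mul {w : Fin 3 → Γ} {a b : Γ} {F G : Series} (hF : Filt w a F) (hG : Filt w b G) :
    inPart w (a + b) (F * G) = inPart w a F * inPart w b G := by
  classical
  ext n
  rw [coeff_mul, coeff_inPart, coeff_mul]
  split_ifs with h
  · refine Finset.sum_congr rfl fun p hp => ?_
    rw [← Finset.HasAntidiagonal.mem_antidiagonal.mp hp, map_add] at h
    by_cases h1 : coeff p.1 F = 0
    · simp [coeff_inPart, h1]
    by_cases h2 : coeff p.2 G = 0
    · simp [coeff_inPart, h2]
    have h1' := hF _ h1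
    have h2' := hG _ h2
    have e1 : wt w p.1 = a := by
      refine le_antisymm ?_ h1'
      by_contra hc
      exact absurd h (add_lt_add_of_lt_of_le (not_le.1 hc) h2').ne'
    have e2 : wt w p.2 = b := by rw [e1] at h; exact add_left_cancel h
    rw [coeff_inPart_of_eq e1, coeff_inPart_of_eq e2]
  · symm
    refine Finset.sum_eq_zero fun p hp => ?_
    by_contra hne
    have h1 := (coeff_inPart_ne_zero.1 (left_ne_zero_of_mul hne)).1
    have h2 := (coeff_inPart_ne_zero.1 (right_ne_zero_of_mul hne)).1
    exact h (by rw [← Finset.HasAntidiagonal.mem_antidiagonal.mp hp, map_add, h1, h2])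

lemma filt_one (w : Fin 3 → Γ) : Filt w 0 (1 : Series) := by
  classical
  intro n hn
  rw [coeff_one] at hn
  have : n = 0 := by by_contra h; exact hn (if_neg h)
  rw [this, map_zero]

lemma inPart_one (w : Fin 3 → Γ) : inPart w 0 (1 : Series) = 1 := by
  classical
  ext n
  rw [coeff_inPart, coeff_one]
  split_ifs with h1 h2 h2 <;> first | rfl | (subst h2; simp at h1)

lemma Filt.pow {w : Fin 3 → Γ} {a : Γ} {F : Series} (hF : Filt w a F) (k : ℕ) :
    Filt w (k • a) (F ^ k) := by
  induction k with
  | zero => simpa using filt_one w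
  | succ k ih => rw [pow_succ, succ_nsmul]; exact ih.mul hF

lemma inPart_pow {w : Fin 3 → Γ} {a : Γ} {F : Series} (hF : Filt w a F) (k : ℕ) :
    inPart w (k • a) (F ^ k) = inPart w a F ^ k := by
  induction k with
  | zero => simpa using inPart_one w
  | succ k ih => rw [pow_succ, succ_nsmul, inPart_mul (hF.pow k) hF, ih, pow_succ]

lemma filt_C (w : Fin 3 → Γ) (c : ℝ) : Filt w 0 (C c : Series) := by
  classical
  intro n hn
  rw [coeff_C] at hn
  have : n = 0 := by by_contra h; exact hn (if_neg h)
  simp [this]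

lemma filt_of_nonneg {w : Fin 3 → Γ} (hw : ∀ k, 0 ≤ w k) (F : Series) : Filt w 0 F := by
  intro n _
  rw [wt_eq]
  exact add_nonneg (add_nonneg (nsmul_nonneg (hw 0) _) (nsmul_nonneg (hw 1) _))
    (nsmul_nonneg (hw 2) _)

lemma Filt.pderiv {w : Fin 3 → Γ} {a : Γ} {F : Series} (hF : Filt w a F) (k : Fin 3) :
    Filt w (a - w k) (MvPowerSeries.pderiv ℝ k F) := by
  intro n hn
  rw [coeff_pderiv] at hn
  have := hF _ (left_ne_zero_of_mul hn)
  rw [map_add, wt_single, one_smul] at this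
  exact sub_le_iff_le_add.2 this

lemma inPart_pderiv (w : Fin 3 → Γ) (a : Γ) (F : Series) (k : Fin 3) :
    inPart w (a - w k) (MvPowerSeries.pderiv ℝ k F) = MvPowerSeries.pderiv ℝ k (inPart w a F) := by
  ext n
  rw [coeff_inPart, coeff_pderiv, coeff_pderiv, coeff_inPart, map_add, wt_single, one_smul]
  by_cases h : wt w n = a - w k
  · rw [if_pos h, if_pos (by rw [h]; abel)]
  · rw [if_neg h, if_neg fun h' => h (by rw [← h']; abel), zero_mul]

lemma prod_eq (Ψ : Fin 3 → Series) (d : Fin 3 →₀ ℕ) :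
    (d.prod fun s e => Ψ s ^ e) = Ψ 0 ^ d 0 * Ψ 1 ^ d 1 * Ψ 2 ^ d 2 := by
  rw [Finsupp.prod_fintype _ _ (by simp), Fin.prod_univ_three]

lemma Filt.prod {w : Fin 3 → Γ} {Ψ : Fin 3 → Series} (hΨ : ∀ j, Filt w (w j) (Ψ j))
    (d : Fin 3 →₀ ℕ) : Filt w (wt w d) (d.prod fun s e => Ψ s ^ e) := by
  rw [prod_eq, wt_eq]
  exact (((hΨ 0).pow _).mul ((hΨ 1).pow _)).mul ((hΨ 2).pow _)

lemma inPart_prod {w : Fin 3 → Γ} {Ψ : Fin 3 → Series} (hΨ : ∀ j, Filt w (w j) (Ψ j))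
    (d : Fin 3 →₀ ℕ) :
    inPart w (wt w d) (d.prod fun s e => Ψ s ^ e) = d.prod fun s e => inMap w Ψ s ^ e := by
  rw [prod_eq, prod_eq, wt_eq, inPart_mul (((hΨ 0).pow _).mul ((hΨ 1).pow _)) ((hΨ 2).pow _),
    inPart_mul ((hΨ 0).pow _) ((hΨ 1).pow _), inPart_pow (hΨ 0), inPart_pow (hΨ 1),
    inPart_pow (hΨ 2)]
  rfl

lemma hasSubst {Ψ : Fin 3 → Series} (h : ∀ j, constantCoeff (Ψ j) = 0) : HasSubst Ψ :=
  hasSubst_of_constantCoeff_zero h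

lemma constantCoeff_inMap (w : Fin 3 → Γ) {Ψ : Fin 3 → Series}
    (h : ∀ j, constantCoeff (Ψ j) = 0) (j : Fin 3) : constantCoeff (inMap w Ψ j) = 0 := by
  rw [← coeff_zero_eq_constantCoeff_apply, inMap, coeff_inPart, coeff_zero_eq_constantCoeff_apply,
    h j, ite_self]

lemma subst_zero' {Ψ : Fin 3 → Series} (h : ∀ j, constantCoeff (Ψ j) = 0) :
    (0 : Series).subst Ψ = 0 := by
  rw [← coe_substAlgHom (hasSubst h), map_zero]

lemma subst_one' {Ψ : Fin 3 → Series} (h : ∀ j, constantCoeff (Ψ j) = 0) :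
    (1 : Series).subst Ψ = 1 := by
  rw [← coe_substAlgHom (hasSubst h), map_one]

lemma subst_sum' {Ψ : Fin 3 → Series} (h : ∀ j, constantCoeff (Ψ j) = 0) {ι : Type*}
    (s : Finset ι) (F : ι → Series) : (∑ k ∈ s, F k).subst Ψ = ∑ k ∈ s, (F k).subst Ψ := by
  simp only [← coe_substAlgHom (hasSubst h), map_sum]

lemma Filt.subst {w : Fin 3 → Γ} {Ψ : Fin 3 → Series} (h0 : ∀ j, constantCoeff (Ψ j) = 0)
    (hΨ : ∀ j, Filt w (w j) (Ψ j)) {γ : Γ} {F : Series} (hF : Filt w γ F) :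
    Filt w γ (F.subst Ψ) := by
  intro e he
  rw [coeff_subst (hasSubst h0)] at he
  obtain ⟨d, hd⟩ : ∃ d, coeff d F • coeff e (d.prod fun s e => Ψ s ^ e) ≠ 0 := by
    by_contra hc
    exact he (finsum_eq_zero_of_forall_eq_zero fun d => by_contra fun h => hc ⟨d, h⟩)
  rw [smul_eq_mul] at hd
  exact (hF d (left_ne_zero_of_mul hd)).trans (Filt.prod hΨ d e (right_ne_zero_of_mul hd))

/-- Monomials of `F` heavier than `γ` stay heavier under a compatible substitution, so only those of
weight `γ` contribute. -/
lemma inPart_subst {w : Fin 3 → Γ} {Ψ : Fin 3 → Series} (h0 : ∀ j, constantCoeff (Ψ j) = 0)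
    (hΨ : ∀ j, Filt w (w j) (Ψ j)) {γ : Γ} {F : Series} (hF : Filt w γ F) :
    inPart w γ (F.subst Ψ) = (inPart w γ F).subst (inMap w Ψ) := by
  ext e
  rw [coeff_subst (hasSubst (constantCoeff_inMap w h0)), coeff_inPart]
  split_ifs with he
  · rw [coeff_subst (hasSubst h0)]
    refine finsum_congr fun d => ?_
    simp only [smul_eq_mul]
    rcases eq_or_ne (coeff d F) 0 with h | h
    · rw [h, coeff_inPart, h, ite_self, zero_mul, zero_mul]
    · rcases (hF d h).eq_or_lt with h' | h'
      · rw [coeff_inPart_of_eq h'.symm, ← inPart_prod hΨ d, coeff_inPart_of_eq (he.trans h')]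
      · rw [coeff_inPart_of_ne h'.ne', zero_mul]
        by_contra hc
        exact absurd (Filt.prod hΨ d e (right_ne_zero_of_mul hc)) (by rw [he]; exact not_le.2 h')
  · symm
    refine finsum_eq_zero_of_forall_eq_zero fun d => ?_
    simp only [smul_eq_mul]
    by_contra hc
    have h1 := (coeff_inPart_ne_zero.1 (left_ne_zero_of_mul hc)).1
    have h2 := right_ne_zero_of_mul hc
    rw [← inPart_prod hΨ d] at h2
    exact he ((coeff_inPart_ne_zero.1 h2).1.trans h1)

/-- Weights may be real or lexicographic, where descending sequences need not stop. Dickson's lemma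
for exponents and monotonicity of the weight make the set of occurring weights well founded. -/
lemma exists_min_wt {w : Fin 3 → Γ} (hw : ∀ k, 0 ≤ w k) {F : Series} (hF : F ≠ 0) :
    ∃ n, coeff n F ≠ 0 ∧ Filt w (wt w n) F := by
  have hmono : Monotone (wt w) := by
    intro a b hab
    obtain ⟨c, rfl⟩ := exists_add_of_le hab
    rw [map_add]
    refine le_add_of_nonneg_right ?_
    rw [wt_eq]
    exact add_nonneg (add_nonneg (nsmul_nonneg (hw 0) _) (nsmul_nonneg (hw 1) _))
      (nsmul_nonneg (hw 2) _)
  have hS : ({n : Fin 3 →₀ ℕ | coeff n F ≠ 0}).Nonempty := by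
    by_contra h
    refine hF (MvPowerSeries.ext fun n => ?_)
    by_contra hn
    exact h ⟨n, by simpa using hn⟩
  have hwf := ((Set.isPWO_of_wellQuasiOrderedLE
    {n : Fin 3 →₀ ℕ | coeff n F ≠ 0}).image_of_monotone hmono).isWF
  obtain ⟨n, hn, hmin⟩ := hwf.min_mem (hS.image _)
  refine ⟨n, hn, fun k hk => ?_⟩
  rw [hmin]
  exact hwf.min_le (hS.image _) ⟨k, hk, rfl⟩

/-- A compatible substitution with injective initial part reflects the filtration. -/
lemma Filt.of_subst {w : Fin 3 → Γ} (hw : ∀ k, 0 ≤ w k) {Ψ : Fin 3 → Series}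
    (h0 : ∀ j, constantCoeff (Ψ j) = 0) (hΨ : ∀ j, Filt w (w j) (Ψ j))
    (hinj : ∀ F : Series, F.subst (inMap w Ψ) = 0 → F = 0) {γ : Γ} {F : Series}
    (hF : Filt w γ (F.subst Ψ)) : Filt w γ F := by
  by_cases hz : F = 0
  · rw [hz]; exact filt_zero _ _
  obtain ⟨n, hn, hmin⟩ := exists_min_wt hw hz
  by_contra hc
  have hlt : wt w n < γ := by
    by_contra hlt
    exact hc (hmin.mono (not_lt.1 hlt))
  -- If the least weight of `F` were below `γ`, the initial part of `F` would substitute to zero,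
  -- against injectivity.
  have h1 := inPart_subst h0 hΨ hmin
  rw [hF.inPart_eq_zero hlt] at h1
  have h2 := hinj _ h1.symm
  apply hn
  rw [← coeff_inPart_of_eq (rfl : wt w n = wt w n) F, h2, map_zero]

end Filtration

/-! ### The chain rule -/

section ChainRule

lemma filt_one_of_constantCoeff {F : Series} (h : constantCoeff F = 0) :
    Filt (fun _ => (1 : ℤ)) 1 F := by
  intro n hn
  have hn0 : n ≠ 0 := by
    rintro rfl
    exact hn (by rw [coeff_zero_eq_constantCoeff_apply, h])
  obtain ⟨k, hk⟩ := Finsupp.ne_iff.1 hn0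
  rw [wt_eq]
  simp only [Finsupp.coe_zero, Pi.zero_apply] at hk
  fin_cases k <;> simp at hk ⊢ <;> omega

lemma exists_polynomial_approx (F : Series) (N : ℤ) :
    ∃ p : MvPolynomial (Fin 3) ℝ, Filt (fun _ => (1 : ℤ)) N (F - (p : Series)) := by
  classical
  refine ⟨truncTotal N.toNat F, fun n hn => ?_⟩
  by_contra hc
  apply hn
  rw [map_sub, MvPolynomial.coeff_coe, coeff_truncTotal, sub_self]
  rw [wt_eq] at hc
  simp at hc
  have : n.degree = n 0 + n 1 + n 2 := by
    rw [Finsupp.degree_eq_sum, Fin.sum_univ_three]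
  omega

lemma eq_zero_of_forall_filt {F : Series} (h : ∀ N : ℤ, Filt (fun _ => (1 : ℤ)) N F) : F = 0 := by
  ext n
  by_contra hn
  have := h (wt (fun _ => (1 : ℤ)) n + 1) n hn
  omega

lemma act_eq (χ : FormalField) (F : Series) :
    χ.act F = χ 0 * pderiv ℝ 0 F + χ 1 * pderiv ℝ 1 F + χ 2 * pderiv ℝ 2 F := by
  rw [FormalField.act, Fin.sum_univ_three]

@[simp] lemma act_add (χ : FormalField) (F G : Series) : χ.act (F + G) = χ.act F + χ.act G := by
  simp only [act_eq, map_add]; ring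

@[simp] lemma act_mul (χ : FormalField) (F G : Series) :
    χ.act (F * G) = F * χ.act G + G * χ.act F := by
  simp only [act_eq, Derivation.leibniz, smul_eq_mul]; ring

@[simp] lemma act_X (χ : FormalField) (k : Fin 3) : χ.act (X k) = χ k := by
  simp only [FormalField.act]
  rw [Finset.sum_eq_single k]
  · simp
  · intro b _ hb; rw [pderiv_X_of_ne hb.symm, mul_zero]
  · simp

@[simp] lemma act_C (χ : FormalField) (c : ℝ) : χ.act (C c) = 0 := by
  simp [act_eq]

@[simp] lemma act_zero (χ : FormalField) : χ.act 0 = 0 := by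
  simp [act_eq]

lemma filt_act {χ : FormalField} {N : ℤ} {F : Series} (hF : Filt (fun _ => (1 : ℤ)) N F) :
    Filt (fun _ => (1 : ℤ)) (N - 1) (χ.act F) := by
  refine Filt.sum fun k _ => ?_
  have := (filt_of_nonneg (w := fun _ => (1 : ℤ)) (fun _ => by simp) (χ k)).mul (hF.pderiv k)
  simpa using this

/-- The chain rule. -/
lemma act_subst (χ : FormalField) {Ψ : Fin 3 → Series} (h0 : ∀ j, constantCoeff (Ψ j) = 0)
    (F : Series) :
    χ.act (F.subst Ψ) = ∑ k, (pderiv ℝ k F).subst Ψ * χ.act (Ψ k) := by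
  have hs := hasSubst h0
  have hΨ : ∀ j, Filt (fun _ => (1 : ℤ)) 1 (Ψ j) := fun j => filt_one_of_constantCoeff (h0 j)
  -- polynomials
  have hpoly : ∀ p : MvPolynomial (Fin 3) ℝ, χ.act ((p : Series).subst Ψ) =
      ∑ k, (pderiv ℝ k (p : Series)).subst Ψ * χ.act (Ψ k) := by
    intro p
    induction p using MvPolynomial.induction_on with
    | C a =>
      rw [MvPolynomial.coe_C, subst_C, act_C]
      refine (Finset.sum_eq_zero fun k _ => ?_).symm
      rw [pderiv_C, subst_zero' h0, zero_mul]
    | add p q hp hq =>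
      rw [MvPolynomial.coe_add, subst_add hs, act_add, hp, hq, ← Finset.sum_add_distrib]
      refine Finset.sum_congr rfl fun k _ => ?_
      rw [map_add, subst_add hs]; ring
    | mul_X p n hp =>
      rw [MvPolynomial.coe_mul, MvPolynomial.coe_X, subst_mul hs, act_mul, hp, subst_X hs,
        Finset.mul_sum]
      have : ∀ k, (pderiv ℝ k ((p : Series) * X n)).subst Ψ * χ.act (Ψ k) =
          (p : Series).subst Ψ * ((pderiv ℝ k (X n)).subst Ψ * χ.act (Ψ k)) +
          Ψ n * ((pderiv ℝ k (p : Series)).subst Ψ * χ.act (Ψ k)) := by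
        intro k
        rw [Derivation.leibniz, subst_add hs, smul_eq_mul, smul_eq_mul, subst_mul hs, subst_mul hs,
          subst_X hs]
        ring
      simp_rw [this]
      rw [Finset.sum_add_distrib, ← Finset.mul_sum]
      congr 1
      rw [Finset.sum_eq_single n]
      · rw [pderiv_X_self, subst_one' h0, one_mul]
      · intro b _ hb; rw [pderiv_X_of_ne hb.symm, subst_zero' h0, zero_mul, mul_zero]
      · simp
  -- Replacing `F` by a polynomial leaves a remainder of high order; differentiation loses one
  -- degree, so approximation to order `N + 1` shows that the defect of the chain rule vanishes to
  -- order `N`.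
  rw [← sub_eq_zero]
  refine eq_zero_of_forall_filt fun N => ?_
  obtain ⟨p, hp⟩ := exists_polynomial_approx F (N + 1)
  have e : F = (F - (p : Series)) + p := by ring
  set R : Series := F - (p : Series) with hR
  have key : χ.act (F.subst Ψ) - ∑ k, (pderiv ℝ k F).subst Ψ * χ.act (Ψ k) =
      χ.act (R.subst Ψ) - ∑ k, (pderiv ℝ k R).subst Ψ * χ.act (Ψ k) := by
    rw [e, subst_add hs, act_add, hpoly]
    simp only [map_add, subst_add hs, add_mul, Finset.sum_add_distrib]
    ring
  rw [key]
  refine Filt.sub ?_ (Filt.sum fun k _ => ?_)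
  · have := filt_act (χ := χ) (Filt.subst h0 hΨ hp)
    simpa using this
  · have h1 := Filt.subst h0 hΨ (hp.pderiv k)
    have h2 := filt_of_nonneg (w := fun _ => (1 : ℤ)) (fun _ => by simp) (χ.act (Ψ k))
    simpa using h1.mul h2

lemma pderiv_eq_act (k : Fin 3) (F : Series) :
    pderiv ℝ k F = FormalField.act (Pi.single k 1) F := by
  rw [FormalField.act, Finset.sum_eq_single k]
  · simp
  · intro b _ hb; simp [hb]
  · simp

lemma pderiv_subst (i : Fin 3) {Ψ : Fin 3 → Series} (h0 : ∀ j, constantCoeff (Ψ j) = 0)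
    (F : Series) :
    pderiv ℝ i (F.subst Ψ) = ∑ k, (pderiv ℝ k F).subst Ψ * pderiv ℝ i (Ψ k) := by
  simp only [pderiv_eq_act i]
  rw [act_subst _ h0]

end ChainRule

/-! ### Formal inverse -/

section FormalInverse

lemma coeff_single_eq (F : Series) (k : Fin 3) :
    constantCoeff (pderiv ℝ k F) = coeff (Finsupp.single k 1) F := by
  rw [← coeff_zero_eq_constantCoeff_apply, coeff_pderiv]
  simp

lemma constantCoeff_subst_eq {Ψ : Fin 3 → Series} (h0 : ∀ j, constantCoeff (Ψ j) = 0) (F : Series) :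
    constantCoeff (F.subst Ψ) = constantCoeff F := by
  have e : F = C (constantCoeff F) + (F - C (constantCoeff F)) := by ring
  have h : constantCoeff ((F - C (constantCoeff F)).subst Ψ) = 0 :=
    constantCoeff_subst_eq_zero (hasSubst h0) h0 (by simp)
  conv_lhs => rw [e, subst_add (hasSubst h0), map_add, h, subst_C]
  simp

lemma subst_subst {A B : Fin 3 → Series} (hA : ∀ j, constantCoeff (A j) = 0)
    (hB : ∀ j, constantCoeff (B j) = 0) (F : Series) :
    (F.subst A).subst B = F.subst (fun j => (A j).subst B) :=
  subst_comp_subst_apply (hasSubst hA) (hasSubst hB) F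

lemma subst_X_eq (F : Series) : F.subst (fun j => (X j : Series)) = F := by
  have := congr_fun (subst_self (σ := Fin 3) (R := ℝ)) F
  simpa using! this

lemma constantCoeff_X' (j : Fin 3) : constantCoeff (X j : Series) = 0 := by simp

lemma jacobian_apply (Φ : Fin 3 → Series) (j k : Fin 3) :
    jacobian Φ j k = constantCoeff (pderiv ℝ k (Φ j)) := rfl

lemma jacobian_subst {Φ : Fin 3 → Series} (h0 : ∀ j, constantCoeff (Φ j) = 0)
    (F : Fin 3 → Series) :
    jacobian (fun j => (F j).subst Φ) = jacobian F * jacobian Φ := by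
  ext j k
  rw [jacobian_apply, pderiv_subst _ h0, map_sum, Matrix.mul_apply]
  refine Finset.sum_congr rfl fun l _ => ?_
  rw [map_mul, constantCoeff_subst_eq h0]
  rfl

lemma jacobian_X : jacobian (fun j => (X j : Series)) = 1 := by
  ext j k
  rw [jacobian_apply, Matrix.one_apply]
  split_ifs with h
  · rw [h, pderiv_X_self, map_one]
  · rw [pderiv_X_of_ne h, map_zero]

/-- The total degree as a weight. -/
abbrev degWt : Fin 3 → ℤ := fun _ => 1

lemma wt_degWt (n : Fin 3 →₀ ℕ) : wt degWt n = n 0 + n 1 + n 2 := by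
  rw [wt_eq]; simp

lemma inMap_degWt_of_jacobian_eq_one {Φ : Fin 3 → Series} (hJ : jacobian Φ = 1) (j : Fin 3) :
    inMap degWt Φ j = X j := by
  classical
  ext n
  rw [inMap, coeff_inPart, coeff_X]
  by_cases h : wt degWt n = degWt j
  · rw [if_pos h]
    obtain ⟨k, rfl⟩ : ∃ k, n = Finsupp.single k 1 := by
      rw [wt_degWt] at h
      have h3 : n 0 + n 1 + n 2 = 1 := by exact_mod_cast h
      have : n 0 = 1 ∧ n 1 = 0 ∧ n 2 = 0 ∨ n 0 = 0 ∧ n 1 = 1 ∧ n 2 = 0 ∨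
        n 0 = 0 ∧ n 1 = 0 ∧ n 2 = 1 := by omega
      rcases this with h | h | h
      · exact ⟨0, by ext l; fin_cases l <;> simp [h]⟩
      · exact ⟨1, by ext l; fin_cases l <;> simp [h]⟩
      · exact ⟨2, by ext l; fin_cases l <;> simp [h]⟩
    have := congr_fun (congr_fun hJ j) k
    rw [jacobian_apply, coeff_single_eq, Matrix.one_apply] at this
    rw [this]
    refine if_congr ⟨fun h => by rw [h], fun h => ?_⟩ rfl rfl
    exact (Finsupp.single_left_injective one_ne_zero h).symm
  · rw [if_neg h, if_neg]
    rintro rfl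
    exact h (by simp)

/-- As `Φ` is tangent to the identity, `F ↦ F - F.subst Φ` raises the order by one; the sum of its
iterates is a Neumann series for the preimage. -/
lemma exists_subst_eq_of_jacobian_eq_one {Φ : Fin 3 → Series}
    (h0 : ∀ j, constantCoeff (Φ j) = 0) (hJ : jacobian Φ = 1) (F : Series) :
    ∃ G : Series, G.subst Φ = F := by
  have hΦ : ∀ j, Filt degWt (degWt j) (Φ j) := fun j => filt_one_of_constantCoeff (h0 j)
  have hs := hasSubst h0
  have step : ∀ (N : ℤ) (F : Series), Filt degWt N F → Filt degWt (N + 1) (F - F.subst Φ) := by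
    intro N F hF n hn
    have h1 := inPart_subst h0 hΦ hF
    have h2 : inMap degWt Φ = fun j => X j := funext (inMap_degWt_of_jacobian_eq_one hJ)
    rw [h2, subst_X_eq] at h1
    have h3 := (hF.sub (Filt.subst h0 hΦ hF)) n hn
    rcases h3.eq_or_lt with h | h
    · exfalso
      apply hn
      rw [map_sub, ← coeff_inPart_of_eq h.symm F, ← coeff_inPart_of_eq h.symm (F.subst Φ), h1,
        sub_self]
    · omega
  let S : ℕ → Series := fun n => (fun F : Series => F - F.subst Φ)^[n] F
  have hS0 : S 0 = F := rfl
  have hS : ∀ n, S (n + 1) = S n - (S n).subst Φ := fun n => Function.iterate_succ_apply' _ _ _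
  have hSf : ∀ n : ℕ, Filt degWt (n : ℤ) (S n) := by
    intro n
    induction n with
    | zero => exact filt_of_nonneg (fun _ => by simp) _
    | succ n ih => rw [hS]; exact_mod_cast step n _ ih
  let T : ℕ → Series := fun N => ∑ k ∈ Finset.range N, S k
  have hT : ∀ N, (T N).subst Φ = F - S N := by
    intro N
    induction N with
    | zero => simp only [T, Finset.range_zero, Finset.sum_empty]; rw [subst_zero' h0, hS0, sub_self]
    | succ N ih =>
      simp only [T, Finset.sum_range_succ] at ih ⊢
      rw [subst_add hs, ih, hS]; ring
  -- `S k` has order at least `k`, so the coefficient of the infinite sum at `n` is that of the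
  -- partial sum over `k ≤ deg n`.
  let G : Series := fun n => coeff n (T ((wt degWt n).toNat + 1))
  have hG : ∀ N : ℕ, Filt degWt (N : ℤ) (G - T N) := by
    intro N n hn
    by_contra hc
    apply hn
    rw [map_sub]
    change coeff n (T ((wt degWt n).toNat + 1)) - _ = 0
    have hnn : 0 ≤ wt degWt n := by rw [wt_degWt]; positivity
    have hle : (wt degWt n).toNat + 1 ≤ N := by omega
    rw [← map_sub, ← neg_sub, map_neg, neg_eq_zero]
    simp only [T]
    rw [← Finset.sum_range_add_sum_Ico _ hle, add_sub_cancel_left, map_sum]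
    refine Finset.sum_eq_zero fun k hk => ?_
    by_contra hne
    have := hSf k n hne
    rw [Finset.mem_Ico] at hk
    omega
  refine ⟨G, ?_⟩
  rw [← sub_eq_zero]
  refine eq_zero_of_forall_filt fun N => ?_
  have e : G.subst Φ - F = (G - T N.toNat).subst Φ - S N.toNat := by
    rw [subst_sub hs, hT]; ring
  rw [e]
  exact ((Filt.subst h0 hΦ (hG _)).sub (hSf _)).mono (by omega)

lemma IsFormalCoordinates.exists_subst_eq {Φ : Fin 3 → Series} (hΦ : IsFormalCoordinates Φ)
    (F : Series) : ∃ G : Series, G.subst Φ = F := by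
  obtain ⟨h0, hJ⟩ := hΦ
  let A := (jacobian Φ)⁻¹
  let Λ : Fin 3 → Series := fun j => ∑ k, C (A j k) * X k
  have hΛ : ∀ j, constantCoeff (Λ j) = 0 := fun j => by simp [Λ]
  have hJΛ : jacobian Λ = A := by
    ext j k
    rw [jacobian_apply]
    simp only [Λ]
    rw [map_sum, map_sum, Finset.sum_eq_single k]
    · simp
    · intro b _ hb; simp [pderiv_X_of_ne hb]
    · simp
  have h0' : ∀ j, constantCoeff ((Λ j).subst Φ) = 0 := fun j => by
    rw [constantCoeff_subst_eq h0, hΛ]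
  have h1 : jacobian (fun j => (Λ j).subst Φ) = 1 := by
    rw [jacobian_subst h0, hJΛ]
    exact Matrix.nonsing_inv_mul _ (isUnit_iff_ne_zero.2 hJ)
  obtain ⟨G, hG⟩ := exists_subst_eq_of_jacobian_eq_one h0' h1 F
  exact ⟨G.subst Λ, by rw [subst_subst hΛ h0, hG]⟩

/-- The formal inverse function theorem. -/
lemma IsFormalCoordinates.exists_inverse {Φ : Fin 3 → Series} (hΦ : IsFormalCoordinates Φ) :
    ∃ Θ : Fin 3 → Series, IsFormalCoordinates Θ ∧ (∀ j, (Θ j).subst Φ = X j) ∧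
      ∀ j, (Φ j).subst Θ = X j := by
  have key : ∀ {Φ : Fin 3 → Series}, IsFormalCoordinates Φ →
      ∃ Θ : Fin 3 → Series, IsFormalCoordinates Θ ∧ ∀ j, (Θ j).subst Φ = X j := by
    intro Φ hΦ
    choose Θ hΘ using fun j => hΦ.exists_subst_eq (X j)
    refine ⟨Θ, ⟨fun j => ?_, ?_⟩, hΘ⟩
    · rw [← constantCoeff_subst_eq hΦ.1, hΘ, constantCoeff_X']
    · have h := jacobian_subst hΦ.1 Θ
      simp only [hΘ, jacobian_X] at h
      intro hd
      have := congr_arg Matrix.det h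
      rw [Matrix.det_mul, hd, zero_mul] at this
      simp at this
  obtain ⟨Θ, hΘ, h1⟩ := key hΦ
  -- A left inverse `Ξ` of the left inverse `Θ` must be `Φ`, which makes `Θ` two-sided.
  obtain ⟨Ξ, hΞ, h2⟩ := key hΘ
  refine ⟨Θ, hΘ, h1, fun j => ?_⟩
  have : Ξ j = Φ j := by
    have h3 := subst_subst hΘ.1 hΦ.1 (Ξ j)
    simp only [h1, h2] at h3
    rw [subst_X_eq, subst_X (hasSubst hΦ.1)] at h3
    exact h3.symm
  rw [← this, h2]

lemma IsFormalCoordinates.subst_injective {Φ : Fin 3 → Series} (hΦ : IsFormalCoordinates Φ)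
    {F G : Series} (h : F.subst Φ = G.subst Φ) : F = G := by
  obtain ⟨Θ, hΘ, -, h2⟩ := hΦ.exists_inverse
  have h3 := congr_arg (MvPowerSeries.subst Θ) h
  rw [subst_subst hΦ.1 hΘ.1, subst_subst hΦ.1 hΘ.1] at h3
  simpa only [h2, subst_X_eq] using h3

lemma IsFormalCoordinates.subst_eq_zero {Φ : Fin 3 → Series} (hΦ : IsFormalCoordinates Φ)
    {F : Series} (h : F.subst Φ = 0) : F = 0 :=
  hΦ.subst_injective (h.trans (subst_zero' hΦ.1).symm)

lemma isUnit_iff_constantCoeff_ne_zero {F : Series} : IsUnit F ↔ constantCoeff F ≠ 0 := by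
  rw [MvPowerSeries.isUnit_iff_constantCoeff, isUnit_iff_ne_zero]

lemma isUnit_subst {Φ : Fin 3 → Series} (h0 : ∀ j, constantCoeff (Φ j) = 0) {F : Series} :
    IsUnit (F.subst Φ) ↔ IsUnit F := by
  rw [isUnit_iff_constantCoeff_ne_zero, isUnit_iff_constantCoeff_ne_zero, constantCoeff_subst_eq h0]

lemma IsFormalCoordinates.dvd_of_subst_dvd {Φ : Fin 3 → Series} (hΦ : IsFormalCoordinates Φ)
    {F G : Series} (h : F.subst Φ ∣ G.subst Φ) : F ∣ G := by
  obtain ⟨H, hH⟩ := h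
  obtain ⟨H', rfl⟩ := hΦ.exists_subst_eq H
  rw [← subst_mul (hasSubst hΦ.1)] at hH
  exact ⟨H', hΦ.subst_injective hH⟩

end FormalInverse

/-! ### Fibered coordinate changes -/

section Fibered

lemma pderiv_eq_zero_iff {k : Fin 3} {F : Series} :
    pderiv ℝ k F = 0 ↔ ∀ n, coeff n F ≠ 0 → n k = 0 := by
  constructor
  · intro h n hn
    by_contra hk
    have h1 := congr_arg (coeff (n - Finsupp.single k 1)) h
    have h2 : n - Finsupp.single k 1 + Finsupp.single k 1 = n := by
      ext l
      rcases eq_or_ne l k with rfl | hl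
      · simp; omega
      · simp [hl.symm]
    rw [coeff_pderiv, map_zero, h2] at h1
    rcases mul_eq_zero.1 h1 with h3 | h3
    · exact hn h3
    · have : (0 : ℝ) ≤ ((n - Finsupp.single k 1 : Fin 3 →₀ ℕ) k : ℝ) := Nat.cast_nonneg _
      linarith
  · intro h
    ext n
    rw [coeff_pderiv, map_zero]
    by_cases hn : coeff (n + Finsupp.single k 1) F = 0
    · rw [hn, zero_mul]
    · have := h _ hn
      simp at this

lemma X_dvd_iff_coeff {k : Fin 3} {F : Series} :
    X k ∣ F ↔ ∀ n, coeff n F ≠ 0 → 1 ≤ n k := by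
  rw [X_dvd_iff]
  refine ⟨fun h n hn => ?_, fun h n hn => ?_⟩
  · by_contra hc
    exact hn (h n (by omega))
  · by_contra hc
    have := h n hc
    omega

/-- Formal changes of coordinates preserving the divisor and the fibration along the axis. -/
structure Fibered (i : ℕ) (Ψ : Fin 3 → Series) : Prop where
  const : ∀ j, constantCoeff (Ψ j) = 0
  z0 : pderiv ℝ 2 (Ψ 0) = 0
  z1 : pderiv ℝ 2 (Ψ 1) = 0
  x0 : X 0 ∣ Ψ 0
  y1 : i = 2 → X 1 ∣ Ψ 1
  det : (jacobian Ψ).det ≠ 0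

variable {i : ℕ} {Ψ : Fin 3 → Series}

lemma Fibered.isFormalCoordinates (h : Fibered i Ψ) : IsFormalCoordinates Ψ := ⟨h.const, h.det⟩

lemma jacobian_apply' (Φ : Fin 3 → Series) (j k : Fin 3) :
    jacobian Φ j k = coeff (Finsupp.single k 1) (Φ j) := by
  rw [jacobian_apply, coeff_single_eq]

/-- The first row has only its `x`-entry because `x` divides `Ψ 0`, and the first two rows have no
`z`-entry: the matrix is lower triangular. -/
lemma jacobian_triangular (z0 : pderiv ℝ 2 (Ψ 0) = 0) (z1 : pderiv ℝ 2 (Ψ 1) = 0)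
    (x0 : X 0 ∣ Ψ 0) :
    (jacobian Ψ).det = coeff (Finsupp.single 0 1) (Ψ 0) * coeff (Finsupp.single 1 1) (Ψ 1) *
      coeff (Finsupp.single 2 1) (Ψ 2) := by
  have h02 : jacobian Ψ 0 2 = 0 := by rw [jacobian_apply, z0, map_zero]
  have h12 : jacobian Ψ 1 2 = 0 := by rw [jacobian_apply, z1, map_zero]
  have h01 : jacobian Ψ 0 1 = 0 := by
    rw [jacobian_apply']
    exact X_dvd_iff.1 x0 _ (by simp)
  rw [Matrix.det_fin_three, h02, h12, h01]
  simp only [jacobian_apply']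
  ring

lemma Fibered.diag (h : Fibered i Ψ) (j : Fin 3) : coeff (Finsupp.single j 1) (Ψ j) ≠ 0 := by
  have := h.det
  rw [jacobian_triangular h.z0 h.z1 h.x0] at this
  fin_cases j
  · exact left_ne_zero_of_mul (left_ne_zero_of_mul this)
  · exact right_ne_zero_of_mul (left_ne_zero_of_mul this)
  · exact right_ne_zero_of_mul this

lemma Fibered.isUnit_z2 (h : Fibered i Ψ) : IsUnit (pderiv ℝ 2 (Ψ 2)) := by
  rw [isUnit_iff_constantCoeff_ne_zero, coeff_single_eq]
  exact h.diag 2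

lemma Fibered.smul (h : Fibered i Ψ) {t : Fin 3 → ℝ} (ht : ∀ j, t j ≠ 0) :
    Fibered i (fun j => C (t j) * Ψ j) := by
  have z0 : pderiv ℝ 2 (C (t 0) * Ψ 0) = 0 := by simp [h.z0]
  have z1 : pderiv ℝ 2 (C (t 1) * Ψ 1) = 0 := by simp [h.z1]
  have x0 : X 0 ∣ C (t 0) * Ψ 0 := h.x0.mul_left _
  refine ⟨fun j => by simp [h.const], z0, z1, x0, fun hi => (h.y1 hi).mul_left _, ?_⟩
  rw [jacobian_triangular z0 z1 x0]
  simp only [coeff_C_mul]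
  exact mul_ne_zero (mul_ne_zero (mul_ne_zero (ht 0) (h.diag 0)) (mul_ne_zero (ht 1) (h.diag 1)))
    (mul_ne_zero (ht 2) (h.diag 2))

/-- The diagonal linear monomials of `Ψ` have exactly the weight of their coordinate, so they
survive in the initial part and keep its Jacobian invertible, whatever the weights. -/
lemma Fibered.inMap {Γ : Type*} [AddCommGroup Γ] [LinearOrder Γ] [IsOrderedAddMonoid Γ]
    (h : Fibered i Ψ) (w : Fin 3 → Γ) : Fibered i (inMap w Ψ) := by
  have hz : ∀ j, pderiv ℝ 2 (Ψ j) = 0 → pderiv ℝ 2 (NewtonFol.inMap w Ψ j) = 0 := by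
    intro j hj
    rw [NewtonFol.inMap, ← inPart_pderiv, hj, inPart_zero]
  have hx : ∀ j k, X k ∣ Ψ j → X k ∣ NewtonFol.inMap w Ψ j := by
    intro j k hj
    rw [X_dvd_iff_coeff] at hj ⊢
    exact fun n hn => hj n (coeff_inPart_ne_zero.1 hn).2
  refine ⟨constantCoeff_inMap w h.const, hz 0 h.z0, hz 1 h.z1, hx 0 0 h.x0,
    fun hi => hx 1 1 (h.y1 hi), ?_⟩
  rw [jacobian_triangular (hz 0 h.z0) (hz 1 h.z1) (hx 0 0 h.x0)]
  have hd : ∀ j, coeff (Finsupp.single j 1) (NewtonFol.inMap w Ψ j) ≠ 0 := fun j =>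
    coeff_inPart_ne_zero.2 ⟨by simp, h.diag j⟩
  exact mul_ne_zero (mul_ne_zero (hd 0) (hd 1)) (hd 2)

/-- The inverse of a fibered change is fibered. -/
lemma Fibered.inverse (h : Fibered i Ψ) {Θ : Fin 3 → Series} (hΘ : IsFormalCoordinates Θ)
    (h1 : ∀ j, (Θ j).subst Ψ = X j) : Fibered i Θ := by
  have hΨ := h.isFormalCoordinates
  have hz : ∀ j : Fin 3, j ≠ 2 → pderiv ℝ 2 (Θ j) = 0 := by
    intro j hj
    -- Differentiating `Θ j ∘ Ψ = X j` in `z` leaves a single term: a unit times `∂(Θ j)/∂z` along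
    -- `Ψ`.
    have h2 := pderiv_subst 2 h.const (Θ j)
    rw [h1, pderiv_X_of_ne hj, Fin.sum_univ_three, h.z0, h.z1, mul_zero, mul_zero, zero_add,
      zero_add] at h2
    exact hΨ.subst_eq_zero (h.isUnit_z2.mul_left_eq_zero.1 h2.symm)
  have hx : ∀ k, X k ∣ Ψ k → X k ∣ Θ k := by
    intro k hk
    refine hΨ.dvd_of_subst_dvd ?_
    rw [h1, subst_X (hasSubst h.const)]
    obtain ⟨q, hq⟩ := hk
    have hu : IsUnit q := by
      rw [isUnit_iff_constantCoeff_ne_zero]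
      have h2 := h.diag k
      rw [hq, ← coeff_single_eq, Derivation.leibniz] at h2
      simpa using h2
    rw [hq]
    exact hu.mul_right_dvd.2 dvd_rfl
  exact ⟨hΘ.1, hz 0 (by decide), hz 1 (by decide), hx 0 h.x0, fun hi => hx 1 (h.y1 hi), hΘ.2⟩

end Fibered

/-! ### Equivalence of vector fields up to a fibered change and a unit -/

section Rel

/-- The change of coordinates `Ψ` transforms `U • Ω` into `Ω'`. -/
structure Rel (i : ℕ) (Ψ : Fin 3 → Series) (U : Series) (Ω Ω' : FormalField) : Prop where
  fibered : Fibered i Ψ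
  unit : IsUnit U
  eq : ∀ j, U * Ω.act (Ψ j) = (Ω' j).subst Ψ

variable {i : ℕ} {Ψ : Fin 3 → Series} {U : Series} {Ω Ω' : FormalField}

/-- The unit of the inverse relation is `U⁻¹` rewritten in the new coordinates. -/
lemma Rel.symm (h : Rel i Ψ U Ω Ω') {Θ : Fin 3 → Series} (hΘ : IsFormalCoordinates Θ)
    (h1 : ∀ j, (Θ j).subst Ψ = X j) : ∃ U', Rel i Θ U' Ω' Ω := by
  have hΨ := h.fibered.isFormalCoordinates
  obtain ⟨V, hV⟩ := h.unit.exists_right_inv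
  obtain ⟨U', hU'⟩ := hΨ.exists_subst_eq V
  refine ⟨U', h.fibered.inverse hΘ h1, ?_, fun j => hΨ.subst_injective ?_⟩
  · rw [← isUnit_subst hΨ.1, hU']
    exact IsUnit.of_mul_eq_one U (by rw [mul_comm, hV])
  · have h2 : ((Ω j).subst Θ).subst Ψ = Ω j := by
      rw [subst_subst hΘ.1 hΨ.1]
      simp only [h1, subst_X_eq]
    rw [h2, subst_mul (hasSubst hΨ.1), hU', FormalField.act, subst_sum' hΨ.1]
    simp only [subst_mul (hasSubst hΨ.1), ← h.eq]
    have h3 := act_subst Ω hΨ.1 (Θ j)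
    rw [h1, act_X] at h3
    rw [h3, Finset.mul_sum]
    refine Finset.sum_congr rfl fun k _ => ?_
    linear_combination (pderiv ℝ k (Θ j)).subst Ψ * Ω.act (Ψ k) * hV

variable {Γ : Type*} [AddCommGroup Γ] [LinearOrder Γ] [IsOrderedAddMonoid Γ]

/-- The vector field has weight at least `δ`. -/
def FiltField (w : Fin 3 → Γ) (δ : Γ) (Ω : FormalField) : Prop := ∀ j, Filt w (δ + w j) (Ω j)

/-- The part of weight `δ` of a vector field. -/
noncomputable def inField (w : Fin 3 → Γ) (δ : Γ) (Ω : FormalField) : FormalField :=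
  fun j => inPart w (δ + w j) (Ω j)

lemma filt_act_field {w : Fin 3 → Γ} {δ γ : Γ} (hΩ : FiltField w δ Ω) {F : Series}
    (hF : Filt w γ F) : Filt w (δ + γ) (Ω.act F) := by
  refine Filt.sum fun k _ => ?_
  have := (hΩ k).mul (hF.pderiv k)
  rwa [show δ + w k + (γ - w k) = δ + γ by abel] at this

lemma inPart_act {w : Fin 3 → Γ} {δ γ : Γ} (hΩ : FiltField w δ Ω) {F : Series}
    (hF : Filt w γ F) :
    inPart w (δ + γ) (Ω.act F) = (inField w δ Ω).act (inPart w γ F) := by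
  rw [FormalField.act, inPart_sum, FormalField.act]
  refine Finset.sum_congr rfl fun k _ => ?_
  rw [← inPart_pderiv, inField, ← inPart_mul (hΩ k) (hF.pderiv k)]
  congr 1
  abel

/-- With positive weights only the constant monomial weighs zero; a unit factor therefore enters
initial parts through its constant term alone. -/
lemma inPart_zero_of_pos {w : Fin 3 → Γ} (hw : ∀ k, 0 < w k) (F : Series) :
    inPart w 0 F = C (constantCoeff F) := by
  classical
  ext n
  rw [coeff_inPart, coeff_C]
  by_cases hn : n = 0
  · subst hn; simp
  · rw [if_neg hn, if_neg]
    intro h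
    obtain ⟨k, hk⟩ := Finsupp.ne_iff.1 hn
    have hk : 0 < n k := Nat.pos_of_ne_zero hk
    have h1 : ∀ l, 0 ≤ n l • w l := fun l => nsmul_nonneg (hw l).le _
    have h2 : 0 < n k • w k := nsmul_pos (hw k) hk.ne'
    rw [wt_eq] at h
    have := h1 0; have := h1 1; have := h1 2
    refine h2.ne' (le_antisymm ?_ h2.le)
    rw [← h]
    fin_cases k
    · simp only [Fin.zero_eta]
      rw [add_assoc]; exact le_add_of_nonneg_right (add_nonneg (h1 1) (h1 2))
    · simp only [Fin.mk_one]
      rw [add_comm (n 0 • w 0), add_assoc]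
      exact le_add_of_nonneg_right (add_nonneg (h1 0) (h1 2))
    · simp only [Fin.reduceFinMk]
      exact le_add_of_nonneg_left (add_nonneg (h1 0) (h1 1))

/-- A compatible change of coordinates preserves the order of a vector field, and transforms
initial parts by its initial part. -/
lemma Rel.init {w : Fin 3 → Γ} (hw : ∀ k, 0 < w k) {δ : Γ} (h : Rel i Ψ U Ω Ω')
    (hΨ : ∀ j, Filt w (w j) (Ψ j)) (hΩ : FiltField w δ Ω) :
    FiltField w δ Ω' ∧ Rel i (inMap w Ψ) (C (constantCoeff U)) (inField w δ Ω)
      (inField w δ Ω') := by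
  have hf := h.fibered.inMap w
  have h0 := h.fibered.const
  have hU : Filt w 0 U := filt_of_nonneg (fun k => (hw k).le) U
  have hact : ∀ j, Filt w (δ + w j) (U * Ω.act (Ψ j)) := fun j => by
    simpa using hU.mul (filt_act_field hΩ (hΨ j))
  -- The initial part of `Ψ` is again a coordinate system, so the lower bound for `Ω'` can be read
  -- off after substitution.
  have hΩ' : FiltField w δ Ω' := fun j => by
    refine Filt.of_subst (fun k => (hw k).le) h0 hΨ
      (fun F hF => hf.isFormalCoordinates.subst_eq_zero hF) ?_
    rw [← h.eq]
    exact hact j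
  refine ⟨hΩ', hf, ?_, fun j => ?_⟩
  · rw [isUnit_iff_constantCoeff_ne_zero]
    simpa using isUnit_iff_constantCoeff_ne_zero.1 h.unit
  · rw [inField, ← inPart_subst h0 hΨ (hΩ' j), ← h.eq, ← inPart_zero_of_pos hw, inMap,
      ← inPart_act hΩ (hΨ j), ← inPart_mul hU (filt_act_field hΩ (hΨ j)), zero_add]

lemma subst_scale (t : Fin 3 → ℝ) (F : Series) (n : Fin 3 →₀ ℕ) :
    coeff n (F.subst (fun j => C (t j) * X j : Fin 3 → Series)) =
      (n.prod fun s e => t s ^ e) * coeff n F := by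
  have h := rescale_eq_subst t F
  rw [← coeff_rescale, h]
  congr 2
  ext1 j
  simp [smul_eq_C_mul]

/-- If the initial part of `Ψ` is a composition of `E` with a diagonal linear map, then the
initial parts of the transforms by `Ψ` and `E` have the same support. -/
lemma Rel.coeff_eq_zero_iff {w : Fin 3 → Γ} (hw : ∀ k, 0 < w k) {δ : Γ} (h : Rel i Ψ U Ω Ω')
    (hΨ : ∀ j, Filt w (w j) (Ψ j)) (hΩ : FiltField w δ Ω) {E : Fin 3 → Series} {t : Fin 3 → ℝ}
    (ht : ∀ j, t j ≠ 0) (hE : ∀ j, inMap w Ψ j = C (t j) * E j) {Ω'' : FormalField}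
    (hΩ'' : IsTransform E Ω Ω'') :
    FiltField w δ Ω'' ∧ ∀ j n, coeff n (inField w δ Ω'' j) = 0 ↔
      coeff n (inField w δ Ω' j) = 0 := by
  have hE' : E = fun j => C ((t j)⁻¹) * inMap w Ψ j := by
    ext1 j
    rw [hE, ← mul_assoc, ← map_mul, inv_mul_cancel₀ (ht j), map_one, one_mul]
  have hEf : Fibered i E := by
    rw [hE']
    exact (h.fibered.inMap w).smul fun j => inv_ne_zero (ht j)
  have hEc : ∀ j, Filt w (w j) (E j) := fun j => by
    rw [hE']
    simpa [inMap] using (filt_C w ((t j)⁻¹)).mul (filt_inPart w (w j) (Ψ j))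
  have hEin : ∀ j, inMap w E j = E j := fun j => by
    rw [hE']
    simp only [inMap]
    ext n
    rw [coeff_inPart]
    split_ifs with hn
    · rfl
    · rw [coeff_C_mul, coeff_inPart_of_ne hn, mul_zero]
  have hrel : Rel i E 1 Ω Ω'' := ⟨hEf, isUnit_one, fun j => by rw [one_mul, hΩ'']⟩
  obtain ⟨hΩf, hin⟩ := hrel.init hw hEc hΩ
  obtain ⟨-, hin'⟩ := h.init hw hΨ hΩ
  refine ⟨hΩf, fun j n => ?_⟩
  have hu : constantCoeff U ≠ 0 := isUnit_iff_constantCoeff_ne_zero.1 h.unit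
  set T : Fin 3 → Series := fun j => C (t j) * X j with hT
  have hT0 : ∀ j, constantCoeff (T j) = 0 := fun j => by simp [hT]
  have hTE : (fun j => (T j).subst E) = inMap w Ψ := by
    ext1 j
    rw [hE, hT]
    simp only
    rw [subst_mul (hasSubst hEf.const), subst_X (hasSubst hEf.const), subst_C]
  -- Both lowest parts come from that of `Ω`, one through `E` and the other through `T ∘ E`. They
  -- differ by the diagonal substitution `T` and nonzero constants, which do not affect supports.
  have e1 : C (constantCoeff U * t j) * inField w δ Ω'' j = (inField w δ Ω' j).subst T := by
    refine hEf.isFormalCoordinates.subst_injective ?_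
    rw [subst_subst hT0 hEf.const, hTE, ← hin'.eq, hE, act_mul, act_C,
      subst_mul (hasSubst hEf.const), subst_C]
    have h2 := hin.eq j
    rw [hEin, map_one, map_one, one_mul] at h2
    rw [funext hEin] at h2
    rw [← h2, mul_zero, add_zero, map_mul]
    exact mul_assoc _ _ _
  have e2 := congr_arg (coeff n) e1
  rw [coeff_C_mul, subst_scale] at e2
  have hp : (n.prod fun s e => t s ^ e) ≠ 0 :=
    Finset.prod_ne_zero_iff.2 fun s _ => pow_ne_zero _ (ht s)
  constructor
  · intro h3
    rw [h3, mul_zero] at e2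
    exact (mul_eq_zero.1 e2.symm).resolve_left hp
  · intro h3
    rw [h3, mul_zero] at e2
    exact (mul_eq_zero.1 e2).resolve_left (mul_ne_zero hu (ht j))

end Rel

/-! ### The support -/

section Support

/-- The exponent `n - e_j` attached to the monomial `n` in the `j`-th coefficient. -/
def logExp (j : Fin 3) (n : Fin 3 →₀ ℕ) : Fin 3 → ℤ := fun k => (n k : ℤ) - if k = j then 1 else 0

lemma mem_supp {Ω : FormalField} {v : Fin 3 → ℤ} :
    v ∈ supp Ω ↔ ∃ j n, coeff n (Ω j) ≠ 0 ∧ v = logExp j n := by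
  have hsing : ∀ j k : Fin 3, (Pi.single j 1 : Fin 3 → ℤ) k = if k = j then 1 else 0 := by
    intro j k
    rw [Pi.single_apply]
  constructor
  · intro hv
    obtain ⟨j, hj⟩ := Function.ne_iff.1 (show newtonMap Ω v ≠ 0 from hv)
    simp only [newtonMap, Pi.zero_apply] at hj
    split_ifs at hj with h
    · refine ⟨j, _, hj, ?_⟩
      ext k
      have := h k
      simp only [logExp, Finsupp.equivFunOnFinite_symm_apply_apply, Pi.add_apply, hsing] at this ⊢
      omega
    · exact absurd rfl hj
  · rintro ⟨j, n, hn, rfl⟩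
    refine Function.ne_iff.2 ⟨j, ?_⟩
    have h1 : ∀ k, (logExp j n + Pi.single j 1 : Fin 3 → ℤ) k = n k := by
      intro k
      simp [logExp, hsing]
    simp only [newtonMap, Pi.zero_apply, h1]
    rw [if_pos (fun k => by omega)]
    convert hn
    ext k
    simp

lemma logExp_mem_supp {Ω : FormalField} {j : Fin 3} {n : Fin 3 →₀ ℕ} (h : coeff n (Ω j) ≠ 0) :
    logExp j n ∈ supp Ω := mem_supp.2 ⟨j, n, h, rfl⟩

lemma neg_one_le_of_mem_supp {Ω : FormalField} {v : Fin 3 → ℤ} (hv : v ∈ supp Ω) (k : Fin 3) :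
    -1 ≤ v k := by
  obtain ⟨j, n, -, rfl⟩ := mem_supp.1 hv
  simp only [logExp]
  split_ifs <;> omega

variable {Γ : Type*} [AddCommGroup Γ] [LinearOrder Γ] [IsOrderedAddMonoid Γ]

/-- The weight of an integer vector. -/
def zwt (w : Fin 3 → Γ) (v : Fin 3 → ℤ) : Γ := v 0 • w 0 + v 1 • w 1 + v 2 • w 2

/-- The shift by `w j` in `FiltField` cancels the shift of exponents in the logarithmic basis; hence
the weight of a vector field can be read on its support. -/
lemma zwt_logExp (w : Fin 3 → Γ) (j : Fin 3) (n : Fin 3 →₀ ℕ) :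
    zwt w (logExp j n) + w j = wt w n := by
  rw [wt_eq, zwt]
  fin_cases j <;> simp [logExp, sub_smul] <;> abel

lemma filtField_iff {w : Fin 3 → Γ} {δ : Γ} {Ω : FormalField} :
    FiltField w δ Ω ↔ ∀ v ∈ supp Ω, δ ≤ zwt w v := by
  constructor
  · intro h v hv
    obtain ⟨j, n, hn, rfl⟩ := mem_supp.1 hv
    have := h j n hn
    rwa [← zwt_logExp w j n, add_le_add_iff_right] at this
  · intro h j n hn
    rw [← zwt_logExp w j n, add_le_add_iff_right]
    exact h _ (logExp_mem_supp hn)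

lemma mem_supp_inField {w : Fin 3 → Γ} {δ : Γ} {Ω : FormalField} {v : Fin 3 → ℤ} :
    v ∈ supp (inField w δ Ω) ↔ v ∈ supp Ω ∧ zwt w v = δ := by
  rw [mem_supp, mem_supp]
  constructor
  · rintro ⟨j, n, hn, rfl⟩
    obtain ⟨h1, h2⟩ := coeff_inPart_ne_zero.1 hn
    refine ⟨⟨j, n, h2, rfl⟩, ?_⟩
    rwa [← zwt_logExp w j n, add_left_inj] at h1
  · rintro ⟨⟨j, n, hn, rfl⟩, h⟩
    refine ⟨j, n, coeff_inPart_ne_zero.2 ⟨?_, hn⟩, rfl⟩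
    rw [← zwt_logExp w j n, h]

lemma supp_eq_of_coeff {Ω Ω' : FormalField}
    (h : ∀ j n, coeff n (Ω j) = 0 ↔ coeff n (Ω' j) = 0) : supp Ω = supp Ω' := by
  ext v
  simp only [mem_supp, ne_eq, h]

end Support

/-! ### Lexicographic half-spaces and the Newton polyhedron -/

section Polyhedron

/-- The vector `(a, b, c)` is lexicographically nonnegative. -/
def LexNonneg (a b c : ℝ) : Prop := 0 < a ∨ (a = 0 ∧ (0 < b ∨ (b = 0 ∧ 0 ≤ c)))

lemma LexNonneg.add {a b c a' b' c' : ℝ} (h : LexNonneg a b c) (h' : LexNonneg a' b' c') :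
    LexNonneg (a + a') (b + b') (c + c') := by
  rcases h with h | ⟨h, h | ⟨h1, h2⟩⟩ <;> rcases h' with h' | ⟨h', h' | ⟨h1', h2'⟩⟩
  · left; linarith
  · left; linarith
  · left; linarith
  · left; linarith
  · right; exact ⟨by linarith, Or.inl (by linarith)⟩
  · right; exact ⟨by linarith, Or.inl (by linarith)⟩
  · left; linarith
  · right; exact ⟨by linarith, Or.inl (by linarith)⟩
  · right; exact ⟨by linarith, Or.inr ⟨by linarith, by linarith⟩⟩

lemma LexNonneg.mul {a b c t : ℝ} (h : LexNonneg a b c) (ht : 0 < t) :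
    LexNonneg (t * a) (t * b) (t * c) := by
  rcases h with h | ⟨rfl, h | ⟨rfl, h2⟩⟩
  · left; positivity
  · right; exact ⟨by simp, Or.inl (by positivity)⟩
  · right; exact ⟨by simp, Or.inr ⟨by simp, by positivity⟩⟩

lemma LexNonneg.of_mul {a b c t : ℝ} (h : LexNonneg (t * a) (t * b) (t * c)) (ht : 0 < t) :
    LexNonneg a b c := by
  have := h.mul (inv_pos.2 ht)
  simpa [← mul_assoc, inv_mul_cancel₀ ht.ne'] using this

lemma lexNonneg_of_nonneg {a b c : ℝ} (ha : 0 ≤ a) (hb : 0 ≤ b) (hc : 0 ≤ c) :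
    LexNonneg a b c := by
  rcases ha.eq_or_lt with ha | ha
  · rcases hb.eq_or_lt with hb | hb
    · exact Or.inr ⟨ha.symm, Or.inr ⟨hb.symm, hc⟩⟩
    · exact Or.inr ⟨ha.symm, Or.inl hb⟩
  · exact Or.inl ha

lemma toLex_le_iff (v w : Fin 3 → ℝ) :
    toLex v ≤ toLex w ↔ LexNonneg (w 0 - v 0) (w 1 - v 1) (w 2 - v 2) := by
  have hlt : ∀ v w : Fin 3 → ℝ, toLex v < toLex w ↔
      ∃ i, (∀ j, j < i → v j = w j) ∧ v i < w i := fun v w => Iff.rfl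
  have h2 : ∀ v w : Fin 3 → ℝ, toLex v < toLex w ↔
      (v 0 < w 0 ∨ (v 0 = w 0 ∧ (v 1 < w 1 ∨ (v 1 = w 1 ∧ v 2 < w 2)))) := by
    intro v w
    rw [hlt]
    constructor
    · rintro ⟨i, h1, h2⟩
      fin_cases i
      · exact Or.inl h2
      · exact Or.inr ⟨h1 0 (by decide), Or.inl h2⟩
      · exact Or.inr ⟨h1 0 (by decide), Or.inr ⟨h1 1 (by decide), h2⟩⟩
    · rintro (h | ⟨h, h' | ⟨h', h''⟩⟩)
      · exact ⟨0, fun j hj => absurd hj (by simp), h⟩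
      · refine ⟨1, fun j hj => ?_, h'⟩
        have : j = 0 := by revert hj; revert j; decide
        rw [this, h]
      · refine ⟨2, fun j hj => ?_, h''⟩
        have : j = 0 ∨ j = 1 := by revert hj; revert j; decide
        rcases this with rfl | rfl <;> assumption
  have h3 : toLex v ≤ toLex w ↔ ¬ (toLex w < toLex v) := not_lt.symm
  refine h3.trans ((not_congr (h2 w v)).trans ?_)
  rw [LexNonneg]
  constructor
  · intro h
    push Not at h
    obtain ⟨h0, h⟩ := h
    rcases h0.eq_or_lt with e | e
    · obtain ⟨h1, h⟩ := h e.symm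
      rcases h1.eq_or_lt with e' | e'
      · exact Or.inr ⟨by linarith, Or.inr ⟨by linarith, by linarith [h e'.symm]⟩⟩
      · exact Or.inr ⟨by linarith, Or.inl (by linarith)⟩
    · exact Or.inl (by linarith)
  · rintro (h | ⟨h, h' | ⟨h', h''⟩⟩) (g | ⟨g, g' | ⟨g', g''⟩⟩) <;> linarith

variable {Ω : FormalField}

lemma intVec_mem {v : Fin 3 → ℤ} (hv : v ∈ supp Ω) : intVec v ∈ newtonPolyhedron Ω := by
  refine ⟨intVec v, subset_convexHull ℝ _ ⟨v, hv, rfl⟩, 0, le_refl (0 : Fin 3 → ℝ), add_zero _⟩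

lemma convex_newtonPolyhedron : Convex ℝ (newtonPolyhedron Ω) :=
  (convex_convexHull ℝ _).add (convex_Ici 0)

lemma add_mem_newtonPolyhedron {v w : Fin 3 → ℝ} (hv : v ∈ newtonPolyhedron Ω) (hw : 0 ≤ w) :
    v + w ∈ newtonPolyhedron Ω := by
  obtain ⟨a, ha, b, hb, rfl⟩ := hv
  exact ⟨a, ha, b + w, add_nonneg hb hw, (add_assoc _ _ _).symm⟩

/-- The polyhedron is the smallest convex set that contains the support and is stable under the
positive orthant. This is how inequalities pass from the support to the polyhedron. -/
lemma newtonPolyhedron_subset {Q : Set (Fin 3 → ℝ)} (hQ : Convex ℝ Q)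
    (hS : ∀ v ∈ supp Ω, intVec v ∈ Q) (hup : ∀ v ∈ Q, ∀ w : Fin 3 → ℝ, 0 ≤ w → v + w ∈ Q) :
    newtonPolyhedron Ω ⊆ Q := by
  rintro _ ⟨a, ha, b, hb, rfl⟩
  refine hup a (convexHull_min ?_ hQ ha) b hb
  rintro _ ⟨v, hv, rfl⟩
  exact hS v hv

/-- A lexicographic inequality between affine functions which holds on the support, and whose
linear part is nonnegative on the positive orthant, holds on the Newton polyhedron. -/
lemma lexNonneg_newtonPolyhedron (ℓ : Fin 3 → (Fin 3 → ℝ) →ₗ[ℝ] ℝ) (c : Fin 3 → ℝ)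
    (hS : ∀ v ∈ supp Ω, LexNonneg (ℓ 0 (intVec v) - c 0) (ℓ 1 (intVec v) - c 1)
      (ℓ 2 (intVec v) - c 2))
    (hup : ∀ w : Fin 3 → ℝ, 0 ≤ w → LexNonneg (ℓ 0 w) (ℓ 1 w) (ℓ 2 w)) :
    ∀ v ∈ newtonPolyhedron Ω, LexNonneg (ℓ 0 v - c 0) (ℓ 1 v - c 1) (ℓ 2 v - c 2) := by
  refine newtonPolyhedron_subset
    (Q := {v | LexNonneg (ℓ 0 v - c 0) (ℓ 1 v - c 1) (ℓ 2 v - c 2)}) ?_ hS ?_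
  · rw [convex_iff_forall_pos]
    intro x hx y hy a b ha hb hab
    have := (LexNonneg.mul hx ha).add (LexNonneg.mul hy hb)
    simp only [Set.mem_ofPred_eq, map_add, map_smul, smul_eq_mul]
    have hb' : b = 1 - a := by linarith
    subst hb'
    convert this using 1 <;> ring
  · intro v hv w hw
    have := LexNonneg.add hv (hup w hw)
    simp only [Set.mem_ofPred_eq, map_add]
    convert this using 1 <;> ring

/-- The linear form with the given coefficients. -/
noncomputable def linForm (a : Fin 3 → ℝ) : (Fin 3 → ℝ) →ₗ[ℝ] ℝ := Fintype.linearCombination ℝ a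

lemma linForm_apply (a v : Fin 3 → ℝ) : linForm a v = v 0 * a 0 + v 1 * a 1 + v 2 * a 2 := by
  simp [linForm, Fintype.linearCombination_apply, Fin.sum_univ_three]

/-- The displacement of `v` from `m` along `Δ`, first component. -/
def disp (d : ℝ) (m v : Fin 3 → ℝ) (k : Fin 3) : ℝ := v k - m k + d * (v 2 - m 2)

/-- Tilting by a lexicographically nonnegative `(a, b)` keeps the linear parts nonnegative on the
positive orthant. The third form `ℓ` serves to break ties. -/
lemma lexNonneg_disp {a b : ℝ} (hab : LexNonneg a b 0) {m : Fin 3 → ℝ}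
    (ℓ : (Fin 3 → ℝ) →ₗ[ℝ] ℝ) (hℓ : ∀ w, 0 ≤ w → 0 ≤ ℓ w)
    (hS : ∀ v ∈ supp Ω, LexNonneg (disp a m (intVec v) 0) (disp b m (intVec v) 1)
      (ℓ (intVec v) - ℓ m)) :
    ∀ v ∈ newtonPolyhedron Ω, LexNonneg (disp a m v 0) (disp b m v 1) (ℓ v - ℓ m) := by
  have := lexNonneg_newtonPolyhedron (Ω := Ω)
    ![linForm ![1, 0, a], linForm ![0, 1, b], ℓ]
    ![m 0 + a * m 2, m 1 + b * m 2, ℓ m] ?_ ?_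
  · intro v hv
    convert this v hv using 1 <;> simp [linForm_apply, disp] <;> ring
  · intro v hv
    convert hS v hv using 1 <;> simp [linForm_apply, disp] <;> ring
  · intro w hw
    have h0 := hw 0
    have h1 := hw 1
    have h2 := hw 2
    have hk := hℓ w hw
    simp only [Pi.zero_apply] at h0 h1 h2
    simp only [Matrix.cons_val_zero, Matrix.cons_val_one, Matrix.cons_val, linForm_apply]
    rcases hab with ha | ⟨ha, hb | ⟨hb, -⟩⟩
    · rcases h2.eq_or_lt with h2 | h2
      · rw [← h2]
        exact lexNonneg_of_nonneg (by simpa using h0) (by simpa using h1) hk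
      · left
        have := mul_pos h2 ha
        linarith
    · subst ha
      refine lexNonneg_of_nonneg (by simpa using h0) ?_ hk
      have := mul_nonneg h2 hb.le
      linarith
    · subst ha; subst hb
      exact lexNonneg_of_nonneg (by simpa using h0) (by simpa using h1) hk

lemma lexNonneg_disp_proj {a b : ℝ} (hab : LexNonneg a b 0) {m : Fin 3 → ℝ} (k : Fin 3)
    (hS : ∀ v ∈ supp Ω, LexNonneg (disp a m (intVec v) 0) (disp b m (intVec v) 1)
      (intVec v k - m k)) :
    ∀ v ∈ newtonPolyhedron Ω, LexNonneg (disp a m v 0) (disp b m v 1) (v k - m k) :=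
  lexNonneg_disp hab (LinearMap.proj k) (fun _ hw => hw k) hS

lemma lexNonneg_disp_zero {a b : ℝ} (hab : LexNonneg a b 0) {m : Fin 3 → ℝ}
    (hS : ∀ v ∈ supp Ω, LexNonneg (disp a m (intVec v) 0) (disp b m (intVec v) 1) 0) :
    ∀ v ∈ newtonPolyhedron Ω, LexNonneg (disp a m v 0) (disp b m v 1) 0 := by
  have := lexNonneg_disp (Ω := Ω) hab (m := m) 0 (fun _ _ => le_rfl) (by simpa using hS)
  simpa using this

lemma LexNonneg.weaken {a b c : ℝ} (h : LexNonneg a b c) : LexNonneg a b 0 := by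
  rcases h with h | ⟨h, h' | ⟨h', -⟩⟩
  · exact Or.inl h
  · exact Or.inr ⟨h, Or.inl h'⟩
  · exact Or.inr ⟨h, Or.inr ⟨h', le_refl _⟩⟩

/-- The lexicographically least point of the Newton polyhedron lies in the support. -/
lemma IsLexLeast.exists_int {h : Fin 3 → ℝ} (hh : IsLexLeast (newtonPolyhedron Ω) h) :
    ∃ v ∈ supp Ω, intVec v = h := by
  by_contra hc
  push Not at hc
  have hge : ∀ w ∈ newtonPolyhedron Ω, LexNonneg (w 0 - h 0) (w 1 - h 1) (w 2 - h 2) :=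
    fun w hw => (toLex_le_iff _ _).1 (hh.2 w hw)
  -- The lexicographic half-space above `h` with `h` removed is still convex and stable under the
  -- positive orthant. Were `h` outside the support, this set would contain the polyhedron.
  have hsub : newtonPolyhedron Ω ⊆
      {v | LexNonneg (v 0 - h 0) (v 1 - h 1) (v 2 - h 2) ∧ v ≠ h} := by
    have key : ∀ u v : Fin 3 → ℝ, LexNonneg (u 0) (u 1) (u 2) → LexNonneg (v 0) (v 1) (v 2) →
        u + v = 0 → u = 0 := by
      intro u v hu hv huv
      have e0 := congr_fun huv 0
      have e1 := congr_fun huv 1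
      have e2 := congr_fun huv 2
      simp only [Pi.add_apply, Pi.zero_apply] at e0 e1 e2
      ext k
      rcases hu with hu | ⟨hu, hu' | ⟨hu', hu''⟩⟩ <;> rcases hv with hv | ⟨hv, hv' | ⟨hv', hv''⟩⟩ <;>
        fin_cases k <;> simp <;> linarith
    refine newtonPolyhedron_subset ?_ (fun v hv => ⟨hge _ (intVec_mem hv), hc v hv⟩) ?_
    · rw [convex_iff_forall_pos]
      rintro x ⟨hx, hx'⟩ y ⟨hy, hy'⟩ a b ha hb hab
      have hb' : b = 1 - a := by linarith
      refine ⟨?_, fun he => hx' ?_⟩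
      · have := (hx.mul ha).add (hy.mul hb)
        simp only [Pi.add_apply, Pi.smul_apply, smul_eq_mul]
        subst hb'
        convert this using 1 <;> ring
      · have := key (a • (x - h)) (b • (y - h)) (by simpa using hx.mul ha)
          (by simpa using hy.mul hb) (by
            rw [smul_sub, smul_sub, ← he]
            subst hb'
            module)
        rw [smul_eq_zero, sub_eq_zero] at this
        exact this.resolve_left ha.ne'
    · rintro v ⟨hv, hv'⟩ w hw
      have hw' : LexNonneg (w 0) (w 1) (w 2) := lexNonneg_of_nonneg (hw 0) (hw 1) (hw 2)
      refine ⟨?_, fun he => hv' ?_⟩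
      · convert hv.add hw' using 1 <;> simp <;> ring
      · have := key (v - h) w (by simpa using hv) hw' (by rw [← he]; abel)
        exact sub_eq_zero.1 this
  exact (hsub hh.1).2 rfl

@[simp] lemma derivedVertex_zero (n : Fin 3 → ℝ) (Δ : ℚ × ℚ) :
    derivedVertex n Δ 0 = n 0 + Δ.1 / 2 := by
  simp [derivedVertex, edgeDir]; ring

@[simp] lemma derivedVertex_one (n : Fin 3 → ℝ) (Δ : ℚ × ℚ) :
    derivedVertex n Δ 1 = n 1 + Δ.2 / 2 := by
  simp [derivedVertex, edgeDir]; ring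

@[simp] lemma derivedVertex_two (n : Fin 3 → ℝ) (Δ : ℚ × ℚ) :
    derivedVertex n Δ 2 = n 2 - 1 / 2 := by
  simp [derivedVertex, edgeDir]; ring

/-- Consequences of the definition of the vertical displacement. -/
structure VertFacts (Ω : FormalField) (m : Fin 3 → ℤ) (Δ : ℚ × ℚ) (r : ℝ) : Prop where
  pos : 0 < (Δ.1 : ℝ) ∨ ((Δ.1 : ℝ) = 0 ∧ r < (Δ.2 : ℝ))
  nonneg : ∀ v ∈ newtonPolyhedron Ω, LexNonneg (disp Δ.1 (intVec m) v 0) (disp Δ.2 (intVec m) v 1) 0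
  low : ∃ p ∈ supp Ω, p 2 < m 2 ∧ disp Δ.1 (intVec m) (intVec p) 0 = 0 ∧
    disp Δ.2 (intVec m) (intVec p) 1 = 0

/-- The number `r` is a slope for which the support is already known to lie on one side: `0` for a
regular main vertex, and `1 / (h₂ - n₂)` in a nilpotent configuration, where the edge `[h, n]`
bounds the part above `n`. It forces `(0, r) < Δ` lexicographically. -/
lemma vertFacts {m : Fin 3 → ℤ} {Δ : ℚ × ℚ} {r : ℝ} (hm : intVec m ∈ newtonPolyhedron Ω)
    (hr : 0 ≤ r)
    (hS : ∀ v ∈ supp Ω, LexNonneg (disp 0 (intVec m) (intVec v) 0)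
      (disp r (intVec m) (intVec v) 1) (intVec v 2 - intVec m 2))
    (hΔ : IsVerticalDisplacement (newtonPolyhedron Ω) (intVec m) Δ) : VertFacts Ω m Δ r := by
  have hN := lexNonneg_disp_proj (Ω := Ω) (a := 0) (b := r)
    (lexNonneg_of_nonneg le_rfl hr le_rfl) 2 hS
  obtain ⟨⟨hm'N, -⟩, hleast⟩ := hΔ
  have h1 := hN _ hm'N
  simp only [disp, derivedVertex_zero, derivedVertex_one, derivedVertex_two] at h1
  have hpos : 0 < (Δ.1 : ℝ) ∨ ((Δ.1 : ℝ) = 0 ∧ r < (Δ.2 : ℝ)) := by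
    rcases h1 with h | ⟨h, h' | ⟨h', h''⟩⟩
    · left; linarith
    · right; exact ⟨by linarith, by linarith⟩
    · exfalso; linarith
  have hlexΔ : LexNonneg (Δ.1 : ℝ) (Δ.2 - r) 0 := by
    rcases hpos with h | ⟨h, h'⟩
    · exact Or.inl h
    · exact Or.inr ⟨h, Or.inl (by linarith)⟩
  have hlexΔ' : LexNonneg (Δ.1 : ℝ) Δ.2 0 := by
    rcases hpos with h | ⟨h, h'⟩
    · exact Or.inl h
    · exact Or.inr ⟨h, Or.inl (by linarith)⟩
  have hnn : ∀ v ∈ supp Ω,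
      LexNonneg (disp Δ.1 (intVec m) (intVec v) 0) (disp Δ.2 (intVec m) (intVec v) 1) 0 := by
    intro v hv
    have hvN := intVec_mem hv
    -- Above `m`, passing from the tilt `(0, r)` to the larger `Δ` only improves the inequality.
    rcases le_or_gt (m 2) (v 2) with hle | hlt
    · have hle' : (0 : ℝ) ≤ intVec v 2 - intVec m 2 := 
        sub_nonneg.2 (Int.cast_le.2 hle)
      rcases hle'.eq_or_lt with he | hlt
      · have := (hN _ hvN).weaken
        convert this using 1
        · simp only [disp]; linear_combination (-(Δ.1 : ℝ)) * he
        · simp only [disp]; linear_combination (-((Δ.2 : ℝ) - r)) * he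
      · have h2 := (hN _ hvN).weaken.add (hlexΔ.mul hlt)
        convert h2 using 1
        · simp only [disp]; ring
        · simp only [disp]; ring
        · ring
    · have hmv : (1 : ℝ) ≤ intVec m 2 - intVec v 2 := by
        have : v 2 + 1 ≤ m 2 := hlt
        have : (v 2 : ℝ) + 1 ≤ m 2 := by exact_mod_cast this
        simp only [intVec]; linarith
      set x := intVec v
      set n := intVec m
      -- The segment from `m` to a lower point meets the plane of the derived polygon at this
      -- parameter; minimality of the derived vertex is tested there.
      set t : ℝ := 1 / (2 * (n 2 - x 2)) with ht
      have ht0 : 0 < t := by positivity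
      have htm : t * (n 2 - x 2) = 1 / 2 := by rw [ht]; field_simp
      have ht1 : t ≤ 1 := by nlinarith
      have hu := convex_newtonPolyhedron hm hvN (sub_nonneg.2 ht1) ht0.le (by ring)
      have h3 := (toLex_le_iff _ _).1 (hleast _ ⟨hu, by
        simp only [Set.mem_ofPred_eq, Pi.add_apply, Pi.smul_apply, smul_eq_mul]
        linarith⟩)
      simp only [derivedVertex_zero, derivedVertex_one, derivedVertex_two, Pi.add_apply,
        Pi.smul_apply, smul_eq_mul] at h3
      refine LexNonneg.of_mul (t := t) ?_ ht0
      rw [mul_zero]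
      convert h3.weaken using 1
      · simp only [disp]; linear_combination (-(Δ.1:ℝ)) * htm
      · simp only [disp]; linear_combination (-(Δ.2:ℝ)) * htm
  refine ⟨hpos, lexNonneg_disp_zero hlexΔ' hnn, ?_⟩
  -- Otherwise all support points of zero displacement lie at or above `m`, and the polyhedron
  -- inherits a tie-break on the height which the derived vertex, half a unit below `m`, violates.
  by_contra hc
  push Not at hc
  have h3 := lexNonneg_disp_proj (Ω := Ω) hlexΔ' 2 (fun v hv => by
    rcases hnn _ hv with h | ⟨h, h' | ⟨h', -⟩⟩
    · exact Or.inl h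
    · exact Or.inr ⟨h, Or.inl h'⟩
    · refine Or.inr ⟨h, Or.inr ⟨h', ?_⟩⟩
      by_contra hlt
      refine hc v hv ?_ h h'
      simp only [intVec] at hlt
      have : (v 2 : ℝ) < m 2 := by linarith
      exact_mod_cast this) _ hm'N
  simp only [disp, derivedVertex_zero, derivedVertex_one, derivedVertex_two] at h3
  rcases h3 with h | ⟨h, h' | ⟨h', h''⟩⟩ <;> linarith

end Polyhedron

/-! ### Combinatorics of the classes of Newton data -/

section Classes

/-- The properties of Newton data at a nonelementary point on which the invariance rests. -/
structure Good (i : ℕ) (Ω : FormalField) : Prop where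
  x0 : X 0 ∣ Ω 0
  y1 : i = 2 → X 1 ∣ Ω 1
  leaf : ∃ v ∈ supp Ω, v 0 = 0 ∧ (v 1 = -1 ∨ v 1 = 0)
  zero : ∀ j, constantCoeff (Ω j) = 0
  nilp : IsNilpotent (jacobian Ω)

variable {i : ℕ} {Ω : FormalField}

lemma zero_le_of_X_dvd {k : Fin 3} (hk : X k ∣ Ω k) {v : Fin 3 → ℤ} (hv : v ∈ supp Ω) :
    0 ≤ v k := by
  obtain ⟨j, n, hn, rfl⟩ := mem_supp.1 hv
  simp only [logExp]
  split_ifs with h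
  · subst h
    have := X_dvd_iff_coeff.1 hk n hn
    omega
  · omega

/-- `h` is the lexicographically least point of the support. -/
structure HigherVertex (Ω : FormalField) (h : Fin 3 → ℤ) : Prop where
  mem : h ∈ supp Ω
  h0 : h 0 = 0
  h1 : h 1 = -1 ∨ h 1 = 0
  nonneg : ∀ v ∈ supp Ω, 0 ≤ v 0
  le1 : ∀ v ∈ supp Ω, v 0 = 0 → h 1 ≤ v 1
  le2 : ∀ v ∈ supp Ω, v 0 = 0 → v 1 = h 1 → h 2 ≤ v 2

lemma intVec_apply (v : Fin 3 → ℤ) (k : Fin 3) : intVec v k = v k := rfl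

lemma intVec_injective {v w : Fin 3 → ℤ} (h : intVec v = intVec w) : v = w := by
  ext k
  have := congr_fun h k
  simpa [intVec] using this

lemma ext3 {α : Type*} {v w : Fin 3 → α} (h0 : v 0 = w 0) (h1 : v 1 = w 1) (h2 : v 2 = w 2) :
    v = w := by
  ext k; fin_cases k <;> assumption

/-- The leaf condition provides a support point with `v₀ = 0` and `v₁ ≤ 0`; this pins the least
point to `h₀ = 0` and `h₁ ∈ {-1, 0}`. -/
lemma IsLexLeast.higherVertex (hg : Good i Ω) {h' : Fin 3 → ℝ}
    (hl : IsLexLeast (newtonPolyhedron Ω) h') : ∃ h, HigherVertex Ω h ∧ intVec h = h' := by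
  obtain ⟨h, hm, rfl⟩ := hl.exists_int
  refine ⟨h, ?_, rfl⟩
  have hlex : ∀ v ∈ supp Ω, LexNonneg ((v 0 : ℝ) - h 0) (v 1 - h 1) (v 2 - h 2) := fun v hv =>
    (toLex_le_iff _ _).1 (hl.2 _ (intVec_mem hv))
  have hnn : ∀ v ∈ supp Ω, 0 ≤ v 0 := fun v hv => zero_le_of_X_dvd hg.x0 hv
  have hz : ∀ v ∈ supp Ω, h 0 ≤ v 0 ∧ (v 0 = h 0 → h 1 ≤ v 1 ∧ (v 1 = h 1 → h 2 ≤ v 2)) := by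
    intro v hv
    have hx := hlex v hv
    refine ⟨?_, fun e0 => ⟨?_, fun e1 => ?_⟩⟩
    · have : (h 0 : ℝ) ≤ v 0 := by rcases hx with h | ⟨h, -⟩ <;> linarith
      exact_mod_cast this
    · have e0' : (v 0 : ℝ) = h 0 := by exact_mod_cast e0
      have : (h 1 : ℝ) ≤ v 1 := by
        rcases hx with h | ⟨-, h | ⟨h, -⟩⟩ <;> linarith
      exact_mod_cast this
    · have e0' : (v 0 : ℝ) = h 0 := by exact_mod_cast e0
      have e1' : (v 1 : ℝ) = h 1 := by exact_mod_cast e1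
      have : (h 2 : ℝ) ≤ v 2 := by
        rcases hx with h | ⟨-, h | ⟨-, h⟩⟩ <;> linarith
      exact_mod_cast this
  obtain ⟨v, hv, hv0, hv1⟩ := hg.leaf
  have h0 : h 0 = 0 := le_antisymm (hv0 ▸ (hz v hv).1) (hnn h hm)
  refine ⟨hm, h0, ?_, hnn, fun w hw hw0 => ((hz w hw).2 (hw0.trans h0.symm)).1,
    fun w hw hw0 hw1 => ((hz w hw).2 (hw0.trans h0.symm)).2 hw1⟩
  have := ((hz v hv).2 (hv0.trans h0.symm)).1
  have := neg_one_le_of_mem_supp hm 1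
  omega

/-- The nilpotent configurations in terms of the support. -/
structure NilConf (i : ℕ) (Ω : FormalField) (h n : Fin 3 → ℤ) : Prop where
  i_eq : i = 1
  n_mem : n ∈ supp Ω
  h1 : h 1 = -1
  n0 : n 0 = 0
  n1 : n 1 = 0
  lt : n 2 < h 2
  edge : ∀ v ∈ supp Ω, v 0 = 0 → n 2 ≤ (h 2 - n 2) * v 1 + v 2
  eq : ∀ v ∈ supp Ω, v 0 = 0 → (h 2 - n 2) * v 1 + v 2 = n 2 → v = h ∨ v = n

lemma HigherVertex.lexNonneg {h : Fin 3 → ℤ} (hh : HigherVertex Ω h) :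
    ∀ v ∈ supp Ω, LexNonneg (disp 0 (intVec h) (intVec v) 0)
      (disp ((0 : ℝ)) (intVec h) (intVec v) 1) (intVec v 2 - intVec h 2) := by
  intro v hv
  simp only [disp, intVec, zero_mul, add_zero, hh.h0, Int.cast_zero, sub_zero]
  rcases (hh.nonneg v hv).eq_or_lt with e0 | e0
  · have h1 := hh.le1 v hv e0.symm
    have h2 := hh.le2 v hv e0.symm
    right
    refine ⟨by exact_mod_cast e0.symm, ?_⟩
    rcases h1.eq_or_lt with e1 | e1
    · right
      refine ⟨sub_eq_zero.2 (by exact_mod_cast e1.symm), sub_nonneg.2 ?_⟩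
      exact_mod_cast h2 e1.symm
    · left
      exact sub_pos.2 (by exact_mod_cast e1)
  · left
    exact_mod_cast e0

/-- Along `[h, n]` the coordinate `v₁` runs from `-1` to `0`, so only the ends can be support
points. Some support point on the edge lies below `h`; it must be `n`, which is therefore integral.
-/
lemma exists_nilConf {h : Fin 3 → ℤ} (hh : HigherVertex Ω h) {n : Fin 3 → ℝ}
    (hn : IsNilpotentConfiguration i (newtonPolyhedron Ω) (intVec h) n) :
    ∃ n', NilConf i Ω h n' ∧ intVec n' = n := by
  obtain ⟨hi, h0, h1, n0, n1, hlt, Δ, hΔ, hseg⟩ := hn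
  have hvert := vertFacts (intVec_mem hh.mem) le_rfl hh.lexNonneg hΔ
  have hnseg : n ∈ mainEdge (newtonPolyhedron Ω) (intVec h) Δ := by
    rw [hseg]; exact right_mem_segment ℝ _ _
  obtain ⟨-, t, ht⟩ := hnseg
  have t0 := congr_fun ht 0
  have t1 := congr_fun ht 1
  have t2 := congr_fun ht 2
  simp [edgeDir, n0, n1, h0, h1] at t0 t1 t2
  have tpos : 0 < t := by linarith
  have hΔ1 : (Δ.1 : ℝ) = 0 := by
    rcases t0 with h | h
    · exact absurd h tpos.ne'
    · exact_mod_cast h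
  have htΔ : t * (Δ.2 : ℝ) = 1 := by linarith
  have key : ∀ v ∈ supp Ω, disp Δ.1 (intVec h) (intVec v) 0 = 0 →
      disp Δ.2 (intVec h) (intVec v) 1 = 0 → v = h ∨ intVec v = n := by
    intro v hv e0 e1
    have hm : intVec v ∈ mainEdge (newtonPolyhedron Ω) (intVec h) Δ := by
      refine ⟨intVec_mem hv, intVec h 2 - intVec v 2, ext3 ?_ ?_ ?_⟩
      · simp only [disp] at e0; simp [edgeDir]; linarith
      · simp only [disp] at e1; simp [edgeDir]; linarith
      · simp [edgeDir]
    rw [hseg] at hm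
    obtain ⟨a, b, ha, hb, hab, he⟩ := hm
    have he1 := congr_fun he 1
    simp only [Pi.add_apply, Pi.smul_apply, smul_eq_mul, h1, n1, intVec_apply] at he1
    have hv1 : v 1 = -1 ∨ v 1 = 0 := by
      have l1 : (-1 : ℝ) ≤ v 1 := by linarith
      have l2 : (v 1 : ℝ) ≤ 0 := by linarith
      have l1' : -1 ≤ v 1 := by exact_mod_cast l1
      have l2' : v 1 ≤ 0 := by exact_mod_cast l2
      omega
    rcases hv1 with e | e
    · left
      have ha1 : a = 1 := by rw [e] at he1; push_cast at he1; linarith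
      have hb0 : b = 0 := by linarith
      rw [ha1, hb0, one_smul, zero_smul, add_zero] at he
      exact (intVec_injective he).symm
    · right
      have ha1 : a = 0 := by rw [e] at he1; push_cast at he1; linarith
      have hb0 : b = 1 := by linarith
      rw [ha1, hb0, one_smul, zero_smul, zero_add] at he
      exact he.symm
  obtain ⟨p, hp, hplt, hp0, hp1⟩ := hvert.low
  have hpn : intVec p = n := by
    rcases key p hp hp0 hp1 with e | e
    · rw [e] at hplt; exact absurd hplt (lt_irrefl _)
    · exact e
  subst hpn
  have tval : t = ((h 2 - p 2 : ℤ) : ℝ) := by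
    simp only [intVec] at t2
    push_cast; linarith
  have hedge : ∀ v ∈ supp Ω, v 0 = 0 → t * disp Δ.2 (intVec h) (intVec v) 1 =
      (((h 2 - p 2) * v 1 + v 2 - p 2 : ℤ) : ℝ) := by
    intro v hv hv0
    have h1' : (h 1 : ℝ) = -1 := h1
    simp only [disp, intVec, h1']
    have : (h 2 : ℝ) - p 2 = t := by rw [tval]; push_cast; ring
    push_cast
    rw [this]
    linear_combination ((v 2 : ℝ) - h 2) * htΔ - this
  have hnn : ∀ v ∈ supp Ω, v 0 = 0 → disp Δ.1 (intVec h) (intVec v) 0 = 0 := by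
    intro v hv hv0
    simp [disp, hΔ1, intVec, hv0, hh.h0]
  refine ⟨p, ⟨hi, hp, Int.cast_injective (α := ℝ) (by simpa [intVec] using h1),
    Int.cast_injective (α := ℝ) (by simpa [intVec] using n0),
    Int.cast_injective (α := ℝ) (by simpa [intVec] using n1), hplt,
    fun v hv hv0 => ?_, fun v hv hv0 he => ?_⟩, rfl⟩
  · have h2 := hvert.nonneg _ (intVec_mem hv)
    rw [hnn v hv hv0] at h2
    have h3 : 0 ≤ disp Δ.2 (intVec h) (intVec v) 1 := by
      rcases h2 with h | ⟨-, h | ⟨h, -⟩⟩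
      · exact absurd h (lt_irrefl _)
      · exact h.le
      · exact h.ge
    have h4 := mul_nonneg tpos.le h3
    rw [hedge v hv hv0] at h4
    have h5 : 0 ≤ (h 2 - p 2) * v 1 + v 2 - p 2 := by exact_mod_cast h4
    linarith
  · have h4 := hedge v hv hv0
    rw [he, sub_self, Int.cast_zero] at h4
    have h5 := (mul_eq_zero.1 h4).resolve_left tpos.ne'
    rcases key v hv (hnn v hv hv0) h5 with e | e
    · exact Or.inl e
    · exact Or.inr (intVec_injective e)

/-- This is the edge inequality divided by `h₂ - n₂`. The third entry only matters on the edge,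
where the support reduces to `h` and `n`. -/
lemma NilConf.lexNonneg {h n : Fin 3 → ℤ} (hh : HigherVertex Ω h) (hn : NilConf i Ω h n)
    {r : ℝ} (hr : r * ((h 2 : ℝ) - n 2) = 1) (k : Fin 3) (a : ℝ)
    (hk : (a ≤ h k ∧ a ≤ n k)) :
    ∀ v ∈ supp Ω, LexNonneg (disp 0 (intVec n) (intVec v) 0)
      (disp r (intVec n) (intVec v) 1) (intVec v k - a) := by
  intro v hv
  have hlt : (0 : ℝ) < (h 2 : ℝ) - n 2 := sub_pos.2 (by exact_mod_cast hn.lt)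
  simp only [disp, intVec, zero_mul, add_zero, hn.n0, hn.n1, Int.cast_zero, sub_zero]
  rcases (hh.nonneg v hv).eq_or_lt with e0 | e0
  · right
    refine ⟨by exact_mod_cast e0.symm, ?_⟩
    have h1 := hn.edge v hv e0.symm
    have h2 := hn.eq v hv e0.symm
    have h3 : ((h 2 : ℝ) - n 2) * ((v 1 : ℝ) + r * (v 2 - n 2)) =
        (((h 2 - n 2) * v 1 + v 2 - n 2 : ℤ) : ℝ) := by
      push_cast
      linear_combination ((v 2 : ℝ) - n 2) * hr
    rcases h1.eq_or_lt with e1 | e1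
    · right
      rw [← e1, sub_self, Int.cast_zero] at h3
      refine ⟨(mul_eq_zero.1 h3).resolve_left hlt.ne', sub_nonneg.2 ?_⟩
      rcases h2 e1.symm with rfl | rfl
      · exact hk.1
      · exact hk.2
    · left
      have h4 : (0 : ℝ) < (((h 2 - n 2) * v 1 + v 2 - n 2 : ℤ) : ℝ) := by
        exact_mod_cast sub_pos.2 e1
      rw [← h3] at h4
      exact pos_of_mul_pos_right h4 hlt.le
  · left
    exact_mod_cast e0

/-- Converse of `exists_nilConf`, needed so that a regular configuration excludes every `NilConf`.
-/
lemma NilConf.isNilpotentConfiguration {h n : Fin 3 → ℤ} (hh : HigherVertex Ω h)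
    (hn : NilConf i Ω h n) :
    IsNilpotentConfiguration i (newtonPolyhedron Ω) (intVec h) (intVec n) := by
  have hlt : (0 : ℝ) < (h 2 : ℝ) - n 2 := sub_pos.2 (by exact_mod_cast hn.lt)
  have hge : (1 : ℝ) ≤ (h 2 : ℝ) - n 2 := by
    have := hn.lt
    have : (n 2 : ℝ) + 1 ≤ h 2 := by exact_mod_cast this
    linarith
  have c0 : intVec h 0 = 0 := by simp [intVec, hh.h0]
  have c1 : intVec h 1 = -1 := by simp [intVec, hn.h1]
  have d0 : intVec n 0 = 0 := by simp [intVec, hn.n0]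
  have d1 : intVec n 1 = 0 := by simp [intVec, hn.n1]
  refine ⟨hn.i_eq, c0, c1, d0, d1, Int.cast_lt.2 hn.lt, (0, 1 / ((h 2 : ℚ) - n 2)), ?_, ?_⟩
  all_goals
    set r : ℝ := (((1 / ((h 2 : ℚ) - n 2)) : ℚ) : ℝ) with hrdef
    have hr : r * ((h 2 : ℝ) - n 2) = 1 := by
      rw [hrdef]; push_cast; field_simp
    have hr0 : 0 < r := by
      by_contra hc
      nlinarith [not_lt.1 hc]
    have hlex : LexNonneg (0 : ℝ) r 0 := Or.inr ⟨rfl, Or.inl hr0⟩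
    have hr' : r * intVec h 2 = 1 + r * intVec n 2 := by simp only [intVec]; linarith
  · have hr1 : r ≤ 1 := by nlinarith
    refine ⟨⟨?_, ?_⟩, ?_⟩
    · have hc := convex_newtonPolyhedron (intVec_mem hh.mem) (intVec_mem hn.n_mem)
        (a := 1 - r / 2) (b := r / 2) (by linarith) (by linarith) (by ring)
      convert hc using 1
      refine ext3 ?_ ?_ ?_
      · simp [c0, d0]
      · simp only [derivedVertex_one, Pi.add_apply, Pi.smul_apply, smul_eq_mul, c1, d1]
        rw [← hrdef]; ring
      · simp only [derivedVertex_two, Pi.add_apply, Pi.smul_apply, smul_eq_mul]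
        linarith
    · simp
    · rintro w ⟨hw, hw2⟩
      rw [toLex_le_iff]
      have h1 := lexNonneg_disp_zero (m := intVec n) hlex
        (fun v hv => (NilConf.lexNonneg hh hn hr 1 (-1) ⟨by simp [hn.h1], by simp [hn.n1]⟩ v
          hv).weaken) w hw
      simp only [Set.mem_ofPred_eq] at hw2
      simp only [disp, d0, d1, hw2] at h1
      simp only [derivedVertex_zero, derivedVertex_one, derivedVertex_two, c0, c1, hw2, ← hrdef]
      convert h1 using 1
      · simp
      · linarith
      · ring
  · ext v
    constructor
    · rintro ⟨hv, t, ht⟩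
      have e0 := congr_fun ht 0
      have e1 := congr_fun ht 1
      have e2 := congr_fun ht 2
      simp only [edgeDir, Pi.add_apply, Pi.smul_apply, smul_eq_mul, c0, c1, Matrix.cons_val_zero,
        Matrix.cons_val_one, Matrix.cons_val, ← hrdef, Rat.cast_zero, mul_zero] at e0 e1 e2
      have g1 := lexNonneg_disp_proj (m := intVec h) hlex 1 (fun v hv => by
        have := NilConf.lexNonneg hh hn hr 1 (-1) ⟨by simp [hn.h1], by simp [hn.n1]⟩ v hv
        convert this using 1
        · simp only [disp, c0, d0, zero_mul]
        · simp only [disp, c1, d1]; linarith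
        · rw [c1]) v hv
      have g2 := lexNonneg_disp_proj (m := intVec n) hlex 2
        (NilConf.lexNonneg hh hn hr 2 (n 2) ⟨by exact_mod_cast hn.lt.le, le_rfl⟩) v hv
      simp only [disp, c0, c1, e0, e1, e2] at g1
      simp only [disp, d0, d1, e0, e1, e2] at g2
      have k1 : 0 ≤ t * r := by rcases g1 with g | ⟨-, g | ⟨-, g⟩⟩ <;> linarith
      have k2 : 0 ≤ intVec h 2 + t * -1 - intVec n 2 := by
        rcases g2 with g | ⟨-, g | ⟨-, g⟩⟩
        · linarith
        · exfalso; linarith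
        · exact g
      refine ⟨1 - t * r, t * r, ?_, k1, by ring, ?_⟩
      · have := mul_nonneg hr0.le k2
        linarith
      · rw [ht]
        refine ext3 ?_ ?_ ?_
        · simp [edgeDir, c0, d0]
        · simp only [edgeDir, Pi.add_apply, Pi.smul_apply, smul_eq_mul, c1, d1,
            Matrix.cons_val_one, Matrix.cons_val_zero, ← hrdef]
          ring
        · simp only [edgeDir, Pi.add_apply, Pi.smul_apply, smul_eq_mul, Matrix.cons_val, intVec]
          linear_combination (-t) * hr
    · rintro ⟨a, b, ha, hb, hab, rfl⟩
      refine ⟨convex_newtonPolyhedron (intVec_mem hh.mem) (intVec_mem hn.n_mem) ha hb hab,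
        b * (h 2 - n 2), ext3 ?_ ?_ ?_⟩
      · simp [edgeDir, c0, d0]
      · simp only [edgeDir, Pi.add_apply, Pi.smul_apply, smul_eq_mul, c1, d1, Matrix.cons_val_one,
          Matrix.cons_val_zero, ← hrdef]
        linear_combination (-b) * hr - hab
      · simp only [edgeDir, Pi.add_apply, Pi.smul_apply, smul_eq_mul, Matrix.cons_val, intVec]
        linear_combination (h 2 : ℝ) * hab

end Classes

/-! ### Membership in a class, read on the support -/

section ClassFacts

variable {i : ℕ} {Ω : FormalField}

lemma disp_convex (d : ℝ) (m a b : Fin 3 → ℝ) (t : ℝ) (k : Fin 3) :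
    disp d m ((1 - t) • a + t • b) k = (1 - t) * disp d m a k + t * disp d m b k := by
  simp only [disp, Pi.add_apply, Pi.smul_apply, smul_eq_mul]; ring

/-- Every point of the Newton polyhedron projects, from a point of the main edge, to the derived
polygon. -/
lemma exists_projection {m : Fin 3 → ℤ} {Δ : ℚ × ℚ} {r : ℝ} (hm : m ∈ supp Ω)
    (hv : VertFacts Ω m Δ r) {v : Fin 3 → ℝ} (hvN : v ∈ newtonPolyhedron Ω) :
    ∃ t : ℝ, 0 < t ∧ ∃ u ∈ derivedPolygon (newtonPolyhedron Ω) (intVec m),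
      disp Δ.1 (intVec m) u 0 = t * disp Δ.1 (intVec m) v 0 ∧
      disp Δ.2 (intVec m) u 1 = t * disp Δ.2 (intVec m) v 1 := by
  obtain ⟨p, hp, hplt, hp0, hp1⟩ := hv.low
  have hp2 : intVec p 2 + 1 ≤ intVec m 2 := by
    have : p 2 + 1 ≤ m 2 := hplt
    simp only [intVec]
    exact_mod_cast this
  have hmm : ∀ (d : ℝ) (k : Fin 3), disp d (intVec m) (intVec m) k = 0 := fun d k => by simp [disp]
  rcases lt_trichotomy (v 2) (intVec m 2 - 1 / 2) with h | h | h
  · have h0 : 0 < intVec m 2 - v 2 := by linarith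
    set t : ℝ := 1 / (2 * (intVec m 2 - v 2)) with ht
    have ht0 : 0 < t := by positivity
    have htm : t * (intVec m 2 - v 2) = 1 / 2 := by rw [ht]; field_simp
    have ht1 : t ≤ 1 := by nlinarith
    refine ⟨t, ht0, (1 - t) • intVec m + t • v, ⟨convex_newtonPolyhedron (intVec_mem hm) hvN
      (by linarith) ht0.le (by ring), ?_⟩, ?_, ?_⟩
    · simp only [Set.mem_ofPred_eq, Pi.add_apply, Pi.smul_apply, smul_eq_mul]; linarith
    · rw [disp_convex, hmm, mul_zero, zero_add]
    · rw [disp_convex, hmm, mul_zero, zero_add]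
  · exact ⟨1, one_pos, v, ⟨hvN, h⟩, by simp, by simp⟩
  -- Above the derived plane, the low support point `p` of the main edge replaces `m` as center of
  -- projection. Both have zero displacement, so displacements are merely rescaled.
  · have h0 : 0 < v 2 - intVec p 2 := by linarith
    set t : ℝ := (intVec m 2 - 1 / 2 - intVec p 2) / (v 2 - intVec p 2) with ht
    have ht0 : 0 < t := div_pos (by linarith) h0
    have htm : t * (v 2 - intVec p 2) = intVec m 2 - 1 / 2 - intVec p 2 := by rw [ht]; field_simp
    have ht1 : t ≤ 1 := (div_le_one h0).2 (by linarith)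
    refine ⟨t, ht0, (1 - t) • intVec p + t • v, ⟨convex_newtonPolyhedron (intVec_mem hp) hvN
      (by linarith) ht0.le (by ring), ?_⟩, ?_, ?_⟩
    · simp only [Set.mem_ofPred_eq, Pi.add_apply, Pi.smul_apply, smul_eq_mul]; linarith
    · rw [disp_convex, hp0, mul_zero, zero_add]
    · rw [disp_convex, hp1, mul_zero, zero_add]

/-- Consequences of the definition of the horizontal displacement. -/
structure HorFacts (Ω : FormalField) (m : Fin 3 → ℤ) (Δ : ℚ × ℚ) (C : WithTop ℚ) : Prop where
  top : C = ⊤ → Δ.1 = 0 ∧ ∀ v ∈ newtonPolyhedron Ω, 0 ≤ disp Δ.2 (intVec m) v 1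
  fin : ∀ c : ℚ, C = c → (0 < Δ.1 ∧ c = 0) ∨ (Δ.1 = 0 ∧ 0 < c ∧
    (∀ v ∈ newtonPolyhedron Ω, 0 ≤ v 0 + c * disp Δ.2 (intVec m) v 1) ∧
    ∃ q ∈ supp Ω, (q 0 : ℝ) + c * disp Δ.2 (intVec m) (intVec q) 1 = 0 ∧
      disp Δ.2 (intVec m) (intVec q) 1 < 0)

/-- By `exists_projection`, displacements on the polyhedron are positive multiples of those on the
derived polygon; a supporting line of the main side thus becomes a supporting plane of the
polyhedron. -/
lemma horFacts {m : Fin 3 → ℤ} {Δ : ℚ × ℚ} {C : WithTop ℚ} {r : ℝ} (hm : m ∈ supp Ω)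
    (hm0 : m 0 = 0) (hv : VertFacts Ω m Δ r)
    (hΔ : IsVerticalDisplacement (newtonPolyhedron Ω) (intVec m) Δ)
    (hC : IsHorizontalDisplacement (newtonPolyhedron Ω) (intVec m) Δ C) : HorFacts Ω m Δ C := by
  have hm0' : intVec m 0 = 0 := by simp [intVec, hm0]
  have hdv0 : derivedVertex (intVec m) Δ 0 = Δ.1 / 2 := by simp [hm0']
  have hu1 : ∀ u ∈ derivedPolygon (newtonPolyhedron Ω) (intVec m),
      disp Δ.2 (intVec m) u 1 = u 1 - derivedVertex (intVec m) Δ 1 := by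
    rintro u ⟨-, hu⟩
    simp only [Set.mem_ofPred_eq] at hu
    simp only [disp, hu, derivedVertex_one]; ring
  have hu0 : (Δ.1 : ℝ) = 0 → ∀ u, disp Δ.1 (intVec m) u 0 = u 0 := by
    intro h u
    simp [disp, h, hm0']
  constructor
  · rintro rfl
    obtain ⟨h0, h1⟩ := hC
    rw [hdv0] at h0
    refine ⟨by have : (Δ.1 : ℝ) = 0 := by linarith
               exact_mod_cast this, fun v hvN => ?_⟩
    obtain ⟨t, ht, u, hu, -, hu'⟩ := exists_projection hm hv hvN
    have h2 := h1 u hu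
    rw [hu1 u hu] at hu'
    by_contra hc
    have := mul_neg_of_pos_of_neg ht (not_le.1 hc)
    linarith
  · rintro c rfl
    rcases hC with ⟨h0, h1⟩ | ⟨h0, h1, w, hw, hw1⟩
    · left
      rw [hdv0] at h0
      refine ⟨?_, h1⟩
      have : (0 : ℝ) < Δ.1 := by linarith
      exact_mod_cast this
    · right
      rw [hdv0] at h0
      have hΔ0 : (Δ.1 : ℝ) = 0 := by linarith
      rw [hdv0, h0, zero_add] at h1
      obtain ⟨hwN, t, ht⟩ := hw
      have hN0 : ∀ v ∈ newtonPolyhedron Ω, 0 ≤ v 0 := by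
        intro v hvN
        have := hv.nonneg v hvN
        rw [hu0 hΔ0] at this
        rcases this with h | ⟨h, -⟩
        · exact h.le
        · exact h.ge
      have t0 := congr_fun ht 0
      have t1 := congr_fun ht 1
      simp only [Pi.add_apply, Pi.smul_apply, smul_eq_mul, hdv0, h0, zero_add, sideDir,
        Matrix.cons_val_zero, Matrix.cons_val_one] at t0 t1
      have tpos : 0 < t := by linarith
      have hw0 := hN0 w hwN.1
      -- A vertical side going down from the derived vertex would contradict its minimality, which
      -- excludes `c = 0`.
      have hc0 : 0 < (c : ℝ) := by
        rcases lt_trichotomy (c : ℝ) 0 with h | h | h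
        · have := mul_neg_of_pos_of_neg tpos h
          linarith
        · exfalso
          have h3 := (toLex_le_iff _ _).1 (hΔ.2 w hwN)
          rw [hdv0, h0] at h3
          rw [h, mul_zero] at t0
          rw [t0] at h3
          rcases h3 with h | ⟨-, h | ⟨h, -⟩⟩ <;> linarith
        · exact h
      have hφ : ∀ v ∈ newtonPolyhedron Ω, 0 ≤ v 0 + c * disp Δ.2 (intVec m) v 1 := by
        intro v hvN
        obtain ⟨s, hs, u, hu, hu0', hu1'⟩ := exists_projection hm hv hvN
        rw [hu0 hΔ0, hu0 hΔ0] at hu0'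
        rw [hu1 u hu] at hu1'
        have h2 := h1 u hu
        by_contra hc
        have := mul_neg_of_pos_of_neg hs (not_le.1 hc)
        have e : (c : ℝ) * (s * disp Δ.2 (intVec m) v 1) =
            c * (u 1 - derivedVertex (intVec m) Δ 1) := by rw [hu1']
        linarith
      refine ⟨by exact_mod_cast hΔ0, by exact_mod_cast hc0, hφ, ?_⟩
      -- If every support point on the supporting plane had nonnegative displacement, the
      -- lexicographic inequality would extend to the polyhedron and exclude the lower point `w` of
      -- the main side.
      by_contra hq
      push Not at hq
      have key := lexNonneg_newtonPolyhedron (Ω := Ω)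
        ![linForm ![1, c, c * Δ.2], linForm ![0, 1, Δ.2], 0]
        ![c * (intVec m 1 + Δ.2 * intVec m 2), intVec m 1 + Δ.2 * intVec m 2, 0] (fun v hvS => by
          have h2 := hφ _ (intVec_mem hvS)
          rcases h2.eq_or_lt with e | e
          · have h3 := hq v hvS e.symm
            have h4 : LexNonneg (0 : ℝ) (disp Δ.2 (intVec m) (intVec v) 1) 0 := by
              rcases h3.eq_or_lt with e' | e'
              · exact Or.inr ⟨rfl, Or.inr ⟨e'.symm, le_rfl⟩⟩
              · exact Or.inr ⟨rfl, Or.inl e'⟩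
            convert h4 using 1
            · simp only [disp] at e
              simp [linForm_apply]; linarith
            · simp [linForm_apply, disp]; ring
            · simp
          · left
            simp only [disp] at e
            simp [linForm_apply]; linarith) (fun w hw => by
          have h0 := hw 0
          have h1 := hw 1
          have h2 := hw 2
          simp only [Pi.zero_apply] at h0 h1 h2
          have hΔ2 : 0 ≤ (Δ.2 : ℝ) := by
            rcases hv.pos with h | ⟨-, h⟩
            · linarith
            · have h4 := hv.nonneg _ (add_mem_newtonPolyhedron (intVec_mem hm)
                (w := ![0, 0, 1]) (by intro k; fin_cases k <;> simp))
              rw [hu0 hΔ0] at h4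
              simp [disp, hm0', LexNonneg] at h4
              rcases h4 with h4 | h4
              · exact_mod_cast h4.le
              · rw [h4]; simp
          refine lexNonneg_of_nonneg ?_ ?_ ?_
          · have a1 := mul_nonneg h1 hc0.le
            have a2 := mul_nonneg h2 (mul_nonneg hc0.le hΔ2)
            simp [linForm_apply]; linarith
          · have a2 := mul_nonneg h2 hΔ2
            simp [linForm_apply]; linarith
          · simp) w hwN.1
      have e1 := hu1 w hwN
      simp only [disp] at e1
      simp [linForm_apply] at key
      rcases key with h | ⟨-, h | ⟨h, -⟩⟩
      · have e2 : (c : ℝ) * (w 1 - intVec m 1 + Δ.2 * (w 2 - intVec m 2)) =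
            c * (w 1 - derivedVertex (intVec m) Δ 1) := by rw [e1]
        have e3 : (c : ℝ) * (w 1 - derivedVertex (intVec m) Δ 1) = c * (-t) := by rw [t1]; ring
        linarith
      · linarith
      · linarith

/-- The consequences of membership in a class, in terms of the support. -/
structure ClassFacts (i : ℕ) (Ω : FormalField) (h m : Fin 3 → ℤ) (Δ : ℚ × ℚ) (C : WithTop ℚ) :
    Prop where
  hv : HigherVertex Ω h
  conf : NilConf i Ω h m ∨ (m = h ∧ ∀ n, ¬ NilConf i Ω h n)
  vert : VertFacts Ω m Δ 0
  hor : HorFacts Ω m Δ C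

lemma InClass.classFacts (hg : Good i Ω) {m : Fin 3 → ℤ} {Δ : ℚ × ℚ} {C : WithTop ℚ}
    (hc : InClass i Ω m Δ C) : ∃ h, ClassFacts i Ω h m Δ C := by
  obtain ⟨⟨h', hlex, hconf⟩, hΔ, hC⟩ := hc
  obtain ⟨h, hh, rfl⟩ := hlex.higherVertex hg
  refine ⟨h, ?_⟩
  rcases hconf with hnil | ⟨hmh, hreg⟩
  · obtain ⟨m', hm', he⟩ := exists_nilConf hh hnil
    obtain rfl := intVec_injective he
    have hlt : (0 : ℝ) < (h 2 : ℝ) - m' 2 := sub_pos.2 (by exact_mod_cast hm'.lt)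
    have hr : (1 / ((h 2 : ℝ) - m' 2)) * ((h 2 : ℝ) - m' 2) = 1 := by field_simp
    have hv := vertFacts (r := 1 / ((h 2 : ℝ) - m' 2)) (intVec_mem hm'.n_mem) (by positivity)
      (NilConf.lexNonneg hh hm' hr 2 (m' 2) ⟨by exact_mod_cast hm'.lt.le, le_rfl⟩) hΔ
    refine ⟨hh, Or.inl hm', ⟨?_, hv.nonneg, hv.low⟩,
      horFacts hm'.n_mem hm'.n0 hv hΔ hC⟩
    rcases hv.pos with h | ⟨h, h'⟩
    · exact Or.inl h
    · exact Or.inr ⟨h, lt_trans (by positivity) h'⟩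
  · obtain rfl := intVec_injective hmh
    have hn : ∀ n, ¬ NilConf i Ω m n := fun n hn => hreg _ (hn.isNilpotentConfiguration hh)
    have hv := vertFacts (intVec_mem hh.mem) le_rfl hh.lexNonneg hΔ
    exact ⟨hh, Or.inr ⟨rfl, hn⟩, hv, horFacts hh.mem hh.h0 hv hΔ hC⟩

variable {h m : Fin 3 → ℤ} {Δ : ℚ × ℚ} {C : WithTop ℚ}

lemma ClassFacts.m_mem (hc : ClassFacts i Ω h m Δ C) : m ∈ supp Ω := by
  rcases hc.conf with hn | ⟨rfl, -⟩
  · exact hn.n_mem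
  · exact hc.hv.mem

lemma ClassFacts.m0 (hc : ClassFacts i Ω h m Δ C) : m 0 = 0 := by
  rcases hc.conf with hn | ⟨rfl, -⟩
  · exact hn.n0
  · exact hc.hv.h0

lemma ClassFacts.m1 (hc : ClassFacts i Ω h m Δ C) : m 1 = -1 ∨ m 1 = 0 := by
  rcases hc.conf with hn | ⟨rfl, -⟩
  · exact Or.inr hn.n1
  · exact hc.hv.h1

lemma coeff_zero_of_good (hg : Good i Ω) (j : Fin 3) : coeff 0 (Ω j) = 0 := by
  rw [coeff_zero_eq_constantCoeff_apply, hg.zero]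

/-- The origin in the support means a nonzero diagonal entry of the linear part `J`. Nilpotency
makes the trace of `J²` vanish. The first row of `J` is diagonal since `x` divides `Ω 0`, so once
`J₁₂ J₂₁ = 0` this trace is a sum of squares of real numbers. -/
lemma not_origin_mem (hg : Good i Ω) (h0 : (0 : Fin 3 → ℤ) ∈ supp Ω)
    (hJ : jacobian Ω 1 2 = 0 ∨ jacobian Ω 2 1 = 0) : False := by
  have ht1 : (jacobian Ω).trace = 0 :=
    (Matrix.isNilpotent_trace_of_isNilpotent hg.nilp).eq_zero
  have ht2 : (jacobian Ω * jacobian Ω).trace = 0 := by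
    have := hg.nilp.pow_succ 1
    rw [pow_two] at this
    exact (Matrix.isNilpotent_trace_of_isNilpotent this).eq_zero
  have hj : ∀ k : Fin 3, k ≠ 0 → jacobian Ω 0 k = 0 := by
    intro k hk
    rw [jacobian_apply']
    exact X_dvd_iff.1 hg.x0 _ (by simp [hk])
  simp only [Matrix.trace, Fin.sum_univ_three, Matrix.diag_apply, Matrix.mul_apply,
    hj 1 (by decide), hj 2 (by decide)] at ht2
  have hp : jacobian Ω 1 2 * jacobian Ω 2 1 = 0 := by
    rcases hJ with h | h <;> simp [h]
  have hsq : jacobian Ω 0 0 ^ 2 + jacobian Ω 1 1 ^ 2 + jacobian Ω 2 2 ^ 2 = 0 := by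
    linear_combination ht2 - 2 * hp
  obtain ⟨j, n, hn, he⟩ := mem_supp.1 h0
  have hnj : n = Finsupp.single j 1 := by
    ext k
    have := congr_fun he k
    simp only [logExp, Pi.zero_apply] at this
    rw [Finsupp.single_apply]
    split_ifs at this ⊢ with h1 h2 h2 <;> omega
  rw [hnj, ← jacobian_apply'] at hn
  have := sq_nonneg (jacobian Ω 0 0)
  have := sq_nonneg (jacobian Ω 1 1)
  have := sq_nonneg (jacobian Ω 2 2)
  have hsqj : jacobian Ω j j ^ 2 = 0 := by
    fin_cases j <;> simp <;> nlinarith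
  exact hn (by simpa using hsqj)

lemma logExp_single (j k : Fin 3) (l : Fin 3) :
    logExp j (Finsupp.single k 1) l = (if l = k then 1 else 0) - if l = j then 1 else 0 := by
  simp only [logExp, Finsupp.single_apply, eq_comm (a := k)]
  split_ifs <;> simp

/-- The exponent `(0, 0, -1)` could only come from a constant term. -/
lemma neg_z_notMem (hg : Good i Ω) {v : Fin 3 → ℤ} (hv : v ∈ supp Ω) (h : v 0 = 0 ∧ v 1 = 0) :
    0 ≤ v 2 := by
  by_contra hc
  obtain ⟨j, n, hn, he⟩ := mem_supp.1 hv
  apply hn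
  have : n = 0 := by
    have e0 := congr_fun he 0
    have e1 := congr_fun he 1
    have e2 := congr_fun he 2
    rw [h.1] at e0
    rw [h.2] at e1
    simp only [logExp] at e0 e1 e2
    fin_cases j <;> simp at e0 e1 e2 <;> (try omega)
    ext k; fin_cases k <;> simp <;> omega
  rw [this]
  exact coeff_zero_of_good hg j

/-- Here nonelementarity enters: height at most zero would mean a nonzero constant term or a linear
part that is not nilpotent. -/
lemma ClassFacts.one_le (hg : Good i Ω) (hc : ClassFacts i Ω h m Δ C) : 1 ≤ m 2 := by
  have hm := hc.m_mem
  have hJ12 : jacobian Ω 1 2 ≠ 0 → logExp 1 (Finsupp.single 2 1) ∈ supp Ω := fun h => by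
    rw [jacobian_apply'] at h
    exact logExp_mem_supp h
  have hJ21 : jacobian Ω 2 1 ≠ 0 → logExp 2 (Finsupp.single 1 1) ∈ supp Ω := fun h => by
    rw [jacobian_apply'] at h
    exact logExp_mem_supp h
  rcases hc.m1 with h1 | h1
  · -- `m = (0, -1, m₂)`
    obtain ⟨j, n, hn, he⟩ := mem_supp.1 hm
    by_contra hlt
    apply hn
    have : n = 0 := by
      have e0 := congr_fun he 0
      have e1 := congr_fun he 1
      have e2 := congr_fun he 2
      rw [hc.m0] at e0
      rw [h1] at e1
      simp only [logExp] at e0 e1 e2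
      fin_cases j <;> simp at e0 e1 e2
      ext k; fin_cases k <;> simp <;> omega
    rw [this]
    exact coeff_zero_of_good hg j
  · have h2 := neg_z_notMem hg hm ⟨hc.m0, h1⟩
    by_contra hlt
    have hm0 : m = 0 := ext3 hc.m0 h1 (by simp; omega)
    rw [hm0] at hm
    refine not_origin_mem hg hm ?_
    by_contra hcon
    push Not at hcon
    -- These are the points `(0, -1, 1)` and `(0, 1, -1)`. If `m = h`, the first contradicts `h₁ =
    -- 0`. In a nilpotent configuration the first forces `h₂ = 1`, and then the second is a third
    -- support point on the line of the edge.
    have a12 := hJ12 hcon.1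
    have a21 := hJ21 hcon.2
    rcases hc.conf with hn | ⟨rfl, -⟩
    · have b12 := hn.edge _ a12 (by simp [logExp_single])
      have b21 := hn.edge _ a21 (by simp [logExp_single])
      have c21 := hn.eq _ a21 (by simp [logExp_single])
      have hl := hn.lt
      simp [logExp_single, hm0] at b12 b21 c21 hl
      have hh1 : h 2 = 1 := by omega
      rcases c21 (by omega) with e | e
      · have := congr_fun e 1
        simp [logExp_single, hn.h1] at this
      · have := congr_fun e 1
        simp [logExp_single] at this
    · have := hc.hv.le1 _ a12 (by simp [logExp_single])
      simp [logExp_single, h1] at this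

end ClassFacts

/-! ### Lexicographic weights -/

section LexWeights

/-- The weights `(1, 0)`, `(0, s)`, `(a, b)` with values in `ℝ × ℝ` ordered lexicographically. -/
noncomputable def lexWt (s a b : ℝ) : Fin 3 → ℝ ×ₗ ℝ :=
  ![toLex (1, 0), toLex (0, s), toLex (a, b)]

lemma lexWt_zero (s a b : ℝ) : lexWt s a b 0 = toLex (1, 0) := rfl
lemma lexWt_one (s a b : ℝ) : lexWt s a b 1 = toLex (0, s) := rfl
lemma lexWt_two (s a b : ℝ) : lexWt s a b 2 = toLex (a, b) := rfl

lemma wt_lexWt (s a b : ℝ) (n : Fin 3 →₀ ℕ) :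
    wt (lexWt s a b) n = toLex ((n 0 : ℝ) + n 2 * a, (n 1 : ℝ) * s + n 2 * b) := by
  rw [wt_eq, lexWt_zero, lexWt_one, lexWt_two]
  refine ofLex.injective (Prod.ext ?_ ?_) <;> simp [ofLex_add]

lemma zwt_lexWt (s a b : ℝ) (v : Fin 3 → ℤ) :
    zwt (lexWt s a b) v = toLex ((v 0 : ℝ) + v 2 * a, (v 1 : ℝ) * s + v 2 * b) := by
  rw [zwt, lexWt_zero, lexWt_one, lexWt_two]
  refine ofLex.injective (Prod.ext ?_ ?_) <;> simp [ofLex_add]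

lemma lex_le_iff {a b c d : ℝ} :
    (toLex (a, b) : ℝ ×ₗ ℝ) ≤ toLex (c, d) ↔ LexNonneg (c - a) (d - b) 0 := by
  rw [Prod.Lex.toLex_le_toLex, LexNonneg]
  constructor
  · rintro (h | ⟨h, h'⟩)
    · left; simpa using h
    · right
      simp only at h h'
      rcases h'.eq_or_lt with e | e
      · exact ⟨by linarith, Or.inr ⟨by linarith, le_rfl⟩⟩
      · exact ⟨by linarith, Or.inl (by linarith)⟩
  · rintro (h | ⟨h, h' | ⟨h', -⟩⟩)
    · left; simpa using h
    · right; exact ⟨by simp only; linarith, by simp only; linarith⟩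
    · right; exact ⟨by simp only; linarith, by simp only; linarith⟩

lemma lex_eq_iff {a b c d : ℝ} : (toLex (a, b) : ℝ ×ₗ ℝ) = toLex (c, d) ↔ a = c ∧ b = d := by
  rw [toLex_inj, Prod.mk.injEq]

lemma lex_pos_iff {a b : ℝ} : (0 : ℝ ×ₗ ℝ) < toLex (a, b) ↔ 0 < a ∨ (a = 0 ∧ 0 < b) := by
  have : (0 : ℝ ×ₗ ℝ) = toLex (0, 0) := rfl
  rw [this, Prod.Lex.toLex_lt_toLex]
  simp [eq_comm]

lemma lexWt_pos {s a b : ℝ} (hs : 0 < s) (hab : 0 < a ∨ (a = 0 ∧ 0 < b)) (k : Fin 3) :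
    0 < lexWt s a b k := by
  fin_cases k
  · exact lex_pos_iff.2 (Or.inl one_pos)
  · exact lex_pos_iff.2 (Or.inr ⟨rfl, hs⟩)
  · exact lex_pos_iff.2 hab

variable {i : ℕ} {Ψ : Fin 3 → Series}

/-- The exponents in the first two variables of the last component of a fibered change dominate
`(a, b)`. -/
def Dominates (s a b : ℝ) (Ψ : Fin 3 → Series) : Prop :=
  ∀ n, coeff n (Ψ 2) ≠ 0 → n 2 = 0 → LexNonneg ((n 0 : ℝ) - a) (n 1 * s - b) 0

lemma Fibered.supp0 (h : Fibered i Ψ) {n : Fin 3 →₀ ℕ} (hn : coeff n (Ψ 0) ≠ 0) :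
    1 ≤ n 0 ∧ n 2 = 0 :=
  ⟨X_dvd_iff_coeff.1 h.x0 n hn, pderiv_eq_zero_iff.1 h.z0 n hn⟩

lemma Fibered.ne_zero (h : Fibered i Ψ) {j : Fin 3} {n : Fin 3 →₀ ℕ} (hn : coeff n (Ψ j) ≠ 0) :
    1 ≤ n 0 + n 1 + n 2 := by
  by_contra hc
  have : n = 0 := by
    ext k; fin_cases k <;> simp <;> omega
  rw [this, coeff_zero_eq_constantCoeff_apply, h.const] at hn
  exact hn rfl

lemma Fibered.supp1 (h : Fibered i Ψ) {n : Fin 3 →₀ ℕ} (hn : coeff n (Ψ 1) ≠ 0) :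
    1 ≤ n 0 + n 1 ∧ n 2 = 0 := by
  have h2 := pderiv_eq_zero_iff.1 h.z1 n hn
  have := h.ne_zero hn
  exact ⟨by omega, h2⟩

/-- As `x` outweighs every power of `y`, the first two components are compatible for free: `x`
divides `Ψ 0`, and a monomial of `Ψ 1` without `x` contains `y`. Only the `z`-free monomials of `Ψ
2` need a hypothesis. -/
lemma Fibered.compat_lexWt (h : Fibered i Ψ) {s a b : ℝ} (hs : 0 < s)
    (hab : 0 < a ∨ (a = 0 ∧ 0 < b)) (hd : Dominates s a b Ψ) :
    ∀ j, Filt (lexWt s a b) (lexWt s a b j) (Ψ j) := by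
  intro j n hn
  rw [wt_lexWt]
  fin_cases j
  · obtain ⟨h1, h2⟩ := h.supp0 hn
    simp only [Fin.zero_eta, lexWt_zero, h2, lex_le_iff]
    have h1' : (1 : ℝ) ≤ n 0 := by exact_mod_cast h1
    exact lexNonneg_of_nonneg (by simpa using h1') (by simp; positivity) le_rfl
  · obtain ⟨h1, h2⟩ := h.supp1 hn
    simp only [Fin.mk_one, lexWt_one, h2, lex_le_iff]
    rcases Nat.eq_zero_or_pos (n 0) with h0 | h0
    · have h1' : (1 : ℝ) ≤ n 1 := by exact_mod_cast (by omega : 1 ≤ n 1)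
      refine lexNonneg_of_nonneg (by simp) ?_ le_rfl
      simp; nlinarith
    · left
      simpa using h0
  · simp only [Fin.reduceFinMk, lexWt_two, lex_le_iff]
    rcases Nat.eq_zero_or_pos (n 2) with h2 | h2
    · simpa [h2] using hd n hn h2
    · have h2' : (1 : ℝ) ≤ n 2 := by exact_mod_cast h2
      have e0 : (0 : ℝ) ≤ n 0 := Nat.cast_nonneg _
      have e1 : (0 : ℝ) ≤ n 1 * s := by positivity
      rcases hab with ha | ⟨ha, hb⟩
      · have : 0 ≤ (n 0 : ℝ) + n 2 * a - a := by nlinarith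
        rcases this.eq_or_lt with e | e
        · have hn2 : (n 2 : ℝ) = 1 := by nlinarith
          refine lexNonneg_of_nonneg this ?_ le_rfl
          rw [hn2]; linarith
        · exact Or.inl e
      · subst ha
        refine lexNonneg_of_nonneg (by simp) ?_ le_rfl
        nlinarith

lemma eq_single_of {n : Fin 3 →₀ ℕ} {k : Fin 3} (h : ∀ l, n l = if l = k then 1 else 0) :
    n = Finsupp.single k 1 := by
  ext l
  rw [h, Finsupp.single_apply]
  exact if_congr eq_comm rfl rfl

/-- The monomial exponent `x^a y^b`. -/
noncomputable def xyExp (a b : ℕ) : Fin 3 →₀ ℕ := Finsupp.single 0 a + Finsupp.single 1 b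

@[simp] lemma xyExp_zero (a b : ℕ) : xyExp a b 0 = a := by simp [xyExp]
@[simp] lemma xyExp_one (a b : ℕ) : xyExp a b 1 = b := by simp [xyExp]
@[simp] lemma xyExp_two (a b : ℕ) : xyExp a b 2 = 0 := by simp [xyExp]

lemma finsupp_ext3 {n k : Fin 3 →₀ ℕ} (h0 : n 0 = k 0) (h1 : n 1 = k 1) (h2 : n 2 = k 2) :
    n = k := by
  ext l; fin_cases l <;> assumption

lemma monomial_xyExp (a b : ℕ) (c : ℝ) :
    (monomial (xyExp a b) c : Series) = C c * (X 0 ^ a * X 1 ^ b) := by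
  classical
  rw [X_pow_eq, X_pow_eq, monomial_mul_monomial, one_mul, ← monomial_zero_eq_C_apply,
    monomial_mul_monomial, mul_one, zero_add, xyExp]

/-- The initial part of a fibered change for lexicographic weights. -/
lemma inMap_lexWt (h : Fibered i Ψ) {s a b : ℝ} (hs : 0 < s)
    (hab : 0 < a ∨ (a = 0 ∧ 0 < b)) {e₁ e₂ : ℕ} {c : ℝ}
    (hc : coeff (xyExp e₁ e₂) (Ψ 2) = c)
    (hce : ((e₁ : ℝ) = a ∧ (e₂ : ℝ) * s = b) ∨
      (c = 0 ∧ ∀ n : Fin 3 →₀ ℕ, coeff n (Ψ 2) ≠ 0 → n 2 = 0 →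
        ¬ ((n 0 : ℝ) = a ∧ (n 1 : ℝ) * s = b))) :
    inMap (lexWt s a b) Ψ 0 = C (coeff (Finsupp.single 0 1) (Ψ 0)) * X 0 ∧
    inMap (lexWt s a b) Ψ 1 = C (coeff (Finsupp.single 1 1) (Ψ 1)) * X 1 ∧
    inMap (lexWt s a b) Ψ 2 = C (coeff (Finsupp.single 2 1) (Ψ 2)) * X 2 +
      C c * (X 0 ^ e₁ * X 1 ^ e₂) := by
  classical
  have hX : ∀ (k : Fin 3) (d : ℝ), C d * (X k : Series) = monomial (Finsupp.single k 1) d := by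
    intro k d
    rw [X, ← monomial_zero_eq_C_apply, monomial_mul_monomial, zero_add, mul_one]
  refine ⟨?_, ?_, ?_⟩
  · ext n
    rw [hX, coeff_monomial, inMap, coeff_inPart]
    simp only [wt_lexWt, lexWt_zero, lex_eq_iff]
    by_cases hn : n = Finsupp.single 0 1
    · rw [hn]; simp
    · rw [if_neg hn]
      split_ifs with h1
      · by_contra hne
        obtain ⟨h2, h3⟩ := h.supp0 hne
        rw [h3] at h1
        simp [hs.ne'] at h1
        exact hn (eq_single_of fun l => by fin_cases l <;> simp [h1, h3])
      · rfl
  · ext n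
    rw [hX, coeff_monomial, inMap, coeff_inPart]
    simp only [wt_lexWt, lexWt_one, lex_eq_iff]
    by_cases hn : n = Finsupp.single 1 1
    · rw [hn]; simp
    · rw [if_neg hn]
      split_ifs with h1
      · by_contra hne
        obtain ⟨h2, h3⟩ := h.supp1 hne
        rw [h3] at h1
        simp [hs.ne'] at h1
        exact hn (eq_single_of fun l => by fin_cases l <;> simp [h1, h3])
      · rfl
  · ext n
    rw [hX, ← monomial_xyExp, map_add, coeff_monomial, coeff_monomial, inMap, coeff_inPart]
    simp only [wt_lexWt, lexWt_two, lex_eq_iff]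
    by_cases hn : n = Finsupp.single 2 1
    · have : n ≠ xyExp e₁ e₂ := by
        intro h'
        have := congr_arg (fun k : Fin 3 →₀ ℕ => k 2) (hn.symm.trans h')
        simp at this
      rw [if_pos hn, if_neg this, hn]; simp
    · rw [if_neg hn, zero_add]
      by_cases hn2 : n 2 = 0
      · by_cases hne : n = xyExp e₁ e₂
        · rw [if_pos hne]
          rcases hce with ⟨h1, h2⟩ | ⟨h1, h2⟩
          · rw [if_pos, hne, hc]
            rw [hne]; simp [h1, h2]
          · rw [hne, hc, h1]; simp
        · rw [if_neg hne]
          split_ifs with h1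
          · by_contra hcn
            rw [hn2] at h1
            simp only [Nat.cast_zero, zero_mul, add_zero] at h1
            rcases hce with ⟨h3, h4⟩ | ⟨h3, h4⟩
            · refine hne (finsupp_ext3 ?_ ?_ (by simp [hn2]))
              · rw [xyExp_zero]; exact_mod_cast h1.1.trans h3.symm
              · rw [xyExp_one]; exact_mod_cast mul_right_cancel₀ hs.ne' (h1.2.trans h4.symm)
            · exact h4 n hcn hn2 h1
          · rfl
      · have hne : n ≠ xyExp e₁ e₂ := fun h' => hn2 (by rw [h']; simp)
        rw [if_neg hne]
        split_ifs with h1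
        · exfalso
          have h2' : (1 : ℝ) ≤ n 2 := by exact_mod_cast Nat.one_le_iff_ne_zero.2 hn2
          have e0 : (0 : ℝ) ≤ n 0 := Nat.cast_nonneg _
          have e1 : (0 : ℝ) ≤ n 1 * s := by positivity
          have hn2' : (n 2 : ℝ) = 1 := by
            rcases hab with ha | ⟨ha, hb⟩
            · nlinarith [h1.1]
            · nlinarith [h1.2]
          rw [hn2'] at h1
          have h3 : (n 0 : ℝ) = 0 := by linarith [h1.1]
          have h4 : (n 1 : ℝ) * s = 0 := by linarith [h1.2]
          have h4' := (mul_eq_zero.1 h4).resolve_right hs.ne'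
          refine hn (finsupp_ext3 ?_ ?_ ?_)
          · simpa using h3
          · simpa using h4'
          · simpa using hn2'
        · rfl

end LexWeights

/-! ### Newton data -/

section NewtonData

/-- Second derivatives of `Φ` drop out because `χ` vanishes at the origin. -/
lemma jacobian_act {χ : FormalField} (h : ∀ j, constantCoeff (χ j) = 0) (Φ : Fin 3 → Series) :
    jacobian (fun j => χ.act (Φ j)) = jacobian Φ * jacobian χ := by
  ext j l
  rw [jacobian_apply, act_eq, Matrix.mul_apply, Fin.sum_univ_three]
  simp only [jacobian_apply, map_add, Derivation.leibniz, smul_eq_mul, map_mul, h]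
  ring

variable {K : ControlledGerm} {Φ : Fin 3 → Series} {Ω : FormalField}

lemma IsAdaptedChart.dvd {i : ℕ} {ζ : FormalField} (h : IsAdaptedChart i ζ Φ) {k : Fin 3}
    (hk : IsDivisorIndex i k) {χ : FormalField} (hχ : X k ∣ χ k)
    (hT : IsTransform Φ χ Ω) : X k ∣ Ω k := by
  refine h.coordinates.dvd_of_subst_dvd ?_
  rw [subst_X (hasSubst h.coordinates.1), ← hT k]
  refine (h.divisor k hk).dvd.trans ?_
  obtain ⟨u, hu⟩ := (h.divisor k hk).symm
  rw [← hu, act_mul, act_X]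
  exact dvd_add (dvd_mul_right _ _) (hχ.mul_left _)

lemma act_smul (F : Series) (χ : FormalField) (G : Series) :
    FormalField.act (fun j => F * χ j) G = F * χ.act G := by
  simp only [FormalField.act, Finset.mul_sum, mul_assoc]

lemma subst_act {χ : FormalField} (h0 : ∀ j, constantCoeff (Φ j) = 0)
    (hT : IsTransform Φ χ Ω) (F : Series) : χ.act (F.subst Φ) = (Ω.act F).subst Φ := by
  rw [act_subst χ h0, FormalField.act, subst_sum' h0]
  refine Finset.sum_congr rfl fun k _ => ?_
  rw [subst_mul (hasSubst h0), hT k, mul_comm]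

lemma isTransform_comp {χ Ω' : FormalField} {Ψ : Fin 3 → Series}
    (h0 : ∀ j, constantCoeff (Φ j) = 0) (h0' : ∀ j, constantCoeff (Ψ j) = 0)
    (hT : IsTransform Φ χ Ω) (hT' : IsTransform Ψ Ω Ω') :
    IsTransform (fun j => (Ψ j).subst Φ) χ Ω' := by
  intro j
  rw [subst_act h0 hT, hT' j, subst_subst h0' h0]

lemma ControlledGerm.one_le (K : ControlledGerm) : 1 ≤ K.i := by
  rcases K.i_eq with h | h <;> omega

lemma IsNewtonData.transform {i : ℕ} (hi : K.i = i) (h : K.IsNewtonData Φ Ω)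
    {Ψ : Fin 3 → Series} {Ω' : FormalField} (hΨ : Fibered i Ψ) (hT : IsTransform Ψ Ω Ω') :
    K.IsNewtonData (fun j => (Ψ j).subst Φ) Ω' := by
  subst hi
  obtain ⟨hA, χ', hχ', hT0⟩ := h
  have h0 := hA.coordinates.1
  have hζ : ∀ j, (toFormal K.ζ).act ((Ψ j).subst Φ) =
      (pderiv ℝ 2 (Ψ j)).subst Φ * (toFormal K.ζ).act (Φ 2) := by
    intro j
    rw [act_subst _ h0, Fin.sum_univ_three, hA.axis_x, hA.axis_y]
    ring
  refine ⟨⟨⟨fun j => ?_, ?_⟩, ?_, ?_, ?_, ?_⟩, χ', hχ', isTransform_comp h0 hΨ.const hT0 hT⟩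
  · rw [constantCoeff_subst_eq h0, hΨ.const]
  · rw [jacobian_subst h0, Matrix.det_mul]
    exact mul_ne_zero hΨ.det hA.coordinates.2
  · rw [hζ, hΨ.z0, subst_zero' h0, zero_mul]
  · rw [hζ, hΨ.z1, subst_zero' h0, zero_mul]
  · rw [hζ]
    exact ((isUnit_subst h0).2 hΨ.isUnit_z2).mul hA.axis_z
  · intro k hk
    have key : X k ∣ Ψ k := by
      rcases K.i_eq with h | h
      · have : k = 0 := by
          simp only [IsDivisorIndex] at hk; ext; simp; omega
        subst this
        exact hΨ.x0
      · have : k = 0 ∨ k = 1 := by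
          simp only [IsDivisorIndex] at hk
          rcases (by omega : (k : ℕ) = 0 ∨ (k : ℕ) = 1) with h | h
          · left; ext; simpa using h
          · right; ext; simpa using h
        rcases this with rfl | rfl
        · exact hΨ.x0
        · exact hΨ.y1 h
    obtain ⟨u, hu⟩ := key
    have hd := hΨ.diag k
    rw [← coeff_single_eq, hu, Derivation.leibniz] at hd
    have hu' : IsUnit u := by
      rw [isUnit_iff_constantCoeff_ne_zero]
      intro h
      apply hd
      simp [h]
    have : (Ψ k).subst Φ = Φ k * u.subst Φ := by
      rw [hu, subst_mul (hasSubst h0), subst_X (hasSubst h0)]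
    rw [this]
    obtain ⟨v, hv⟩ := (isUnit_subst h0).2 hu'
    rw [← hv]
    exact (associated_mul_unit_left _ _ v.isUnit).trans (hA.divisor k hk)

/-- Weights detecting the nonvanishing of the restriction to the axis. -/
lemma axisRestrict_eq_zero {F : Series} {w : Fin 3 → ℤ} (hw : w 2 = 0) {γ : ℤ} (hγ : 0 < γ)
    (hF : Filt w γ F) : axisRestrict F = 0 := by
  ext n
  rw [axisRestrict, PowerSeries.coeff_mk, map_zero]
  by_contra h
  have := hF _ h
  rw [wt_single, hw, smul_zero] at this
  omega

lemma axisRestrict_pderiv_eq_zero {F : Series} {w : Fin 3 → ℤ} (hw : w 2 = 0) {γ : ℤ}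
    {k : Fin 3} (hγ : w k < γ) (hF : Filt w γ F) : axisRestrict (pderiv ℝ k F) = 0 :=
  axisRestrict_eq_zero hw (by omega) (hF.pderiv k)

/-- A vector field with zero linear part above the diagonal along the axis. -/
lemma axisNonelementary_of_filt {Ω : FormalField} (h0 : Filt ![1, 1, 0] (2 : ℤ) (Ω 0))
    (h1 : Filt ![2, 1, 0] (2 : ℤ) (Ω 1)) (h2 : Filt ![1, 1, 0] (1 : ℤ) (Ω 2)) :
    AxisNonelementary Ω := by
  refine ⟨fun j => ?_, ?_⟩
  · fin_cases j
    · exact axisRestrict_eq_zero rfl (by norm_num) h0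
    · exact axisRestrict_eq_zero rfl (by norm_num) h1
    · exact axisRestrict_eq_zero rfl (by norm_num) h2
  · have e00 := axisRestrict_pderiv_eq_zero (k := 0) rfl (by norm_num [Matrix.cons_val_zero]) h0
    have e01 := axisRestrict_pderiv_eq_zero (k := 1) rfl (by norm_num) h0
    have e02 := axisRestrict_pderiv_eq_zero (k := 2) rfl (by simp) h0
    have e11 := axisRestrict_pderiv_eq_zero (k := 1) rfl (by norm_num) h1
    have e12 := axisRestrict_pderiv_eq_zero (k := 2) rfl (by simp) h1
    have e22 := axisRestrict_pderiv_eq_zero (k := 2) rfl (by simp) h2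
    -- Only entries strictly below the diagonal survive. The weight `2` of `x` in the second
    -- component is what leaves `∂(Ω 1)/∂x` unconstrained.
    refine ⟨3, ?_⟩
    ext1 a b
    simp only [pow_succ, pow_zero, one_mul, Matrix.mul_apply, Fin.sum_univ_three, Matrix.of_apply,
      Matrix.zero_apply]
    fin_cases a <;> fin_cases b <;>
      simp [e00, e01, e02, e11, e12, e22]

/-- Without such a support point, the Jacobian along the axis is strictly lower triangular, so the
whole leaf is nonelementary; multiplication by `V` does not change this. -/
lemma exists_mem_supp_of_not_axisNonelementary {Ω Ω₀ : FormalField} (hx : X 0 ∣ Ω 0) {V : Series}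
    (hV : ∀ j, Ω₀ j = V * Ω j) (h : ¬ AxisNonelementary Ω₀) :
    ∃ v ∈ supp Ω, v 0 = 0 ∧ (v 1 = -1 ∨ v 1 = 0) := by
  by_contra hc
  push Not at hc
  apply h
  have hs : ∀ j n, coeff n (Ω j) ≠ 0 → logExp j n 0 = 0 →
      logExp j n 1 ≠ -1 ∧ logExp j n 1 ≠ 0 := fun j n hn h0 => hc _ (logExp_mem_supp hn) h0
  have hfilt : ∀ {w : Fin 3 → ℤ} (hw : ∀ k, 0 ≤ w k) {γ : ℤ} (j : Fin 3), Filt w γ (Ω j) →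
      Filt w γ (Ω₀ j) := by
    intro w hw γ j hF
    rw [hV, ← zero_add γ]
    exact (filt_of_nonneg hw V).mul hF
  refine axisNonelementary_of_filt (hfilt ?_ 0 ?_) (hfilt ?_ 1 ?_) (hfilt ?_ 2 ?_)
  · intro k; fin_cases k <;> simp
  · intro n hn
    have h1 := X_dvd_iff_coeff.1 hx n hn
    have h2 := hs 0 n hn
    simp only [logExp] at h2
    rw [wt_eq]
    simp at h2 ⊢
    omega
  · intro k; fin_cases k <;> simp
  · intro n hn
    have h2 := hs 1 n hn
    simp only [logExp] at h2
    rw [wt_eq]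
    simp at h2 ⊢
    omega
  · intro k; fin_cases k <;> simp
  · intro n hn
    have h2 := hs 2 n hn
    simp only [logExp] at h2
    rw [wt_eq]
    simp at h2 ⊢
    omega

/-- The support conditions come from the invariance of the divisor and from the leaf axiom.
Nilpotency carries over because the linear parts are conjugate by the Jacobian of the chart, up to
the factor `h(0)`. -/
lemma IsNewtonData.good {i : ℕ} (hi : K.i = i) (hK : K.Nonelementary) (h : K.IsNewtonData Φ Ω) :
    Good i Ω := by
  subst hi
  obtain ⟨hA, χ', ⟨h, hpos, hh⟩, hT⟩ := h
  have h0 := hA.coordinates.1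
  have hχ : ∀ j, (toFormal χ') j = (h : Series) * (toFormal K.χ) j := fun j => by
    simp only [toFormal, hh, Subring.coe_mul]
  have hdvd : ∀ k, IsDivisorIndex K.i k → X k ∣ Ω k := by
    intro k hk
    refine hA.dvd hk ?_ hT
    obtain ⟨u, hu⟩ := K.χ_preserves k hk
    rw [hχ]
    have : X k ∣ toFormal K.χ k := ⟨u, by simp only [toFormal, hu, Subring.coe_mul, coord]⟩
    exact this.mul_left _
  have hz : ∀ j, constantCoeff (toFormal χ' j) = 0 := fun j => by
    rw [hχ, map_mul, toFormal, hK.1 j, mul_zero]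
  have hx0 := hdvd 0 (by have := K.one_le; simp [IsDivisorIndex]; omega)
  refine ⟨hx0, fun h2 => hdvd 1 (by simp [IsDivisorIndex, h2]), ?_, fun j => ?_, ?_⟩
  · choose Ω₀ hΩ₀ using fun j => hA.coordinates.exists_subst_eq ((toFormal K.χ).act (Φ j))
    have hT₀ : IsTransform Φ (toFormal K.χ) Ω₀ := fun j => (hΩ₀ j).symm
    have hu : IsUnit (h : Series) := isUnit_iff_constantCoeff_ne_zero.2 hpos.ne'
    obtain ⟨V, hV⟩ := hA.coordinates.exists_subst_eq (↑(hu.unit⁻¹) : Series)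
    refine exists_mem_supp_of_not_axisNonelementary hx0 (V := V) (fun j => ?_)
      (K.leaf Φ hA Ω₀ hT₀)
    apply hA.coordinates.subst_injective
    rw [subst_mul (hasSubst h0), hV, ← hT j, ← hT₀ j,
      show toFormal χ' = fun j => (h : Series) * (toFormal K.χ) j from funext hχ, act_smul,
      ← mul_assoc, IsUnit.val_inv_mul, one_mul]
  · rw [← constantCoeff_subst_eq h0, ← hT j, act_eq]
    simp only [map_add, map_mul, hz, zero_mul, add_zero]
  · have hJ : jacobian Ω * jacobian Φ = jacobian Φ * jacobian (toFormal χ') := by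
      rw [← jacobian_subst h0, ← jacobian_act hz]
      congr 1
      funext j
      exact (hT j).symm
    have hJ' : jacobian (toFormal χ') = constantCoeff (h : Series) • jacobian (toFormal K.χ) := by
      ext j l
      rw [Matrix.smul_apply, jacobian_apply, jacobian_apply, hχ, Derivation.leibniz]
      have := hK.1 j
      simp only [toFormal] at this ⊢
      simp [this]
    have hu : IsUnit (jacobian Φ).det := hA.coordinates.2.isUnit
    have hJ2 : jacobian Ω =
        jacobian Φ * (constantCoeff (h : Series) • jacobian (toFormal K.χ)) * (jacobian Φ)⁻¹ := by
      rw [← hJ', ← hJ, Matrix.mul_assoc, Matrix.mul_nonsing_inv _ hu, Matrix.mul_one]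
    obtain ⟨N, hN⟩ := hK.2
    refine ⟨N, ?_⟩
    rw [hJ2]
    have : ∀ N : ℕ, (jacobian Φ * (constantCoeff (h : Series) • jacobian (toFormal K.χ)) *
        (jacobian Φ)⁻¹) ^ N = jacobian Φ * (constantCoeff (h : Series) •
          jacobian (toFormal K.χ)) ^ N * (jacobian Φ)⁻¹ := by
      intro N
      induction N with
      | zero => simp [Matrix.mul_nonsing_inv _ hu]
      | succ N ih =>
        rw [pow_succ, ih, pow_succ]
        calc _ = jacobian Φ * (constantCoeff (h : Series) • jacobian (toFormal K.χ)) ^ N *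
              ((jacobian Φ)⁻¹ * jacobian Φ) * (constantCoeff (h : Series) •
                jacobian (toFormal K.χ)) * (jacobian Φ)⁻¹ := by simp only [Matrix.mul_assoc]
          _ = _ := by rw [Matrix.nonsing_inv_mul _ hu]; simp only [Matrix.mul_assoc, Matrix.one_mul]
    rw [this, smul_pow, hN, smul_zero, Matrix.mul_zero, Matrix.zero_mul]

end NewtonData

/-! ### Invariance of the higher vertex -/

section HigherVertexInvariance

variable {i : ℕ} {Ψ : Fin 3 → Series} {U : Series} {Ω Ω' : FormalField} {h h' : Fin 3 → ℤ}

lemma dominates_zero_one (hΨ : Fibered i Ψ) {s : ℝ} (hs : 1 ≤ s) : Dominates s 0 1 Ψ := by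
  intro n hn h2
  have h3 := hΨ.ne_zero hn
  rcases Nat.eq_zero_or_pos (n 0) with h0 | h0
  · have h1' : (1 : ℝ) ≤ n 1 := by exact_mod_cast (by omega : 1 ≤ n 1)
    refine lexNonneg_of_nonneg (by simp) ?_ le_rfl
    nlinarith
  · left; simpa using h0

/-- With `x` infinitely heavy and `N` larger than the difference of the heights of `h` and `h'`,
comparing weights of `h` and `h'` is comparing them lexicographically. These weights are compatible
with every fibered change. -/
lemma HigherVertex.le_of_rel (hR : Rel i Ψ U Ω Ω') (hh : HigherVertex Ω h)
    (hh' : HigherVertex Ω' h') : h 1 ≤ h' 1 ∧ (h 1 = h' 1 → h 2 ≤ h' 2) := by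
  set N : ℝ := |(h 2 : ℝ)| + |(h' 2 : ℝ)| + 1 with hN
  have a1 := abs_nonneg (h 2 : ℝ)
  have a2 := abs_nonneg (h' 2 : ℝ)
  have b1 := le_abs_self (h 2 : ℝ)
  have b2 := le_abs_self (h' 2 : ℝ)
  have hw : ∀ k, 0 < lexWt N 0 1 k := lexWt_pos (by linarith) (Or.inr ⟨rfl, one_pos⟩)
  have hΩ : FiltField (lexWt N 0 1) (zwt (lexWt N 0 1) h) Ω := by
    rw [filtField_iff]
    intro v hv
    rw [zwt_lexWt, zwt_lexWt, lex_le_iff, hh.h0]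
    have h0 := hh.nonneg v hv
    rcases h0.eq_or_lt with e | e
    · refine lexNonneg_of_nonneg (by simp [← e]) ?_ le_rfl
      rcases (hh.le1 v hv e.symm).eq_or_lt with e1 | e1
      · have : (h 2 : ℝ) ≤ v 2 := by exact_mod_cast hh.le2 v hv e.symm e1.symm
        rw [e1]; linarith
      · have h3 : (-1 : ℝ) ≤ v 2 := by exact_mod_cast neg_one_le_of_mem_supp hv 2
        have h4 : (h 1 : ℝ) + 1 ≤ v 1 := by exact_mod_cast e1
        nlinarith
    · left; simpa using e
  have := filtField_iff.1 (hR.init hw (hR.fibered.compat_lexWt (by linarith)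
    (Or.inr ⟨rfl, one_pos⟩) (dominates_zero_one hR.fibered (by linarith))) hΩ).1 h' hh'.mem
  rw [zwt_lexWt, zwt_lexWt, lex_le_iff, hh.h0, hh'.h0] at this
  simp only [Int.cast_zero, mul_zero, add_zero, sub_zero, LexNonneg, lt_irrefl, false_or,
    true_and, mul_one] at this
  have key : (h 1 : ℝ) * N + h 2 ≤ h' 1 * N + h' 2 := by
    rcases this with h | ⟨h, -⟩ <;> linarith
  constructor
  · by_contra hc
    have : (h' 1 : ℝ) + 1 ≤ h 1 := by exact_mod_cast not_le.1 hc
    have : -|(h 2 : ℝ)| ≤ h 2 := neg_abs_le _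
    nlinarith
  · intro e
    rw [e] at key
    exact_mod_cast (by linarith : (h 2 : ℝ) ≤ h' 2)

lemma HigherVertex.eq_of_rel (hR : Rel i Ψ U Ω Ω') (hh : HigherVertex Ω h)
    (hh' : HigherVertex Ω' h') : h = h' := by
  obtain ⟨Θ, hΘ, h1, -⟩ := hR.fibered.isFormalCoordinates.exists_inverse
  obtain ⟨U', hR'⟩ := hR.symm hΘ h1
  obtain ⟨a1, a2⟩ := hh.le_of_rel hR hh'
  obtain ⟨b1, b2⟩ := hh'.le_of_rel hR' hh
  have e := le_antisymm a1 b1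
  exact ext3 (hh.h0.trans hh'.h0.symm) e (le_antisymm (a2 e) (b2 e.symm))

end HigherVertexInvariance

/-! ### Stable data -/

section Stable

/-- The consequences of stability used below. -/
structure StableFacts (i : ℕ) (Ω : FormalField) (h m : Fin 3 → ℤ) (Δ : ℚ × ℚ) (C : WithTop ℚ) :
    Prop where
  good : Good i Ω
  facts : ClassFacts i Ω h m Δ C
  stab : ∀ f g, (f, g) ∈ faceGroup i Δ C → f.coeff 0 = 0 → g.coeff 0 = 0 →
    ∃ Ω', IsTransform (polyMap f g) Ω Ω' ∧ ClassFacts i Ω' h m Δ C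

lemma constantCoeff_aeval (f : MvPolynomial (Fin 2) ℝ) (hf : f.coeff 0 = 0) :
    constantCoeff (MvPolynomial.aeval ![X 0, X 1] f : Series) = 0 := by
  have : (constantCoeff : Series →+* ℝ).comp
      (MvPolynomial.aeval ![(X 0 : Series), X 1] : MvPolynomial (Fin 2) ℝ →ₐ[ℝ] Series).toRingHom
      = MvPolynomial.constantCoeff := by
    apply MvPolynomial.ringHom_ext
    · intro r
      simp [MvPowerSeries.algebraMap_apply]
    · intro k
      fin_cases k <;> simp
  have h2 := RingHom.congr_fun this f
  rw [MvPolynomial.constantCoeff_eq, hf] at h2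
  exact h2

lemma constantCoeff_aeval' (g : Polynomial ℝ) (hg : g.coeff 0 = 0) :
    constantCoeff (Polynomial.aeval (X 0) g : Series) = 0 := by
  obtain ⟨q, rfl⟩ := Polynomial.X_dvd_iff.2 hg
  simp

lemma pderiv_two_aeval (f : MvPolynomial (Fin 2) ℝ) :
    pderiv ℝ 2 (MvPolynomial.aeval ![X 0, X 1] f : Series) = 0 := by
  induction f using MvPolynomial.induction_on with
  | C a => simp
  | add p q hp hq => simp [hp, hq]
  | mul_X p k hp =>
    rw [map_mul, Derivation.leibniz, hp, MvPolynomial.aeval_X]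
    fin_cases k <;> simp [pderiv_X]

lemma fibered_polyMap {i : ℕ} {f : MvPolynomial (Fin 2) ℝ} {g : Polynomial ℝ}
    (hf : f.coeff 0 = 0) (hg : g.coeff 0 = 0) (hi : i = 2 → g = 0) :
    Fibered i (polyMap f g) := by
  have z0 : pderiv ℝ 2 (polyMap f g 0) = 0 := by simp [polyMap, pderiv_X]
  have z1 : pderiv ℝ 2 (polyMap f g 1) = 0 := by
    simp [polyMap, pderiv_X]
  have z2 : pderiv ℝ 2 (polyMap f g 2) = 1 := by
    simp [polyMap, pderiv_X, pderiv_two_aeval]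
  refine ⟨fun j => ?_, z0, z1, dvd_rfl, fun h => ?_, ?_⟩
  · fin_cases j
    · simp [polyMap]
    · simp [polyMap, constantCoeff_aeval' g hg]
    · simp [polyMap, constantCoeff_aeval f hf]
  · simp [polyMap, hi h]
  · rw [jacobian_triangular z0 z1 dvd_rfl, ← coeff_single_eq (polyMap f g 2), z2,
      ← coeff_single_eq, ← coeff_single_eq]
    have : pderiv ℝ 1 (Polynomial.aeval (X 0) g : Series) = 0 := by
      induction g using Polynomial.induction_on' with
      | add p q hp hq => simp [hp, hq]
      | monomial n a =>
        simp [Polynomial.aeval_monomial, Derivation.leibniz, Derivation.leibniz_pow, pderiv_X]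
    simp [polyMap, this]

variable {K : ControlledGerm} {Φ : Fin 3 → Series} {Ω Ω' : FormalField} {i : ℕ}
  {h h' m m' : Fin 3 → ℤ} {Δ Δ' : ℚ × ℚ} {C₀ C₀' : WithTop ℚ} {Ψ : Fin 3 → Series} {U : Series}

lemma rel_of_isTransform (hΨ : Fibered i Ψ) (hT : IsTransform Ψ Ω Ω') : Rel i Ψ 1 Ω Ω' :=
  ⟨hΨ, isUnit_one, fun j => by rw [one_mul, hT j]⟩

/-- Changes in the stability condition are fibered and hence keep the higher vertex; the same `h`
serves for all transformed data. -/
lemma IsStable.facts (hi : K.i = i) (hK : K.Nonelementary) (hN : K.IsNewtonData Φ Ω)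
    (hS : IsStable i Ω m Δ C₀) : ∃ h, StableFacts i Ω h m Δ C₀ := by
  obtain ⟨hC, hS⟩ := hS
  have hg := IsNewtonData.good hi hK hN
  obtain ⟨h, hc⟩ := hC.classFacts hg
  refine ⟨h, hg, hc, fun f g hfg hf h0 => ?_⟩
  obtain ⟨Ω', hT, hC'⟩ := hS f g hfg hf h0
  have hF : Fibered i (polyMap f g) := fibered_polyMap hf h0 hfg.2.2
  obtain ⟨h', hc'⟩ := hC'.classFacts (IsNewtonData.good hi hK (IsNewtonData.transform hi hN hF hT))
  obtain rfl := hc.hv.eq_of_rel (rel_of_isTransform hF hT) hc'.hv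
  exact ⟨Ω', hT, hc'⟩

lemma polyMap_monomial (n : Fin 2 →₀ ℕ) (c : ℝ) :
    polyMap (MvPolynomial.monomial n c) 0 =
      ![X 0, X 1, X 2 + C c * (X 0 ^ n 0 * X 1 ^ n 1)] := by
  rw [polyMap, MvPolynomial.aeval_monomial, Finsupp.prod_fintype _ _ (fun _ => pow_zero _),
    Fin.prod_univ_two]
  simp [MvPowerSeries.algebraMap_apply]

/-- Stability for a single monomial. Allowing `c = 0` treats displacements that are not exponents
together with those that are. -/
lemma StableFacts.exists_monomial (hS : StableFacts i Ω h m Δ C₀) {e₁ e₂ : ℕ} {c : ℝ}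
    (he : e₁ ≠ 0 ∨ e₂ ≠ 0) (hc : c = 0 ∨ ((e₁ : ℚ), (e₂ : ℚ)) = Δ) :
    ∃ Ω', IsTransform ![X 0, X 1, X 2 + C c * (X 0 ^ e₁ * X 1 ^ e₂)] Ω Ω' ∧
      ClassFacts i Ω' h m Δ C₀ := by
  classical
  set n : Fin 2 →₀ ℕ := Finsupp.equivFunOnFinite.symm ![e₁, e₂] with hn
  have h0 : n 0 = e₁ := rfl
  have h1 : n 1 = e₂ := rfl
  have := hS.stab (MvPolynomial.monomial n c) 0 ⟨fun k hk => ?_, by simp, fun _ => rfl⟩ ?_ (by simp)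
  · rwa [polyMap_monomial, h0, h1] at this
  · rw [MvPolynomial.mem_support_iff, MvPolynomial.coeff_monomial] at hk
    split_ifs at hk with hk'
    · subst hk'
      rcases hc with h | h
      · exact absurd h hk
      · left; rw [← h, h0, h1]
    · simp at hk
  · rw [MvPolynomial.coeff_monomial, if_neg]
    intro h
    rw [h] at h0 h1
    simp at h0 h1
    omega

end Stable

/-! ### Monomial vector fields under tilted changes -/

section Tilt

lemma eq_monomial_of {F : Series} {n : Fin 3 →₀ ℕ} (h : ∀ k, coeff k F ≠ 0 → k = n) :
    F = monomial n (coeff n F) := by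
  classical
  ext k
  rw [coeff_monomial]
  split_ifs with hk
  · rw [hk]
  · by_contra hc
    exact hk (h k hc)

/-- A monomial becomes a constant times a product of powers of the nonzero series `Q j`, and power
series form a domain. -/
lemma eq_zero_of_subst {F : Series} (hF : ∀ k k', coeff k F ≠ 0 → coeff k' F ≠ 0 → k = k')
    {Q : Fin 3 → Series} (h0 : ∀ j, constantCoeff (Q j) = 0) (hQ : ∀ j, Q j ≠ 0)
    (h : F.subst Q = 0) : F = 0 := by
  by_contra hne
  obtain ⟨n, hn⟩ : ∃ n, coeff n F ≠ 0 := by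
    by_contra hc
    push Not at hc
    exact hne (ext fun n => by simp [hc n])
  rw [eq_monomial_of fun k hk => hF k n hk hn, subst_monomial (hasSubst h0), prod_eq] at h
  simp [hQ, hn] at h

lemma X_two_dvd {Ω : FormalField} (h : ∀ v ∈ supp Ω, 1 ≤ v 2) (j : Fin 3) : X 2 ∣ Ω j := by
  rw [X_dvd_iff_coeff]
  intro n hn
  have := h _ (logExp_mem_supp hn)
  simp only [logExp] at this
  split_ifs at this <;> omega

lemma coeff_X_mul_pderiv (j : Fin 3) (F : Series) (n : Fin 3 →₀ ℕ) :
    coeff n (X j * pderiv ℝ j F) = n j * coeff n F := by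
  classical
  rw [X, coeff_monomial_mul, one_mul]
  split_ifs with h
  · have h1 : 1 ≤ n j := by simpa using h j
    rw [coeff_pderiv, tsub_add_cancel_of_le h, mul_comm]
    congr 1
    simp [Nat.cast_sub h1]
  · have : n j = 0 := by
      by_contra hc
      apply h
      intro l
      rw [Finsupp.single_apply]
      split_ifs with hl
      · subst hl; omega
      · exact Nat.zero_le _
    rw [this, Nat.cast_zero, zero_mul]

variable {i : ℕ} {P : Fin 3 → Series} {U : Series} {Y Y' : FormalField}

/-- `Q` maps into the surface `P 2 = 0`, the preimage of `z = 0`. There the transformed coefficient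
vanishes while `U` does not. -/
lemma Rel.subst_eq_zero (hR : Rel i P U Y Y') {Q : Fin 3 → Series}
    (h0 : ∀ j, constantCoeff (Q j) = 0) (hQ : (P 2).subst Q = 0) {j : Fin 3} (hj : X 2 ∣ Y' j) :
    (Y.act (P j)).subst Q = 0 := by
  obtain ⟨G, hG⟩ := hj
  have h1 := hR.eq j
  have hP := hasSubst hR.fibered.const
  rw [hG, subst_mul hP, subst_X hP] at h1
  have h2 := congr_arg (fun F : Series => F.subst Q) h1
  simp only [subst_mul (hasSubst h0), hQ, zero_mul] at h2
  exact (mul_eq_zero.1 h2).resolve_left ((isUnit_subst h0).2 hR.unit).ne_zero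

lemma X_ne_zero' (k : Fin 3) : (X k : Series) ≠ 0 := by
  intro h
  have := congr_arg (coeff (Finsupp.single k 1)) h
  simp at this

lemma subst_C' {Q : Fin 3 → Series} (h0 : ∀ j, constantCoeff (Q j) = 0) (c : ℝ) :
    (C c : Series).subst Q = C c := by
  rw [← monomial_zero_eq_C_apply, subst_monomial (hasSubst h0), prod_eq]
  simp [MvPowerSeries.algebraMap_apply]

/-- The parametrization of the zero set of `w z + c x^{e₁} y^{e₂}`. -/
noncomputable def tilt (κ : ℝ) (e₁ e₂ : ℕ) : Fin 3 → Series :=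
  ![X 0, X 1, C κ * (X 0 ^ e₁ * X 1 ^ e₂)]

variable {κ : ℝ} {e₁ e₂ : ℕ}

lemma tilt_const (he : e₁ ≠ 0 ∨ e₂ ≠ 0) (j : Fin 3) : constantCoeff (tilt κ e₁ e₂ j) = 0 := by
  fin_cases j
  · simp [tilt]
  · simp [tilt]
  · rcases he with h | h <;> simp [tilt, h]

lemma tilt_ne_zero (hκ : κ ≠ 0) (j : Fin 3) : tilt κ e₁ e₂ j ≠ 0 := by
  fin_cases j <;> simp [tilt, hκ, X_ne_zero']

lemma subst_tilt (he : e₁ ≠ 0 ∨ e₂ ≠ 0) {w c : ℝ} (hw : w ≠ 0) :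
    (C w * X 2 + C c * (X 0 ^ e₁ * X 1 ^ e₂) : Series).subst (tilt (-c / w) e₁ e₂) = 0 := by
  have h := hasSubst (tilt_const (κ := -c / w) he)
  rw [subst_add h, subst_mul h, subst_mul h, subst_mul h, subst_pow h, subst_pow h, subst_X h,
    subst_X h, subst_X h, subst_C' (tilt_const he), subst_C' (tilt_const he)]
  simp only [tilt, Matrix.cons_val]
  rw [← mul_assoc, ← map_mul, mul_div_cancel₀ _ hw, map_neg]
  ring

/-- A monomial vector field cannot be transformed to a vector field divisible by `z` by a change of
coordinates which tilts the plane `z = 0`. -/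
lemma Rel.tilt_false (hR : Rel i P U Y Y') {m : Fin 3 → ℤ} (hm : m ∈ supp Y)
    (hY : ∀ v ∈ supp Y, v = m) (hY' : ∀ v ∈ supp Y', 1 ≤ v 2) (he : e₁ ≠ 0 ∨ e₂ ≠ 0)
    {u v w c : ℝ} (hP0 : P 0 = C u * X 0) (hP1 : P 1 = C v * X 1)
    (hP2 : P 2 = C w * X 2 + C c * (X 0 ^ e₁ * X 1 ^ e₂)) (hu : u ≠ 0) (hv : v ≠ 0) (hw : w ≠ 0)
    (hc : c ≠ 0) : False := by
  have h0 : ∀ j, constantCoeff (tilt (-c / w) e₁ e₂ j) = 0 := tilt_const he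
  have hκ : -c / w ≠ 0 := div_ne_zero (neg_ne_zero.2 hc) hw
  have hz : ∀ j, (Y.act (P j)).subst (tilt (-c / w) e₁ e₂) = 0 := fun j =>
    hR.subst_eq_zero h0 (by rw [hP2, subst_tilt he hw]) (X_two_dvd hY' j)
  -- A monomial does not vanish on the tilted surface, where `z = κ x^{e₁} y^{e₂}` with `κ ≠ 0`; so
  -- each coefficient of `Y` that vanishes there is zero.
  have hs : ∀ j, (Y j).subst (tilt (-c / w) e₁ e₂) = 0 → Y j = 0 := by
    intro j hj
    refine eq_zero_of_subst (fun k k' hk hk' => ?_) h0 (tilt_ne_zero hκ) hj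
    have := (hY _ (logExp_mem_supp hk)).trans (hY _ (logExp_mem_supp hk')).symm
    ext l
    have := congr_fun this l
    simp only [logExp] at this
    omega
  have hY0 : Y 0 = 0 := by
    apply hs
    have := hz 0
    rw [hP0, act_mul, act_C, act_X, mul_zero, add_zero, subst_mul (hasSubst h0), subst_C' h0] at this
    simpa [hu] using this
  have hY1 : Y 1 = 0 := by
    apply hs
    have := hz 1
    rw [hP1, act_mul, act_C, act_X, mul_zero, add_zero, subst_mul (hasSubst h0), subst_C' h0] at this
    simpa [hv] using this
  have hY2 : Y 2 = 0 := by
    apply hs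
    have := hz 2
    rw [hP2, act_eq, hY0, hY1] at this
    have e : pderiv ℝ 2 (C w * X 2 + C c * (X 0 ^ e₁ * X 1 ^ e₂) : Series) = C w := by
      simp [Derivation.leibniz, Derivation.leibniz_pow, pderiv_X]
    rw [e, zero_mul, zero_mul, zero_add, zero_add, subst_mul (hasSubst h0), subst_C' h0] at this
    simpa [hw] using this
  obtain ⟨j, n, hn, -⟩ := mem_supp.1 hm
  fin_cases j
  · exact hn (by simp [hY0])
  · exact hn (by simp [hY1])
  · exact hn (by simp [hY2])

/-- The analogue of `Rel.tilt_false` for the initial part in a nilpotent configuration. -/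
lemma Rel.tilt_false' (hR : Rel i P U Y Y') {h n : Fin 3 → ℤ} (hh0 : h 0 = 0) (hh1 : h 1 = -1)
    (hh2 : h 2 = n 2 + 1) (hn0 : n 0 = 0) (hn1 : n 1 = 0) (hn2 : 1 ≤ n 2) (hm : h ∈ supp Y)
    (hY : ∀ v ∈ supp Y, v = h ∨ v = n) (hY' : ∀ v ∈ supp Y', v = h ∨ v = n)
    {u v w c : ℝ} (hP0 : P 0 = C u * X 0) (hP1 : P 1 = C v * X 1)
    (hP2 : P 2 = C w * X 2 + C c * (X 0 ^ 0 * X 1 ^ 1)) (hu : u ≠ 0) (hv : v ≠ 0) (hw : w ≠ 0)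
    (hc : c ≠ 0) : False := by
  have he : (0 : ℕ) ≠ 0 ∨ (1 : ℕ) ≠ 0 := Or.inr one_ne_zero
  have h0 : ∀ j, constantCoeff (tilt (-c / w) 0 1 j) = 0 := tilt_const he
  have hS := hasSubst h0
  have hκ : -c / w ≠ 0 := div_ne_zero (neg_ne_zero.2 hc) hw
  have hP20 : (P 2).subst (tilt (-c / w) 0 1) = 0 := by rw [hP2, subst_tilt he hw]
  have hz : ∀ j, (Y.act (P j)).subst (tilt (-c / w) 0 1) = 0 := fun j =>
    hR.subst_eq_zero h0 hP20
      (X_two_dvd (fun v hv => by rcases hY' v hv with rfl | rfl <;> omega) j)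
  -- The exponent `-1` in `y` confines `h` to the `y`-coefficient; the other two coefficients have
  -- at most the monomial coming from `n`.
  have hmon : ∀ {Y : FormalField}, (∀ v ∈ supp Y, v = h ∨ v = n) → ∀ j k, j ≠ 1 →
      coeff k (Y j) ≠ 0 → ∀ l, (k l : ℤ) = n l + if l = j then 1 else 0 := by
    intro Y hY j k hj hk l
    rcases hY _ (logExp_mem_supp hk) with h | h
    · have := congr_fun h 1
      simp only [logExp, if_neg hj.symm, hh1] at this
      omega
    · have := congr_fun h l
      simp only [logExp] at this
      omega
  have hs : ∀ j, j ≠ 1 → (Y j).subst (tilt (-c / w) 0 1) = 0 → Y j = 0 := by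
    intro j hj1 hj
    refine eq_zero_of_subst (fun k k' hk hk' => ?_) h0 (tilt_ne_zero hκ) hj
    ext l
    exact_mod_cast (hmon hY j k hj1 hk l).trans (hmon hY j k' hj1 hk' l).symm
  have hY0 : Y 0 = 0 := by
    apply hs 0 (by decide)
    have := hz 0
    rw [hP0, act_mul, act_C, act_X, mul_zero, add_zero, subst_mul (hasSubst h0), subst_C' h0] at this
    simpa [hu] using this
  have hY1 : (Y 1).subst (tilt (-c / w) 0 1) = 0 := by
    have := hz 1
    rw [hP1, act_mul, act_C, act_X, mul_zero, add_zero, subst_mul (hasSubst h0), subst_C' h0] at this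
    simpa [hv] using this
  have hact : Y.act (P 2) = C w * Y 2 + C c * Y 1 := by
    rw [hP2]; simp
  have hY2 : Y 2 = 0 := by
    apply hs 2 (by decide)
    have := hz 2
    rw [hact, subst_add hS, subst_mul hS, subst_mul hS, hY1, mul_zero, add_zero, subst_C' h0]
      at this
    simpa [hw] using this
  -- The `z`-coefficient of `Y'` is a multiple of `z^{n₂+1}`, divisible by `z²` since `n₂ ≥ 1`.
  -- Together with `Y 2 = 0`, this makes `Y 1` vanish doubly on the tilted plane.
  obtain ⟨G, hG⟩ : X 2 ^ 2 ∣ Y' 2 := by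
    rw [X_pow_dvd_iff]
    intro k hk
    by_contra hne
    have := hmon hY' 2 k (by decide) hne 2
    simp at this
    omega
  have hE := hR.eq 2
  have hPs := hasSubst hR.fibered.const
  rw [hact, hY2, mul_zero, zero_add, hG, subst_mul hPs, subst_pow hPs, subst_X hPs] at hE
  have hE2 := congr_arg (fun F : Series => (pderiv ℝ 2 F).subst (tilt (-c / w) 0 1)) hE
  simp only [Derivation.leibniz, Derivation.leibniz_pow, smul_eq_mul, subst_add hS, subst_mul hS,
    subst_pow hS, hP20, hY1] at hE2
  have hd : (pderiv ℝ 2 (Y 1)).subst (tilt (-c / w) 0 1) = 0 := by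
    have hU := ((isUnit_subst h0).2 hR.unit).ne_zero
    have hC : pderiv ℝ 2 (C c : Series) = 0 := by simp
    rw [hC, subst_zero' h0, subst_C' h0] at hE2
    have h2 : ((2 : Series) * (P 2 * pderiv ℝ 2 (P 2))).subst (tilt (-c / w) 0 1) = 0 := by
      rw [mul_left_comm, subst_mul hS, hP20, zero_mul]
    simpa [hU, hc, h2] using hE2
  -- The operator `z ∂/∂z - n₂` kills the monomial at `n` and leaves the one at `h`, which then
  -- vanishes on the tilted plane and must be zero.
  have hG0 : X 2 * pderiv ℝ 2 (Y 1) - C (n 2 : ℝ) * Y 1 = 0 := by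
    refine eq_zero_of_subst (fun k k' hk hk' => ?_) h0 (tilt_ne_zero hκ) ?_
    · have key : ∀ k, coeff k (X 2 * pderiv ℝ 2 (Y 1) - C (n 2 : ℝ) * Y 1) ≠ 0 →
          ∀ l, (k l : ℤ) = h l + if l = 1 then 1 else 0 := by
        intro k hk l
        rw [map_sub, coeff_X_mul_pderiv, coeff_C_mul, ← sub_mul] at hk
        rcases hY _ (logExp_mem_supp (right_ne_zero_of_mul hk)) with h | h
        · have := congr_fun h l
          simp only [logExp] at this
          omega
        · exfalso
          have := congr_fun h 2
          simp [logExp] at this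
          apply left_ne_zero_of_mul hk
          rw [← this]
          simp
      ext l
      exact_mod_cast (key k hk l).trans (key k' hk' l).symm
    · rw [sub_eq_add_neg, subst_add hS, ← neg_mul, subst_mul hS, subst_mul hS, hd, hY1]
      simp
  obtain ⟨j, k, hk, hv⟩ := mem_supp.1 hm
  have hj : j = 1 := by
    fin_cases j
    · exact absurd (by simp [hY0]) hk
    · rfl
    · exact absurd (by simp [hY2]) hk
  subst hj
  have := congr_arg (coeff k) hG0
  rw [map_sub, coeff_X_mul_pderiv, coeff_C_mul, ← sub_mul, map_zero] at this
  have h3 := (mul_eq_zero.1 this).resolve_right hk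
  have h4 := congr_fun hv 2
  simp only [logExp] at h4
  have h5 : (k 2 : ℤ) = n 2 := by
    have : (k 2 : ℝ) = n 2 := by linarith
    exact_mod_cast this
  simp at h4
  omega

end Tilt

/-! ### Invariance of the main vertex -/

section MainVertexInvariance

variable {i : ℕ} {Ω Ω' : FormalField} {Ψ : Fin 3 → Series} {U : Series}
  {h m m' : Fin 3 → ℤ} {Δ Δ' : ℚ × ℚ} {C₀ C₀' : WithTop ℚ}

lemma isTransform_X (Ω : FormalField) : IsTransform (fun j => X j) Ω Ω := fun j => by
  rw [act_X, subst_X_eq]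

/-- For these weights the level `(0, n₂)` is the line through `h` and `n` inside `v₀ = 0`. -/
lemma NilConf.filtField_iff {n : Fin 3 → ℤ} :
    FiltField (lexWt (h 2 - n 2) 0 1) (toLex (0, (n 2 : ℝ))) Ω ↔
      ∀ v ∈ supp Ω, 0 ≤ v 0 ∧ (v 0 = 0 → n 2 ≤ (h 2 - n 2) * v 1 + v 2) := by
  rw [NewtonFol.filtField_iff]
  refine forall₂_congr fun v _ => ?_
  rw [zwt_lexWt, lex_le_iff, LexNonneg]
  have e : (n 2 : ℝ) ≤ v 1 * (h 2 - n 2) + v 2 ↔ n 2 ≤ (h 2 - n 2) * v 1 + v 2 := by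
    rw [mul_comm]; exact_mod_cast Iff.rfl
  rw [← e]
  constructor
  · rintro (h0 | ⟨h0, h1⟩)
    · have : 0 < v 0 := by simpa using h0
      exact ⟨this.le, fun h => absurd h this.ne'⟩
    · have h0' : v 0 = 0 := by simpa using h0
      refine ⟨h0'.ge, fun _ => ?_⟩
      rcases h1 with h1 | ⟨h1, -⟩ <;> linarith
  · rintro ⟨h0, h1⟩
    rcases h0.eq_or_lt with e0 | e0
    · right
      refine ⟨by simp [← e0], ?_⟩
      rcases (h1 e0.symm).eq_or_lt with e1 | e1
      · right; exact ⟨by linarith, le_rfl⟩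
      · left; linarith
    · left; simpa using e0

lemma NilConf.zwt_eq_iff {n v : Fin 3 → ℤ} :
    zwt (lexWt (h 2 - n 2) 0 1) v = toLex (0, (n 2 : ℝ)) ↔
      v 0 = 0 ∧ (h 2 - n 2) * v 1 + v 2 = n 2 := by
  rw [zwt_lexWt, lex_eq_iff]
  refine and_congr (by simp) ?_
  rw [mul_comm, mul_one]
  exact_mod_cast Iff.rfl

lemma NilConf.supp_inField {n : Fin 3 → ℤ} (hh : HigherVertex Ω h) (hn : NilConf i Ω h n)
    {v : Fin 3 → ℤ} :
    v ∈ supp (inField (lexWt (h 2 - n 2) 0 1) (toLex (0, (n 2 : ℝ))) Ω) ↔ v = h ∨ v = n := by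
  rw [mem_supp_inField, NilConf.zwt_eq_iff]
  constructor
  · rintro ⟨h1, h2, h3⟩
    exact hn.eq v h1 h2 h3
  · rintro (rfl | rfl)
    · exact ⟨hh.mem, hh.h0, by rw [hn.h1]; ring⟩
    · exact ⟨hn.n_mem, hn.n0, by rw [hn.n1]; ring⟩

/-- A nilpotent configuration is determined by the support of the lowest part for the edge weights,
so it passes to any field whose lowest part has the same support. -/
lemma NilConf.of_supp_inField {n : Fin 3 → ℤ} (hn : NilConf i Ω h n)
    (hf : FiltField (lexWt (h 2 - n 2) 0 1) (toLex (0, (n 2 : ℝ))) Ω')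
    (hs : ∀ v, v ∈ supp (inField (lexWt (h 2 - n 2) 0 1) (toLex (0, (n 2 : ℝ))) Ω') ↔
      v = h ∨ v = n) : NilConf i Ω' h n := by
  refine ⟨hn.i_eq, (mem_supp_inField.1 ((hs n).2 (Or.inr rfl))).1, hn.h1, hn.n0, hn.n1, hn.lt,
    fun v hv h0 => (NilConf.filtField_iff.1 hf v hv).2 h0, fun v hv h0 he => ?_⟩
  exact (hs v).1 (mem_supp_inField.2 ⟨hv, NilConf.zwt_eq_iff.2 ⟨h0, he⟩⟩)

lemma NilConf.unique {n n' : Fin 3 → ℤ} (hn : NilConf i Ω h n) (hn' : NilConf i Ω h n') :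
    n = n' := by
  have h1 := hn.edge n' hn'.n_mem hn'.n0
  have h2 := hn'.edge n hn.n_mem hn.n0
  rw [hn'.n1] at h1
  rw [hn.n1] at h2
  exact ext3 (hn.n0.trans hn'.n0.symm) (hn.n1.trans hn'.n1.symm) (by linarith)

lemma vec_smul_eq (t : Fin 3 → ℝ) {P E : Fin 3 → Series} (h0 : P 0 = C (t 0) * E 0)
    (h1 : P 1 = C (t 1) * E 1) (h2 : P 2 = C (t 2) * E 2) : ∀ j, P j = C (t j) * E j := by
  intro j; fin_cases j <;> assumption

lemma factor_tilt {w : ℝ} (hw : w ≠ 0) (c : ℝ) (F : Series) :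
    (C w * X 2 + C c * F : Series) = C w * (X 2 + C (c / w) * F) := by
  rw [mul_add, ← mul_assoc, ← map_mul, mul_div_cancel₀ _ hw]

/-- The change from `Ω'` back to `Ω` is compatible with the edge weights, and diagonal in lowest
order unless `h₂ = m₂ + 1` and `z` is tilted by `c y`. In that case, if the claim failed, `Ω'` would
be regular with `Δ' ≥ (0, 1)` lexicographically. For `Δ' = (0, 1)` the tilt is an allowed change and
contradicts stability; otherwise the lowest part of `Ω'` lives at `h` alone and `Rel.tilt_false`
applies. -/
lemma NilConf.of_rel (hR : Rel i Ψ U Ω Ω') (hS : StableFacts i Ω h m Δ C₀)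
    (hS' : StableFacts i Ω' h m' Δ' C₀') (hn : NilConf i Ω h m) : NilConf i Ω' h m := by
  have hh := hS.facts.hv
  have hh' := hS'.facts.hv
  have hs1 : (1 : ℝ) ≤ (h 2 : ℝ) - m 2 := by exact_mod_cast (by have := hn.lt; omega : 1 ≤ h 2 - m 2)
  have hs : (0 : ℝ) < (h 2 : ℝ) - m 2 := by linarith
  have hab : (0 : ℝ) < 0 ∨ ((0 : ℝ) = 0 ∧ (0 : ℝ) < 1) := Or.inr ⟨rfl, one_pos⟩
  have hw := lexWt_pos hs hab
  have hf : FiltField (lexWt (h 2 - m 2) 0 1) (toLex (0, (m 2 : ℝ))) Ω :=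
    NilConf.filtField_iff.2 fun v hv => ⟨hh.nonneg v hv, hn.edge v hv⟩
  have hf' := (hR.init hw (hR.fibered.compat_lexWt hs hab (dominates_zero_one hR.fibered hs1))
    hf).1
  obtain ⟨Θ, hΘ, h1, -⟩ := hR.fibered.isFormalCoordinates.exists_inverse
  obtain ⟨U', hR'⟩ := hR.symm hΘ h1
  have hd := dominates_zero_one hR'.fibered hs1
  have hcomp := hR'.fibered.compat_lexWt hs hab hd
  set t : Fin 3 → ℝ := fun j => coeff (Finsupp.single j 1) (Θ j) with ht
  have ht0 : ∀ j, t j ≠ 0 := hR'.fibered.diag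
  obtain ⟨c, hc, hce⟩ : ∃ c : ℝ, coeff (xyExp 0 1) (Θ 2) = c ∧
      (((0 : ℕ) : ℝ) = 0 ∧ ((1 : ℕ) : ℝ) * (h 2 - m 2) = 1 ∨ 1 < (h 2 : ℝ) - m 2) := by
    refine ⟨_, rfl, ?_⟩
    rcases hs1.eq_or_lt with e | e
    · left; exact ⟨by simp, by simp [← e]⟩
    · right; exact e
  by_cases hcz : (h 2 : ℝ) - m 2 = 1 ∧ c ≠ 0
  · obtain ⟨hs', hcz⟩ := hcz
    have h2m : h 2 = m 2 + 1 := by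
      have : (h 2 : ℝ) = m 2 + 1 := by linarith
      exact_mod_cast this
    obtain ⟨i0, i1, i2⟩ := inMap_lexWt (h := hR'.fibered) hs hab hc (e₁ := 0) (e₂ := 1)
      (a := 0) (b := 1) (Or.inl ⟨by simp, by simp [hs']⟩)
    by_contra hno
    have hedge := NilConf.filtField_iff.1 hf'
    -- A nilpotent configuration of `Ω'` satisfies `m₂ ≤ m'₂ < h₂ = m₂ + 1`, so its main vertex
    -- would again be `m`.
    have hreg : m' = h ∧ ∀ n, ¬ NilConf i Ω' h n := by
      rcases hS'.facts.conf with hN | hN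
      · exfalso
        have a := (hedge m' hN.n_mem).2 hN.n0
        have b := hN.lt
        rw [hN.n1] at a
        have e : m = m' := ext3 (hn.n0.trans hN.n0.symm) (hn.n1.trans hN.n1.symm) (by omega)
        rw [e] at hno
        exact hno hN
      · exact hN
    obtain ⟨rfl, hreg⟩ := hreg
    obtain ⟨p, hp, hp2, hpx, hpy⟩ := hS'.facts.vert.low
    have hp2' : (p 2 : ℝ) + 1 ≤ m' 2 := by exact_mod_cast hp2
    simp only [disp, intVec_apply, hh'.h0, hn.h1] at hpx hpy
    push_cast at hpx hpy
    have hpos := hS'.facts.vert.pos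
    have hge : 0 < (Δ'.1 : ℝ) ∨ ((Δ'.1 : ℝ) = 0 ∧ 1 ≤ (Δ'.2 : ℝ)) := by
      rcases hpos with h | ⟨h, -⟩
      · exact Or.inl h
      · refine Or.inr ⟨h, ?_⟩
        have p0 : p 0 = 0 := by
          rw [h] at hpx
          have : (p 0 : ℝ) = 0 := by linarith
          exact_mod_cast this
        have := (hedge p hp).2 p0
        rw [h2m] at this
        have h3 : (m 2 : ℝ) ≤ p 1 + p 2 := by
          have : m 2 ≤ p 1 + p 2 := by linarith
          exact_mod_cast this
        by_contra hlt
        nlinarith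
    by_cases heq : Δ' = (0, 1)
    · obtain ⟨Ω'', hT, hC''⟩ := hS'.exists_monomial (e₁ := 0) (e₂ := 1) (c := c / t 2)
        (Or.inr one_ne_zero) (Or.inr (by simp [heq]))
      obtain ⟨g1, g2⟩ := hR'.coeff_eq_zero_iff hw hcomp hf' ht0
        (vec_smul_eq t (by simpa using i0) (by simpa using i1)
          (by simpa using i2.trans (factor_tilt (ht0 2) c _))) hT
      have := hn.of_supp_inField (Ω' := Ω'') g1
        (fun v => by rw [supp_eq_of_coeff g2, hn.supp_inField hh])
      rcases hC''.conf with hN | ⟨-, hN⟩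
      · exact lt_irrefl _ hN.lt
      · exact hN _ this
    · have hI := (hR'.init hw hcomp hf').2
      have hsY : ∀ v ∈ supp (inField (lexWt (m' 2 - m 2) 0 1) (toLex (0, (m 2 : ℝ))) Ω'),
          v = m' := by
        intro v hv
        obtain ⟨hv, hvw⟩ := mem_supp_inField.1 hv
        obtain ⟨v0, v1⟩ := NilConf.zwt_eq_iff.1 hvw
        have hL := hS'.facts.vert.nonneg _ (intVec_mem hv)
        simp only [disp, intVec_apply, hh'.h0, hn.h1, v0] at hL
        push_cast at hL
        have v1' : (v 1 : ℝ) = m 2 - v 2 := by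
          rw [h2m] at v1
          have : v 1 = m 2 - v 2 := by linarith
          exact_mod_cast this
        have h2m' : (m' 2 : ℝ) = m 2 + 1 := by exact_mod_cast h2m
        have hle : m' 2 ≤ v 2 := by
          by_contra hlt
          have hlt : (v 2 : ℝ) + 1 ≤ m' 2 := by exact_mod_cast not_le.1 hlt
          rcases hge with h | ⟨h, h'⟩
          · rcases hL with h3 | ⟨h3, -⟩ <;> nlinarith
          · rcases h'.eq_or_lt with e | e
            · apply heq
              refine Prod.ext ?_ ?_
              · exact_mod_cast h
              · exact_mod_cast e.symm
            · rcases hL with h3 | ⟨h3, h3 | ⟨h3, -⟩⟩ <;> nlinarith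
        have h1 : -1 ≤ v 1 := neg_one_le_of_mem_supp hv 1
        rw [h2m] at v1
        refine ext3 (v0.trans hh'.h0.symm) ?_ ?_
        · rw [hn.h1]; linarith
        · linarith
      refine hI.tilt_false (m := m') (mem_supp_inField.2 ⟨hh'.mem, ?_⟩) hsY ?_ (Or.inr one_ne_zero)
        i0 i1 i2 (ht0 0) (ht0 1) (ht0 2) hcz
      · exact NilConf.zwt_eq_iff.2 ⟨hh'.h0, by rw [hn.h1]; ring⟩
      · intro v hv
        have := hS.facts.one_le hS.good
        rcases (hn.supp_inField hh).1 hv with rfl | rfl <;> omega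
  · obtain ⟨i0, i1, i2⟩ : inMap (lexWt (h 2 - m 2) 0 1) Θ 0 = C (t 0) * X 0 ∧
        inMap (lexWt (h 2 - m 2) 0 1) Θ 1 = C (t 1) * X 1 ∧
        inMap (lexWt (h 2 - m 2) 0 1) Θ 2 = C (t 2) * X 2 := by
      rcases hce with h | h
      · have hc0 : c = 0 := by
          by_contra hne
          exact hcz ⟨by simpa using h.2, hne⟩
        have := inMap_lexWt (h := hR'.fibered) hs hab hc (Or.inl h)
        simpa [hc0] using this
      · have := inMap_lexWt (h := hR'.fibered) hs hab (e₁ := 0) (e₂ := 0) (c := 0) (a := 0)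
          (b := 1) ?_ (Or.inr ⟨rfl, ?_⟩)
        · simpa using this
        · rw [show xyExp 0 0 = 0 by simp [xyExp], coeff_zero_eq_constantCoeff_apply,
            hR'.fibered.const]
        · rintro n - - ⟨-, h2⟩
          rcases Nat.eq_zero_or_pos (n 1) with e | e
          · simp [e] at h2
          · have : (1 : ℝ) ≤ n 1 := by exact_mod_cast e
            nlinarith
    obtain ⟨g1, g2⟩ := hR'.coeff_eq_zero_iff hw hcomp hf' ht0 (vec_smul_eq t i0 i1 i2)
      (isTransform_X Ω')
    exact hn.of_supp_inField g1 fun v => by rw [supp_eq_of_coeff g2, hn.supp_inField hh]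

lemma mainVertex_eq_of_rel (hR : Rel i Ψ U Ω Ω') (hS : StableFacts i Ω h m Δ C₀)
    (hS' : StableFacts i Ω' h m' Δ' C₀') : m = m' := by
  obtain ⟨Θ, hΘ, h1, -⟩ := hR.fibered.isFormalCoordinates.exists_inverse
  obtain ⟨U', hR'⟩ := hR.symm hΘ h1
  rcases hS.facts.conf with hn | ⟨e, hn⟩
  · have := hn.of_rel hR hS hS'
    rcases hS'.facts.conf with hn' | ⟨-, hn'⟩
    · exact this.unique hn'
    · exact absurd this (hn' _)
  · rcases hS'.facts.conf with hn' | ⟨e', -⟩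
    · exact absurd (hn'.of_rel hR' hS' hS) (hn _)
    · rw [e, e']

end MainVertexInvariance

/-! ### Invariance of the vertical displacement -/

section VerticalInvariance

variable {i : ℕ} {Ω Ω' : FormalField} {Ψ : Fin 3 → Series} {U : Series}
  {h m : Fin 3 → ℤ} {Δ Δ' : ℚ × ℚ} {C₀ C₀' : WithTop ℚ}

/-- The strict lexicographic ordering of displacements. -/
def LexLt (a b a' b' : ℝ) : Prop := a < a' ∨ (a = a' ∧ b < b')

lemma lexNonneg_iff_not_lexLt {a b a' b' : ℝ} :
    LexNonneg (a' - a) (b' - b) 0 ↔ ¬ LexLt a' b' a b := by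
  rw [LexNonneg, LexLt, not_or, not_and]
  constructor
  · rintro (h | ⟨h, h'⟩)
    · exact ⟨by linarith, fun e => by linarith⟩
    · exact ⟨by linarith, fun e => by rcases h' with h' | ⟨h', -⟩ <;> linarith⟩
  · rintro ⟨h1, h2⟩
    rcases (not_lt.1 h1).lt_or_eq with e | e
    · left; linarith
    · right
      refine ⟨by linarith, ?_⟩
      rcases (not_lt.1 (h2 e.symm)).lt_or_eq with e' | e'
      · left; linarith
      · right; exact ⟨by linarith, le_rfl⟩

/-- The face of the support cut out by a displacement smaller than the vertical one. -/
lemma ClassFacts.tilted (hc : ClassFacts i Ω h m Δ C₀) {a b : ℕ} (hab : a ≠ 0 ∨ b ≠ 0)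
    (hlt : LexLt a b Δ.1 Δ.2) {v : Fin 3 → ℤ} (hv : v ∈ supp Ω) :
    LexNonneg (disp a (intVec m) (intVec v) 0) (disp b (intVec m) (intVec v) 1) 0 ∧
      (disp a (intVec m) (intVec v) 0 = 0 → disp b (intVec m) (intVec v) 1 = 0 →
        v = m ∨ (NilConf i Ω h m ∧ h 2 = m 2 + 1 ∧ a = 0 ∧ b = 1 ∧ v = h)) := by
  have hL := hc.vert.nonneg _ (intVec_mem hv)
  have hh := hc.hv
  have hm0 := hc.m0
  have hv0 := hh.nonneg v hv
  simp only [disp, intVec_apply, hm0] at hL ⊢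
  push_cast at hL ⊢
  have a0 : (0 : ℝ) ≤ a := Nat.cast_nonneg a
  have b0 : (0 : ℝ) ≤ b := Nat.cast_nonneg b
  have v0 : (0 : ℝ) ≤ v 0 := by exact_mod_cast hv0
  -- Below `m` the bound by `Δ` turns strict for the smaller `(a, b)`. At the height of `m` equality
  -- means `v = m`. Above `m` the only possible tie is `h`, in a nilpotent configuration with `h₂ =
  -- m₂ + 1`.
  rcases lt_trichotomy (v 2) (m 2) with hD | hD | hD
  · have hD' : (v 2 : ℝ) < m 2 := by exact_mod_cast hD
    have key : LexLt 0 0 ((v 0 : ℝ) - 0 + a * (v 2 - m 2)) (v 1 - m 1 + b * (v 2 - m 2)) := by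
      rcases hlt with h1 | ⟨h1, h2⟩
      · left
        rcases hL with h3 | ⟨h3, -⟩ <;> nlinarith
      · rcases hL with h3 | ⟨h3, h3 | ⟨h3, -⟩⟩
        · left; rw [h1]; linarith
        · right; rw [h1]; exact ⟨by linarith, by nlinarith⟩
        · right; rw [h1]; exact ⟨by linarith, by nlinarith⟩
    constructor
    · rcases key with h | ⟨h, h'⟩
      · left; exact h
      · right; exact ⟨h.symm, Or.inl h'⟩
    · intro h1 h2
      rcases key with h | ⟨h, h'⟩ <;> linarith
  · rw [hD]
    simp only [sub_self, mul_zero, add_zero, sub_zero]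
    have hv1 : v 0 = 0 → m 1 ≤ v 1 := by
      intro e
      rcases hc.conf with hn | ⟨rfl, -⟩
      · have := hn.edge v hv e
        rw [hD] at this
        rw [hn.n1]
        have h3 := hn.lt
        by_contra hlt
        nlinarith [not_le.1 hlt]
      · exact hh.le1 v hv e
    constructor
    · rcases hv0.eq_or_lt with e | e
      · have : (m 1 : ℝ) ≤ v 1 := by exact_mod_cast hv1 e.symm
        exact lexNonneg_of_nonneg v0 (by linarith) le_rfl
      · left; exact_mod_cast e
    · intro h1 h2
      left
      refine ext3 ?_ ?_ hD
      · rw [hm0]; exact_mod_cast h1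
      · have : (v 1 : ℝ) = m 1 := by linarith
        exact_mod_cast this
  · have hD' : (m 2 : ℝ) + 1 ≤ v 2 := by exact_mod_cast hD
    have e0 : 0 ≤ (v 0 : ℝ) - 0 + a * (v 2 - m 2) := by nlinarith
    rcases e0.eq_or_lt with e0 | e0
    · have v00 : (v 0 : ℝ) = 0 := by nlinarith
      have ha : (a : ℝ) = 0 := by nlinarith
      have ha' : a = 0 := by exact_mod_cast ha
      have v00' : v 0 = 0 := by exact_mod_cast v00
      have hb : 1 ≤ b := by omega
      have hb' : (1 : ℝ) ≤ b := by exact_mod_cast hb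
      rcases hc.conf with hn | ⟨rfl, -⟩
      · have hedge := hn.edge v hv v00'
        have hs : 1 ≤ h 2 - m 2 := by have := hn.lt; omega
        have h1 : -(v 2 - m 2) ≤ v 1 := by nlinarith
        have h1' : -((v 2 : ℝ) - m 2) ≤ v 1 := by exact_mod_cast h1
        rw [hn.n1]
        push_cast
        constructor
        · exact lexNonneg_of_nonneg e0.le (by nlinarith) le_rfl
        · intro _ h2
          right
          have hb1 : b = 1 := by
            by_contra hne
            have : (2 : ℝ) ≤ b := by exact_mod_cast (by omega : 2 ≤ b)
            nlinarith
          have hv1 : v 1 = -(v 2 - m 2) := by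
            rw [hb1] at h2
            have : (v 1 : ℝ) = -(v 2 - m 2) := by push_cast at h2; linarith
            exact_mod_cast this
          have hs1 : h 2 - m 2 = 1 := by
            rw [hv1] at hedge
            nlinarith
          refine ⟨hn, by omega, ha', hb1, ?_⟩
          rcases hn.eq v hv v00' (by rw [hs1, hv1]; ring) with h | h
          · exact h
          · rw [h] at hD; omega
      · have hv1 : (v 1 : ℝ) ≥ m 1 := by exact_mod_cast hh.le1 v hv v00'
        constructor
        · exact lexNonneg_of_nonneg e0.le (by nlinarith) le_rfl
        · intro _ h2; nlinarith
    · exact ⟨Or.inl e0, fun h => by linarith⟩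

lemma zwt_lexWt_le_iff {a b : ℝ} {v : Fin 3 → ℤ} :
    zwt (lexWt 1 a b) m ≤ zwt (lexWt 1 a b) v ↔
      LexNonneg (disp a (intVec m) (intVec v) 0) (disp b (intVec m) (intVec v) 1) 0 := by
  rw [zwt_lexWt, zwt_lexWt, lex_le_iff]
  simp only [disp, intVec_apply]
  ring_nf

lemma zwt_lexWt_eq_iff {a b : ℝ} {v : Fin 3 → ℤ} :
    zwt (lexWt 1 a b) v = zwt (lexWt 1 a b) m ↔
      disp a (intVec m) (intVec v) 0 = 0 ∧ disp b (intVec m) (intVec v) 1 = 0 := by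
  rw [zwt_lexWt, zwt_lexWt, lex_eq_iff]
  simp only [disp, intVec_apply]
  constructor
  · rintro ⟨h1, h2⟩
    exact ⟨by linarith, by linarith⟩
  · rintro ⟨h1, h2⟩
    exact ⟨by linarith, by linarith⟩

/-- The part of a series independent of `z`. -/
lemma exists_least_pure {F : Series} (h : ∃ n, coeff n F ≠ 0 ∧ n 2 = 0) :
    ∃ e : Fin 3 →₀ ℕ, coeff e F ≠ 0 ∧ e 2 = 0 ∧ ∀ n, coeff n F ≠ 0 → n 2 = 0 →
      LexNonneg ((n 0 : ℝ) - e 0) ((n 1 : ℝ) - e 1) 0 := by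
  set w : Fin 3 → ℤ := ![0, 0, 1]
  have hw : ∀ n, wt w n = 0 ↔ n 2 = 0 := fun n => by simp [wt_eq, w]
  have hne : inPart w 0 F ≠ 0 := by
    obtain ⟨n, hn, h2⟩ := h
    intro h0
    apply hn
    rw [← coeff_inPart_of_eq ((hw n).2 h2), h0, map_zero]
  obtain ⟨e, he, hmin⟩ := exists_min_wt (w := lexWt 1 0 1)
    (fun k => (lexWt_pos one_pos (Or.inr ⟨rfl, one_pos⟩) k).le) hne
  obtain ⟨he2, he⟩ := coeff_inPart_ne_zero.1 he
  rw [hw] at he2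
  refine ⟨e, he, he2, fun n hn h2 => ?_⟩
  have := hmin n (coeff_inPart_ne_zero.2 ⟨(hw n).2 h2, hn⟩)
  rw [wt_lexWt, wt_lexWt, lex_le_iff, he2, h2] at this
  simpa using this

/-- Otherwise the least `z`-free exponent `e` of `Ψ 2` lies below both displacements. In the weights
given by `e` both lowest parts are supported at `m`, or in `{h, m}`, while `Ψ` tilts `z`;
`Rel.tilt_false` and `Rel.tilt_false'` exclude this. -/
lemma dominates_of_le (hR : Rel i Ψ U Ω Ω') (hg : Good i Ω) (hc : ClassFacts i Ω h m Δ C₀)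
    (hc' : ClassFacts i Ω' h m Δ' C₀') (hle : ¬ LexLt (Δ'.1 : ℝ) Δ'.2 Δ.1 Δ.2) :
    Dominates 1 Δ.1 Δ.2 Ψ := by
  by_contra hno
  simp only [Dominates] at hno
  push Not at hno
  obtain ⟨k, hk, hk2, hkL⟩ := hno
  obtain ⟨e, he, he2, hmin⟩ := exists_least_pure ⟨k, hk, hk2⟩
  rw [mul_one, lexNonneg_iff_not_lexLt, not_not] at hkL
  have hek := hmin k hk hk2
  rw [lexNonneg_iff_not_lexLt] at hek
  have hlt : LexLt (e 0) (e 1) Δ.1 Δ.2 := by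
    simp only [LexLt, not_or, not_and, not_lt] at hek hkL ⊢
    obtain ⟨h1, h2⟩ := hek
    rcases hkL with h3 | ⟨h3, h4⟩
    · left; linarith
    · rcases h1.eq_or_lt with h5 | h5
      · right; exact ⟨by linarith, by have := h2 h5.symm; linarith⟩
      · left; linarith
  have hlt' : LexLt (e 0) (e 1) Δ'.1 Δ'.2 := by
    simp only [LexLt, not_or, not_and, not_lt] at hle hlt ⊢
    obtain ⟨h1, h2⟩ := hle
    rcases hlt with h3 | ⟨h3, h4⟩
    · left; linarith
    · rcases h1.eq_or_lt with h5 | h5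
      · right; exact ⟨by linarith, by have := h2 h5.symm; linarith⟩
      · left; linarith
  have hne : e 0 ≠ 0 ∨ e 1 ≠ 0 := by
    have := hR.fibered.ne_zero he
    omega
  have hab : 0 < (e 0 : ℝ) ∨ ((e 0 : ℝ) = 0 ∧ 0 < (e 1 : ℝ)) := by
    rcases Nat.eq_zero_or_pos (e 0) with h | h
    · right
      exact ⟨by simp [h], by exact_mod_cast (by omega : 0 < e 1)⟩
    · left; exact_mod_cast h
  have hex : xyExp (e 0) (e 1) = e := finsupp_ext3 (by simp) (by simp) (by simp [he2])
  have hw := lexWt_pos (one_pos : (0 : ℝ) < 1) hab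
  have hd : Dominates 1 (e 0) (e 1) Ψ := fun n hn h2 => by simpa using hmin n hn h2
  have hf : FiltField (lexWt 1 (e 0) (e 1)) (zwt (lexWt 1 (e 0) (e 1)) m) Ω :=
    filtField_iff.2 fun v hv => zwt_lexWt_le_iff.2 (hc.tilted hne hlt hv).1
  have hI := (hR.init hw (hR.fibered.compat_lexWt one_pos hab hd) hf).2
  obtain ⟨i0, i1, i2⟩ := inMap_lexWt (h := hR.fibered) one_pos hab (c := coeff e (Ψ 2))
    (e₁ := e 0) (e₂ := e 1) (by rw [hex]) (Or.inl ⟨rfl, by simp⟩)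
  have hdg := hR.fibered.diag
  have hs : ∀ v ∈ supp (inField (lexWt 1 (e 0) (e 1)) (zwt (lexWt 1 (e 0) (e 1)) m) Ω),
      v = m ∨ (NilConf i Ω h m ∧ h 2 = m 2 + 1 ∧ e 0 = 0 ∧ e 1 = 1 ∧ v = h) := by
    intro v hv
    obtain ⟨hv, hvw⟩ := mem_supp_inField.1 hv
    obtain ⟨z0, z1⟩ := zwt_lexWt_eq_iff.1 hvw
    exact (hc.tilted hne hlt hv).2 z0 z1
  have hs' : ∀ v ∈ supp (inField (lexWt 1 (e 0) (e 1)) (zwt (lexWt 1 (e 0) (e 1)) m) Ω'),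
      v = m ∨ (NilConf i Ω' h m ∧ h 2 = m 2 + 1 ∧ e 0 = 0 ∧ e 1 = 1 ∧ v = h) := by
    intro v hv
    obtain ⟨hv, hvw⟩ := mem_supp_inField.1 hv
    obtain ⟨z0, z1⟩ := zwt_lexWt_eq_iff.1 hvw
    exact (hc'.tilted hne hlt' hv).2 z0 z1
  have hm2 := hc.one_le hg
  have hmm : m ∈ supp (inField (lexWt 1 (e 0) (e 1)) (zwt (lexWt 1 (e 0) (e 1)) m) Ω) :=
    mem_supp_inField.2 ⟨hc.m_mem, rfl⟩
  by_cases hn : NilConf i Ω h m ∧ h 2 = m 2 + 1 ∧ e 0 = 0 ∧ e 1 = 1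
  · obtain ⟨hn, h2, e0, e1⟩ := hn
    refine hI.tilt_false' hc.hv.h0 hn.h1 h2 hn.n0 hn.n1 hm2
      (mem_supp_inField.2 ⟨hc.hv.mem, zwt_lexWt_eq_iff.2 ?_⟩) (fun v hv => ?_) (fun v hv => ?_)
      i0 i1 (by rw [i2, e0, e1]) (hdg 0) (hdg 1) (hdg 2) he
    · simp only [disp, intVec_apply, hc.hv.h0, hn.h1, hn.n0, hn.n1, h2, e0, e1]
      norm_num
    · rcases hs v hv with h | h
      · exact Or.inr h
      · exact Or.inl h.2.2.2.2
    · rcases hs' v hv with h | h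
      · exact Or.inr h
      · exact Or.inl h.2.2.2.2
  · refine hI.tilt_false hmm (fun v hv => ?_) (fun v hv => ?_) hne i0 i1 i2
      (hdg 0) (hdg 1) (hdg 2) he
    · rcases hs v hv with h | h
      · exact h
      · exact absurd ⟨h.1, h.2.1, h.2.2.1, h.2.2.2.1⟩ hn
    · rcases hs' v hv with h | h
      · rw [h]; exact hm2
      · rw [h.2.2.2.2]; omega

lemma VertFacts.pos' {r : ℝ} (hr : 0 ≤ r) (hv : VertFacts Ω m Δ r) :
    0 < (Δ.1 : ℝ) ∨ ((Δ.1 : ℝ) = 0 ∧ 0 < (Δ.2 : ℝ)) := by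
  rcases hv.pos with h | ⟨h, h'⟩
  · exact Or.inl h
  · exact Or.inr ⟨h, by linarith⟩

/-- The initial part of a fibered change for the weights given by the vertical displacement. -/
lemma exists_inMap_disp (hΨ : Fibered i Ψ) (hΔ : 0 < (Δ.1 : ℝ) ∨ ((Δ.1 : ℝ) = 0 ∧ 0 < (Δ.2 : ℝ))) :
    ∃ e₁ e₂ : ℕ, ∃ c : ℝ, (e₁ ≠ 0 ∨ e₂ ≠ 0) ∧ (c = 0 ∨ ((e₁ : ℚ), (e₂ : ℚ)) = Δ) ∧
      inMap (lexWt 1 Δ.1 Δ.2) Ψ 0 = C (coeff (Finsupp.single 0 1) (Ψ 0)) * X 0 ∧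
      inMap (lexWt 1 Δ.1 Δ.2) Ψ 1 = C (coeff (Finsupp.single 1 1) (Ψ 1)) * X 1 ∧
      inMap (lexWt 1 Δ.1 Δ.2) Ψ 2 = C (coeff (Finsupp.single 2 1) (Ψ 2)) * X 2 +
        C c * (X 0 ^ e₁ * X 1 ^ e₂) := by
  by_cases hex : ∃ e₁ e₂ : ℕ, ((e₁ : ℚ), (e₂ : ℚ)) = Δ
  · obtain ⟨e₁, e₂, he⟩ := hex
    refine ⟨e₁, e₂, coeff (xyExp e₁ e₂) (Ψ 2), ?_, Or.inr he, ?_⟩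
    · by_contra hc
      push Not at hc
      rw [← he, hc.1, hc.2] at hΔ
      simp at hΔ
    · exact inMap_lexWt (h := hΨ) one_pos hΔ rfl (Or.inl ⟨by rw [← he]; simp, by rw [← he]; simp⟩)
  -- If `Δ` is not an exponent, nothing tilts `z`; `(1, 0)` is a dummy exponent with coefficient
  -- zero.
  · refine ⟨1, 0, 0, by simp, Or.inl rfl, ?_⟩
    have := inMap_lexWt (h := hΨ) (one_pos : (0 : ℝ) < 1) hΔ (e₁ := 0) (e₂ := 0) (c := 0)
      (by rw [show xyExp 0 0 = 0 by simp [xyExp], coeff_zero_eq_constantCoeff_apply, hΨ.const])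
      (Or.inr ⟨rfl, fun n _ _ hn => hex ⟨n 0, n 1, ?_⟩⟩)
    · simpa using this
    · refine Prod.ext ?_ ?_
      · exact_mod_cast hn.1
      · have := hn.2
        rw [mul_one] at this
        exact_mod_cast this

/-- In the weights given by `Δ`, the lowest part of `Ψ` is a tilt by the monomial of exponent `Δ`,
up to a diagonal map. By stability the image under this tilt still has a point below `m` on the edge
of direction `Δ`. The same point lies in the support of `Ω'`, which a larger `Δ'` forbids. -/
lemma not_lexLt_of_rel (hR : Rel i Ψ U Ω Ω') (hS : StableFacts i Ω h m Δ C₀)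
    (hc' : ClassFacts i Ω' h m Δ' C₀') : ¬ LexLt (Δ.1 : ℝ) Δ.2 Δ'.1 Δ'.2 := by
  intro hlt
  have hc := hS.facts
  have hle : ¬ LexLt (Δ'.1 : ℝ) Δ'.2 Δ.1 Δ.2 := by
    rintro (h | ⟨h, h'⟩) <;> rcases hlt with h3 | ⟨h3, h4⟩ <;> linarith
  have hΔ := hc.vert.pos' le_rfl
  have hd := dominates_of_le hR hS.good hc hc' hle
  have hw := lexWt_pos (one_pos : (0 : ℝ) < 1) hΔ
  have hf : FiltField (lexWt 1 Δ.1 Δ.2) (zwt (lexWt 1 (Δ.1 : ℝ) Δ.2) m) Ω :=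
    filtField_iff.2 fun v hv => zwt_lexWt_le_iff.2 (hc.vert.nonneg _ (intVec_mem hv))
  have hdg := hR.fibered.diag
  obtain ⟨e₁, e₂, c, he, hce, i0, i1, i2⟩ := exists_inMap_disp (Δ := Δ) hR.fibered hΔ
  obtain ⟨Ω'', hT, hC''⟩ := hS.exists_monomial he
    (c := c / coeff (Finsupp.single 2 1) (Ψ 2)) (hce.imp (fun h => by rw [h, zero_div]) id)
  obtain ⟨-, g2⟩ := hR.coeff_eq_zero_iff hw (hR.fibered.compat_lexWt one_pos hΔ hd) hf hdg
    (vec_smul_eq (fun j => coeff (Finsupp.single j 1) (Ψ j)) (by simpa using i0) (by simpa using i1)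
      (by simpa using i2.trans (factor_tilt (hdg 2) c _))) hT
  obtain ⟨p, hp, hp2, hpx, hpy⟩ := hC''.vert.low
  have hp' : p ∈ supp (inField (lexWt 1 (Δ.1 : ℝ) Δ.2) (zwt (lexWt 1 (Δ.1 : ℝ) Δ.2) m) Ω') := by
    rw [← supp_eq_of_coeff g2]
    exact mem_supp_inField.2 ⟨hp, zwt_lexWt_eq_iff.2 ⟨hpx, hpy⟩⟩
  have hL := hc'.vert.nonneg _ (intVec_mem (mem_supp_inField.1 hp').1)
  have hp2' : (p 2 : ℝ) < m 2 := by exact_mod_cast hp2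
  simp only [disp, intVec_apply] at hpx hpy hL
  rcases hlt with h1 | ⟨h1, h2⟩
  · rcases hL with h3 | ⟨h3, -⟩ <;> nlinarith
  · rw [← h1] at hL
    rcases hL with h3 | ⟨h3, h3 | ⟨h3, -⟩⟩ <;> nlinarith

lemma displacement_eq_of_rel (hR : Rel i Ψ U Ω Ω') (hS : StableFacts i Ω h m Δ C₀)
    (hS' : StableFacts i Ω' h m Δ' C₀') : Δ = Δ' := by
  obtain ⟨Θ, hΘ, h1, -⟩ := hR.fibered.isFormalCoordinates.exists_inverse
  obtain ⟨U', hR'⟩ := hR.symm hΘ h1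
  have h1 := not_lexLt_of_rel hR hS hS'.facts
  have h2 := not_lexLt_of_rel hR' hS' hS.facts
  simp only [LexLt, not_or, not_lt, not_and] at h1 h2
  have e := le_antisymm h2.1 h1.1
  refine Prod.ext ?_ ?_
  · exact_mod_cast e
  · exact_mod_cast le_antisymm (h2.2 e.symm) (h1.2 e)

end VerticalInvariance

/-! ### Commuting vector fields -/

section Commuting

lemma pderiv_comm (j k : Fin 3) (F : Series) :
    pderiv ℝ j (pderiv ℝ k F) = pderiv ℝ k (pderiv ℝ j F) := by
  ext n
  simp only [coeff_pderiv]
  rw [add_right_comm]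
  by_cases h : j = k
  · subst h; rfl
  · have h1 : (Finsupp.single j 1 : Fin 3 →₀ ℕ) k = 0 := Finsupp.single_eq_of_ne (Ne.symm h)
    have h2 : (Finsupp.single k 1 : Fin 3 →₀ ℕ) j = 0 := Finsupp.single_eq_of_ne h
    simp only [Finsupp.add_apply, h1, h2, add_zero]
    ring

lemma act_act (A B : FormalField) (F : Series) :
    A.act (B.act F) - B.act (A.act F) =
      FormalField.act (fun k => A.act (B k) - B.act (A k)) F := by
  simp only [act_eq, map_add, Derivation.leibniz, smul_eq_mul]
  rw [pderiv_comm 1 0 F, pderiv_comm 2 0 F, pderiv_comm 2 1 F]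
  ring

/-- Commuting vector fields. -/
def Commutes (A B : FormalField) : Prop := ∀ j, A.act (B j) = B.act (A j)

lemma Commutes.act_act {A B : FormalField} (h : Commutes A B) (F : Series) :
    A.act (B.act F) = B.act (A.act F) := by
  rw [← sub_eq_zero, NewtonFol.act_act, act_eq, h 0, h 1, h 2]
  simp

/-- A vector field invariant under the rescalings of `x`. -/
def XHom (Y : FormalField) : Prop :=
  ∀ j, X 0 * pderiv ℝ 0 (Y j) = if j = 0 then Y j else 0

lemma xHom_of_supp {Y : FormalField} (h : ∀ v ∈ supp Y, v 0 = 0) : XHom Y := by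
  intro j
  ext n
  rw [coeff_X_mul_pderiv]
  by_cases hn : coeff n (Y j) = 0
  · split_ifs <;> simp [hn]
  · have := h _ (logExp_mem_supp hn)
    simp only [logExp] at this
    by_cases hj : j = 0
    · subst hj
      simp at this
      have h1 : n 0 = 1 := by omega
      simp [h1]
    · have hj' : ¬ (0 : Fin 3) = j := fun e => hj e.symm
      simp [hj'] at this
      simp [hj, this]

variable {i : ℕ} {P : Fin 3 → Series} {Y Y' : FormalField} {c₀ u v w : ℝ} {b c : Series}

lemma act_cons (a b c F : Series) : FormalField.act ![a, b, c] F =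
    a * pderiv ℝ 0 F + b * pderiv ℝ 1 F + c * pderiv ℝ 2 F := by
  rw [act_eq]; rfl

lemma pderiv_C_mul_X (k : Fin 3) (u : ℝ) :
    pderiv ℝ k (C u * X k : Series) = C u := by
  simp [Derivation.leibniz]

/-- `Y'` commutes with `x ∂/∂x`, so `Y` commutes with its pullback `E` by `P`, determined by `E(P 0)
= P 0` and `E(P 1) = E(P 2) = 0`. Solving gives `E = x ∂/∂x + b ∂/∂y + c ∂/∂z`; subtracting `x
∂/∂x`, which commutes with `Y` as well, leaves the asserted field. -/
lemma commutes_of_rel (hR : Rel i P (C c₀) Y Y') (hY : XHom Y) (hY' : XHom Y')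
    (h0 : P 0 = C u * X 0) (h1 : pderiv ℝ 1 (P 1) = C v) (h2 : pderiv ℝ 2 (P 2) = C w)
    (hu : u ≠ 0) (hv : v ≠ 0) (hw : w ≠ 0) (hb : C v * b = -(X 0 * pderiv ℝ 0 (P 1)))
    (hc : C w * c = -(X 0 * pderiv ℝ 0 (P 2) + b * pderiv ℝ 1 (P 2))) :
    Commutes Y ![0, b, c] := by
  have hCC : ∀ {r : ℝ}, r ≠ 0 → (C r : Series) ≠ 0 := fun hr h => hr (by
    simpa using congr_arg constantCoeff h)
  have hc0 : c₀ ≠ 0 := by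
    have := isUnit_iff_constantCoeff_ne_zero.1 hR.unit
    simpa using this
  set E : FormalField := ![X 0, b, c] with hE
  have d01 : pderiv ℝ 1 (P 0) = 0 := by rw [h0]; simp [Derivation.leibniz, pderiv_X]
  have d00 : pderiv ℝ 0 (P 0) = C u := by rw [h0, pderiv_C_mul_X]
  have e0 : E.act (P 0) = P 0 := by
    rw [hE, act_cons, d00, d01, hR.fibered.z0, h0]; ring
  have e1 : E.act (P 1) = 0 := by
    rw [hE, act_cons, h1, hR.fibered.z1, mul_comm b, hb]; ring
  have e2 : E.act (P 2) = 0 := by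
    rw [hE, act_cons, h2, mul_comm c, hc]; ring
  have hcomm : ∀ j, E.act (Y.act (P j)) = Y.act (E.act (P j)) := by
    intro j
    have hj := congr_arg E.act (hR.eq j)
    rw [act_mul, act_C, mul_zero, add_zero, act_subst _ hR.fibered.const, Fin.sum_univ_three,
      e0, e1, e2, mul_zero, mul_zero, add_zero, add_zero] at hj
    have hP := hasSubst hR.fibered.const
    have h3 : (pderiv ℝ 0 (Y' j)).subst P * P 0 = (X 0 * pderiv ℝ 0 (Y' j)).subst P := by
      rw [subst_mul hP, subst_X hP, mul_comm]
    rw [h3, hY' j] at hj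
    apply mul_left_cancel₀ (hCC hc0)
    rw [hj]
    fin_cases j
    · simp only [Fin.zero_eta, if_true, ← hR.eq, e0]
    · simp [e1, subst_zero' hR.fibered.const]
    · simp [e2, subst_zero' hR.fibered.const]
  -- The bracket annihilates the three coordinates `P j`; by their triangular form it is zero.
  set Z : FormalField := fun k => E.act (Y k) - Y.act (E k) with hZ
  have hZP : ∀ j, Z.act (P j) = 0 := fun j => by rw [← act_act, hcomm j, sub_self]
  have z0 : Z 0 = 0 := by
    have := hZP 0
    rw [act_eq, d00, d01, hR.fibered.z0, mul_zero, mul_zero, add_zero, add_zero] at this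
    exact (mul_eq_zero.1 this).resolve_right (hCC hu)
  have z1 : Z 1 = 0 := by
    have := hZP 1
    rw [act_eq, z0, h1, hR.fibered.z1, mul_zero, zero_mul, add_zero, zero_add] at this
    exact (mul_eq_zero.1 this).resolve_right (hCC hv)
  have z2 : Z 2 = 0 := by
    have := hZP 2
    rw [act_eq, z0, z1, h2, zero_mul, zero_mul, zero_add, zero_add] at this
    exact (mul_eq_zero.1 this).resolve_right (hCC hw)
  have key : ∀ j, E.act (Y j) =
      FormalField.act ![0, b, c] (Y j) + if j = 0 then Y j else 0 := by
    intro j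
    rw [← hY j, hE, act_cons, act_cons]
    ring
  intro j
  fin_cases j
  · have k0 := key 0
    have : E.act (Y 0) = Y 0 := by
      have := sub_eq_zero.1 z0
      rwa [hE, Matrix.cons_val_zero, act_X] at this
    rw [this] at k0
    have k1 : FormalField.act ![0, b, c] (Y 0) = 0 := by simpa using k0
    exact (act_zero Y).trans k1.symm
  · have k0 := key 1
    have := sub_eq_zero.1 z1
    rw [this, hE] at k0
    simpa using k0
  · have k0 := key 2
    have := sub_eq_zero.1 z2
    rw [this, hE] at k0
    simpa using k0

/-- The first two brackets give `c ∂(Y j)/∂z = 0`; the third, differentiated once in `z`, gives `c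
∂²(Y 2)/∂z² = 0`. -/
lemma pderiv_two_of_commutes (hcm : Commutes Y ![0, 0, c]) (hc : c ≠ 0)
    (hc2 : pderiv ℝ 2 c = 0) :
    pderiv ℝ 2 (Y 0) = 0 ∧ pderiv ℝ 2 (Y 1) = 0 ∧ pderiv ℝ 2 (pderiv ℝ 2 (Y 2)) = 0 := by
  have h0 : pderiv ℝ 2 (Y 0) = 0 := by
    have := hcm 0
    rw [act_cons] at this
    simpa [hc] using this
  have h1 : pderiv ℝ 2 (Y 1) = 0 := by
    have := hcm 1
    rw [act_cons] at this
    simpa [hc] using this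
  refine ⟨h0, h1, ?_⟩
  have h2 := congr_arg (pderiv ℝ 2) (hcm 2)
  rw [act_cons, act_eq] at h2
  simp only [zero_mul, zero_add, Matrix.cons_val, hc2, mul_zero, add_zero, map_add,
    Derivation.leibniz, smul_eq_mul, h0, h1, pderiv_comm 2 0 c, pderiv_comm 2 1 c, map_zero] at h2
  simpa [hc] using h2.symm

/-- The weights counting the degree in `x`. -/
def xWt : Fin 3 → ℤ := ![1, 0, 0]

lemma wt_xWt (n : Fin 3 →₀ ℕ) : wt xWt n = n 0 := by simp [wt_eq, xWt]

lemma inPart_homog_mul {a : ℤ} {F : Series} (hF : inPart xWt a F = F) (b : ℤ) (G : Series) :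
    inPart xWt (a + b) (F * G) = F * inPart xWt b G := by
  ext n
  have hs : ∀ p ∈ Finset.HasAntidiagonal.antidiagonal n, coeff p.1 F ≠ 0 →
      (wt xWt n = a + b ↔ wt xWt p.2 = b) := by
    intro p hp hne
    rw [← hF] at hne
    rw [← Finset.HasAntidiagonal.mem_antidiagonal.1 hp, map_add, (coeff_inPart_ne_zero.1 hne).1]
    exact add_right_inj a
  rw [coeff_mul]
  by_cases hn : wt xWt n = a + b
  · rw [coeff_inPart_of_eq hn, coeff_mul]
    refine Finset.sum_congr rfl fun p hp => ?_
    by_cases hne : coeff p.1 F = 0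
    · rw [hne, zero_mul, zero_mul]
    · rw [coeff_inPart_of_eq ((hs p hp hne).1 hn)]
  · rw [coeff_inPart_of_ne hn]
    refine (Finset.sum_eq_zero fun p hp => ?_).symm
    by_cases hne : coeff p.1 F = 0
    · rw [hne, zero_mul]
    · rw [coeff_inPart_of_ne (fun h => hn ((hs p hp hne).2 h)), mul_zero]

lemma XHom.inPart_eq (hY : XHom Y) (j : Fin 3) : inPart xWt (xWt j) (Y j) = Y j := by
  ext n
  by_cases hn : wt xWt n = xWt j
  · rw [coeff_inPart_of_eq hn]
  · rw [coeff_inPart_of_ne hn]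
    have := congr_arg (coeff n) (hY j)
    rw [coeff_X_mul_pderiv] at this
    by_contra hne
    apply hn
    rw [wt_xWt]
    have hne' : coeff n (Y j) ≠ 0 := fun h => hne h.symm
    fin_cases j
    · simp only [Fin.zero_eta, if_true] at this hne'
      have h1 : (n 0 : ℝ) = 1 := by
        apply mul_right_cancel₀ hne'; rw [this, one_mul]
      have : n 0 = 1 := by exact_mod_cast h1
      simp [this, xWt]
    · simp [hne'] at this hne'
      have := this.resolve_right hne'
      simp [this, xWt]
    · simp [hne'] at this hne'
      have := this.resolve_right hne'
      simp [this, xWt]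

lemma XHom.inPart_act (hY : XHom Y) (a : ℤ) (F : Series) :
    inPart xWt a (Y.act F) = Y.act (inPart xWt a F) := by
  rw [FormalField.act, inPart_sum, FormalField.act]
  refine Finset.sum_congr rfl fun k _ => ?_
  rw [← inPart_pderiv, ← inPart_homog_mul (hY.inPart_eq k), add_sub_cancel]

/-- `Y` respects the grading by `x`-degree, so the commutation relation splits into homogeneous
components, and `b` already has degree `a`. -/
lemma Commutes.inPart (hY : XHom Y) (hcm : Commutes Y ![0, b, c]) {a : ℤ}
    (hb : inPart xWt a b = b) : Commutes Y ![0, b, NewtonFol.inPart xWt a c] := by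
  have hR : ∀ j, NewtonFol.inPart xWt (a + xWt j) (FormalField.act ![0, b, c] (Y j)) =
      FormalField.act ![0, b, NewtonFol.inPart xWt a c] (Y j) := by
    intro j
    have hd : ∀ k, xWt k = 0 →
        NewtonFol.inPart xWt (xWt j) (pderiv ℝ k (Y j)) = pderiv ℝ k (Y j) := by
      intro k hk
      conv_rhs => rw [← hY.inPart_eq j, ← inPart_pderiv, hk, sub_zero]
    rw [act_cons, act_cons, zero_mul, inPart_add, inPart_add, inPart_zero,
      inPart_homog_mul hb, hd 1 rfl, add_comm a, mul_comm c, inPart_homog_mul (hd 2 rfl), mul_comm _ (NewtonFol.inPart xWt a c)]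
  intro j
  rw [← hR j, ← hcm j, hY.inPart_act]
  fin_cases j
  · simp
  · rw [show xWt ((fun k => k) ⟨1, by decide⟩) = 0 from rfl, add_zero]
    exact congr_arg Y.act hb.symm
  · rw [show xWt ((fun k => k) ⟨2, by decide⟩) = 0 from rfl, add_zero]
    rfl

/-- `E` straightens `β x^a ∂/∂y + d ∂/∂z` to `β x^a ∂/∂y`, which therefore commutes with `Y''`. This
frees the outer coefficients of `y` and yields `x ∂(Y'' 1)/∂y = a Y'' 0`, whence linearity in `y`.
-/
lemma pderiv_one_of_commutes {β : ℝ} {a : ℕ} {d : Series} {Y'' : FormalField} {E : Fin 3 → Series}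
    (hR : Rel i E (C c₀) Y Y'') (hcm : Commutes Y ![0, C β * X 0 ^ a, d]) (hβ : β ≠ 0)
    (hE0 : E 0 = X 0) (hE1 : E 1 = X 1)
    (hE2 : FormalField.act ![0, C β * X 0 ^ a, d] (E 2) = 0) :
    pderiv ℝ 1 (Y'' 0) = 0 ∧ pderiv ℝ 1 (Y'' 2) = 0 ∧ pderiv ℝ 1 (pderiv ℝ 1 (Y'' 1)) = 0 := by
  set D : FormalField := ![0, C β * X 0 ^ a, d] with hD
  have hE := hR.fibered.const
  have hEs := hasSubst hE
  have hF := hR.fibered.isFormalCoordinates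
  have hb : (C β * X 0 ^ a : Series) ≠ 0 := by simp [hβ, X_ne_zero']
  have d0 : D.act (E 0) = 0 := by rw [hE0, act_X]; rfl
  have d1 : D.act (E 1) = C β * X 0 ^ a := by rw [hE1, act_X]; rfl
  have key : ∀ j, C c₀ * Y.act (D.act (E j)) = (pderiv ℝ 1 (Y'' j)).subst E * (C β * X 0 ^ a) := by
    intro j
    have := congr_arg D.act (hR.eq j)
    rw [act_mul, act_C, mul_zero, add_zero, act_subst _ hE, Fin.sum_univ_three, d0, d1, hE2,
      mul_zero, mul_zero, zero_add, add_zero] at this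
    rw [← this, hcm.act_act]
  have k0 : pderiv ℝ 1 (Y'' 0) = 0 := by
    have := key 0
    rw [d0, act_zero, mul_zero] at this
    exact hF.subst_eq_zero ((mul_eq_zero.1 this.symm).resolve_right hb)
  have k2 : pderiv ℝ 1 (Y'' 2) = 0 := by
    have := key 2
    rw [hE2, act_zero, mul_zero] at this
    exact hF.subst_eq_zero ((mul_eq_zero.1 this.symm).resolve_right hb)
  refine ⟨k0, k2, ?_⟩
  have h1 : X 0 * Y.act (C β * X 0 ^ a) = C (a : ℝ) * Y 0 * (C β * X 0 ^ a) := by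
    have e1 : pderiv ℝ 1 (C β * X 0 ^ a : Series) = 0 := by
      simp [Derivation.leibniz, Derivation.leibniz_pow, pderiv_X]
    have e2 : pderiv ℝ 2 (C β * X 0 ^ a : Series) = 0 := by
      simp [Derivation.leibniz, Derivation.leibniz_pow, pderiv_X]
    have e0 : X 0 * pderiv ℝ 0 (C β * X 0 ^ a : Series) = C (a : ℝ) * (C β * X 0 ^ a) := by
      rcases a with _ | a
      · simp [Derivation.leibniz]
      · simp [Derivation.leibniz, Derivation.leibniz_pow]
        ring
    rw [act_eq, e1, e2, mul_zero, mul_zero, add_zero, add_zero, mul_left_comm, e0]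
    ring
  have h2 : X 0 * pderiv ℝ 1 (Y'' 1) = C (a : ℝ) * Y'' 0 := by
    apply hF.subst_injective
    rw [subst_mul hEs, subst_mul hEs, subst_X hEs, hE0, subst_C' hE, ← hR.eq 0, hE0, act_X]
    have := key 1
    rw [d1] at this
    apply mul_right_cancel₀ hb
    rw [mul_assoc, ← this, mul_left_comm, h1]
    ring
  have h3 := congr_arg (pderiv ℝ 1) h2
  simp only [Derivation.leibniz, k0, smul_eq_mul] at h3
  simpa [pderiv_X, X_ne_zero'] using h3

lemma le_one_of_pderiv_pderiv {k : Fin 3} {F : Series} (h : pderiv ℝ k (pderiv ℝ k F) = 0)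
    {n : Fin 3 →₀ ℕ} (hn : coeff n F ≠ 0) : n k ≤ 1 := by
  by_contra hc
  have hle : Finsupp.single k 1 ≤ n := by
    rw [Finsupp.single_le_iff]; omega
  have := pderiv_eq_zero_iff.1 h (n - Finsupp.single k 1) (by
    rw [coeff_pderiv, tsub_add_cancel_of_le hle]
    exact mul_ne_zero hn (by positivity))
  simp at this
  omega

end Commuting

/-! ### Quasihomogeneous weights -/

section QuasiWeights

/-- The weights `(1, s, s d)`. -/
noncomputable def quasiWt (s d : ℝ) : Fin 3 → ℝ := ![1, s, s * d]

lemma wt_quasiWt (s d : ℝ) (n : Fin 3 →₀ ℕ) :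
    wt (quasiWt s d) n = n 0 + n 1 * s + n 2 * (s * d) := by
  simp [wt_eq, quasiWt]

lemma zwt_quasiWt (s d : ℝ) (v : Fin 3 → ℤ) :
    zwt (quasiWt s d) v = v 0 + v 1 * s + v 2 * (s * d) := by
  simp [zwt, quasiWt]

lemma quasiWt_pos {s d : ℝ} (hs : 0 < s) (hd : 0 < d) (k : Fin 3) : 0 < quasiWt s d k := by
  fin_cases k
  · exact one_pos
  · exact hs
  · exact mul_pos hs hd

/-- The components of a change of coordinates dominate the weights `(1, s, s d)`. -/
def QuasiDominates (s d : ℝ) (Ψ : Fin 3 → Series) : Prop :=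
  (∀ n, coeff n (Ψ 2) ≠ 0 → n 2 = 0 → s * d ≤ n 0 + n 1 * s) ∧
    ∀ n, coeff n (Ψ 1) ≠ 0 → n 1 = 0 → s ≤ n 0

variable {i : ℕ} {Ψ : Fin 3 → Series} {s d : ℝ}

lemma Fibered.compat_quasiWt (hΨ : Fibered i Ψ) (hs : 0 < s) (hd : 0 < d)
    (hq : QuasiDominates s d Ψ) : ∀ j, Filt (quasiWt s d) (quasiWt s d j) (Ψ j) := by
  intro j n hn
  rw [wt_quasiWt]
  have a0 : (0 : ℝ) ≤ n 0 := Nat.cast_nonneg _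
  have a1 : (0 : ℝ) ≤ n 1 * s := by positivity
  have a2 : (0 : ℝ) ≤ n 2 * (s * d) := by positivity
  fin_cases j
  · have h1 : (1 : ℝ) ≤ n 0 := by exact_mod_cast (hΨ.supp0 hn).1
    change 1 ≤ _
    linarith
  · change s ≤ _
    rcases Nat.eq_zero_or_pos (n 1) with h | h
    · have := hq.2 n hn h
      linarith
    · have h1 : (1 : ℝ) ≤ n 1 := by exact_mod_cast h
      nlinarith
  · change s * d ≤ _
    rcases Nat.eq_zero_or_pos (n 2) with h | h
    · have := hq.1 n hn h
      linarith
    · have h1 : (1 : ℝ) ≤ n 2 := by exact_mod_cast h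
      nlinarith [mul_pos hs hd]

lemma inMap_quasiWt_zero (hΨ : Fibered i Ψ) (hs : 0 < s) :
    inMap (quasiWt s d) Ψ 0 = C (coeff (Finsupp.single 0 1) (Ψ 0)) * X 0 := by
  classical
  ext n
  rw [X, ← monomial_zero_eq_C_apply, monomial_mul_monomial, zero_add, mul_one, coeff_monomial,
    inMap]
  split_ifs with h
  · rw [h, coeff_inPart_of_eq]
    simp
  · by_contra hne
    obtain ⟨hw, hn⟩ := coeff_inPart_ne_zero.1 hne
    obtain ⟨h0, h2⟩ := hΨ.supp0 hn
    rw [wt_quasiWt, h2] at hw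
    change _ = (1 : ℝ) at hw
    have h1 : (1 : ℝ) ≤ n 0 := by exact_mod_cast h0
    have a1 : (0 : ℝ) ≤ n 1 := Nat.cast_nonneg _
    have e1 : (n 1 : ℝ) = 0 := by push_cast at hw; nlinarith
    have e0 : (n 0 : ℝ) = 1 := by rw [e1] at hw; simpa using hw
    exact h (finsupp_ext3 (by simpa using e0) (by simpa using e1) (by simpa using h2))

lemma coeff_inMap_quasiWt_one (hΨ : Fibered i Ψ) (hs : 0 < s) {n : Fin 3 →₀ ℕ}
    (hn : coeff n (inMap (quasiWt s d) Ψ 1) ≠ 0) :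
    n = Finsupp.single 1 1 ∨ (n 1 = 0 ∧ n 2 = 0 ∧ (n 0 : ℝ) = s) := by
  obtain ⟨hw, hn⟩ := coeff_inPart_ne_zero.1 hn
  obtain ⟨-, h2⟩ := hΨ.supp1 hn
  rw [wt_quasiWt, h2] at hw
  change _ = s at hw
  have a0 : (0 : ℝ) ≤ n 0 := Nat.cast_nonneg _
  push_cast at hw
  rcases Nat.eq_zero_or_pos (n 1) with h | h
  · right
    refine ⟨h, h2, ?_⟩
    rw [h] at hw
    simpa using hw
  · left
    have h1 : (1 : ℝ) ≤ n 1 := by exact_mod_cast h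
    have e0 : (n 0 : ℝ) = 0 := by nlinarith
    have e1 : (n 1 : ℝ) = 1 := by
      rw [e0] at hw
      have : (n 1 : ℝ) * s = 1 * s := by linarith
      exact mul_right_cancel₀ hs.ne' this
    exact finsupp_ext3 (by simpa using e0) (by simpa using e1) (by simpa using h2)

lemma coeff_inMap_quasiWt_two (hs : 0 < s) (hd : 0 < d) {n : Fin 3 →₀ ℕ}
    (hn : coeff n (inMap (quasiWt s d) Ψ 2) ≠ 0) :
    n = Finsupp.single 2 1 ∨ (n 2 = 0 ∧ (n 0 : ℝ) + n 1 * s = s * d) := by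
  obtain ⟨hw, hn⟩ := coeff_inPart_ne_zero.1 hn
  rw [wt_quasiWt] at hw
  change _ = s * d at hw
  have a0 : (0 : ℝ) ≤ n 0 := Nat.cast_nonneg _
  have a1 : (0 : ℝ) ≤ n 1 := Nat.cast_nonneg _
  have hsd := mul_pos hs hd
  rcases Nat.eq_zero_or_pos (n 2) with h | h
  · right
    refine ⟨h, ?_⟩
    rw [h] at hw
    simpa using hw
  · left
    have h1 : (1 : ℝ) ≤ n 2 := by exact_mod_cast h
    have b1 : (0 : ℝ) ≤ n 1 * s := by positivity
    have e0 : (n 0 : ℝ) = 0 := by nlinarith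
    have e1 : (n 1 : ℝ) = 0 := by nlinarith
    have e2 : (n 2 : ℝ) = 1 := by
      rw [e0, e1] at hw
      have : (n 2 : ℝ) * (s * d) = 1 * (s * d) := by linarith
      exact mul_right_cancel₀ hsd.ne' this
    exact finsupp_ext3 (by simpa using e0) (by simpa using e1) (by simpa using e2)

lemma coeff_single_inMap {Γ : Type*} [AddCommGroup Γ] [LinearOrder Γ] [IsOrderedAddMonoid Γ]
    (w : Fin 3 → Γ) (j : Fin 3) :
    coeff (Finsupp.single j 1) (inMap w Ψ j) = coeff (Finsupp.single j 1) (Ψ j) := by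
  rw [inMap, coeff_inPart_of_eq]; simp

lemma pderiv_inMap_quasiWt_two (hs : 0 < s) (hd : 0 < d) :
    pderiv ℝ 2 (inMap (quasiWt s d) Ψ 2) = C (coeff (Finsupp.single 2 1) (Ψ 2)) := by
  classical
  have : pderiv ℝ 2 (inMap (quasiWt s d) Ψ 2 - C (coeff (Finsupp.single 2 1) (Ψ 2)) * X 2) = 0 := by
    rw [pderiv_eq_zero_iff]
    intro n hn
    rw [X, ← monomial_zero_eq_C_apply, monomial_mul_monomial, zero_add, mul_one, map_sub,
      coeff_monomial] at hn
    by_cases h : n = Finsupp.single 2 1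
    · rw [if_pos h, h, coeff_single_inMap, sub_self] at hn
      exact absurd rfl hn
    · rw [if_neg h, sub_zero] at hn
      exact ((coeff_inMap_quasiWt_two hs hd hn).resolve_left h).1
  rw [map_sub, pderiv_C_mul_X, sub_eq_zero] at this
  exact this

lemma pderiv_inMap_quasiWt_one (hΨ : Fibered i Ψ) (hs : 0 < s) :
    pderiv ℝ 1 (inMap (quasiWt s d) Ψ 1) = C (coeff (Finsupp.single 1 1) (Ψ 1)) := by
  classical
  have : pderiv ℝ 1 (inMap (quasiWt s d) Ψ 1 - C (coeff (Finsupp.single 1 1) (Ψ 1)) * X 1) = 0 := by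
    rw [pderiv_eq_zero_iff]
    intro n hn
    rw [X, ← monomial_zero_eq_C_apply, monomial_mul_monomial, zero_add, mul_one, map_sub,
      coeff_monomial] at hn
    by_cases h : n = Finsupp.single 1 1
    · rw [if_pos h, h, coeff_single_inMap, sub_self] at hn
      exact absurd rfl hn
    · rw [if_neg h, sub_zero] at hn
      exact ((coeff_inMap_quasiWt_one hΨ hs hn).resolve_left h).1
  rw [map_sub, pderiv_C_mul_X, sub_eq_zero] at this
  exact this

/-- Weighted homogeneous series. -/
def Homog (w : Fin 3 → ℝ) (γ : ℝ) (F : Series) : Prop := ∀ n, coeff n F ≠ 0 → wt w n = γ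

variable {w : Fin 3 → ℝ} {γ γ' : ℝ} {F G : Series}

lemma homog_inPart : Homog w γ (inPart w γ F) := fun _ hn => (coeff_inPart_ne_zero.1 hn).1

lemma Homog.inPart_eq (h : Homog w γ F) : inPart w γ F = F := by
  ext n
  by_cases hn : wt w n = γ
  · rw [coeff_inPart_of_eq hn]
  · rw [coeff_inPart_of_ne hn]
    by_contra hne
    exact hn (h n (Ne.symm hne))

lemma Homog.filt (h : Homog w γ F) : Filt w γ F := fun n hn => (h n hn).ge

lemma Homog.add (hF : Homog w γ F) (hG : Homog w γ G) : Homog w γ (F + G) := by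
  intro n hn
  by_cases h : coeff n F = 0
  · exact hG n (by rwa [map_add, h, zero_add] at hn)
  · exact hF n h

lemma Homog.mul (hF : Homog w γ F) (hG : Homog w γ' G) : Homog w (γ + γ') (F * G) := by
  intro n hn
  rw [coeff_mul] at hn
  obtain ⟨p, hp, hne⟩ := Finset.exists_ne_zero_of_sum_ne_zero hn
  rw [← Finset.HasAntidiagonal.mem_antidiagonal.1 hp, map_add, hF _ (left_ne_zero_of_mul hne),
    hG _ (right_ne_zero_of_mul hne)]

lemma Homog.pderiv (hF : Homog w γ F) (k : Fin 3) : Homog w (γ - w k) (pderiv ℝ k F) := by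
  intro n hn
  rw [coeff_pderiv] at hn
  have := hF _ (left_ne_zero_of_mul hn)
  rw [map_add, wt_single, one_smul] at this
  linarith

lemma homog_X (k : Fin 3) : Homog w (w k) (X k : Series) := by
  intro n hn
  classical
  rw [coeff_X] at hn
  split_ifs at hn with h
  · rw [h]; simp
  · exact absurd rfl hn

lemma homog_monomial {n : Fin 3 →₀ ℕ} {r : ℝ} (h : r = 0 ∨ wt w n = γ) :
    Homog w γ (monomial n r : Series) := by
  intro k hk
  classical
  rw [coeff_monomial] at hk
  split_ifs at hk with hkn
  · rw [hkn]; exact h.resolve_left hk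
  · exact absurd rfl hk

end QuasiWeights

/-! ### The critical slope -/

section CriticalSlope

variable {i : ℕ} {Ω Ω' : FormalField} {Ψ : Fin 3 → Series} {U : Series}
  {h m : Fin 3 → ℤ} {Δ Δ' : ℚ × ℚ} {C₀ C₀' : WithTop ℚ} {s : ℝ}

lemma zwt_quasiWt_sub (hm : m 0 = 0) {d : ℝ} (v : Fin 3 → ℤ) :
    zwt (quasiWt s d) v - zwt (quasiWt s d) m =
      v 0 + s * disp d (intVec m) (intVec v) 1 := by
  rw [zwt_quasiWt, zwt_quasiWt, hm]
  simp only [disp, intVec_apply]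
  push_cast
  ring

/-- The face of the support for a slope which is smaller than the horizontal displacement. -/
lemma ClassFacts.below_slope (hc : ClassFacts i Ω h m Δ C₀) (hΔ : Δ.1 = 0) (hs : 0 < s)
    (hsC : ∀ c : ℚ, C₀ = c → s < c) {v : Fin 3 → ℤ} (hv : v ∈ supp Ω) :
    0 ≤ (v 0 : ℝ) + s * disp Δ.2 (intVec m) (intVec v) 1 ∧
      ((v 0 : ℝ) + s * disp Δ.2 (intVec m) (intVec v) 1 = 0 →
        v 0 = 0 ∧ disp Δ.2 (intVec m) (intVec v) 1 = 0) := by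
  have h0 : (0 : ℝ) ≤ v 0 := by exact_mod_cast hc.hv.nonneg v hv
  set D := disp Δ.2 (intVec m) (intVec v) 1 with hD
  have key : 0 ≤ D ∨ ∃ c : ℝ, s < c ∧ 0 ≤ (v 0 : ℝ) + c * D := by
    rcases C₀ with _ | c
    · exact Or.inl ((hc.hor.top rfl).2 _ (intVec_mem hv))
    · right
      refine ⟨c, hsC c rfl, ?_⟩
      rcases hc.hor.fin c rfl with ⟨h1, -⟩ | ⟨-, -, h1, -⟩
      · exact absurd hΔ h1.ne'
      · exact h1 _ (intVec_mem hv)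
  rcases le_or_gt 0 D with hD0 | hD0
  · refine ⟨by positivity, fun h => ?_⟩
    have h1 : 0 ≤ s * D := by positivity
    have h2 : (v 0 : ℝ) = 0 := by linarith
    refine ⟨by exact_mod_cast h2, ?_⟩
    have : s * D = 0 := by linarith
    exact (mul_eq_zero.1 this).resolve_left hs.ne'
  -- For negative displacement, the inequality at the larger slope `c` makes the one at `s` strict.
  · obtain ⟨c, hc1, hc2⟩ := key.resolve_left hD0.not_ge
    have : 0 < (v 0 : ℝ) + s * D := by nlinarith
    exact ⟨this.le, fun h => absurd h this.ne'⟩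

lemma fibered_tilt {e₁ e₂ : ℕ} (he : e₁ ≠ 0 ∨ e₂ ≠ 0) (c : ℝ) :
    Fibered i ![X 0, X 1, X 2 + C c * (X 0 ^ e₁ * X 1 ^ e₂)] := by
  classical
  set n : Fin 2 →₀ ℕ := Finsupp.equivFunOnFinite.symm ![e₁, e₂] with hn
  have h0 : n 0 = e₁ := rfl
  have h1 : n 1 = e₂ := rfl
  rw [← h0, ← h1, ← polyMap_monomial]
  refine fibered_polyMap ?_ (by simp) (fun _ => rfl)
  rw [MvPolynomial.coeff_monomial, if_neg]
  intro h
  rw [h] at h0 h1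
  simp at h0 h1
  omega

lemma exists_commuting {P : Fin 3 → Series} {Y Y' : FormalField} {c₀ u v w : ℝ}
    (hR : Rel i P (C c₀) Y Y') (hY : XHom Y) (hY' : XHom Y')
    (h0 : P 0 = C u * X 0) (h1 : pderiv ℝ 1 (P 1) = C v) (h2 : pderiv ℝ 2 (P 2) = C w)
    (hu : u ≠ 0) (hv : v ≠ 0) (hw : w ≠ 0) {b : Series}
    (hb : C v * b = -(X 0 * pderiv ℝ 0 (P 1))) (hb2 : pderiv ℝ 2 b = 0) :
    ∃ c : Series, Commutes Y ![0, b, c] ∧ pderiv ℝ 2 c = 0 ∧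
      C w * c = -(X 0 * pderiv ℝ 0 (P 2) + b * pderiv ℝ 1 (P 2)) := by
  have hc : C w * (C (w⁻¹) * -(X 0 * pderiv ℝ 0 (P 2) + b * pderiv ℝ 1 (P 2))) =
      -(X 0 * pderiv ℝ 0 (P 2) + b * pderiv ℝ 1 (P 2)) := by
    rw [← mul_assoc, ← map_mul, mul_inv_cancel₀ hw, map_one, one_mul]
  refine ⟨_, commutes_of_rel hR hY hY' h0 h1 h2 hu hv hw hb hc, ?_, hc⟩
  simp [Derivation.leibniz, pderiv_comm 2 0 (P 2), pderiv_comm 2 1 (P 2), h2, hb2, pderiv_X]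

/-- The edge has a support point below `m`, hence with larger `v₁`. With only `-1` and `0`
available, it would join `(0, -1, m₂)` to some `(0, 0, p₂)`: a nilpotent configuration, whose main
vertex is not `m`. -/
lemma nilConf_of_edge (hi : i = 1) (hc : ClassFacts i Ω h m Δ C₀) (hΔ : Δ.1 = 0)
    (hv : ∀ v ∈ supp Ω, v 0 = 0 → disp Δ.2 (intVec m) (intVec v) 1 = 0 → v 1 = -1 ∨ v 1 = 0) :
    False := by
  have hΔ2 : 0 < (Δ.2 : ℝ) := by
    rcases hc.vert.pos with h | ⟨-, h⟩
    · rw [hΔ] at h; simp at h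
    · exact h
  obtain ⟨p, hp, hp2, hp0, hp1⟩ := hc.vert.low
  have hm0 := hc.m0
  have p0 : p 0 = 0 := by
    simp only [disp, intVec_apply, hΔ, hm0] at hp0
    simpa using hp0
  have hpv := hv p hp p0 hp1
  simp only [disp, intVec_apply] at hp1
  have hp2' : (p 2 : ℝ) < m 2 := by exact_mod_cast hp2
  have hlt : m 1 < p 1 := by
    have : (m 1 : ℝ) < p 1 := by nlinarith
    exact_mod_cast this
  have hm1 : m 1 = -1 := by
    have := hc.m1
    omega
  have hpz : p 1 = 0 := by omega
  have hd : (Δ.2 : ℝ) * (m 2 - p 2) = 1 := by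
    rw [hm1, hpz] at hp1; push_cast at hp1; linarith
  rcases hc.conf with hn | ⟨rfl, hn⟩
  · rw [hn.n1] at hm1; omega
  · have hdpos : (0 : ℝ) < m 2 - p 2 := by linarith
    have key : ∀ v : Fin 3 → ℤ, ((m 2 : ℝ) - p 2) * v 1 + v 2 - p 2 =
        (m 2 - p 2) * disp Δ.2 (intVec m) (intVec v) 1 := by
      intro v
      simp only [disp, intVec_apply, hm1]
      push_cast
      linear_combination (-(v 2 : ℝ) + m 2) * hd
    refine hn p ⟨hi, hp, hm1, p0, hpz, hp2, fun v hv' h0 => ?_, fun v hv' h0 he => ?_⟩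
    · have hL := hc.vert.nonneg _ (intVec_mem hv')
      have h00 : disp Δ.1 (intVec m) (intVec v) 0 = 0 := by
        simp [disp, intVec_apply, hΔ, hm0, h0]
      rw [h00] at hL
      have hL' : 0 ≤ disp Δ.2 (intVec m) (intVec v) 1 := by
        rcases hL with h | ⟨-, h | ⟨h, -⟩⟩
        · exact absurd h (lt_irrefl _)
        · exact h.le
        · exact h.ge
      have := key v
      have h3 : (p 2 : ℝ) ≤ (m 2 - p 2) * v 1 + v 2 := by nlinarith
      exact_mod_cast h3
    · have he' : ((m 2 : ℝ) - p 2) * v 1 + v 2 = p 2 := by exact_mod_cast he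
      have hz : disp Δ.2 (intVec m) (intVec v) 1 = 0 := by
        have := key v
        rw [he', sub_self] at this
        exact (mul_eq_zero.1 this.symm).resolve_left hdpos.ne'
      rcases hv v hv' h0 hz with e | e
      · left
        refine ext3 (h0.trans hm0.symm) (e.trans hm1.symm) ?_
        rw [e] at he
        linarith
      · right
        refine ext3 (h0.trans p0.symm) (e.trans hpz.symm) ?_
        rw [e] at he
        linarith

end CriticalSlope

/-! ### Invariance of the horizontal displacement -/

section HorizontalInvariance

variable {i : ℕ} {Ω Ω' : FormalField} {Ψ : Fin 3 → Series} {U : Series}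
  {h m : Fin 3 → ℤ} {Δ : ℚ × ℚ} {C₀ C₀' : WithTop ℚ} {s : ℝ}

lemma ClassFacts.filtField_quasiWt (hc : ClassFacts i Ω h m Δ C₀) {d : ℝ}
    (hv : ∀ v ∈ supp Ω, 0 ≤ (v 0 : ℝ) + s * disp d (intVec m) (intVec v) 1) :
    FiltField (quasiWt s d) (zwt (quasiWt s d) m) Ω :=
  filtField_iff.2 fun v hv' => by
    have := zwt_quasiWt_sub (s := s) hc.m0 (d := d) v
    have := hv v hv'
    linarith

lemma ClassFacts.zwt_quasiWt_eq_iff (hc : ClassFacts i Ω h m Δ C₀) {d : ℝ} {v : Fin 3 → ℤ} :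
    zwt (quasiWt s d) v = zwt (quasiWt s d) m ↔
      (v 0 : ℝ) + s * disp d (intVec m) (intVec v) 1 = 0 := by
  rw [← zwt_quasiWt_sub hc.m0, sub_eq_zero]

lemma VertFacts.snd_pos {r : ℝ} (hr : 0 ≤ r) (hv : VertFacts Ω m Δ r) (hΔ : Δ.1 = 0) :
    0 < (Δ.2 : ℝ) := by
  rcases hv.pos' hr with h | ⟨-, h⟩
  · rw [hΔ] at h; simp at h
  · exact h

/-- Below both horizontal displacements the lowest parts live on the main edge, in `v₀ = 0`, and are
invariant under rescalings of `x`. A change whose lowest part lacks this invariance produces a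
commuting field `b ∂/∂y + c ∂/∂z`, as in `commutes_of_rel`; the cases `b ≠ 0` and `b = 0` are
excluded separately. -/
lemma not_of_critical_slope (hi : i = 1 ∨ i = 2) (hR : Rel i Ψ U Ω Ω')
    (hS : StableFacts i Ω h m Δ C₀) (hc' : ClassFacts i Ω' h m Δ C₀') (hΔ : Δ.1 = 0)
    (hs : 0 < s) (hsC : ∀ c : ℚ, C₀ = c → s < c) (hsC' : ∀ c : ℚ, C₀' = c → s < c)
    (hq : QuasiDominates s Δ.2 Ψ)
    (hatt : (∃ n, coeff n (Ψ 1) ≠ 0 ∧ n 1 = 0 ∧ (n 0 : ℝ) = s) ∨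
      ∃ n, coeff n (Ψ 2) ≠ 0 ∧ n 2 = 0 ∧ n 0 ≠ 0 ∧ (n 0 : ℝ) + n 1 * s = s * Δ.2) : False := by
  classical
  have hc := hS.facts
  have hd := hc.vert.snd_pos le_rfl hΔ
  have hw := quasiWt_pos hs hd
  have hf : FiltField (quasiWt s Δ.2) (zwt (quasiWt s (Δ.2 : ℝ)) m) Ω :=
    hc.filtField_quasiWt fun v hv => (hc.below_slope hΔ hs hsC hv).1
  have hI := (hR.init hw (hR.fibered.compat_quasiWt hs hd hq) hf).2
  have hY : XHom (inField (quasiWt s Δ.2) (zwt (quasiWt s (Δ.2 : ℝ)) m) Ω) :=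
    xHom_of_supp fun v hv => by
      obtain ⟨hv, he⟩ := mem_supp_inField.1 hv
      exact ((hc.below_slope hΔ hs hsC hv).2 (hc.zwt_quasiWt_eq_iff.1 he)).1
  have hY' : XHom (inField (quasiWt s Δ.2) (zwt (quasiWt s (Δ.2 : ℝ)) m) Ω') :=
    xHom_of_supp fun v hv => by
      obtain ⟨hv, he⟩ := mem_supp_inField.1 hv
      exact ((hc'.below_slope hΔ hs hsC' hv).2 (hc.zwt_quasiWt_eq_iff.1 he)).1
  have h0 := inMap_quasiWt_zero (d := Δ.2) hR.fibered hs
  have h1 := pderiv_inMap_quasiWt_one (d := Δ.2) hR.fibered hs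
  have h2 := pderiv_inMap_quasiWt_two (Ψ := Ψ) hs hd
  have hdg := hR.fibered.diag
  have hone : ∀ n : Fin 3 →₀ ℕ, n ≠ Finsupp.single 1 1 →
      coeff n (inMap (quasiWt s Δ.2) Ψ 1) ≠ 0 →
      (n 1 = 0 ∧ n 2 = 0 ∧ (n 0 : ℝ) = s) := fun n hn hne =>
    (coeff_inMap_quasiWt_one hR.fibered hs hne).resolve_left hn
  by_cases hx : ∃ n, coeff n (Ψ 1) ≠ 0 ∧ n 1 = 0 ∧ (n 0 : ℝ) = s
  -- A term `g x^a` of `Ψ 1`, possible only for `i = 1`, gives `b = β x^a` with `β ≠ 0`.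
  · obtain ⟨n, hn, hn1, hns⟩ := hx
    obtain ⟨-, hn2⟩ := hR.fibered.supp1 hn
    have hi1 : i = 1 := by
      rcases hi with h | h
      · exact h
      · have := X_dvd_iff_coeff.1 (hR.fibered.y1 h) n hn
        omega
    set a := n 0 with ha
    have ha0 : (0 : ℝ) < a := by rw [hns]; exact hs
    set g := coeff n (Ψ 1) with hg
    have hna : n = Finsupp.single 0 a := finsupp_ext3 (by simp [ha]) (by simp [hn1]) (by simp [hn2])
    set v := coeff (Finsupp.single 1 1) (Ψ 1) with hv
    have hv0 : v ≠ 0 := hdg 1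
    obtain ⟨β, hβ⟩ : ∃ β : ℝ, β = -(a * g / v) := ⟨_, rfl⟩
    have hβ0 : β ≠ 0 := hβ ▸ neg_ne_zero.2 (div_ne_zero (mul_ne_zero ha0.ne' hn) hv0)
    have hbmon : (C β * X 0 ^ a : Series) = monomial n β := by
      rw [hna, X_pow_eq, ← monomial_zero_eq_C_apply, monomial_mul_monomial, zero_add, mul_one]
    have hb : C v * (C β * X 0 ^ a) = -(X 0 * pderiv ℝ 0 (inMap (quasiWt s Δ.2) Ψ 1)) := by
      ext k
      rw [map_neg, coeff_X_mul_pderiv, hbmon, coeff_C_mul, coeff_monomial]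
      by_cases hk : k = n
      · rw [if_pos hk, hk, inMap, coeff_inPart_of_eq]
        · rw [hβ, ← ha, ← hg]; field_simp
        · rw [wt_quasiWt, ← ha, hn1, hn2, hns]
          simp [quasiWt]
      · rw [if_neg hk, mul_zero, eq_comm, neg_eq_zero]
        by_contra hne
        have hne' := right_ne_zero_of_mul hne
        by_cases hk1 : k = Finsupp.single 1 1
        · apply left_ne_zero_of_mul hne
          rw [hk1]; simp
        · obtain ⟨e1, e2, e0⟩ := hone k hk1 hne'
          apply hk
          refine finsupp_ext3 ?_ (e1.trans hn1.symm) (e2.trans hn2.symm)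
          rw [← hns] at e0
          exact_mod_cast e0
    obtain ⟨c, hcm, hc2, hceq⟩ := exists_commuting hI hY hY' h0 h1 h2 (hdg 0) (hdg 1) (hdg 2) hb
      (by simp [Derivation.leibniz, Derivation.leibniz_pow, pderiv_X])
    have hbh : inPart xWt (a : ℤ) (C β * X 0 ^ a) = C β * X 0 ^ a := by
      ext k
      rw [hbmon]
      by_cases hk : wt xWt k = a
      · rw [coeff_inPart_of_eq hk]
      · rw [coeff_inPart_of_ne hk, coeff_monomial, if_neg]
        rintro rfl
        exact hk (by rw [wt_xWt])
    have hcmd := hcm.inPart hY hbh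
    have hch : Homog (quasiWt s Δ.2) (s * Δ.2) c := by
      have e : Homog (quasiWt s Δ.2) (s * Δ.2)
          (X 0 * pderiv ℝ 0 (inMap (quasiWt s Δ.2) Ψ 2) +
            (C β * X 0 ^ a) * pderiv ℝ 1 (inMap (quasiWt s Δ.2) Ψ 2)) := by
        have hP : Homog (quasiWt s Δ.2) (s * Δ.2) (inMap (quasiWt s Δ.2) Ψ 2) := homog_inPart
        have hB : Homog (quasiWt s Δ.2) s (C β * X 0 ^ a) := by
          rw [hbmon]
          refine homog_monomial (Or.inr ?_)
          rw [wt_quasiWt, hn1, hn2, ← ha, hns]; simp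
        have t1 := (homog_X (w := quasiWt s Δ.2) 0).mul (hP.pderiv 0)
        have t2 := hB.mul (hP.pderiv 1)
        rw [add_sub_cancel] at t1
        rw [show quasiWt s (Δ.2 : ℝ) 1 = s from rfl, add_sub_cancel] at t2
        exact t1.add t2
      intro k hk
      apply e k
      intro hz
      have := congr_arg (coeff k) hceq
      rw [coeff_C_mul, map_neg, hz, neg_zero] at this
      exact mul_ne_zero (hdg 2) hk this
    -- Weight `s Δ₂` and `x`-degree `a = s` leave a single possible monomial `x^a y^k`, with `k + 1
    -- = Δ₂`.
    obtain ⟨k, γ, hdk, hγ⟩ : ∃ (k : ℕ) (γ : ℝ),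
        inPart xWt (a : ℤ) c = monomial (xyExp a k) γ ∧ (γ = 0 ∨ ((k + 1 : ℕ) : ℚ) = Δ.2) := by
      have hmon : ∀ k, coeff k (inPart xWt (a : ℤ) c) ≠ 0 →
          k 0 = a ∧ k 2 = 0 ∧ ((k 1 + 1 : ℕ) : ℚ) = Δ.2 := by
        intro k hk
        obtain ⟨hk0, hk⟩ := coeff_inPart_ne_zero.1 hk
        rw [wt_xWt] at hk0
        have hk0 : k 0 = a := by exact_mod_cast hk0
        have hk2 := pderiv_eq_zero_iff.1 hc2 k hk
        have := hch k hk
        rw [wt_quasiWt, hk0, hk2, hns] at this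
        refine ⟨hk0, hk2, ?_⟩
        have h3 : s * ((k 1 + 1 : ℕ) : ℝ) = s * Δ.2 := by push_cast at this ⊢; linarith
        exact_mod_cast mul_left_cancel₀ hs.ne' h3
      by_cases hz : ∃ k, coeff k (inPart xWt (a : ℤ) c) ≠ 0
      · obtain ⟨k, hk⟩ := hz
        obtain ⟨k0, k2, k1⟩ := hmon k hk
        have hkk : k = xyExp a (k 1) := finsupp_ext3 (by simp [k0]) (by simp) (by simp [k2])
        refine ⟨k 1, coeff k (inPart xWt (a : ℤ) c), ?_, Or.inr k1⟩
        rw [← hkk]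
        refine eq_monomial_of fun l hl => ?_
        obtain ⟨l0, l2, l1⟩ := hmon l hl
        have : k 1 = l 1 := by
          have := k1.trans l1.symm
          have : k 1 + 1 = l 1 + 1 := by exact_mod_cast this
          omega
        exact finsupp_ext3 (l0.trans k0.symm) this.symm (l2.trans k2.symm)
      · push Not at hz
        exact ⟨0, 0, by ext n; rw [hz n]; simp, Or.inl rfl⟩
    -- Chosen so that `β x^a ∂/∂y + γ x^a y^k ∂/∂z` annihilates `z + τ y^{k+1}`. Unless `τ = 0`, the
    -- exponent `(0, k + 1)` is `Δ`, so stability covers this change.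
    set τ : ℝ := -(γ / (β * (k + 1 : ℕ))) with hτ
    have hτd : τ = 0 ∨ (((0 : ℕ) : ℚ), ((k + 1 : ℕ) : ℚ)) = Δ := by
      rcases hγ with h | h
      · left; rw [hτ, h]; simp
      · right; exact Prod.ext (by simp [hΔ]) h
    have he : (0 : ℕ) ≠ 0 ∨ k + 1 ≠ 0 := Or.inr (Nat.succ_ne_zero k)
    obtain ⟨Ω'', hT, hC''⟩ := hS.exists_monomial he hτd
    set E : Fin 3 → Series := ![X 0, X 1, X 2 + C τ * (X 0 ^ 0 * X 1 ^ (k + 1))] with hE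
    have hEF : Fibered i E := fibered_tilt he τ
    have hER := rel_of_isTransform hEF hT
    have hEh : ∀ j, Homog (quasiWt s Δ.2) (quasiWt s Δ.2 j) (E j) := by
      intro j
      fin_cases j
      · exact homog_X 0
      · exact homog_X 1
      · refine (homog_X 2).add ?_
        rw [← monomial_xyExp]
        refine homog_monomial (hτd.imp id fun h => ?_)
        have h := congr_arg Prod.snd h
        simp only at h
        rw [wt_quasiWt, ← h]
        simp [quasiWt]
        ring
    have hEI := (hER.init hw (fun j => (hEh j).filt) hf).2
    have hEin : inMap (quasiWt s Δ.2) E = E := funext fun j => (hEh j).inPart_eq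
    rw [hEin] at hEI
    rw [hdk] at hcmd
    obtain ⟨g0, g2, g1⟩ := pderiv_one_of_commutes hEI hcmd hβ0 rfl rfl (by
      rw [act_cons, hE]
      simp only [Matrix.cons_val, map_add, Derivation.leibniz, Derivation.leibniz_pow]
      rw [monomial_xyExp]
      have hk1 : ((k + 1 : ℕ) : ℝ) ≠ 0 := by positivity
      have e : C γ = -(C β * C τ * C ((k + 1 : ℕ) : ℝ) : Series) := by
        rw [← map_mul, ← map_mul, ← map_neg, hτ]
        congr 1
        field_simp
      have e3 : (C ((k + 1 : ℕ) : ℝ) : Series) = ((k + 1 : ℕ) : Series) := map_natCast _ _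
      rw [e, e3]
      simp [pderiv_X]
      ring)
    -- Degree at most one in `y` in the second coefficient and zero in the others means `v₁ ∈ {-1,
    -- 0}` along the edge.
    refine nilConf_of_edge hi1 hC'' hΔ fun v hv h0 hD => ?_
    have hvI : v ∈ supp (inField (quasiWt s Δ.2) (zwt (quasiWt s (Δ.2 : ℝ)) m) Ω'') :=
      mem_supp_inField.2 ⟨hv, hc.zwt_quasiWt_eq_iff.2 (by rw [h0, hD]; simp)⟩
    obtain ⟨j, l, hl, rfl⟩ := mem_supp.1 hvI
    fin_cases j
    · right
      have := pderiv_eq_zero_iff.1 g0 l hl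
      simp [logExp, this]
    · have := le_one_of_pderiv_pderiv g1 hl
      simp [logExp]
      omega
    · right
      have := pderiv_eq_zero_iff.1 g2 l hl
      simp [logExp, this]
  -- Here `b = 0` and `c ≠ 0`. Commuting with `c ∂/∂z` forces `v₂ ≤ 0` on the support of the lowest
  -- part, against `m₂ ≥ 1`.
  · obtain ⟨n, hn, hn2, hn0, hns⟩ := hatt.resolve_left hx
    have hb : C (coeff (Finsupp.single 1 1) (Ψ 1)) * (0 : Series) =
        -(X 0 * pderiv ℝ 0 (inMap (quasiWt s Δ.2) Ψ 1)) := by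
      rw [mul_zero, eq_comm, neg_eq_zero]
      ext k
      rw [coeff_X_mul_pderiv, LinearMap.map_zero]
      by_contra hne
      by_cases hk1 : k = Finsupp.single 1 1
      · apply left_ne_zero_of_mul hne
        rw [hk1]; simp
      · obtain ⟨e1, e2, e0⟩ := hone k hk1 (right_ne_zero_of_mul hne)
        exact hx ⟨k, (coeff_inPart_ne_zero.1 (right_ne_zero_of_mul hne)).2, e1, e0⟩
    obtain ⟨c, hcm, hc2, hceq⟩ := exists_commuting hI hY hY' h0 h1 h2 (hdg 0) (hdg 1) (hdg 2) hb
      (by simp)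
    have hcne : c ≠ 0 := by
      intro hc0
      have := congr_arg (coeff n) hceq
      rw [hc0, mul_zero, zero_mul, add_zero, map_neg, map_zero, coeff_X_mul_pderiv, inMap,
        coeff_inPart_of_eq] at this
      · exact neg_ne_zero.2 (mul_ne_zero (Nat.cast_ne_zero.2 hn0) hn) this.symm
      · rw [wt_quasiWt, hn2, hns]; simp [quasiWt]
    obtain ⟨g0, g1, g2⟩ := pderiv_two_of_commutes hcm hcne hc2
    have hmI : m ∈ supp (inField (quasiWt s Δ.2) (zwt (quasiWt s (Δ.2 : ℝ)) m) Ω) :=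
      mem_supp_inField.2 ⟨hc.m_mem, rfl⟩
    obtain ⟨j, l, hl, hml⟩ := mem_supp.1 hmI
    have hm2 := hc.one_le hS.good
    have hml2 := congr_fun hml 2
    fin_cases j
    · have := pderiv_eq_zero_iff.1 g0 l hl
      simp [logExp, this] at hml2
      omega
    · have := pderiv_eq_zero_iff.1 g1 l hl
      simp [logExp, this] at hml2
      omega
    · have := le_one_of_pderiv_pderiv g2 hl
      simp [logExp] at hml2
      omega

end HorizontalInvariance

/-! ### From the critical slope to equality of horizontal displacements -/

section HorizontalInvariance

variable {i : ℕ} {Ω Ω' : FormalField} {Ψ : Fin 3 → Series} {U : Series}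
  {h h' m m' : Fin 3 → ℤ} {Δ Δ' : ℚ × ℚ} {C₀ C₀' : WithTop ℚ}

/-- Both kinds of slope are monotone in the exponent, so by Dickson's lemma the set of slopes is
well founded and its infimum is attained. -/
lemma exists_least_slope {d : ℝ} (F G : Series) {r : ℝ}
    (hr : (∃ n, coeff n F ≠ 0 ∧ n 2 = 0 ∧ (n 1 : ℝ) < d ∧ (n 0 : ℝ) / (d - n 1) = r) ∨
      ∃ n, coeff n G ≠ 0 ∧ n 1 = 0 ∧ (n 0 : ℝ) = r) :
    ∃ s, s ≤ r ∧ ((∃ n, coeff n F ≠ 0 ∧ n 2 = 0 ∧ (n 1 : ℝ) < d ∧ (n 0 : ℝ) / (d - n 1) = s) ∨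
      ∃ n, coeff n G ≠ 0 ∧ n 1 = 0 ∧ (n 0 : ℝ) = s) ∧
      (∀ n, coeff n F ≠ 0 → n 2 = 0 → (n 1 : ℝ) < d → s ≤ n 0 / (d - n 1)) ∧
      ∀ n, coeff n G ≠ 0 → n 1 = 0 → s ≤ n 0 := by
  set A : Set (Fin 3 →₀ ℕ) := {n | coeff n F ≠ 0 ∧ n 2 = 0 ∧ (n 1 : ℝ) < d}
  set B : Set (Fin 3 →₀ ℕ) := {n | coeff n G ≠ 0 ∧ n 1 = 0}
  set S : Set ℝ := (fun n => (n 0 : ℝ) / (d - n 1)) '' A ∪ (fun n => (n 0 : ℝ)) '' B with hS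
  have hmem : ∀ x, x ∈ S ↔
      ((∃ n, coeff n F ≠ 0 ∧ n 2 = 0 ∧ (n 1 : ℝ) < d ∧ (n 0 : ℝ) / (d - n 1) = x) ∨
        ∃ n, coeff n G ≠ 0 ∧ n 1 = 0 ∧ (n 0 : ℝ) = x) := by
    intro x
    simp only [hS, A, B, Set.mem_union, Set.mem_image, Set.mem_ofPred_eq, and_assoc]
  have hwf : S.IsWF := by
    refine Set.IsPWO.isWF (Set.IsPWO.union ?_ ?_)
    · refine Set.IsPWO.image_of_monotoneOn (Set.isPWO_of_wellQuasiOrderedLE A) ?_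
      rintro n ⟨-, -, hn⟩ k ⟨-, -, hk⟩ hnk
      have h0 : (n 0 : ℝ) ≤ k 0 := by exact_mod_cast hnk 0
      have h1 : (n 1 : ℝ) ≤ k 1 := by exact_mod_cast hnk 1
      have : 0 < d - k 1 := by linarith
      exact div_le_div₀ (Nat.cast_nonneg _) h0 this (by linarith)
    · refine Set.IsPWO.image_of_monotoneOn (Set.isPWO_of_wellQuasiOrderedLE B) ?_
      intro n _ k _ hnk
      exact Nat.cast_le.2 (hnk 0)
  have hne : S.Nonempty := ⟨r, (hmem r).2 hr⟩
  refine ⟨hwf.min hne, hwf.min_le hne ((hmem r).2 hr), (hmem _).1 (hwf.min_mem hne),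
    fun n h1 h2 h3 => hwf.min_le hne ((hmem _).2 (Or.inl ⟨n, h1, h2, h3, rfl⟩)),
    fun n h1 h2 => hwf.min_le hne ((hmem _).2 (Or.inr ⟨n, h1, h2, rfl⟩))⟩

/-- A violation has a slope below `t`. At the least slope `s` occurring in `Ψ` the change is
compatible and attains equality, which `not_of_critical_slope` excludes. -/
lemma quasiDominates_of_rel (hi : i = 1 ∨ i = 2) (hR : Rel i Ψ U Ω Ω')
    (hS : StableFacts i Ω h m Δ C₀) (hc' : ClassFacts i Ω' h m Δ C₀') (hΔ : Δ.1 = 0) {t : ℝ} (ht : 0 < t)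
    (htC : ∀ c : ℚ, C₀ = c → t ≤ c) (htC' : ∀ c : ℚ, C₀' = c → t ≤ c) :
    QuasiDominates t Δ.2 Ψ := by
  have hd := hS.facts.vert.snd_pos le_rfl hΔ
  -- By `dominates_of_le`, a `z`-free monomial of `Ψ 2` with `y`-exponent below `Δ₂` contains `x`;
  -- this keeps the critical slope positive.
  have hdom : ∀ n, coeff n (Ψ 2) ≠ 0 → n 2 = 0 → (n 1 : ℝ) < Δ.2 → n 0 ≠ 0 := by
    intro n hn h2 h1 h0
    have := dominates_of_le hR hS.good hS.facts hc'
      (by rintro (h | ⟨-, h⟩) <;> exact lt_irrefl _ h) n hn h2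
    rw [h0, hΔ] at this
    rcases this with h | ⟨-, h | ⟨h, -⟩⟩
    · simp at h
    · linarith
    · linarith
  by_contra hno
  obtain ⟨r, hrt, hr⟩ : ∃ r, r < t ∧
      ((∃ n, coeff n (Ψ 2) ≠ 0 ∧ n 2 = 0 ∧ (n 1 : ℝ) < Δ.2 ∧ (n 0 : ℝ) / (Δ.2 - n 1) = r) ∨
        ∃ n, coeff n (Ψ 1) ≠ 0 ∧ n 1 = 0 ∧ (n 0 : ℝ) = r) := by
    rw [QuasiDominates, not_and_or] at hno
    push Not at hno
    rcases hno with ⟨n, hn, h2, hlt⟩ | ⟨n, hn, h1, hlt⟩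
    · have h0 : (0 : ℝ) ≤ n 0 := Nat.cast_nonneg _
      have hlt' : (n 1 : ℝ) < Δ.2 := by
        by_contra hge
        nlinarith
      refine ⟨_, ?_, Or.inl ⟨n, hn, h2, hlt', rfl⟩⟩
      rw [div_lt_iff₀ (by linarith)]
      linarith
    · exact ⟨_, hlt, Or.inr ⟨n, hn, h1, rfl⟩⟩
  obtain ⟨s, hsr, hs, hs2, hs1⟩ := exists_least_slope _ _ hr
  have hst : s < t := by linarith
  have hspos : 0 < s := by
    rcases hs with ⟨n, hn, h2, h1, rfl⟩ | ⟨n, hn, h1, rfl⟩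
    · have := Nat.pos_of_ne_zero (hdom n hn h2 h1)
      have : (0 : ℝ) < n 0 := by exact_mod_cast this
      exact div_pos this (by linarith)
    · have := (hR.fibered.supp1 hn).1
      exact_mod_cast (by omega : 0 < n 0)
  refine not_of_critical_slope hi hR hS hc' hΔ hspos (fun c hc => hst.trans_le (htC c hc))
    (fun c hc => hst.trans_le (htC' c hc)) ⟨fun n hn h2 => ?_, hs1⟩ ?_
  · rcases lt_or_ge (n 1 : ℝ) Δ.2 with h1 | h1
    · have := hs2 n hn h2 h1
      rw [le_div_iff₀ (by linarith)] at this
      linarith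
    · have : (0 : ℝ) ≤ n 0 := Nat.cast_nonneg _
      nlinarith
  · rcases hs with ⟨n, hn, h2, h1, hns⟩ | ⟨n, hn, h1, hns⟩
    · right
      refine ⟨n, hn, h2, hdom n hn h2 h1, ?_⟩
      rw [div_eq_iff (by linarith)] at hns
      linarith
    · exact Or.inl ⟨n, hn, h1, hns⟩

/-- A series with finitely many monomials in `x` and `y` as a polynomial. -/
lemma exists_mvPolynomial {G : Series} (N : ℕ)
    (hG : ∀ n, coeff n G ≠ 0 → n 2 = 0 ∧ n 0 ≤ N ∧ n 1 ≤ N) :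
    ∃ f : MvPolynomial (Fin 2) ℝ, MvPolynomial.aeval ![X 0, X 1] f = G ∧
      ∀ n, n ∈ f.support → coeff (xyExp (n 0) (n 1)) G ≠ 0 := by
  classical
  set e : ℕ × ℕ → Fin 2 →₀ ℕ := fun p => Finsupp.equivFunOnFinite.symm ![p.1, p.2] with he
  have e0 : ∀ p, e p 0 = p.1 := fun _ => rfl
  have e1 : ∀ p, e p 1 = p.2 := fun _ => rfl
  refine ⟨∑ p ∈ Finset.range (N + 1) ×ˢ Finset.range (N + 1),
    MvPolynomial.monomial (e p) (coeff (xyExp p.1 p.2) G), ?_, fun n hn => ?_⟩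
  · have hm : ∀ p : ℕ × ℕ, (MvPolynomial.aeval ![(X 0 : Series), X 1]
        (MvPolynomial.monomial (e p) (coeff (xyExp p.1 p.2) G))) =
        monomial (xyExp p.1 p.2) (coeff (xyExp p.1 p.2) G) := by
      intro p
      rw [MvPolynomial.aeval_monomial, Finsupp.prod_fintype _ _ (fun _ => pow_zero _),
        Fin.prod_univ_two, monomial_xyExp, e0, e1]
      simp [MvPowerSeries.algebraMap_apply]
    rw [map_sum]
    simp only [hm]
    ext k
    rw [map_sum]
    simp only [coeff_monomial]
    by_cases hk : coeff k G = 0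
    · rw [hk]
      refine Finset.sum_eq_zero fun p _ => ?_
      split_ifs with h
      · rw [← h, hk]
      · rfl
    · obtain ⟨h2, h0, h1⟩ := hG k hk
      have hkx : k = xyExp (k 0) (k 1) := finsupp_ext3 (by simp) (by simp) (by simp [h2])
      rw [Finset.sum_eq_single (k 0, k 1)]
      · rw [if_pos hkx, ← hkx]
      · intro p _ hp
        rw [if_neg]
        rintro rfl
        exact hp (by simp)
      · intro h
        exact absurd (by simp; omega) h
  · rw [MvPolynomial.mem_support_iff, MvPolynomial.coeff_sum] at hn
    obtain ⟨p, -, hp⟩ := Finset.exists_ne_zero_of_sum_ne_zero hn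
    rw [MvPolynomial.coeff_monomial] at hp
    split_ifs at hp with h
    · rw [← h, e0, e1]; exact hp
    · exact absurd rfl hp

/-- Positive weights leave finitely many monomials in each lowest part; after division by the
diagonal coefficients it is a polynomial change of the type used to test stability. -/
lemma exists_polyMap_eq_inMap (hΨ : Fibered i Ψ) {c d : ℝ} (hc : 0 < c) (hd : 0 < d) :
    ∃ (f : MvPolynomial (Fin 2) ℝ) (g : Polynomial ℝ),
      (∀ n ∈ f.support, (n 0 : ℝ) + n 1 * c = c * d) ∧ (∀ k ∈ g.support, (k : ℝ) = c) ∧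
      (i = 2 → g = 0) ∧
      ∀ j, inMap (quasiWt c d) Ψ j = C (coeff (Finsupp.single j 1) (Ψ j)) * polyMap f g j := by
  classical
  have hdg := hΨ.diag
  have hCC : ∀ (j : Fin 3) (F : Series), C (coeff (Finsupp.single j 1) (Ψ j)) *
      (C ((coeff (Finsupp.single j 1) (Ψ j))⁻¹) * F) = F := by
    intro j F
    rw [← mul_assoc, ← map_mul, mul_inv_cancel₀ (hdg j), map_one, one_mul]
  have hsub : ∀ j n, coeff n (C ((coeff (Finsupp.single j 1) (Ψ j))⁻¹) *
      inMap (quasiWt c d) Ψ j - X j) ≠ 0 →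
      n ≠ Finsupp.single j 1 ∧ coeff n (inMap (quasiWt c d) Ψ j) ≠ 0 := by
    intro j n hn
    rw [map_sub, coeff_C_mul, coeff_X] at hn
    by_cases h : n = Finsupp.single j 1
    · rw [if_pos h, h, coeff_single_inMap, inv_mul_cancel₀ (hdg j), sub_self] at hn
      exact absurd rfl hn
    · rw [if_neg h, sub_zero] at hn
      exact ⟨h, right_ne_zero_of_mul hn⟩
  obtain ⟨N, hN⟩ := exists_nat_ge (max (c * d) d)
  have hN1 := (le_max_left _ _).trans hN
  have hN2 := (le_max_right _ _).trans hN
  obtain ⟨f, hf, hfs⟩ := exists_mvPolynomial (G := C ((coeff (Finsupp.single 2 1) (Ψ 2))⁻¹) *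
      inMap (quasiWt c d) Ψ 2 - X 2) N (by
    intro n hn
    obtain ⟨h1, h2⟩ := hsub 2 n hn
    obtain ⟨h3, h4⟩ := (coeff_inMap_quasiWt_two hc hd h2).resolve_left h1
    have a0 : (0 : ℝ) ≤ n 0 := Nat.cast_nonneg _
    have a1 : (0 : ℝ) ≤ n 1 := Nat.cast_nonneg _
    refine ⟨h3, ?_, ?_⟩
    · have : (n 0 : ℝ) ≤ N := by nlinarith
      exact_mod_cast this
    · have : (n 1 : ℝ) ≤ N := by nlinarith
      exact_mod_cast this)
  obtain ⟨g, hg, hgs, hgi⟩ : ∃ g : Polynomial ℝ, (Polynomial.aeval (X 0) g : Series) =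
      C ((coeff (Finsupp.single 1 1) (Ψ 1))⁻¹) * inMap (quasiWt c d) Ψ 1 - X 1 ∧
      (∀ k ∈ g.support, (k : ℝ) = c) ∧ (i = 2 → g = 0) := by
    set G : Series := C ((coeff (Finsupp.single 1 1) (Ψ 1))⁻¹) * inMap (quasiWt c d) Ψ 1 - X 1
    have hG : ∀ n, coeff n G ≠ 0 → n 1 = 0 ∧ n 2 = 0 ∧ (n 0 : ℝ) = c ∧ i ≠ 2 := by
      intro n hn
      obtain ⟨h1, h2⟩ := hsub 1 n hn
      obtain ⟨h3, h4, h5⟩ := (coeff_inMap_quasiWt_one hΨ hc h2).resolve_left h1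
      refine ⟨h3, h4, h5, fun h => ?_⟩
      have := X_dvd_iff_coeff.1 (hΨ.y1 h) n (coeff_inPart_ne_zero.1 h2).2
      omega
    by_cases hz : ∃ n, coeff n G ≠ 0
    · obtain ⟨n, hn⟩ := hz
      obtain ⟨h1, h2, h0, hi⟩ := hG n hn
      refine ⟨Polynomial.monomial (n 0) (coeff n G), ?_, fun k hk => ?_, fun h => absurd h hi⟩
      · rw [Polynomial.aeval_monomial, eq_monomial_of (F := G) (n := n) fun k hk => ?_]
        · have hna : n = Finsupp.single 0 (n 0) :=
            finsupp_ext3 (by simp) (by simp [h1]) (by simp [h2])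
          rw [coeff_monomial, if_pos rfl, MvPowerSeries.algebraMap_apply, X_pow_eq,
            ← monomial_zero_eq_C_apply, monomial_mul_monomial, zero_add, mul_one, ← hna]
          rfl
        · obtain ⟨k1, k2, k0, -⟩ := hG k hk
          refine finsupp_ext3 ?_ (k1.trans h1.symm) (k2.trans h2.symm)
          exact_mod_cast k0.trans h0.symm
      · rw [Polynomial.mem_support_iff, Polynomial.coeff_monomial] at hk
        split_ifs at hk with h
        · rw [← h]; exact h0
        · exact absurd rfl hk
    · push Not at hz
      exact ⟨0, by rw [map_zero]; ext n; rw [hz n, LinearMap.map_zero], by simp, fun _ => rfl⟩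
  refine ⟨f, g, fun n hn => ?_, hgs, hgi, fun j => ?_⟩
  · obtain ⟨h1, h2⟩ := hsub 2 _ (hfs n hn)
    have := ((coeff_inMap_quasiWt_two hc hd h2).resolve_left h1).2
    simpa using this
  · fin_cases j
    · exact inMap_quasiWt_zero hΨ hc
    · change _ = _ * (X 1 + Polynomial.aeval (X 0) g)
      rw [hg, add_sub_cancel]
      exact (hCC 1 _).symm
    · change _ = _ * (X 2 + MvPolynomial.aeval ![X 0, X 1] f)
      rw [hf, add_sub_cancel]
      exact (hCC 2 _).symm

/-- At slope `C₀` the lowest part of `Ψ` is an allowed change up to a diagonal map. By stability the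
image keeps a support point of negative displacement on the supporting plane of the main side. It
also belongs to `Ω'`, where a larger `C₀'` leaves only points of zero displacement on that plane. -/
lemma not_lt_of_rel (hi : i = 1 ∨ i = 2) (hR : Rel i Ψ U Ω Ω')
    (hS : StableFacts i Ω h m Δ C₀) (hc' : ClassFacts i Ω' h m Δ C₀') (hΔ : Δ.1 = 0) :
    ¬ C₀ < C₀' := by
  intro hlt
  have hc := hS.facts
  have hd := hc.vert.snd_pos le_rfl hΔ
  obtain ⟨c, rfl⟩ : ∃ c : ℚ, C₀ = c := ⟨_, (WithTop.coe_untop C₀ hlt.ne_top).symm⟩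
  have hcc : ∀ x : ℚ, ((c : ℚ) : WithTop ℚ) = x → (c : ℝ) ≤ x := fun x hx => by
    rw [WithTop.coe_inj.1 hx]
  have hlt' : ∀ x : ℚ, C₀' = x → (c : ℝ) < x := fun x hx => by
    rw [hx] at hlt
    exact_mod_cast WithTop.coe_lt_coe.1 hlt
  obtain ⟨hcpos, hnn, -⟩ := (hc.hor.fin c rfl).resolve_left (fun h => h.1.ne' hΔ) |>.2
  have hcpos' : (0 : ℝ) < c := by exact_mod_cast hcpos
  have hq := quasiDominates_of_rel hi hR hS hc' hΔ hcpos' hcc fun x hx => (hlt' x hx).le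
  have hw := quasiWt_pos hcpos' hd
  have hf : FiltField (quasiWt c Δ.2) (zwt (quasiWt (c : ℝ) (Δ.2 : ℝ)) m) Ω :=
    hc.filtField_quasiWt fun v hv => by
      simpa [intVec_apply] using hnn _ (intVec_mem hv)
  obtain ⟨f, g, hfs, hgs, hgi, hin⟩ := exists_polyMap_eq_inMap hR.fibered hcpos' hd
  have hfg : (f, g) ∈ faceGroup i Δ c := by
    refine ⟨fun n hn => Or.inr ?_, fun k hk => ⟨hΔ, ?_⟩, hgi⟩
    · have e : (n 0 : ℚ) + n 1 * c = c * Δ.2 := by exact_mod_cast hfs n hn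
      refine ⟨hΔ, c, rfl, Δ.2 - n 1, ?_, ?_⟩
      · have : (0 : ℚ) ≤ n 0 := Nat.cast_nonneg _
        by_contra hneg
        nlinarith [not_le.1 hneg]
      · refine Prod.ext ?_ ?_
        · simp only [Prod.fst_add, Prod.smul_fst, smul_eq_mul, hΔ]
          linarith
        · simp
    · have : (k : ℚ) = c := by exact_mod_cast hgs k hk
      rw [this]
  have hf0 : f.coeff 0 = 0 := by
    by_contra hne
    have := hfs 0 (MvPolynomial.mem_support_iff.2 hne)
    simp at this
    rcases this with h | h
    · exact hcpos.ne' h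
    · rw [h] at hd; simp at hd
  have hg0 : g.coeff 0 = 0 := by
    by_contra hne
    have := hgs 0 (Polynomial.mem_support_iff.2 hne)
    simp at this
    exact hcpos'.ne this
  obtain ⟨Ω'', hT, hC''⟩ := hS.stab f g hfg hf0 hg0
  obtain ⟨-, g2⟩ := hR.coeff_eq_zero_iff hw (hR.fibered.compat_quasiWt hcpos' hd hq) hf
    hR.fibered.diag hin hT
  obtain ⟨q, hq, hq0, hq1⟩ := ((hC''.hor.fin c rfl).resolve_left (fun h => h.1.ne' hΔ)).2.2.2
  have hqI : q ∈ supp (inField (quasiWt c Δ.2) (zwt (quasiWt (c : ℝ) (Δ.2 : ℝ)) m) Ω') := by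
    rw [← supp_eq_of_coeff g2]
    exact mem_supp_inField.2 ⟨hq, hc.zwt_quasiWt_eq_iff.2 hq0⟩
  have := ((hc'.below_slope hΔ hcpos' hlt' (mem_supp_inField.1 hqI).1).2 hq0).2
  linarith

/-- Main vertex and displacements are invariants of stable Newton data. -/
lemma StableFacts.eq_of_rel (hi : i = 1 ∨ i = 2) (hR : Rel i Ψ U Ω Ω')
    (hS : StableFacts i Ω h m Δ C₀) (hS' : StableFacts i Ω' h' m' Δ' C₀') :
    h = h' ∧ m = m' ∧ Δ = Δ' ∧ C₀ = C₀' := by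
  obtain ⟨Θ, hΘ, h1, -⟩ := hR.fibered.isFormalCoordinates.exists_inverse
  obtain ⟨U', hR'⟩ := hR.symm hΘ h1
  obtain rfl := hS.facts.hv.eq_of_rel hR hS'.facts.hv
  obtain rfl := mainVertex_eq_of_rel hR hS hS'
  obtain rfl := displacement_eq_of_rel hR hS hS'
  refine ⟨rfl, rfl, rfl, ?_⟩
  by_cases hΔ : Δ.1 = 0
  · exact le_antisymm (not_lt.1 (not_lt_of_rel hi hR' hS' hS.facts hΔ))
      (not_lt.1 (not_lt_of_rel hi hR hS hS'.facts hΔ))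
  -- For `Δ.1 ≠ 0` the definition leaves only `C = 0`.
  · have key : ∀ {Ω : FormalField} {C₁ : WithTop ℚ}, HorFacts Ω m Δ C₁ → C₁ = ((0 : ℚ) : WithTop ℚ) := by
      intro Ω C₁ hh
      rcases C₁ with _ | c
      · exact absurd (hh.top rfl).1 hΔ
      · rcases hh.fin c rfl with ⟨-, h⟩ | ⟨h, -⟩
        · rw [h]; rfl
        · exact absurd h hΔ
    rw [key hS.facts.hor, key hS'.facts.hor]

end HorizontalInvariance

/-! ### Orbits and transition maps -/

section Transition

variable {K : ControlledGerm} {Φ Φ' : Fin 3 → Series} {Ω Ω' : FormalField} {i : ℕ}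

lemma DependsOnlyOn.pderiv_eq_zero {s : Set (Fin 3)} {F : Series} (h : DependsOnlyOn s F)
    {k : Fin 3} (hk : k ∉ s) : pderiv ℝ k F = 0 :=
  pderiv_eq_zero_iff.2 fun n hn => h n hn k hk

lemma fibered_of_mem_formalGroup {Ψ : Fin 3 → Series} (h : Ψ ∈ formalGroup i) : Fibered i Ψ := by
  obtain ⟨f, g, u, v, w, hf, hg, hu, hv, f0, g0, uu, uv, uw, hi, rfl⟩ := h
  rw [isUnit_iff_constantCoeff_ne_zero] at uu uv uw
  have n2 : (2 : Fin 3) ∉ ({0, 1} : Set (Fin 3)) := by simp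
  have n2' : (2 : Fin 3) ∉ ({0} : Set (Fin 3)) := by simp
  have n1' : (1 : Fin 3) ∉ ({0} : Set (Fin 3)) := by simp
  have z0 : pderiv ℝ 2 (X 0 * u) = 0 := by
    simp [Derivation.leibniz, hu.pderiv_eq_zero n2, pderiv_X]
  have z1 : pderiv ℝ 2 (g + X 1 * v) = 0 := by
    simp [Derivation.leibniz, hv.pderiv_eq_zero n2, hg.pderiv_eq_zero n2', pderiv_X]
  refine ⟨fun j => ?_, z0, z1, dvd_mul_right _ _, fun h => ?_, ?_⟩
  · fin_cases j <;> simp [f0, g0]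
  · simp [hi h]
  · rw [jacobian_triangular z0 z1 (dvd_mul_right _ _)]
    simp only [← coeff_single_eq, Matrix.cons_val]
    refine mul_ne_zero (mul_ne_zero ?_ ?_) ?_
    · simpa [Derivation.leibniz] using uu
    · simpa [Derivation.leibniz, hg.pderiv_eq_zero n1'] using uv
    · simpa [Derivation.leibniz, hf.pderiv_eq_zero n2] using uw

lemma eq_of_sameOrbit (hK : K.Nonelementary) (hN : K.IsNewtonData Φ Ω)
    (hO : SameOrbit K.i Ω Ω') {m m' : Fin 3 → ℤ} {Δ Δ' : ℚ × ℚ} {C₀ C₀' : WithTop ℚ}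
    (hS : IsStable K.i Ω m Δ C₀) (hS' : IsStable K.i Ω' m' Δ' C₀') :
    m = m' ∧ Δ = Δ' ∧ C₀ = C₀' := by
  obtain ⟨Ψ, hΨ, hT⟩ := hO
  have hF := fibered_of_mem_formalGroup hΨ
  obtain ⟨h, hf⟩ := hS.facts rfl hK hN
  obtain ⟨h', hf'⟩ := hS'.facts rfl hK (IsNewtonData.transform rfl hN hF hT)
  exact (hf.eq_of_rel K.i_eq (rel_of_isTransform hF hT) hf').2

/-- The transition is `Φ' ∘ Φ⁻¹`. It is fibered because both charts straighten the axis up to a unit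
and define the same divisor; the quotient of the two generators supplies `U`. -/
lemma exists_transition (hN : K.IsNewtonData Φ Ω) (hN' : K.IsNewtonData Φ' Ω') :
    ∃ φ U, IsTransition Φ Φ' φ ∧ Rel K.i φ U Ω Ω' := by
  obtain ⟨hA, χ₁, ⟨h₁, hp₁, hχ₁⟩, hT⟩ := hN
  obtain ⟨hA', χ₂, ⟨h₂, hp₂, hχ₂⟩, hT'⟩ := hN'
  have hF := hA.coordinates
  have h0 := hF.1
  have hs := hasSubst h0
  obtain ⟨Θ, hΘ, hΘ1, hΘ2⟩ := hF.exists_inverse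
  set φ : Fin 3 → Series := fun j => (Φ' j).subst Θ with hφ
  have φ0 : ∀ j, constantCoeff (φ j) = 0 := fun j => by
    rw [hφ, constantCoeff_subst_eq hΘ.1, hA'.coordinates.1]
  have hφΦ : ∀ j, (φ j).subst Φ = Φ' j := fun j => by
    rw [hφ]
    simp only
    rw [subst_subst hΘ.1 h0, show (fun j => (Θ j).subst Φ) = fun j => X j from funext hΘ1,
      subst_X_eq]
  have hu₁ : IsUnit (h₁ : Series) := isUnit_iff_constantCoeff_ne_zero.2 hp₁.ne'
  have hu₂ : IsUnit (h₂ : Series) := isUnit_iff_constantCoeff_ne_zero.2 hp₂.ne'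
  obtain ⟨U, hU⟩ := hF.exists_subst_eq ((h₂ : Series) * ↑(hu₁.unit⁻¹))
  have hζ : ∀ j, (toFormal K.ζ).act (Φ' j) =
      (pderiv ℝ 2 (φ j)).subst Φ * (toFormal K.ζ).act (Φ 2) := by
    intro j
    rw [← hφΦ, act_subst _ h0, Fin.sum_univ_three, hA.axis_x, hA.axis_y]
    ring
  have hdvd : ∀ k, IsDivisorIndex K.i k → X k ∣ φ k := by
    intro k hk
    refine hF.dvd_of_subst_dvd ?_
    rw [subst_X hs, hφΦ]
    exact ((hA.divisor k hk).trans (hA'.divisor k hk).symm).dvd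
  refine ⟨φ, U, ⟨φ0, fun j => (hφΦ j).symm⟩, ⟨φ0, ?_, ?_, ?_, ?_, ?_⟩, ?_, fun j => ?_⟩
  · have := hζ 0
    rw [hA'.axis_x] at this
    exact hF.subst_eq_zero ((mul_eq_zero.1 this.symm).resolve_right hA.axis_z.ne_zero)
  · have := hζ 1
    rw [hA'.axis_y] at this
    exact hF.subst_eq_zero ((mul_eq_zero.1 this.symm).resolve_right hA.axis_z.ne_zero)
  · exact hdvd 0 (by have := K.one_le; simp [IsDivisorIndex]; omega)
  · exact fun h => hdvd 1 (by simp [IsDivisorIndex, h])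
  · have := hA'.coordinates.2
    rw [← funext hφΦ, jacobian_subst h0, Matrix.det_mul] at this
    exact left_ne_zero_of_mul this
  · rw [← isUnit_subst h0, hU]
    exact hu₂.mul (Units.isUnit _)
  · apply hF.subst_injective
    have e₁ : ∀ F, (toFormal χ₁).act F = (h₁ : Series) * (toFormal K.χ).act F := fun F => by
      rw [← act_smul]
      congr 1
      funext k
      simp only [toFormal, hχ₁, Subring.coe_mul]
    have e₂ : ∀ F, (toFormal χ₂).act F = (h₂ : Series) * (toFormal K.χ).act F := fun F => by
      rw [← act_smul]
      congr 1
      funext k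
      simp only [toFormal, hχ₂, Subring.coe_mul]
    rw [subst_mul hs, ← subst_act h0 hT, hφΦ, subst_subst φ0 h0, funext hφΦ, ← hT' j, hU, e₁, e₂]
    calc _ = (h₂ : Series) * (↑(hu₁.unit⁻¹) * (h₁ : Series)) * (toFormal K.χ).act (Φ' j) := by ring
      _ = _ := by rw [IsUnit.val_inv_mul, mul_one]

end Transition

/-! ### Weight vectors -/

section WeightVector

variable {i : ℕ} {Ω Ω' : FormalField} {Ψ : Fin 3 → Series} {U : Series}
  {h m : Fin 3 → ℤ} {Δ : ℚ × ℚ} {C₀ C₀' : WithTop ℚ} {ω ω' : Fin 3 → ℕ}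

/-- The primitive weight vectors which are orthogonal to the directions `(Δ, -1)` of the main edge
and `(C, -1, 0)` of the main side. -/
structure IsPrimitiveNormal (Δ : ℚ × ℚ) (C₀ : WithTop ℚ) (ω : Fin 3 → ℕ) : Prop where
  ne_zero : ω ≠ 0
  gcd : Finset.univ.gcd ω = 1
  edge : (ω 2 : ℚ) = ω 0 * Δ.1 + ω 1 * Δ.2
  side_top : C₀ = ⊤ → ω 0 = 0
  side : ∀ c : ℚ, C₀ = c → (ω 1 : ℚ) = c * ω 0

/-- Taking gcds of the proportionality gives `ω k₀ = ω' k₀`, both vectors being primitive. -/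
lemma eq_of_cross {k₀ : Fin 3} (hk : ω k₀ ≠ 0) (hω : Finset.univ.gcd ω = 1)
    (hω' : Finset.univ.gcd ω' = 1) (h : ∀ k, ω k₀ * ω' k = ω' k₀ * ω k) : ω' = ω := by
  have h1 := Finset.gcd_mul_left (s := Finset.univ) (f := ω') (a := ω k₀)
  have h2 := Finset.gcd_mul_left (s := Finset.univ) (f := ω) (a := ω' k₀)
  rw [hω', mul_one, normalize_eq] at h1
  rw [hω, mul_one, normalize_eq] at h2
  rw [funext h, h2] at h1
  funext k
  have := h k
  rw [h1] at this
  exact mul_left_cancel₀ hk this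

lemma IsPrimitiveNormal.unique (h : IsPrimitiveNormal Δ C₀ ω) (h' : IsPrimitiveNormal Δ C₀ ω') :
    ω' = ω := by
  have e := h.edge
  have e' := h'.edge
  rcases C₀ with _ | c
  · have a := h.side_top rfl
    have a' := h'.side_top rfl
    have hne : ω 1 ≠ 0 := by
      intro h1
      refine h.ne_zero (ext3 a h1 ?_)
      rw [a, h1] at e
      simpa using e
    refine eq_of_cross hne h.gcd h'.gcd fun k => ?_
    fin_cases k
    · simp [a, a']
    · exact mul_comm _ _
    · have : (ω 1 : ℚ) * ω' 2 = ω' 1 * ω 2 := by rw [e, e', a, a']; push_cast; ring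
      exact_mod_cast this
  · have a := h.side c rfl
    have a' := h'.side c rfl
    have hne : ω 0 ≠ 0 := by
      intro h0
      rw [h0] at a e
      have h1 : ω 1 = 0 := by simpa using a
      refine h.ne_zero (ext3 h0 h1 ?_)
      rw [h1] at e
      simpa using e
    refine eq_of_cross hne h.gcd h'.gcd fun k => ?_
    fin_cases k
    · exact mul_comm _ _
    · have : (ω 0 : ℚ) * ω' 1 = ω' 0 * ω 1 := by rw [a, a']; ring
      exact_mod_cast this
    · have : (ω 0 : ℚ) * ω' 2 = ω' 0 * ω 2 := by rw [e, e', a, a']; ring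
      exact_mod_cast this

/-- Clear the denominators and divide by the gcd. -/
lemma exists_primitive {q : Fin 3 → ℚ} (hq : ∀ k, 0 ≤ q k) (hne : ∃ k, q k ≠ 0) :
    ∃ ω : Fin 3 → ℕ, ω ≠ 0 ∧ Finset.univ.gcd ω = 1 ∧ ∃ r : ℚ, ∀ k, (ω k : ℚ) = r * q k := by
  set f : Fin 3 → ℕ := fun k => (q k).num.toNat * ∏ j ∈ Finset.univ.erase k, (q j).den with hf
  have hfq : ∀ k, (f k : ℚ) = (∏ j, (q j).den : ℕ) * q k := by
    intro k
    have h1 : (((q k).num.toNat : ℕ) : ℚ) = (q k).num := by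
      exact_mod_cast Int.toNat_of_nonneg (Rat.num_nonneg.2 (hq k))
    rw [hf, ← Finset.mul_prod_erase Finset.univ _ (Finset.mem_univ k)]
    push_cast
    rw [h1]
    have h2 : ((q k).den : ℚ) * q k = (q k).num := by rw [mul_comm]; exact Rat.mul_den_eq_num _
    rw [mul_right_comm, h2]
  obtain ⟨g, hg, hg1⟩ := Finset.extract_gcd f (Finset.univ_nonempty (α := Fin 3))
  have hG : Finset.univ.gcd f ≠ 0 := by
    obtain ⟨k, hk⟩ := hne
    intro h0
    have := Finset.gcd_eq_zero_iff.1 h0 k (Finset.mem_univ k)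
    have h3 := hfq k
    rw [this] at h3
    have hD : ((∏ j, (q j).den : ℕ) : ℚ) ≠ 0 := by
      exact_mod_cast (Finset.prod_pos fun j _ => (q j).den_pos).ne'
    exact mul_ne_zero hD hk (by simpa using h3.symm)
  refine ⟨g, ?_, hg1, ((∏ j, (q j).den : ℕ) : ℚ) / Finset.univ.gcd f, fun k => ?_⟩
  · rintro rfl
    have : Finset.univ.gcd (0 : Fin 3 → ℕ) = 0 := Finset.gcd_eq_zero_iff.2 fun _ _ => rfl
    rw [this] at hg1
    exact zero_ne_one hg1
  · have h1 := hfq k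
    rw [hg k (Finset.mem_univ k)] at h1
    have hG' : ((Finset.univ.gcd f : ℕ) : ℚ) ≠ 0 := by exact_mod_cast hG
    push_cast at h1 ⊢
    field_simp
    linarith

/-- The orthogonality relations are solved by the ray of `(0, 1, Δ₂)` if `C = ∞`, and of `(1, C, Δ₁
+ C Δ₂)` otherwise. -/
lemma ClassFacts.exists_isPrimitiveNormal (hc : ClassFacts i Ω h m Δ C₀) :
    ∃ ω, IsPrimitiveNormal Δ C₀ ω := by
  rcases C₀ with _ | c
  · have hΔ := (hc.hor.top rfl).1
    have hd : 0 < Δ.2 := by exact_mod_cast hc.vert.snd_pos le_rfl hΔ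
    obtain ⟨ω, h0, h1, r, hr⟩ := exists_primitive (q := ![0, 1, Δ.2])
      (fun k => by fin_cases k <;> simp [hd.le]) ⟨1, by simp⟩
    have e0 := hr 0
    have e1 := hr 1
    have e2 := hr 2
    simp only [Matrix.cons_val] at e0 e1 e2
    refine ⟨ω, h0, h1, ?_, fun _ => ?_, fun c hc => absurd hc (by exact WithTop.top_ne_coe)⟩
    · rw [e0, e1, e2]; ring
    · rw [mul_zero] at e0; exact_mod_cast e0
  · have hnn : 0 ≤ c ∧ 0 ≤ Δ.1 + c * Δ.2 := by
      rcases hc.hor.fin c rfl with ⟨h1, rfl⟩ | ⟨h1, h2, -⟩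
      · exact ⟨le_rfl, by simpa using h1.le⟩
      · have hd : 0 < Δ.2 := by exact_mod_cast hc.vert.snd_pos le_rfl h1
        exact ⟨h2.le, by rw [h1]; positivity⟩
    obtain ⟨ω, h0, h1, r, hr⟩ := exists_primitive (q := ![1, c, Δ.1 + c * Δ.2])
      (fun k => by fin_cases k <;> simp [hnn.1, hnn.2]) ⟨0, by simp⟩
    have e0 := hr 0
    have e1 := hr 1
    have e2 := hr 2
    simp only [Matrix.cons_val] at e0 e1 e2
    refine ⟨ω, h0, h1, ?_, fun h => absurd h (by exact WithTop.coe_ne_top), fun c' hc' => ?_⟩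
    · rw [e0, e1, e2]; ring
    · have : c = c' := WithTop.coe_inj.1 hc'
      rw [← this, e0, e1]; ring

lemma pairing_eq (ω : Fin 3 → ℕ) (v : Fin 3 → ℝ) :
    pairing ω v = ω 0 * v 0 + ω 1 * v 1 + ω 2 * v 2 := by
  rw [pairing, Fin.sum_univ_three]

lemma IsPrimitiveNormal.pairing_sub (hω : IsPrimitiveNormal Δ C₀ ω) (n v : Fin 3 → ℝ) :
    pairing ω v - pairing ω n = ω 0 * disp Δ.1 n v 0 + ω 1 * disp Δ.2 n v 1 := by
  have e : (ω 2 : ℝ) = ω 0 * Δ.1 + ω 1 * Δ.2 := by exact_mod_cast hω.edge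
  rw [pairing_eq, pairing_eq, e, disp, disp]
  ring

lemma ClassFacts.pairing_le (hc : ClassFacts i Ω h m Δ C₀) (hω : IsPrimitiveNormal Δ C₀ ω)
    {v : Fin 3 → ℝ} (hv : v ∈ newtonPolyhedron Ω) : pairing ω (intVec m) ≤ pairing ω v := by
  rw [← sub_nonneg, hω.pairing_sub]
  rcases C₀ with _ | c
  · have := (hc.hor.top rfl).2 v hv
    rw [hω.side_top rfl]
    push_cast
    rw [zero_mul, zero_add]
    positivity
  · have hs : (ω 1 : ℝ) = c * ω 0 := by exact_mod_cast hω.side c rfl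
    have h0 : (0 : ℝ) ≤ ω 0 := Nat.cast_nonneg _
    rw [hs]
    rcases hc.hor.fin c rfl with ⟨h1, rfl⟩ | ⟨h1, h2, h3, -⟩
    · have h4 : 0 ≤ disp Δ.1 (intVec m) v 0 := by
        rcases hc.vert.nonneg v hv with h | ⟨h, -⟩
        · exact h.le
        · exact h.ge
      simp only [Rat.cast_zero, zero_mul, add_zero]
      positivity
    · have h4 := h3 v hv
      have h5 : disp Δ.1 (intVec m) v 0 = v 0 := by
        simp [disp, intVec_apply, hc.m0, h1]
      rw [h5]
      nlinarith [mul_nonneg h0 h4]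

lemma pairing_edgeDir (ω : Fin 3 → ℕ) :
    pairing ω (edgeDir Δ) = ω 0 * Δ.1 + ω 1 * Δ.2 - ω 2 := by
  rw [pairing_eq]; simp [edgeDir]; ring

lemma pairing_add_smul (ω : Fin 3 → ℕ) (v w : Fin 3 → ℝ) (t : ℝ) :
    pairing ω (v + t • w) = pairing ω v + t * pairing ω w := by
  simp only [pairing_eq, Pi.add_apply, Pi.smul_apply, smul_eq_mul]
  ring

lemma pairing_sideDir_top (ω : Fin 3 → ℕ) : pairing ω (sideDir ⊤) = ω 0 := by
  rw [pairing_eq]; simp [sideDir]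

lemma pairing_sideDir_coe (ω : Fin 3 → ℕ) (c : ℚ) :
    pairing ω (sideDir (c : WithTop ℚ)) = ω 0 * c - ω 1 := by
  rw [pairing_eq]; simp [sideDir]; ring

lemma IsPrimitiveNormal.pairing_sideDir (hω : IsPrimitiveNormal Δ C₀ ω) :
    pairing ω (sideDir C₀) = 0 := by
  rcases C₀ with _ | c
  · have := pairing_sideDir_top ω
    rw [hω.side_top rfl] at this
    exact_mod_cast this
  · have hs : (ω 1 : ℝ) = c * ω 0 := by exact_mod_cast hω.side c rfl
    refine (pairing_sideDir_coe ω c).trans ?_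
    rw [hs]; ring

lemma IsPrimitiveNormal.pairing_derivedVertex (hω : IsPrimitiveNormal Δ C₀ ω) (n : Fin 3 → ℝ) :
    pairing ω (derivedVertex n Δ) = pairing ω n := by
  have e : (ω 2 : ℝ) = ω 0 * Δ.1 + ω 1 * Δ.2 := by exact_mod_cast hω.edge
  rw [derivedVertex, pairing_add_smul, pairing_edgeDir, e]
  ring

lemma IsPrimitiveNormal.exists_smul_sideDir (hω : IsPrimitiveNormal Δ C₀ ω) {w : Fin 3 → ℝ}
    (h2 : w 2 = 0) (hw : pairing ω w = 0) : ∃ t : ℝ, w = t • sideDir C₀ := by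
  have e := hω.edge
  rw [pairing_eq, h2, mul_zero, add_zero] at hw
  rcases C₀ with _ | c
  · have a := hω.side_top rfl
    have hne : (ω 1 : ℝ) ≠ 0 := by
      intro h1
      have h1 : ω 1 = 0 := by exact_mod_cast h1
      refine hω.ne_zero (ext3 a h1 ?_)
      rw [a, h1] at e
      simpa using e
    rw [a] at hw
    have h1 : w 1 = 0 := by simpa [hne] using hw
    refine ⟨w 0, ?_⟩
    change w = w 0 • ![1, 0, 0]
    exact ext3 (by simp) (by simp [h1]) (by simp [h2])
  · have a := hω.side c rfl
    have hne : (ω 0 : ℝ) ≠ 0 := by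
      intro h0
      have h0 : ω 0 = 0 := by exact_mod_cast h0
      rw [h0] at a e
      have h1 : ω 1 = 0 := by simpa using a
      refine hω.ne_zero (ext3 h0 h1 ?_)
      rw [h1] at e
      simpa using e
    have a' : (ω 1 : ℝ) = c * ω 0 := by exact_mod_cast a
    have h0 : w 0 + c * w 1 = 0 := by
      apply mul_left_cancel₀ hne
      rw [mul_zero, ← hw, a']
      ring
    refine ⟨-w 1, ?_⟩
    change w = (-w 1) • ![(c : ℝ), -1, 0]
    exact ext3 (by simp; linarith) (by simp) (by simp [h2])

lemma derivedVertex_mem_mainSide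
    (hΔ : IsVerticalDisplacement (newtonPolyhedron Ω) (intVec m) Δ) :
    derivedVertex (intVec m) Δ ∈ mainSide (newtonPolyhedron Ω) (intVec m) Δ C₀ :=
  ⟨hΔ.1, 0, by simp⟩

/-- Inside the derived plane the kernel of the form is spanned by the side direction, so the face
meets the derived polygon in the main side and nothing else. -/
lemma IsPrimitiveNormal.isWeight (hg : ClassFacts i Ω h m Δ C₀) (hω : IsPrimitiveNormal Δ C₀ ω)
    {μ : ℤ} (hμ : (μ : ℝ) = pairing ω (intVec m)) : IsWeight Ω m Δ C₀ ω μ := by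
  refine ⟨hω.ne_zero, hω.gcd, fun v hv => hμ ▸ hg.pairing_le hω hv, ?_⟩
  ext v
  constructor
  · rintro ⟨⟨-, hv⟩, hv'⟩
    refine ⟨hv', ?_⟩
    obtain ⟨t, ht⟩ := hω.exists_smul_sideDir (w := v - derivedVertex (intVec m) Δ)
      (by
        have := hv'.2
        simp only [Set.mem_ofPred_eq] at this
        rw [Pi.sub_apply, derivedVertex_two, this, sub_self])
      (by
        have e := pairing_add_smul ω (v - derivedVertex (intVec m) Δ)
          (derivedVertex (intVec m) Δ) 1
        rw [one_smul, sub_add_cancel, hω.pairing_derivedVertex, hv, hμ, one_mul] at e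
        linarith)
    exact ⟨t, by rw [← ht]; simp⟩
  · rintro ⟨hv', t, rfl⟩
    refine ⟨⟨hv'.1, ?_⟩, hv'⟩
    rw [pairing_add_smul, hω.pairing_derivedVertex, hω.pairing_sideDir, mul_zero, add_zero, hμ]

/-- The form is minimal at the derived vertex, which lies strictly between the support points `m`
and `p` of the main edge; so it is constant along the edge. A second point of the main side gives
orthogonality to the side. -/
lemma IsWeight.isPrimitiveNormal (hC : InClass i Ω m Δ C₀) (hc : ClassFacts i Ω h m Δ C₀)
    {μ : ℤ} (hw : IsWeight Ω m Δ C₀ ω μ) :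
    IsPrimitiveNormal Δ C₀ ω ∧ (μ : ℝ) = pairing ω (intVec m) := by
  obtain ⟨h0, hgcd, hle, hface⟩ := hw
  have hside : ∀ v ∈ mainSide (newtonPolyhedron Ω) (intVec m) Δ C₀, pairing ω v = μ := by
    intro v hv
    rw [← hface] at hv
    exact hv.1.2
  have hd := hside _ (derivedVertex_mem_mainSide hC.vertical)
  have hm := hle _ (intVec_mem hc.m_mem)
  obtain ⟨p, hp, hp2, hp0, hp1⟩ := hc.vert.low
  have hp' := hle _ (intVec_mem hp)
  have hp2' : (p 2 : ℝ) + 1 ≤ m 2 := by exact_mod_cast hp2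
  have hpe : intVec p = intVec m + ((m 2 : ℝ) - p 2) • edgeDir Δ := by
    simp only [disp, intVec_apply] at hp0 hp1
    refine ext3 ?_ ?_ ?_ <;> simp only [intVec_apply, Pi.add_apply, Pi.smul_apply, smul_eq_mul,
      edgeDir, Matrix.cons_val] <;> linarith
  rw [hpe, pairing_add_smul] at hp'
  rw [derivedVertex, pairing_add_smul] at hd
  have he : pairing ω (edgeDir Δ) = 0 := by nlinarith
  rw [he, mul_zero, add_zero] at hd
  have hd' := hside _ (derivedVertex_mem_mainSide hC.vertical)
  rw [pairing_edgeDir] at he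
  have hsd : pairing ω (sideDir C₀) = 0 := by
    have key : ∀ t : ℝ, t ≠ 0 → derivedVertex (intVec m) Δ + t • sideDir C₀ ∈
        derivedPolygon (newtonPolyhedron Ω) (intVec m) → pairing ω (sideDir C₀) = 0 := by
      intro t ht hv
      have := hside _ ⟨hv, t, rfl⟩
      rw [pairing_add_smul, hd'] at this
      have : t * pairing ω (sideDir C₀) = 0 := by linarith
      exact (mul_eq_zero.1 this).resolve_left ht
    have hdv := hC.vertical.1
    rcases C₀ with _ | c
    · refine key 1 one_ne_zero ⟨add_mem_newtonPolyhedron hdv.1 ?_, ?_⟩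
      · intro k
        change 0 ≤ (1 : ℝ) * (![1, 0, 0] : Fin 3 → ℝ) k
        fin_cases k <;> simp
      · have := hdv.2
        simp only [Set.mem_ofPred_eq] at this ⊢
        rw [Pi.add_apply, this, Pi.smul_apply]
        change _ + (1 : ℝ) * (![1, 0, 0] : Fin 3 → ℝ) 2 = _
        simp
    · rcases hC.horizontal with ⟨-, rfl⟩ | ⟨-, -, v, ⟨hv, t, rfl⟩, hlt⟩
      -- The vertical side is infinite upwards, which is the direction opposite to `(0, -1, 0)`.
      · refine key (-1) (by norm_num) ⟨add_mem_newtonPolyhedron hdv.1 ?_, ?_⟩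
        · intro k
          change 0 ≤ (-1 : ℝ) * (![((0 : ℚ) : ℝ), -1, 0] : Fin 3 → ℝ) k
          fin_cases k <;> simp
        · have := hdv.2
          simp only [Set.mem_ofPred_eq] at this ⊢
          rw [Pi.add_apply, this, Pi.smul_apply]
          change _ + (-1 : ℝ) * (![((0 : ℚ) : ℝ), -1, 0] : Fin 3 → ℝ) 2 = _
          simp
      · refine key t ?_ hv
        rintro rfl
        simp at hlt
  refine ⟨⟨h0, hgcd, ?_, fun h => ?_, fun c h => ?_⟩, hd.symm⟩
  · have : (ω 2 : ℝ) = ω 0 * Δ.1 + ω 1 * Δ.2 := by linarith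
    exact_mod_cast this
  · rw [h, pairing_sideDir_top] at hsd
    exact_mod_cast hsd
  · rw [h, pairing_sideDir_coe] at hsd
    have : (ω 1 : ℝ) = c * ω 0 := by linarith
    exact_mod_cast this

/-- The weight vector and the face order of a class. -/
lemma isWeight_iff (hC : InClass i Ω m Δ C₀) (hc : ClassFacts i Ω h m Δ C₀)
    (hω : IsPrimitiveNormal Δ C₀ ω) {μ : ℤ} (hμ : (μ : ℝ) = pairing ω (intVec m))
    (ω₁ : Fin 3 → ℕ) (μ₁ : ℤ) : IsWeight Ω m Δ C₀ ω₁ μ₁ ↔ ω₁ = ω ∧ μ₁ = μ := by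
  constructor
  · intro hw
    obtain ⟨h1, h2⟩ := hw.isPrimitiveNormal hC hc
    obtain rfl := hω.unique h1
    exact ⟨rfl, by exact_mod_cast h2.trans hμ.symm⟩
  · rintro ⟨rfl, rfl⟩
    exact hω.isWeight hc hμ

end WeightVector

/-! ### Quasihomogeneous structure -/

section Quasihomogeneous

variable {i : ℕ} {Ω Ω' : FormalField} {Ψ : Fin 3 → Series} {U : Series}
  {h m : Fin 3 → ℤ} {Δ : ℚ × ℚ} {C₀ : WithTop ℚ} {ω : Fin 3 → ℕ}

lemma filt_natCast_iff {γ : ℝ} {F : Series} : Filt (fun k => (ω k : ℝ)) γ F ↔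
    ∀ n, coeff n F ≠ 0 → γ ≤ n 0 * ω 0 + n 1 * ω 1 + n 2 * ω 2 := by
  simp only [Filt, wt_eq, nsmul_eq_mul]

/-- For `0 < C < ∞` one has `ω = ω₀ (1, C, C Δ₂)`, and `quasiDominates_of_rel` applies at slope `C`.
For `Δ₁ > 0` the lexicographic bound suffices because `ω₁ = 0`. For `C = ∞` compatibility holds at
every slope, and large slopes give the bound with `ω₀ = 0`. -/
lemma Rel.filt_of_isPrimitiveNormal (hi : i = 1 ∨ i = 2) (hR : Rel i Ψ U Ω Ω')
    (hS : StableFacts i Ω h m Δ C₀) (hc' : ClassFacts i Ω' h m Δ C₀)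
    (hω : IsPrimitiveNormal Δ C₀ ω) (j : Fin 3) :
    Filt (fun k => (ω k : ℝ)) (ω j) (Ψ j) := by
  have hF := hR.fibered
  have he : (ω 2 : ℝ) = ω 0 * Δ.1 + ω 1 * Δ.2 := by exact_mod_cast hω.edge
  have p0 : (0 : ℝ) ≤ ω 0 := Nat.cast_nonneg _
  have p1 : (0 : ℝ) ≤ ω 1 := Nat.cast_nonneg _
  have p2 : (0 : ℝ) ≤ ω 2 := Nat.cast_nonneg _
  rw [filt_natCast_iff]
  intro n hn
  have a0 : (0 : ℝ) ≤ n 0 * ω 0 := by positivity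
  have a1 : (0 : ℝ) ≤ n 1 * ω 1 := by positivity
  have a2 : (0 : ℝ) ≤ n 2 * ω 2 := by positivity
  have hj0 : j = 0 → (ω j : ℝ) ≤ n 0 * ω 0 + n 1 * ω 1 + n 2 * ω 2 := by
    rintro rfl
    have h1 : (1 : ℝ) ≤ n 0 := by exact_mod_cast (hF.supp0 hn).1
    nlinarith
  have hj1 : j = 1 → 1 ≤ n 1 → (ω j : ℝ) ≤ n 0 * ω 0 + n 1 * ω 1 + n 2 * ω 2 := by
    rintro rfl h1
    have h1 : (1 : ℝ) ≤ n 1 := by exact_mod_cast h1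
    nlinarith
  have hj2 : j = 2 → 1 ≤ n 2 → (ω j : ℝ) ≤ n 0 * ω 0 + n 1 * ω 1 + n 2 * ω 2 := by
    rintro rfl h1
    have h1 : (1 : ℝ) ≤ n 2 := by exact_mod_cast h1
    nlinarith
  rcases C₀ with _ | c
  · have hΔ := (hS.facts.hor.top rfl).1
    have hd := hS.facts.vert.snd_pos le_rfl hΔ
    have hq : ∀ t : ℝ, 0 < t → QuasiDominates t Δ.2 Ψ := fun t ht =>
      quasiDominates_of_rel hi hR hS hc' hΔ ht (fun c hc => absurd hc (by exact WithTop.top_ne_coe))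
        fun c hc => absurd hc (by exact WithTop.top_ne_coe)
    have ht : (0 : ℝ) < n 0 + 1 := by positivity
    fin_cases j
    · exact hj0 rfl
    · rcases Nat.eq_zero_or_pos (n 1) with h1 | h1
      · have := (hq _ ht).2 n hn h1
        linarith
      · exact hj1 rfl h1
    · rcases Nat.eq_zero_or_pos (n 2) with h2 | h2
      · have hle : (Δ.2 : ℝ) ≤ n 1 := by
          by_contra hlt
          rw [not_le, ← sub_pos] at hlt
          have h3 := (hq _ (div_pos ht hlt)).1 n hn h2
          have h4 : ((n 0 : ℝ) + 1) / (Δ.2 - n 1) * (Δ.2 - n 1) = n 0 + 1 :=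
            div_mul_cancel₀ _ hlt.ne'
          nlinarith
        rw [hω.side_top rfl] at he
        change (ω 2 : ℝ) ≤ _
        push_cast at he
        nlinarith
      · exact hj2 rfl h2
  · have hs : (ω 1 : ℝ) = c * ω 0 := by exact_mod_cast hω.side c rfl
    rcases hS.facts.hor.fin c rfl with ⟨h1, rfl⟩ | ⟨h1, h2, -⟩
    · push_cast at hs
      rw [zero_mul] at hs
      fin_cases j
      · exact hj0 rfl
      · change (ω 1 : ℝ) ≤ _
        linarith
      · rcases Nat.eq_zero_or_pos (n 2) with h2 | h2
        · have h3 := dominates_of_le hR hS.good hS.facts hc'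
            (by rintro (h | ⟨-, h⟩) <;> exact lt_irrefl _ h) n hn h2
          have h4 : (Δ.1 : ℝ) ≤ n 0 := by rcases h3 with h | ⟨h, -⟩ <;> linarith
          change (ω 2 : ℝ) ≤ _
          rw [hs] at he
          nlinarith
        · exact hj2 rfl h2
    · have hd := hS.facts.vert.snd_pos le_rfl h1
      have hc0 : (0 : ℝ) < c := by exact_mod_cast h2
      have hle : ∀ x : ℚ, ((c : WithTop ℚ)) = x → (c : ℝ) ≤ x := fun x hx => by
        rw [WithTop.coe_inj.1 hx]
      have hq := quasiDominates_of_rel hi hR hS hc' h1 hc0 hle hle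
      have h3 := hF.compat_quasiWt hc0 hd hq j n hn
      rw [wt_quasiWt] at h3
      have h4 : (ω j : ℝ) = ω 0 * quasiWt c Δ.2 j := by
        fin_cases j
        · simp [quasiWt]
        · simp [quasiWt, hs, mul_comm]
        · simp [quasiWt, he, h1, hs]; ring
      rw [h4, he, h1, hs]
      refine (mul_le_mul_of_nonneg_left h3 p0).trans_eq ?_
      push_cast
      ring

lemma weightedOrder_eq_nat_iff {F : Series} {d : ℕ} : F.weightedOrder ω = d ↔
    Filt (fun k => (ω k : ℝ)) d F ∧ ¬ Filt (fun k => (ω k : ℝ)) (d + 1 : ℕ) F := by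
  have hw : ∀ n : Fin 3 →₀ ℕ, wt (fun k => (ω k : ℝ)) n = (Finsupp.weight ω n : ℕ) := fun n => by
    simp [wt, Finsupp.weight_apply, Finsupp.sum_fintype]
  simp only [weightedOrder_eq_nat, Filt, hw, Nat.cast_le]
  constructor
  · rintro ⟨⟨n, hn, hd⟩, h2⟩
    refine ⟨fun k hk => ?_, fun hc => ?_⟩
    · by_contra hlt
      exact hk (h2 k (not_le.1 hlt))
    · have := hc n hn
      omega
  · rintro ⟨h1, h2⟩
    push Not at h2
    obtain ⟨n, hn, hlt⟩ := h2
    refine ⟨⟨n, hn, ?_⟩, fun k hk => ?_⟩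
    · have := h1 n hn
      omega
    · by_contra hne
      have := h1 k hne
      omega

/-- Multiplicity `d` means order at least `d` but not at least `d + 1`; the negative half is
transported by the inverse map. -/
lemma preservesQuasihomogeneous {Θ : Fin 3 → Series} (h0 : ∀ j, constantCoeff (Ψ j) = 0)
    (h0' : ∀ j, constantCoeff (Θ j) = 0) (hΘ : ∀ j, (Ψ j).subst Θ = X j)
    (hf : ∀ j, Filt (fun k => (ω k : ℝ)) (ω j) (Ψ j))
    (hf' : ∀ j, Filt (fun k => (ω k : ℝ)) (ω j) (Θ j)) : PreservesQuasihomogeneous ω Ψ := by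
  intro d F hF
  rw [weightedOrder_eq_nat_iff] at hF ⊢
  refine ⟨hF.1.subst h0 hf, fun hc => hF.2 ?_⟩
  have := hc.subst h0' hf'
  rwa [subst_subst h0 h0', funext hΘ, subst_X_eq] at this

end Quasihomogeneous

/-! ### Evaluation of convergent series -/

section Evaluation

open Filter Asymptotics Topology

variable {F G : Series}

lemma abs_prod_pow_le (d : Fin 3 →₀ ℕ) {q : Fin 3 → ℝ} {r : ℝ} (hq : ‖q‖ ≤ r) :
    ‖∏ k, q k ^ d k‖ ≤ r ^ d.degree := by
  rw [norm_prod, Finsupp.degree_eq_sum, ← Finset.prod_pow_eq_pow_sum]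
  refine Finset.prod_le_prod (fun k _ => norm_nonneg _) fun k _ => ?_
  rw [norm_pow]
  exact pow_le_pow_left₀ (norm_nonneg _) ((norm_le_pi_norm q k).trans hq) _

lemma IsConvergent.eventually_summable (hF : IsConvergent F) :
    ∀ᶠ q in 𝓝 (0 : Fin 3 → ℝ), Summable fun d => ‖coeff d F * ∏ k, q k ^ d k‖ := by
  obtain ⟨r, hr, hs⟩ := hF
  filter_upwards [Metric.closedBall_mem_nhds (0 : Fin 3 → ℝ) hr] with q hq
  rw [mem_closedBall_zero_iff] at hq
  refine Summable.of_nonneg_of_le (fun d => norm_nonneg _) (fun d => ?_) hs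
  rw [norm_mul]
  exact mul_le_mul_of_nonneg_left (abs_prod_pow_le d hq) (norm_nonneg _)

lemma IsConvergent.evalSeries_isBigO (hF : IsConvergent F) {N : ℕ}
    (hN : ∀ d, coeff d F ≠ 0 → N ≤ d.degree) :
    evalSeries F =O[𝓝 0] fun q => ‖q‖ ^ N := by
  obtain ⟨r, hr, hs⟩ := hF
  refine IsBigO.of_bound (∑' d, ‖coeff d F‖ * r ^ d.degree / r ^ N) ?_
  filter_upwards [Metric.closedBall_mem_nhds (0 : Fin 3 → ℝ) hr] with q hq
  rw [mem_closedBall_zero_iff] at hq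
  have hs' := (hs.div_const (r ^ N)).mul_right (‖q‖ ^ N)
  rw [norm_pow, norm_norm, ← tsum_mul_right]
  refine tsum_of_norm_bounded hs'.hasSum fun d => ?_
  rw [norm_mul]
  by_cases hd : coeff d F = 0
  · simp [hd]
  · obtain ⟨e, he⟩ := Nat.exists_eq_add_of_le (hN d hd)
    have h1 : ‖∏ k, q k ^ d k‖ ≤ ‖q‖ ^ N * r ^ e := by
      refine (abs_prod_pow_le d le_rfl).trans ?_
      rw [he, pow_add]
      gcongr
    calc _ ≤ ‖coeff d F‖ * (‖q‖ ^ N * r ^ e) := by gcongr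
      _ = _ := by rw [he, pow_add]; field_simp

lemma evalSeries_C (c : ℝ) (q : Fin 3 → ℝ) : evalSeries (C c) q = c := by
  classical
  rw [evalSeries, tsum_eq_single 0 fun d hd => by rw [coeff_C, if_neg hd, zero_mul]]
  simp

lemma evalSeries_X (k : Fin 3) (q : Fin 3 → ℝ) : evalSeries (X k) q = q k := by
  classical
  rw [evalSeries, tsum_eq_single (Finsupp.single k 1)
    fun d hd => by rw [coeff_X, if_neg hd, zero_mul]]
  rw [coeff_X, if_pos rfl, one_mul, Finset.prod_eq_single k]
  · simp
  · intro l _ hl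
    rw [Finsupp.single_eq_of_ne (by simpa using hl), pow_zero]
  · simp

lemma evalSeries_add (hF : IsConvergent F) (hG : IsConvergent G) :
    ∀ᶠ q in 𝓝 (0 : Fin 3 → ℝ), evalSeries (F + G) q = evalSeries F q + evalSeries G q := by
  filter_upwards [hF.eventually_summable, hG.eventually_summable] with q h1 h2
  rw [evalSeries, evalSeries, evalSeries, ← h1.of_norm.tsum_add h2.of_norm]
  simp only [map_add, add_mul]

lemma tsum_mul_pow {q : Fin 3 → ℝ} (h1 : Summable fun d => ‖coeff d F * ∏ k, q k ^ d k‖)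
    (h2 : Summable fun d => ‖coeff d G * ∏ k, q k ^ d k‖) :
    evalSeries (F * G) q = evalSeries F q * evalSeries G q := by
  classical
  have e := Summable.tsum_mul_tsum_eq_tsum_sum_antidiagonal
    (f := fun d : Fin 3 →₀ ℕ => coeff d F * ∏ k, q k ^ d k)
    (g := fun d : Fin 3 →₀ ℕ => coeff d G * ∏ k, q k ^ d k) h1.of_norm h2.of_norm
    (summable_mul_of_summable_norm (f := fun d : Fin 3 →₀ ℕ => coeff d F * ∏ k, q k ^ d k)
      (g := fun d : Fin 3 →₀ ℕ => coeff d G * ∏ k, q k ^ d k) h1 h2)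
  refine Eq.trans (tsum_congr fun d => ?_) e.symm
  rw [coeff_mul, Finset.sum_mul]
  refine Finset.sum_congr rfl fun p hp => ?_
  have hd := Finset.HasAntidiagonal.mem_antidiagonal.mp hp
  have h3 : ∏ k, q k ^ d k = (∏ k, q k ^ p.1 k) * ∏ k, q k ^ p.2 k := by
    rw [← Finset.prod_mul_distrib]
    exact Finset.prod_congr rfl fun k _ => by rw [← pow_add, ← hd]; rfl
  rw [h3]
  ring

lemma evalSeries_mul (hF : IsConvergent F) (hG : IsConvergent G) :
    ∀ᶠ q in 𝓝 (0 : Fin 3 → ℝ), evalSeries (F * G) q = evalSeries F q * evalSeries G q := by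
  filter_upwards [hF.eventually_summable, hG.eventually_summable] with q h1 h2
  exact tsum_mul_pow h1 h2

lemma isConvergent_C (c : ℝ) : IsConvergent (C c : Series) := by
  classical
  refine isConvergent_of_mem_support_finite ((Set.finite_singleton 0).subset fun n hn => ?_)
  by_contra h
  exact hn (by rw [coeff_C, if_neg (by simpa using h)])

/-- Evaluation is compared only for polynomials in convergent series, since the transition map is
available only as a formal series. -/
lemma isConvergent_aeval {Φ : Fin 3 → Series} (hΦ : ∀ k, IsConvergent (Φ k))
    (P : MvPolynomial (Fin 3) ℝ) : IsConvergent (MvPolynomial.aeval Φ P) ∧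
      ∀ᶠ q in 𝓝 (0 : Fin 3 → ℝ), evalSeries (MvPolynomial.aeval Φ P) q =
        MvPolynomial.eval (fun k => evalSeries (Φ k) q) P := by
  induction P using MvPolynomial.induction_on with
  | C a =>
    rw [MvPolynomial.aeval_C, MvPowerSeries.algebraMap_apply, Algebra.algebraMap_self_apply]
    exact ⟨isConvergent_C a, Eventually.of_forall fun q => by
      rw [evalSeries_C, MvPolynomial.eval_C]⟩
  | add p q hp hq =>
    simp only [map_add]
    refine ⟨hp.1.add hq.1, ?_⟩
    filter_upwards [evalSeries_add hp.1 hq.1, hp.2, hq.2] with q h1 h2 h3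
    rw [h1, h2, h3]
  | mul_X p k hp =>
    simp only [map_mul, MvPolynomial.aeval_X, MvPolynomial.eval_X]
    refine ⟨hp.1.mul (hΦ k), ?_⟩
    filter_upwards [evalSeries_mul hp.1 (hΦ k), hp.2] with q h1 h2
    rw [h1, h2]

/-- The multilinear map whose restriction to the diagonal is the monomial with exponent `d`. -/
noncomputable def monomialMap (n : ℕ) (d : Fin 3 →₀ ℕ) :
    ContinuousMultilinearMap ℝ (fun _ : Fin n => Fin 3 → ℝ) ℝ :=
  (ContinuousMultilinearMap.mkPiAlgebra ℝ (Fin n) ℝ).compContinuousLinearMap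
    -- The list of variables of the monomial has length `d.degree`; the default `0` is never used
    -- when this is `n`.
    fun j => ContinuousLinearMap.proj (d.toMultiset.toList.getD j 0)

lemma monomialMap_apply (n : ℕ) (d : Fin 3 →₀ ℕ) (v : Fin n → Fin 3 → ℝ) :
    monomialMap n d v = ∏ j, v j (d.toMultiset.toList.getD j 0) := by
  simp [monomialMap]

lemma monomialMap_diag {n : ℕ} {d : Fin 3 →₀ ℕ} (hd : d.degree = n) (q : Fin 3 → ℝ) :
    (monomialMap n d fun _ => q) = ∏ k, q k ^ d k := by
  have hl : d.toMultiset.toList.length = n := by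
    rw [Multiset.length_toList, Finsupp.card_toMultiset, ← hd, Finsupp.degree_eq_sum,
      Finsupp.sum_fintype _ _ fun _ => rfl]
    rfl
  have h1 : (d.toMultiset.map q).prod = ∏ k, q k ^ d k := by
    rw [Finsupp.toMultiset_map, Finsupp.prod_toMultiset, Finsupp.prod_mapDomain_index (by simp)
      (by intros; rw [pow_add]), Finsupp.prod_fintype _ _ (by simp)]
  rw [monomialMap_apply, ← h1, ← Multiset.coe_toList d.toMultiset, Multiset.map_coe,
    Multiset.prod_coe, Multiset.coe_toList]
  generalize d.toMultiset.toList = l at hl ⊢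
  subst hl
  rw [← List.prod_ofFn]
  congr 1
  refine List.ext_getElem (by simp) fun j h1 h2 => ?_
  simp at h1
  simp [h1]

lemma norm_monomialMap_le (n : ℕ) (d : Fin 3 →₀ ℕ) : ‖monomialMap n d‖ ≤ 1 := by
  refine ContinuousMultilinearMap.opNorm_le_bound zero_le_one fun v => ?_
  rw [monomialMap_apply, one_mul, norm_prod]
  exact Finset.prod_le_prod (fun j _ => norm_nonneg _) fun j _ => norm_le_pi_norm _ _

/-- The Taylor series at the origin of the function defined by a convergent power series. -/
noncomputable def taylor (F : Series) : FormalMultilinearSeries ℝ (Fin 3 → ℝ) ℝ := fun n =>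
  ∑ d ∈ Finset.finsuppAntidiag Finset.univ n, coeff d F • monomialMap n d

lemma mem_antidiag_iff {n : ℕ} {d : Fin 3 →₀ ℕ} :
    d ∈ Finset.finsuppAntidiag Finset.univ n ↔ d.degree = n := by
  rw [Finset.mem_finsuppAntidiag, Finsupp.degree_eq_sum]
  simp

lemma taylor_diag (F : Series) (n : ℕ) (q : Fin 3 → ℝ) : (taylor F n fun _ => q) =
    ∑ d ∈ Finset.finsuppAntidiag Finset.univ n, coeff d F * ∏ k, q k ^ d k := by
  rw [taylor, _root_.sum_apply]
  refine Finset.sum_congr rfl fun d hd => ?_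
  rw [_root_.smul_apply, monomialMap_diag (mem_antidiag_iff.1 hd), smul_eq_mul]

/-- Grouping monomials by degree gives the Taylor series; the bound one on the norm of `monomialMap`
keeps the radius of convergence at least `r`. -/
lemma IsConvergent.analyticAt (hF : IsConvergent F) : AnalyticAt ℝ (evalSeries F) 0 := by
  classical
  obtain ⟨r, hr, hs⟩ := hF
  refine ⟨taylor F, ENNReal.ofReal r, ?_, ENNReal.ofReal_pos.2 hr, fun {y} hy => ?_⟩
  · refine (taylor F).le_radius_of_bound (∑' d, ‖coeff d F‖ * r ^ d.degree) fun n => ?_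
    rw [Real.coe_toNNReal _ hr.le]
    calc ‖taylor F n‖ * r ^ n
        ≤ (∑ d ∈ Finset.finsuppAntidiag Finset.univ n, ‖coeff d F‖) * r ^ n := by
          gcongr
          refine (norm_sum_le _ _).trans (Finset.sum_le_sum fun d _ => ?_)
          rw [norm_smul]
          exact mul_le_of_le_one_right (norm_nonneg _) (norm_monomialMap_le n d)
      _ = ∑ d ∈ Finset.finsuppAntidiag Finset.univ n, ‖coeff d F‖ * r ^ d.degree := by
          rw [Finset.sum_mul]
          exact Finset.sum_congr rfl fun d hd => by rw [mem_antidiag_iff.1 hd]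
      _ ≤ _ := hs.sum_le_tsum _ fun d _ => by positivity
  · have hy' : ‖y‖ ≤ r := by
      rw [Metric.eball_ofReal, mem_ball_zero_iff] at hy
      exact hy.le
    have h1 : Summable fun d => coeff d F * ∏ k, y k ^ d k := by
      refine Summable.of_norm_bounded hs fun d => ?_
      rw [norm_mul]
      exact mul_le_mul_of_nonneg_left (abs_prod_pow_le d hy') (norm_nonneg _)
    rw [zero_add]
    convert h1.hasSum.tsum_fiberwise Finsupp.degree using 2 with n
    · rw [taylor_diag, ← Finset.tsum_subtype']
      exact tsum_congr_set_coe (fun d => coeff d F * ∏ k, y k ^ d k)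
        (Set.ext fun d => by simp only [Finset.mem_coe, mem_antidiag_iff]; rfl)
    · rfl

/-- The remainder after the affine part has order two, hence zero derivative at the origin;
analyticity makes the derivative strict. -/
lemma IsConvergent.hasStrictFDerivAt (hF : IsConvergent F) :
    HasStrictFDerivAt (evalSeries F)
      (∑ k, coeff (Finsupp.single k 1) F • ContinuousLinearMap.proj (R := ℝ) (φ := fun _ => ℝ) k)
      0 := by
  classical
  refine hF.analyticAt.hasStrictFDerivAt.congr_fderiv (HasFDerivAt.fderiv ?_)
  set P : MvPolynomial (Fin 3) ℝ := MvPolynomial.C (coeff 0 F) +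
    ∑ k, MvPolynomial.C (coeff (Finsupp.single k 1) F) * MvPolynomial.X k with hP
  obtain ⟨hc, he⟩ := isConvergent_aeval (fun k => X_mem_analyticGerm k) P
  have hPX : (MvPolynomial.aeval (fun k => (X k : Series)) P : Series) =
      C (coeff 0 F) + ∑ k, C (coeff (Finsupp.single k 1) F) * X k := by
    simp [hP, MvPowerSeries.algebraMap_apply]
  have hco : ∀ d, coeff d (F + -MvPolynomial.aeval (fun k => (X k : Series)) P) ≠ 0 →
      2 ≤ d.degree := by
    intro d hd
    by_contra hlt
    apply hd
    rw [Finsupp.degree_eq_sum, Fin.sum_univ_three] at hlt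
    have hcases : d = 0 ∨ ∃ l, d = Finsupp.single l 1 := by
      by_cases h0 : d 0 = 1
      · exact Or.inr ⟨0, finsupp_ext3 (by simpa using h0) (by simp; omega) (by simp; omega)⟩
      by_cases h1 : d 1 = 1
      · exact Or.inr ⟨1, finsupp_ext3 (by simp; omega) (by simpa using h1) (by simp; omega)⟩
      by_cases h2 : d 2 = 1
      · exact Or.inr ⟨2, finsupp_ext3 (by simp; omega) (by simp; omega) (by simpa using h2)⟩
      exact Or.inl (finsupp_ext3 (by simp; omega) (by simp; omega) (by simp; omega))
    rw [hPX]
    rcases hcases with rfl | ⟨l, rfl⟩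
    · simp
    · simp [coeff_C, coeff_C_mul, coeff_X, Finsupp.single_left_inj]
  have hO := (IsConvergent.add hF hc.neg).evalSeries_isBigO hco
  have hev : evalSeries F =ᶠ[𝓝 0] fun q => coeff 0 F + (∑ k, coeff (Finsupp.single k 1) F * q k)
      + evalSeries (F + -MvPolynomial.aeval (fun k => (X k : Series)) P) q := by
    filter_upwards [he, evalSeries_add (IsConvergent.add hF hc.neg) hc] with q h1 h2
    rw [neg_add_cancel_right] at h2
    rw [h2, h1]
    simp [hP, evalSeries_X]
    ring
  have hR : HasFDerivAt (evalSeries (F + -MvPolynomial.aeval (fun k => (X k : Series)) P))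
      (0 : (Fin 3 → ℝ) →L[ℝ] ℝ) 0 :=
    IsBigO.hasFDerivAt (by simpa using hO) one_lt_two
  refine HasFDerivAt.congr_of_eventuallyEq ?_ hev
  have hlin := (∑ k, coeff (Finsupp.single k 1) F •
    ContinuousLinearMap.proj (R := ℝ) (φ := fun _ : Fin 3 => ℝ) k).hasFDerivAt (x := 0)
  have := (hlin.const_add (coeff 0 F)).add hR
  rw [add_zero] at this
  refine this.congr_of_eventuallyEq (Eventually.of_forall fun q => ?_)
  simp

/-- A flat analytic germ is zero: by induction each homogeneous Taylor term of degree `k` is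
`O(‖y‖^(k+1))` and therefore vanishes. -/
lemma AnalyticAt.eventually_eq_zero_of_isBigO {E : Type*} [NormedAddCommGroup E] [NormedSpace ℝ E]
    {g : E → ℝ} (hg : AnalyticAt ℝ g 0) (hO : ∀ N : ℕ, g =O[𝓝 0] fun y => ‖y‖ ^ N) :
    ∀ᶠ y in 𝓝 0, g y = 0 := by
  obtain ⟨p, hp⟩ := hg
  have hp0 : ∀ n y, (p n fun _ => y) = 0 := by
    intro n
    refine Nat.strong_induction_on n fun k hk => ?_
    have hs : p.partialSum (k + 1) = fun y => p k fun _ => y := by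
      funext z
      refine Finset.sum_eq_single _ (fun b hb hne => ?_) fun hn => ?_
      · exact hk b ((Finset.mem_range_succ_iff.1 hb).lt_of_ne hne) z
      · exact absurd (Finset.mem_range.2 (lt_add_one k)) hn
    have h1 := hp.isBigO_sub_partialSum_pow (k + 1)
    simp only [hs, zero_add] at h1
    refine IsBigO.continuousMultilinearMap_apply_eq_zero ?_
    have := (hO (k + 1)).sub h1
    simpa using this
  obtain ⟨r, hr⟩ := hp
  filter_upwards [Metric.eball_mem_nhds (0 : E) hr.r_pos] with y hy
  have h1 := hr.hasSum hy
  simp only [hp0, zero_add] at h1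
  exact h1.unique hasSum_zero

end Evaluation

/-! ### Blowing-up centers -/

section Centers

open Filter Asymptotics Topology

/-- The map whose components are the functions defined by the series `Φ j`. -/
noncomputable def evalMap (Φ : Fin 3 → Series) (q : Fin 3 → ℝ) : Fin 3 → ℝ :=
  fun k => evalSeries (Φ k) q

lemma evalSeries_zero (F : Series) : evalSeries F 0 = constantCoeff F := by
  rw [evalSeries, tsum_eq_single 0 fun d hd => ?_]
  · simp
  · obtain ⟨k, hk⟩ := Finsupp.ne_iff.1 hd
    rw [Finset.prod_eq_zero (Finset.mem_univ k) (by rw [Pi.zero_apply, zero_pow hk]), mul_zero]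

lemma exists_localInverse {Φ : Fin 3 → Series} (hc : ∀ k, IsConvergent (Φ k))
    (hΦ : IsFormalCoordinates Φ) : ∃ σ : (Fin 3 → ℝ) → Fin 3 → ℝ, AnalyticAt ℝ σ 0 ∧ σ 0 = 0 ∧
      (∀ᶠ q in 𝓝 0, σ (evalMap Φ q) = q) ∧ ∀ᶠ t in 𝓝 0, evalMap Φ (σ t) = t := by
  set L : (Fin 3 → ℝ) →L[ℝ] (Fin 3 → ℝ) :=
    LinearMap.toContinuousLinearMap (Matrix.toLin' (jacobian Φ)) with hL
  have hdet : L.det ≠ 0 := by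
    rw [hL, LinearMap.det_toContinuousLinearMap, LinearMap.det_toLin']
    exact hΦ.2
  have h0 : evalMap Φ 0 = 0 := funext fun k => by rw [evalMap, evalSeries_zero, hΦ.1]; rfl
  have han : AnalyticAt ℝ (evalMap Φ) 0 := AnalyticAt.pi fun k => (hc k).analyticAt
  have hstr : HasStrictFDerivAt (evalMap Φ) L 0 := by
    rw [hasStrictFDerivAt_pi']
    intro k
    refine (hc k).hasStrictFDerivAt.congr_fderiv ?_
    ext v
    simp [hL, Matrix.mulVec, dotProduct, jacobian_apply, coeff_single_eq]
  have hstr' : HasStrictFDerivAt (evalMap Φ)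
      (L.toContinuousLinearEquivOfDetNeZero hdet : (Fin 3 → ℝ) →L[ℝ] (Fin 3 → ℝ)) 0 := by
    rwa [ContinuousLinearMap.coe_toContinuousLinearEquivOfDetNeZero]
  set R := hstr'.toOpenPartialHomeomorph (evalMap Φ) with hR
  have hmem : (0 : Fin 3 → ℝ) ∈ R.source := hstr'.mem_toOpenPartialHomeomorph_source
  obtain ⟨p, hp⟩ := han
  have hp' : HasFPowerSeriesAt R p 0 := hp
  refine ⟨R.symm, ?_, ?_, ?_, ?_⟩
  · have := (R.hasFPowerSeriesAt_symm hmem hp' (i := L.toContinuousLinearEquivOfDetNeZero hdet) ?_)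
    · have h := this.analyticAt
      rwa [show R 0 = 0 from h0] at h
    · rw [ContinuousLinearMap.coe_toContinuousLinearEquivOfDetNeZero]
      rw [LinearIsometryEquiv.eq_symm_apply]
      exact hp.hasStrictFDerivAt.hasFDerivAt.unique hstr.hasFDerivAt
  · have := R.left_inv hmem
    rwa [show R 0 = 0 from h0] at this
  · exact hstr'.eventually_left_inverse
  · have := hstr'.eventually_right_inverse
    rwa [h0] at this

/-- The projection of `ℝ³` to the coordinates of weight zero. -/
noncomputable def zeroProj (ω : Fin 3 → ℕ) : (Fin 3 → ℝ) →L[ℝ] (Fin 3 → ℝ) :=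
  ContinuousLinearMap.pi fun k => if ω k = 0 then ContinuousLinearMap.proj k else 0

lemma zeroProj_apply (ω : Fin 3 → ℕ) (t : Fin 3 → ℝ) (k : Fin 3) :
    zeroProj ω t k = if ω k = 0 then t k else 0 := by
  rw [zeroProj, ContinuousLinearMap.pi_apply]
  split_ifs <;> simp

/-- Each monomial of `F` has positive weight, so it contains a coordinate of nonzero weight, and
these are zero on the image of `zeroProj ω`. -/
lemma eval_zeroProj_eq_zero {ω : Fin 3 → ℕ} {k : Fin 3} (hk : ω k ≠ 0) {F : Series}
    (hF : Filt (fun j => (ω j : ℝ)) (ω k) F) (N : ℕ) (t : Fin 3 → ℝ) :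
    MvPolynomial.eval (zeroProj ω t) (truncTotal N F) = 0 := by
  rw [MvPolynomial.eval_eq]
  refine Finset.sum_eq_zero fun d hd => ?_
  have hdF : coeff d F ≠ 0 := by
    rw [MvPolynomial.mem_support_iff, coeff_truncTotal_eq_ite] at hd
    exact fun h => hd (by rw [h, ite_self])
  have hle := hF d hdF
  have hpos : (0 : ℝ) < ω k := by exact_mod_cast Nat.pos_of_ne_zero hk
  obtain ⟨l, hl⟩ : ∃ l, ω l ≠ 0 ∧ d l ≠ 0 := by
    by_contra hc
    push Not at hc
    refine (hpos.trans_le hle).ne' ?_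
    rw [wt, Finsupp.weight_apply, Finsupp.sum_fintype _ _ (by simp)]
    refine Finset.sum_eq_zero fun l _ => ?_
    by_cases h : ω l = 0
    · simp [h]
    · simp [hc l h]
  rw [Finset.prod_eq_zero (Finsupp.mem_support_iff.2 hl.2) (by rw [zeroProj_apply, if_neg hl.1, zero_pow hl.2]),
    mul_zero]

/-- The center of `Φ` is parametrized by `σ ∘ zeroProj ω`. Along it the Taylor polynomials of `φ k`
at `Φ` vanish if `ω k ≠ 0`, so `Φ' k` is flat and, being analytic, zero. Convergence of `φ` is not
needed. -/
lemma eventually_mem_blowupCenter {ω : Fin 3 → ℕ} {Φ Φ' : Fin 3 → AnalyticGerm}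
    {φ : Fin 3 → Series} (hΦ : IsFormalCoordinates fun k => (Φ k : Series))
    (hφ : IsTransition (fun k => (Φ k : Series)) (fun k => (Φ' k : Series)) φ)
    (hf : ∀ j, Filt (fun k => (ω k : ℝ)) (ω j) (φ j)) :
    ∀ᶠ q in 𝓝 (0 : Fin 3 → ℝ), q ∈ blowupCenter ω Φ → q ∈ blowupCenter ω Φ' := by
  obtain ⟨σ, hσ, hσ0, hl, hr⟩ := exists_localInverse (fun k => (Φ k).2) hΦ
  have h0 := hΦ.1
  have hs := hasSubst h0
  have hσ' : AnalyticAt ℝ (fun t => σ (zeroProj ω t)) 0 :=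
    AnalyticAt.comp (by rwa [map_zero]) ((zeroProj ω).analyticAt 0)
  have hσ0' : σ (zeroProj ω 0) = 0 := by rw [map_zero, hσ0]
  have htend : Tendsto (fun t => σ (zeroProj ω t)) (𝓝 0) (𝓝 0) := by
    have := hσ'.continuousAt.tendsto
    rwa [hσ0'] at this
  have hbig : (fun t => σ (zeroProj ω t)) =O[𝓝 0] fun t => ‖t‖ := by
    have := hσ'.differentiableAt.isBigO_sub
    simpa [hσ0] using this.norm_right
  have hπ : Tendsto (zeroProj ω) (𝓝 0) (𝓝 0) := by
    have := (zeroProj ω).continuous.tendsto 0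
    rwa [map_zero] at this
  have key : ∀ k, ω k ≠ 0 → ∀ᶠ t in 𝓝 0, evalSeries (Φ' k : Series) (σ (zeroProj ω t)) = 0 := by
    intro k hk
    refine AnalyticAt.eventually_eq_zero_of_isBigO ?_ fun N => ?_
    · exact AnalyticAt.comp (by rw [hσ0']; exact (Φ' k).2.analyticAt) hσ'
    · obtain ⟨hc, he⟩ := isConvergent_aeval (fun k => (Φ k).2) (truncTotal N (φ k))
      set Q : Series := MvPolynomial.aeval (fun k => (Φ k : Series)) (truncTotal N (φ k)) with hQ
      have hS : IsConvergent ((Φ' k : Series) + -Q) := IsConvergent.add (Φ' k).2 hc.neg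
      have hSN : ∀ d, coeff d ((Φ' k : Series) + -Q) ≠ 0 → N ≤ d.degree := by
        have h1 : (Φ' k : Series) + -Q =
            (φ k - (truncTotal N (φ k) : Series)).subst fun k => (Φ k : Series) := by
          rw [subst_sub hs, ← hφ.2 k, subst_coe, sub_eq_add_neg]
        have h2 : Filt (fun _ => (1 : ℤ)) N (φ k - (truncTotal N (φ k) : Series)) := by
          intro d hd
          rw [map_sub, MvPolynomial.coeff_coe, coeff_truncTotal_eq_ite] at hd
          by_contra hlt
          refine hd ?_
          rw [wt_eq] at hlt
          rw [Finsupp.degree_eq_sum, Fin.sum_univ_three, if_pos (by simp at hlt; omega), sub_self]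
        intro d hd
        rw [h1] at hd
        have := h2.subst h0 (fun j => filt_one_of_constantCoeff (h0 j)) d hd
        rw [wt_eq] at this
        rw [Finsupp.degree_eq_sum, Fin.sum_univ_three]
        simp at this
        omega
      have hO := (hS.evalSeries_isBigO hSN).comp_tendsto htend
      have hO' := hO.trans (hbig.norm_left.pow N)
      refine hO'.congr' ?_ (EventuallyEq.refl _ _)
      filter_upwards [htend.eventually he, htend.eventually (evalSeries_add hS hc),
        hπ.eventually hr] with t e1 e2 e3
      rw [neg_add_cancel_right, e1, show (fun k => evalSeries (Φ k : Series) (σ (zeroProj ω t))) =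
        zeroProj ω t from e3, eval_zeroProj_eq_zero hk (hf k), add_zero] at e2
      exact e2.symm
  have htΦ : Tendsto (evalMap fun k => (Φ k : Series)) (𝓝 0) (𝓝 0) := by
    have h1 : ContinuousAt (evalMap fun k => (Φ k : Series)) 0 :=
      (AnalyticAt.pi fun k => (Φ k).2.analyticAt).continuousAt
    have h2 : evalMap (fun k => (Φ k : Series)) 0 = 0 :=
      funext fun k => by rw [evalMap, evalSeries_zero, h0]; rfl
    rw [ContinuousAt, h2] at h1
    exact h1
  have hall : ∀ᶠ t in 𝓝 0, ∀ k, ω k ≠ 0 → evalSeries (Φ' k : Series) (σ (zeroProj ω t)) = 0 :=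
    eventually_all.2 fun k => by
      by_cases hk : ω k = 0
      · simp [hk]
      · filter_upwards [key k hk] with t ht _ using ht
  filter_upwards [hl, htΦ.eventually hall] with q h1 h2 hq k hk
  have h3 : zeroProj ω (evalMap (fun k => (Φ k : Series)) q) = evalMap (fun k => (Φ k : Series)) q := by
    funext l
    rw [zeroProj_apply]
    split_ifs with h
    · rfl
    · exact (hq l h).symm
  have := h2 k hk
  rwa [h3, h1] at this

end Centers

/-! ### Independence of the stable adapted chart -/

/-- The face order is `⟨ω, m⟩`. The filtration estimate is applied to the transition and to its
inverse, which gives both inclusions of the centers and the exact preservation of multiplicities. -/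
lemma exists_weight_of_stable {K : ControlledGerm} (hK : K.Nonelementary)
    {Φ Φ' : Fin 3 → AnalyticGerm} {Ω Ω' : FormalField}
    (hN : K.IsNewtonData (fun k => (Φ k : Series)) Ω)
    (hN' : K.IsNewtonData (fun k => (Φ' k : Series)) Ω')
    {m m' : Fin 3 → ℤ} {Δ Δ' : ℚ × ℚ} {C₀ C₀' : WithTop ℚ}
    (hS : IsStable K.i Ω m Δ C₀) (hS' : IsStable K.i Ω' m' Δ' C₀') :
    (m = m' ∧ Δ = Δ' ∧ C₀ = C₀') ∧
      ∃ (ω : Fin 3 → ℕ) (μ : ℤ),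
        (∀ ω₁ μ₁, IsWeight Ω m Δ C₀ ω₁ μ₁ ↔ ω₁ = ω ∧ μ₁ = μ) ∧
        (∀ ω₁ μ₁, IsWeight Ω' m' Δ' C₀' ω₁ μ₁ ↔ ω₁ = ω ∧ μ₁ = μ) ∧
        (∀ᶠ q in nhds (0 : Fin 3 → ℝ), q ∈ blowupCenter ω Φ ↔ q ∈ blowupCenter ω Φ') ∧
        ∃ φ : Fin 3 → Series,
          IsTransition (fun k => (Φ k : Series)) (fun k => (Φ' k : Series)) φ ∧
          PreservesQuasihomogeneous ω φ := by
  obtain ⟨φ, U, hφ, hR⟩ := exists_transition hN hN'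
  obtain ⟨h, hf⟩ := hS.facts rfl hK hN
  obtain ⟨h', hf'⟩ := hS'.facts rfl hK hN'
  obtain ⟨rfl, rfl, rfl, rfl⟩ := hf.eq_of_rel K.i_eq hR hf'
  obtain ⟨ω, hω⟩ := hf.facts.exists_isPrimitiveNormal
  obtain ⟨Θ, hΘ, h1, h2⟩ := hR.fibered.isFormalCoordinates.exists_inverse
  obtain ⟨U', hR'⟩ := hR.symm hΘ h1
  have hφω := fun j => hR.filt_of_isPrimitiveNormal K.i_eq hf hf'.facts hω j
  have hΘω := fun j => hR'.filt_of_isPrimitiveNormal K.i_eq hf' hf.facts hω j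
  have hΦ := hN.1.coordinates
  have hφ' : IsTransition (fun k => (Φ' k : Series)) (fun k => (Φ k : Series)) Θ := by
    refine ⟨hΘ.1, fun j => ?_⟩
    rw [funext hφ.2, ← subst_subst hφ.1 hΦ.1, h1, subst_X (hasSubst hΦ.1)]
  have hμ : ((∑ k, ω k * m k : ℤ) : ℝ) = pairing ω (intVec m) := by
    rw [pairing]
    push_cast
    rfl
  refine ⟨⟨rfl, rfl, rfl⟩, ω, ∑ k, ω k * m k, isWeight_iff hS.1 hf.facts hω hμ,
    isWeight_iff hS'.1 hf'.facts hω hμ, ?_, φ, hφ,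
    preservesQuasihomogeneous hφ.1 hΘ.1 h2 hφω hΘω⟩
  filter_upwards [eventually_mem_blowupCenter hΦ hφ hφω,
    eventually_mem_blowupCenter hN'.1.coordinates hφ' hΘω] with q a b
  exact ⟨a, b⟩

end NewtonFol

/-! ### Assembly of the two statements -/

open NewtonFol

theorem mainTheorem5 (K : ControlledGerm) (hK : K.Nonelementary) :
    -- invariance of `(m, Δ, C)` on orbits of the formal group
    (∀ (Φ : Fin 3 → Series) (Ω Ω' : FormalField),
      K.IsNewtonData Φ Ω → SameOrbit K.i Ω Ω' →
      ∀ (m m' : Fin 3 → ℤ) (Δ Δ' : ℚ × ℚ) (C C' : WithTop ℚ),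
        IsStable K.i Ω m Δ C → IsStable K.i Ω' m' Δ' C' →
        m = m' ∧ Δ = Δ' ∧ C = C') ∧
    -- independence of the stable adapted local chart
    (∀ (Φ Φ' : Fin 3 → AnalyticGerm) (Ω Ω' : FormalField),
      K.IsNewtonData (fun k => (Φ k : Series)) Ω →
      K.IsNewtonData (fun k => (Φ' k : Series)) Ω' →
      ∀ (m m' : Fin 3 → ℤ) (Δ Δ' : ℚ × ℚ) (C C' : WithTop ℚ),
        IsStable K.i Ω m Δ C → IsStable K.i Ω' m' Δ' C' →
        (m = m' ∧ Δ = Δ' ∧ C = C') ∧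
        newtonInv K.i m Δ = newtonInv K.i m' Δ' ∧
        ∃ (ω : Fin 3 → ℕ) (μ : ℤ),
          (∀ ω₁ μ₁, IsWeight Ω m Δ C ω₁ μ₁ ↔ ω₁ = ω ∧ μ₁ = μ) ∧
          (∀ ω₁ μ₁, IsWeight Ω' m' Δ' C' ω₁ μ₁ ↔ ω₁ = ω ∧ μ₁ = μ) ∧
          (∀ᶠ q in nhds (0 : Fin 3 → ℝ), q ∈ blowupCenter ω Φ ↔ q ∈ blowupCenter ω Φ') ∧
          ∃ φ : Fin 3 → Series,
            IsTransition (fun k => (Φ k : Series)) (fun k => (Φ' k : Series)) φ ∧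
            PreservesQuasihomogeneous ω φ) := by
  refine ⟨fun Φ Ω Ω' hN hO m m' Δ Δ' C C' hS hS' => eq_of_sameOrbit hK hN hO hS hS',
    fun Φ Φ' Ω Ω' hN hN' m m' Δ Δ' C C' hS hS' => ?_⟩
  obtain ⟨⟨rfl, rfl, rfl⟩, hω⟩ := exists_weight_of_stable hK hN hN' hS hS'
  -- The invariant is a function of `K.i`, `m` and `Δ` alone.
  exact ⟨⟨rfl, rfl, rfl⟩, rfl, hω⟩
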